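/- Conventions. All manifolds are smooth, Hausdorff and second countable. A symplectic manifold $(M^{2n},\omega)$ is monotone if $[\omega]=\tau\,c_1(M)$ in $H^2(M;\mathbb R)$ for some $\tau\in\mathbb R$. Let $\pi:\mathcal L M\to M$ be the bundle of (unoriented) Lagrangian subspaces of the tangent spaces of $M$; a primitive $\lambda$ of $\pi^*\omega$ is called an action form. A Lagrangian immersion $f:L\to M$ has the Gauss map $\tilde f:L\to\mathcal L M$, $p\mapsto df(T_pL)$, and, given an action form $\lambda$, the action class $a_\lambda(f)=[\tilde f^*\lambda]\in H^1(L;\mathbb R)$. Stabilization $i:\mathcal L M\to\mathcal L(\mathbb C\times M)$ sends $U\subset T_pM$ to $\mathbb R\oplus U\subset T_{(0,p)}(\mathbb C\times M)$, where $\mathbb C\times M$ carries $\omega_{\mathbb C}\oplus\omega$; a class $x\in H^k(\mathcal L M;\mathbb R)$ is stable if it lies in the image of $i^*:H^k(\mathcal L(\mathbb C\times M);\mathbb R)\to H^k(\mathcal L M;\mathbb R)$. Let $f_1,\dots,f_r$ and $g_1,\dots,g_s$ be Lagrangian immersions $f_i:L_i\to M$, $g_j:L_j'\to M$ of closed oriented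 $n$-manifolds. An oriented Lagrangian cobordism $(f_1,\dots,f_r)\rightsquigarrow(g_1,\dots,g_s)$ is a compact oriented $(n+1)$-manifold $V$ with boundary $\coprod_i L_i\sqcup\coprod_j L'_j$ and a Lagrangian immersion $F:V\to[0,1]\times\mathbb R\times M\subset\mathbb C\times M$ such that, for some $\varepsilon>0$, there are orientation-preserving collar embeddings $(1-\varepsilon,1]\times L_i\to V$ over which $F(t,p)=(t,i,f_i(p))$, and $[0,\varepsilon)\times L_j'\to V$ over which $F(t,p)=(t,j,g_j(p))$. Theorem. (1) If $(M^{2n},\omega)$ is monotone, then $\pi^*\omega$ is exact on $\mathcal L M$. (2) Let $(M^{2n},\omega)$ be monotone, $n\ge 1$, let $\lambda$ be an action form and $x\in H^{n-1}(\mathcal L M;\mathbb R)$. For every Lagrangian immersion $f:L\to M$ of a closed oriented $n$-manifold, the number $N(f)=\langle a_\lambda(f)\cup\tilde f^*x,[L]\rangle\in\mathbb R$ is well defined (it equals $\int_L\alpha\wedge\beta$ for all closed forms $\alpha,\beta$ on $L$ representing $a_\lambda(f)$ and $\tilde f^*x$). If $x$ is stable, $N$ is an invariant of oriented Lagrangian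 cobordism: if there is an oriented Lagrangian cobordism $(f_1,\dots,f_r)\rightsquigarrow(g_1,\dots,g_s)$, then $\sum_i N(f_i)=\sum_j N(g_j)$. (3) Let $(\Sigma,\omega)$ be a symplectic surface and $p:S\Sigma\to\Sigma$ its unit tangent bundle. If $\Sigma$ is monotone, then $p^*\omega$ is exact. Let $\lambda$ be any primitive of $p^*\omega$ and define the holonomy of an immersed closed curve $\gamma:S^1\to\Sigma$ by $\mathrm{hol}_\lambda(\gamma)=\int_{S^1}\tilde\gamma^*\lambda$, where $\tilde\gamma:S^1\to S\Sigma$ is the lift of $\gamma$ by its unit tangent vector. If there is an oriented Lagrangian cobordism $(\gamma_1,\dots,\gamma_r)\rightsquigarrow\emptyset$ of immersed curves, each $S^1$ having its standard orientation, then $\sum_{k=1}^r\mathrm{hol}_\lambda(\gamma_k)=0$. -/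

import Mathlib

open Set Filter Topology Bundle Module
open scoped Manifold ContDiff

noncomputable section

/-! ### Differential forms on diffeological spaces and de Rham cohomology -/

/-- A differential `k`-form on a diffeological space `X`: a family of smooth `k`-forms `P^*α` on
`ℝᵐ`, one for every plot `P : ℝᵐ → X`, compatible with smooth reparametrizations
(`(P ∘ g)^*α = g^*(P^*α)`). For a smooth manifold, whose plots are the smooth maps from the
spaces `ℝᵐ`, these are the usual differential forms. -/
structure DForm {X : Type*} (D : DiffeologicalSpace X) (k : ℕ) where
  val : ∀ {m : ℕ} (P : EuclideanSpace ℝ (Fin m) → X), P ∈ D.plots m →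
    EuclideanSpace ℝ (Fin m) → EuclideanSpace ℝ (Fin m) [⋀^Fin k]→L[ℝ] ℝ
  smooth : ∀ {m : ℕ} (P : EuclideanSpace ℝ (Fin m) → X) (hP : P ∈ D.plots m),
    ContDiff ℝ ∞ (val P hP)
  natural : ∀ {m m' : ℕ} (P : EuclideanSpace ℝ (Fin m) → X) (hP : P ∈ D.plots m)
    (g : EuclideanSpace ℝ (Fin m') → EuclideanSpace ℝ (Fin m)) (hg : ContDiff ℝ ∞ g)
    (u : EuclideanSpace ℝ (Fin m')),
    val (P ∘ g) (D.plot_reparam hP hg) u =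
      (val P hP (g u)).compContinuousLinearMap (fderiv ℝ g u)

namespace DForm

variable {X Y Z : Type*} {D : DiffeologicalSpace X} {D' : DiffeologicalSpace Y} {k : ℕ}

@[ext]
theorem ext {α β : DForm D k}
    (h : ∀ {m : ℕ} (P : EuclideanSpace ℝ (Fin m) → X) (hP : P ∈ D.plots m) u,
      α.val P hP u = β.val P hP u) : α = β := by
  cases α; cases β
  congr
  funext m P hP u
  exact h P hP u

instance : Zero (DForm D k) :=
  ⟨⟨fun _ _ _ => 0, fun _ _ => contDiff_const, fun _ _ _ _ _ => by ext; simp⟩⟩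

instance : Add (DForm D k) :=
  ⟨fun α β => ⟨fun P hP u => α.val P hP u + β.val P hP u,
    fun P hP => (α.smooth P hP).add (β.smooth P hP),
    fun P hP g hg u => by rw [α.natural P hP g hg, β.natural P hP g hg]; ext; simp⟩⟩

instance : SMul ℝ (DForm D k) :=
  ⟨fun c α => ⟨fun P hP u => c • α.val P hP u,
    fun P hP => (contDiff_const (c := c)).smul (α.smooth P hP),
    fun P hP g hg u => by rw [α.natural P hP g hg]; ext; simp⟩⟩

instance : Neg (DForm D k) := ⟨fun α => (-1 : ℝ) • α⟩

@[simp] theorem zero_val {m : ℕ} (P : EuclideanSpace ℝ (Fin m) → X) (hP : P ∈ D.plots m) (u) :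
    (0 : DForm D k).val P hP u = 0 := rfl
@[simp] theorem add_val (α β : DForm D k) {m : ℕ} (P : EuclideanSpace ℝ (Fin m) → X)
    (hP : P ∈ D.plots m) (u) : (α + β).val P hP u = α.val P hP u + β.val P hP u := rfl
@[simp] theorem smul_val (c : ℝ) (α : DForm D k) {m : ℕ} (P : EuclideanSpace ℝ (Fin m) → X)
    (hP : P ∈ D.plots m) (u) : (c • α).val P hP u = c • α.val P hP u := rfl
@[simp] theorem neg_val (α : DForm D k) {m : ℕ} (P : EuclideanSpace ℝ (Fin m) → X)
    (hP : P ∈ D.plots m) (u) : (-α).val P hP u = (-1 : ℝ) • α.val P hP u := rfl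

instance : AddCommGroup (DForm D k) where
  add_assoc a b c := by ext; simp [add_assoc]
  zero_add a := by ext; simp
  add_zero a := by ext; simp
  add_comm a b := by ext; simp [add_comm]
  neg_add_cancel a := by ext; simp
  nsmul := nsmulRec
  zsmul := zsmulRec

instance : Module ℝ (DForm D k) where
  one_smul a := by ext; simp
  mul_smul a b c := by ext; simp [mul_assoc]
  smul_zero a := by ext; simp
  smul_add a b c := by ext; simp
  add_smul a b c := by ext; simp [add_mul]
  zero_smul a := by ext; simp

/-- The exterior derivative. -/
def d : DForm D k →ₗ[ℝ] DForm D (k + 1) where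
  toFun α := 
    { val := fun P hP => extDeriv (α.val P hP)
      smooth := fun P hP => by
        have h : ContDiff ℝ ∞ (fderiv ℝ (α.val P hP)) :=
          (α.smooth P hP).fderiv_right (m := ∞) (by simp)
        exact (ContinuousAlternatingMap.alternatizeUncurryFinCLM ℝ _ ℝ).contDiff.comp h
      natural := fun P hP g hg u => by
        have h1 : α.val (P ∘ g) (D.plot_reparam hP hg) =
            fun x => (α.val P hP (g x)).compContinuousLinearMap (fderiv ℝ g x) :=
          funext (α.natural P hP g hg)
        rw [h1]
        exact extDeriv_pullback (r := ∞) ((α.smooth P hP).differentiable (by simp) _)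
          hg.contDiffAt (by simp; exact WithTop.coe_le_coe.2 le_top) }
  map_add' α β := by
    refine DForm.ext fun P hP u => ?_
    exact extDeriv_add ((α.smooth P hP).differentiable (by simp) _)
      ((β.smooth P hP).differentiable (by simp) _)
  map_smul' c α := by
    refine DForm.ext fun P hP u => ?_
    exact extDeriv_smul c (α.val P hP)

theorem d_val (α : DForm D k) {m : ℕ} (P : EuclideanSpace ℝ (Fin m) → X)
    (hP : P ∈ D.plots m) : (d α).val P hP = extDeriv (α.val P hP) := rfl

theorem d_d (α : DForm D k) : d (d α) = 0 := by
  refine DForm.ext fun P hP u => ?_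
  rw [d_val, d_val, extDeriv_extDeriv (α.smooth P hP) (by simp; exact WithTop.coe_le_coe.2 le_top)]
  rfl

/-- Pullback of forms along a smooth map. -/
def pullback (f : X → Y) (hf : @Diffeology.DSmooth X Y D D' f) :
    DForm D' k →ₗ[ℝ] DForm D k where
  toFun α :=
    { val := fun {_} P hP => α.val (f ∘ P) (hf _ P hP)
      smooth := fun _ _ => α.smooth _ _
      natural := fun P hP g hg u => α.natural (f ∘ P) (hf _ P hP) g hg u }
  map_add' _ _ := rfl
  map_smul' _ _ := rfl

theorem d_pullback (f : X → Y) (hf : @Diffeology.DSmooth X Y D D' f) (α : DForm D' k) :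
    d (pullback f hf α) = pullback f hf (d α) := rfl

end DForm

/-- The exterior product of a covector with an alternating `k`-form:
`(a ∧ b)(v₀, …, v_k) = ∑ᵢ (-1)ⁱ a(vᵢ) b(v₀, …, v̂ᵢ, …, v_k)`. -/
def wedgeOne {E : Type*} [NormedAddCommGroup E] [NormedSpace ℝ E] {k : ℕ}
    (a : E [⋀^Fin 1]→L[ℝ] ℝ) (b : E [⋀^Fin k]→L[ℝ] ℝ) : E [⋀^Fin (k + 1)]→L[ℝ] ℝ :=
  ContinuousAlternatingMap.alternatizeUncurryFin
    (((ContinuousAlternatingMap.ofSubsingletonLIE (𝕜 := ℝ) (E := E) (F := ℝ) (0 : Fin 1)).symm a).smulRight b)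

theorem wedgeOne_apply {E : Type*} [NormedAddCommGroup E] [NormedSpace ℝ E] {k : ℕ}
    (a : E [⋀^Fin 1]→L[ℝ] ℝ) (b : E [⋀^Fin k]→L[ℝ] ℝ) (v : Fin (k + 1) → E) :
    wedgeOne a b v = ∑ i : Fin (k + 1), (-1) ^ (i : ℕ) * (a (fun _ => v i) * b (i.removeNth v)) := by
  simp only [wedgeOne, ContinuousAlternatingMap.alternatizeUncurryFin_apply]
  refine Finset.sum_congr rfl fun i _ => ?_
  have h : (((ContinuousAlternatingMap.ofSubsingletonLIE (𝕜 := ℝ) (E := E) (F := ℝ)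
      (0 : Fin 1)).symm a).smulRight b) (v i) (i.removeNth v) =
      a (fun _ => v i) * b (i.removeNth v) := rfl
  rw [h]
  rw [zsmul_eq_mul]; push_cast; rfl

/-- The exterior product of a `1`-form with a `k`-form. -/
def DForm.wedge {X : Type*} {D : DiffeologicalSpace X} {k : ℕ} (α : DForm D 1) (β : DForm D k) :
    DForm D (k + 1) where
  val P hP u := wedgeOne (α.val P hP u) (β.val P hP u)
  smooth P hP := by
    have h1 := (ContinuousAlternatingMap.ofSubsingletonLIE (𝕜 := ℝ)
      (E := EuclideanSpace ℝ (Fin _)) (F := ℝ) (0 : Fin 1)).symm.contDiff.comp (α.smooth P hP)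
    exact (ContinuousAlternatingMap.alternatizeUncurryFinCLM ℝ _ ℝ).contDiff.comp
      (h1.smulRight (β.smooth P hP))
  natural P hP g hg u := by
    rw [α.natural P hP g hg, β.natural P hP g hg]
    ext v
    simp only [wedgeOne_apply, ContinuousAlternatingMap.compContinuousLinearMap_apply]
    rfl

/-- Closed `k`-forms. -/
def closedForms {X : Type*} (D : DiffeologicalSpace X) (k : ℕ) : Submodule ℝ (DForm D k) :=
  LinearMap.ker DForm.d

/-- Exact `k`-forms. -/
def exactForms {X : Type*} (D : DiffeologicalSpace X) : (k : ℕ) → Submodule ℝ (DForm D k)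
  | 0 => ⊥
  | _ + 1 => LinearMap.range DForm.d

/-- The de Rham cohomology `H^k(X; ℝ)`. -/
abbrev HdR {X : Type*} (D : DiffeologicalSpace X) (k : ℕ) : Type _ :=
  closedForms D k ⧸ (exactForms D k).comap (closedForms D k).subtype

/-- The cohomology class of a closed form. -/
def HdR.mk {X : Type*} {D : DiffeologicalSpace X} {k : ℕ} (α : DForm D k)
    (hα : DForm.d α = 0) : HdR D k :=
  Submodule.Quotient.mk ⟨α, LinearMap.mem_ker.2 hα⟩

/-- The map induced on cohomology by a smooth map. -/
def HdR.map {X Y : Type*} {D : DiffeologicalSpace X} {D' : DiffeologicalSpace Y} (k : ℕ)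
    (f : X → Y) (hf : @Diffeology.DSmooth X Y D D' f) : HdR D' k →ₗ[ℝ] HdR D k :=
  Submodule.mapQ _ _
    ((DForm.pullback f hf).restrict (p := closedForms D' k) (q := closedForms D k)
      (fun α hα => by
        rw [closedForms, LinearMap.mem_ker] at hα ⊢
        rw [DForm.d_pullback, hα, map_zero]))
    (by
      rintro ⟨α, hα⟩ h
      cases k with
      | zero =>
        have h0 : α = 0 := by simpa [exactForms] using h
        subst h0
        exact Submodule.zero_mem _
      | succ k =>
        obtain ⟨β, hβ⟩ : α ∈ LinearMap.range DForm.d := h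
        exact ⟨DForm.pullback f hf β, by rw [DForm.d_pullback, hβ]; rfl⟩)

theorem totalSpace_mk_inj {B F : Type*} {V : B → Type*} {b : B} {v w : V b}
    (h : (⟨b, v⟩ : TotalSpace F V) = ⟨b, w⟩) : v = w := by
  cases h; rfl

/-! ### Smooth manifolds: diffeology, forms, symplectic forms -/

section Manifold

variable {E : Type*} [NormedAddCommGroup E] [NormedSpace ℝ E]
  {H : Type*} [TopologicalSpace H] (I : ModelWithCorners ℝ E H)
  (M : Type*) [TopologicalSpace M] [ChartedSpace H M]

/-- The standard diffeology of a manifold: plots are the smooth maps `ℝᵐ → M`. -/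
@[reducible] def manifoldDiffeology : DiffeologicalSpace M :=
  .ofCorePlotsOn {
    isPlotOn := fun {m u} _ p => ContMDiffOn 𝓘(ℝ, EuclideanSpace ℝ (Fin m)) I ∞ p u
    isPlotOn_congr := fun _ _ _ h => contMDiffOn_congr h
    isPlot := fun {m} p => ContMDiff 𝓘(ℝ, EuclideanSpace ℝ (Fin m)) I ∞ p
    isPlotOn_univ := contMDiffOn_univ
    isPlot_const := fun _ => contMDiff_const
    isPlotOn_reparam := fun _ _ _ h hp hf => hp.comp hf.contMDiffOn h.subset_preimage
    locality := fun _ _ h x hxu => by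
      obtain ⟨v, hv, hxv, hv'⟩ := h x hxu
      exact ((hv' x hxv).contMDiffAt (hv.mem_nhds hxv)).contMDiffWithinAt }

theorem mem_manifoldDiffeology_plots {m : ℕ} (P : EuclideanSpace ℝ (Fin m) → M) :
    P ∈ (manifoldDiffeology I M).plots m ↔
      ContMDiff 𝓘(ℝ, EuclideanSpace ℝ (Fin m)) I ∞ P := Iff.rfl

/-- Families of alternating `k`-forms on the tangent spaces (no smoothness). -/
abbrev FormField (k : ℕ) : Type _ := ∀ x : M, TangentSpace I x [⋀^Fin k]→L[ℝ] ℝ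

variable {I M} in
/-- The pullback `P^*η` of a form along a map `P : ℝᵐ → M`. -/
def FormField.pull {k m : ℕ} (η : FormField I M k) (P : EuclideanSpace ℝ (Fin m) → M)
    (u : EuclideanSpace ℝ (Fin m)) : EuclideanSpace ℝ (Fin m) [⋀^Fin k]→L[ℝ] ℝ :=
  (η (P u)).compContinuousLinearMap
    (mfderiv 𝓘(ℝ, EuclideanSpace ℝ (Fin m)) I P u)

/-- A smooth differential `k`-form on a manifold without boundary, given by its values on the
tangent spaces; smoothness means that its pullback along every smooth map `ℝᵐ → M`
is smooth. -/
structure SmoothForm (k : ℕ) where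
  toFun : FormField I M k
  smooth : ∀ {m : ℕ} (P : EuclideanSpace ℝ (Fin m) → M),
    ContMDiff 𝓘(ℝ, EuclideanSpace ℝ (Fin m)) I ∞ P → ContDiff ℝ ∞ (toFun.pull P)

variable {I M}

/-- The form on the plots of `M` given by a smooth form. -/
def SmoothForm.toDForm {k : ℕ} (η : SmoothForm I M k) : DForm (manifoldDiffeology I M) k where
  val P _ := η.toFun.pull P
  smooth P hP := η.smooth P hP
  natural {m m'} P hP g hg u := by
    have h : mfderiv 𝓘(ℝ, EuclideanSpace ℝ (Fin m')) I (P ∘ g) u =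
        (mfderiv 𝓘(ℝ, EuclideanSpace ℝ (Fin m)) I P (g u)).comp (fderiv ℝ g u) := by
      have h0 := mfderiv_comp u
        (((mem_manifoldDiffeology_plots I M P).1 hP).mdifferentiableAt (by simp))
        (hg.contMDiff.mdifferentiableAt (by simp))
      rw [mfderiv_eq_fderiv] at h0
      exact h0
    ext v
    simp only [FormField.pull, ContinuousAlternatingMap.compContinuousLinearMap_apply, h]
    rfl

variable (I M) in
/-- A symplectic form: a smooth, closed, nondegenerate `2`-form. -/
structure SymplecticForm extends SmoothForm I M 2 where
  closed : DForm.d toSmoothForm.toDForm = 0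
  nondegenerate : ∀ (x : M) (u : TangentSpace I x),
    (∀ v : TangentSpace I x, toFun x ![u, v] = 0) → u = 0

/-- The de Rham class `[σ] ∈ H²(M; ℝ)`. -/
def SymplecticForm.cls (σ : SymplecticForm I M) : HdR (manifoldDiffeology I M) 2 :=
  HdR.mk σ.toSmoothForm.toDForm σ.closed

variable [IsManifold I ∞ M]

/-! ### The first Chern class and monotonicity -/

/-- `J` is a smooth almost complex structure compatible with `σ`. -/
structure IsCompatibleJ (σ : SymplecticForm I M)
    (J : ∀ x : M, TangentSpace I x →L[ℝ] TangentSpace I x) : Prop where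
  smooth : ContMDiff I (I.prod 𝓘(ℝ, E →L[ℝ] E)) ∞
    (fun x => TotalSpace.mk' (E →L[ℝ] E)
      (E := fun x : M => TangentSpace I x →L[ℝ] TangentSpace I x) x (J x))
  sq : ∀ x v, J x (J x v) = -v
  invariant : ∀ x u v, σ.toFun x ![J x u, J x v] = σ.toFun x ![u, v]
  pos : ∀ x u, u ≠ 0 → 0 < σ.toFun x ![u, J x u]

/-- Smooth vector fields. -/
def IsSmoothField (X : ∀ x : M, TangentSpace I x) : Prop :=
  ContMDiff I I.tangent ∞ (fun x => (⟨x, X x⟩ : TangentBundle I M))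

/-- `κ` is the first Chern form `(i/2π) tr_ℂ R` (its real part, `(1/4π) tr_ℝ (J ∘ R)`) of the
connection `cov` on the complex vector bundle `(TM, J)`, where `R` is the curvature tensor
`R(X, Y)Z = ∇_X ∇_Y Z - ∇_Y ∇_X Z - ∇_[X,Y] Z`. -/
def IsChernForm (J : ∀ x : M, TangentSpace I x →L[ℝ] TangentSpace I x)
    (cov : CovariantDerivative I E (TangentSpace I : M → Type _)) (κ : SmoothForm I M 2) : Prop :=
  ∃ R : ∀ x : M, TangentSpace I x → TangentSpace I x → (TangentSpace I x →ₗ[ℝ] TangentSpace I x),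
    (∀ X Y Z : (∀ x : M, TangentSpace I x), IsSmoothField X → IsSmoothField Y → IsSmoothField Z →
      ∀ x, R x (X x) (Y x) (Z x) =
        cov (fun y => cov Z y (Y y)) x (X x) - cov (fun y => cov Z y (X y)) x (Y x)
          - cov Z x (VectorField.mlieBracket I X Y x)) ∧
    ∀ (x : M) (u v : TangentSpace I x),
      κ.toFun x ![u, v] =
        1 / (4 * Real.pi) * LinearMap.trace ℝ (TangentSpace I x)
          ((J x : TangentSpace I x →ₗ[ℝ] TangentSpace I x) ∘ₗ R x u v)

/-- `c` is the real first Chern class of `(M, σ)`: the class of the Chern form of a smooth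
`J`-linear connection on `TM`, for a compatible almost complex structure `J`. -/
def IsFirstChernClass (σ : SymplecticForm I M)
    (c : HdR (manifoldDiffeology I M) 2) : Prop :=
  ∃ (J : ∀ x : M, TangentSpace I x →L[ℝ] TangentSpace I x)
    (cov : CovariantDerivative I E (TangentSpace I : M → Type _)) (κ : SmoothForm I M 2)
    (hκ : DForm.d κ.toDForm = 0),
    IsCompatibleJ σ J ∧
    CovariantDerivative.ContMDiffCovariantDerivative cov ∞ ∧
    (∀ Z : (∀ x : M, TangentSpace I x), IsSmoothField Z →
      ∀ x v, cov (fun y => J y (Z y)) x v = J x (cov Z x v)) ∧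
    IsChernForm J cov κ ∧ c = HdR.mk κ.toDForm hκ

/-- `(M, σ)` is monotone: `[σ] = τ c₁(M)` in `H²(M; ℝ)` for some real `τ`. -/
def IsMonotone (σ : SymplecticForm I M) : Prop :=
  ∃ (τ : ℝ) (c : HdR (manifoldDiffeology I M) 2), IsFirstChernClass σ c ∧ σ.cls = τ • c

/-! ### Lagrangian immersions and the Lagrangian Grassmannian -/

/-- `W` is a Lagrangian subspace: it equals its symplectic orthogonal. -/
def IsLagrangianSubspace {V : Type*} [AddCommGroup V] [Module ℝ V] [TopologicalSpace V]
    (σ : V [⋀^Fin 2]→L[ℝ] ℝ) (W : Submodule ℝ V) : Prop :=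
  ∀ u, u ∈ W ↔ ∀ w ∈ W, σ ![u, w] = 0

/-- A Lagrangian immersion into `(M, σ)`: a smooth immersion all of whose tangent planes are
Lagrangian subspaces. -/
structure IsLagrangianImmersion {E' : Type*} [NormedAddCommGroup E'] [NormedSpace ℝ E']
    {H' : Type*} [TopologicalSpace H'] (I' : ModelWithCorners ℝ E' H')
    {L : Type*} [TopologicalSpace L] [ChartedSpace H' L]
    (σ : FormField I M 2) (f : L → M) : Prop where
  contMDiff : ContMDiff I' I ∞ f
  injective : ∀ p, Function.Injective (mfderiv I' I f p)
  lagrangian : ∀ p, IsLagrangianSubspace (σ (f p))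
    (LinearMap.range (mfderiv I' I f p : TangentSpace I' p →ₗ[ℝ] TangentSpace I (f p)))

/-- The Lagrangian Grassmannian `ℒM` of `(M, σ)`. -/
@[ext]
structure LagGr (σ : FormField I M 2) where
  pt : M
  plane : Submodule ℝ (TangentSpace I pt)
  isLagrangian : IsLagrangianSubspace (σ pt) plane

/-- The smooth structure of `ℒM`: a map `P : ℝᵐ → ℒM` is smooth on `u` if its base point is smooth on `u` and, locally on `u`,
the planes `P y` are spanned by finitely many smooth vector fields along it (the rank being
constant, this says that the planes form a smooth subbundle of the pulled back tangent bundle). -/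
def LagGr.IsPlotOn {σ : FormField I M 2} {m : ℕ} (u : Set (EuclideanSpace ℝ (Fin m)))
    (P : EuclideanSpace ℝ (Fin m) → LagGr σ) : Prop :=
  ContMDiffOn 𝓘(ℝ, EuclideanSpace ℝ (Fin m)) I ∞ (fun y => (P y).pt) u ∧
  ∀ x ∈ u, ∃ v, IsOpen v ∧ x ∈ v ∧ v ⊆ u ∧
    ∃ (N : ℕ) (X : Fin N → EuclideanSpace ℝ (Fin m) → TangentBundle I M),
      (∀ i, ContMDiffOn 𝓘(ℝ, EuclideanSpace ℝ (Fin m)) I.tangent ∞ (X i) v) ∧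
      ∀ y ∈ v, (∀ i, (X i y).proj = (P y).pt) ∧
        (P y).plane = Submodule.span ℝ {w | ∃ i, X i y = ⟨(P y).pt, w⟩}

/-- The smooth structure of the Lagrangian Grassmannian bundle. -/
@[reducible] def lagGrDiffeology [FiniteDimensional ℝ E] (σ : FormField I M 2) :
    DiffeologicalSpace (LagGr σ) :=
  .ofCorePlotsOn {
    isPlotOn := fun {m u} _ P => LagGr.IsPlotOn u P
    isPlotOn_congr := by
      have key : ∀ {m : ℕ} {u : Set (EuclideanSpace ℝ (Fin m))}
          {p q : EuclideanSpace ℝ (Fin m) → LagGr σ}, Set.EqOn p q u →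
          LagGr.IsPlotOn u p → LagGr.IsPlotOn u q := by
        rintro m u p q h ⟨h1, h2⟩
        refine ⟨h1.congr fun y hy => by rw [h hy], fun x hx => ?_⟩
        obtain ⟨v, hv, hxv, hvu, N, X, hX, hs⟩ := h2 x hx
        exact ⟨v, hv, hxv, hvu, N, X, hX, fun y hy => h (hvu hy) ▸ hs y hy⟩
      intro n u _ p q h
      exact ⟨key h, key h.symm⟩
    isPlot_const := fun x => by
      refine ⟨contMDiffOn_const, fun y _ => ⟨univ, isOpen_univ, mem_univ _, Subset.rfl, ?_⟩⟩
      have : FiniteDimensional ℝ (TangentSpace I x.pt) := inferInstanceAs (FiniteDimensional ℝ E)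
      obtain ⟨N, s, hs⟩ := Submodule.fg_iff_exists_fin_generating_family.1
        (IsNoetherian.noetherian x.plane)
      refine ⟨N, fun i _ => ⟨x.pt, s i⟩, fun i => contMDiffOn_const, fun y _ => ⟨fun i => rfl, ?_⟩⟩
      rw [← hs]
      congr 1
      ext w
      constructor
      · rintro ⟨i, rfl⟩; exact ⟨i, rfl⟩
      · rintro ⟨i, hi⟩
        exact ⟨i, by simpa using hi⟩
    isPlotOn_reparam := fun {n m u v hu} hv p f h hp hf => by
      refine ⟨hp.1.comp hf.contMDiffOn h.subset_preimage, fun x hx => ?_⟩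
      obtain ⟨w, hw, hxw, hwu, N, X, hX, hs⟩ := hp.2 (f x) (h hx)
      refine ⟨v ∩ f ⁻¹' w, hf.continuousOn.isOpen_inter_preimage hv hw, ⟨hx, hxw⟩,
        inter_subset_left, N, fun i => X i ∘ f, fun i => ?_, fun y hy => hs (f y) hy.2⟩
      exact (hX i).comp (hf.contMDiffOn.mono inter_subset_left) inter_subset_right
    locality := fun {n u} hu p hp => by
      refine ⟨fun x hx => ?_, fun x hx => ?_⟩
      · obtain ⟨v, hv, hxv, h1, -⟩ := hp x hx
        exact ((h1 x hxv).contMDiffAt (hv.mem_nhds hxv)).contMDiffWithinAt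
      · obtain ⟨v, hv, hxv, -, h2⟩ := hp x hx
        obtain ⟨w, hw, hxw, hwv, N, X, hX, hs⟩ := h2 x hxv
        exact ⟨w ∩ u, hw.inter hu, ⟨hxw, hx⟩, inter_subset_right, N, X,
          fun i => (hX i).mono inter_subset_left, fun y hy => hs y hy.1⟩ }

/-- The projection `π : ℒM → M` is smooth. -/
theorem LagGr.smooth_pt [FiniteDimensional ℝ E] (σ : FormField I M 2) :
    @Diffeology.DSmooth (LagGr σ) M (lagGrDiffeology σ) (manifoldDiffeology I M) LagGr.pt :=
  fun _ _ hP => contMDiffOn_univ.1 hP.1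

/-- The Gauss map `f̃ : L → ℒM` of a Lagrangian immersion. -/
def gaussMap {E' : Type*} [NormedAddCommGroup E'] [NormedSpace ℝ E']
    {H' : Type*} [TopologicalSpace H'] {I' : ModelWithCorners ℝ E' H'}
    {L : Type*} [TopologicalSpace L] [ChartedSpace H' L]
    {σ : FormField I M 2} {f : L → M} (hf : IsLagrangianImmersion I' σ f) (p : L) : LagGr σ where
  pt := f p
  plane := LinearMap.range (mfderiv I' I f p : TangentSpace I' p →ₗ[ℝ] TangentSpace I (f p))
  isLagrangian := hf.lagrangian p

theorem smooth_gaussMap {E' : Type*} [NormedAddCommGroup E'] [NormedSpace ℝ E']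
    [FiniteDimensional ℝ E'] [FiniteDimensional ℝ E]
    {H' : Type*} [TopologicalSpace H'] {I' : ModelWithCorners ℝ E' H'}
    {L : Type*} [TopologicalSpace L] [ChartedSpace H' L] [IsManifold I' ∞ L]
    {σ : FormField I M 2} {f : L → M} (hf : IsLagrangianImmersion I' σ f) :
    @Diffeology.DSmooth L (LagGr σ) (manifoldDiffeology I' L) (lagGrDiffeology σ)
      (gaussMap hf) := by
  intro m P hP
  have hP' : ContMDiff 𝓘(ℝ, EuclideanSpace ℝ (Fin m)) I' ∞ P := hP
  have hm : ContMDiff 𝓘(ℝ, EuclideanSpace ℝ (Fin m)) I ∞ (f ∘ P) := hf.contMDiff.comp hP'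
  refine ⟨hm.contMDiffOn, fun x _ => ?_⟩
  let e := trivializationAt E' (TangentSpace I' : L → Type _) (P x)
  let b := Module.finBasis ℝ E'
  have hx0 : P x ∈ e.baseSet :=
    FiberBundle.mem_baseSet_trivializationAt E' (TangentSpace I' : L → Type _) (P x)
  refine ⟨P ⁻¹' e.baseSet, e.open_baseSet.preimage hP'.continuous,
    hx0, subset_univ _, Module.finrank ℝ E',
    fun i y => tangentMap I' I f ⟨P y, e.localFrame b i (P y)⟩, fun i => ?_, fun y hy => ?_⟩
  · have h1 : ContMDiffOn I' I'.tangent ∞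
        (fun q : L => (⟨q, e.localFrame b i q⟩ : TangentBundle I' L)) e.baseSet :=
      e.contMDiffOn_localFrame_baseSet ∞ b i
    have h2 : ContMDiff I'.tangent I.tangent ∞ (tangentMap I' I f) :=
      hf.contMDiff.contMDiff_tangentMap (m := ∞) (by simp)
    exact h2.comp_contMDiffOn (h1.comp hP'.contMDiffOn Subset.rfl)
  · refine ⟨fun i => rfl, ?_⟩
    have hb : Submodule.span ℝ (range fun i => e.localFrame b i (P y)) = ⊤ :=
      top_le_iff.1 ((e.isLocalFrameOn_localFrame_baseSet I' ∞ b).generating hy)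
    change LinearMap.range (mfderiv I' I f (P y) :
      TangentSpace I' (P y) →ₗ[ℝ] TangentSpace I (f (P y))) = _
    rw [LinearMap.range_eq_map, ← hb, Submodule.map_span, ← range_comp]
    congr 1
    ext w
    constructor
    · rintro ⟨i, rfl⟩; exact ⟨i, rfl⟩
    · rintro ⟨i, hi⟩
      refine ⟨i, ?_⟩
      exact totalSpace_mk_inj hi

/-- An action form on `(M, σ)`: a primitive of `π^*σ` on `ℒM`. -/
def IsActionForm [FiniteDimensional ℝ E] (σ : SymplecticForm I M)
    (lam : DForm (lagGrDiffeology σ.toFun) 1) : Prop :=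
  DForm.d lam = DForm.pullback LagGr.pt (LagGr.smooth_pt σ.toFun) σ.toSmoothForm.toDForm

end Manifold

/-! ### Stabilization -/

section Stabilization

variable {E : Type*} [NormedAddCommGroup E] [NormedSpace ℝ E]
  {H : Type*} [TopologicalSpace H] {I : ModelWithCorners ℝ E H}
  {M : Type*} [TopologicalSpace M] [ChartedSpace H M]

/-- The standard symplectic form `dx ∧ dy` on `ℂ`. -/
def omegaC : ℂ [⋀^Fin 2]→L[ℝ] ℝ :=
  wedgeOne (ContinuousAlternatingMap.ofSubsingleton ℝ ℂ ℝ (0 : Fin 1) Complex.reCLM)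
    (ContinuousAlternatingMap.ofSubsingleton ℝ ℂ ℝ (0 : Fin 1) Complex.imCLM)

theorem omegaC_apply (z w : ℂ) : omegaC ![z, w] = z.re * w.im - w.re * z.im := by
  simp [omegaC, wedgeOne_apply, Fin.sum_univ_two, Fin.removeNth]
  ring

/-- The form `ω_ℂ ⊕ σ` on `ℂ × M`. -/
def prodForm (σ : FormField I M 2) : FormField (𝓘(ℝ, ℂ).prod I) (ℂ × M) 2 := fun q =>
  (omegaC.compContinuousLinearMap (ContinuousLinearMap.fst ℝ ℂ (TangentSpace I q.2)) +
    (σ q.2).compContinuousLinearMap (ContinuousLinearMap.snd ℝ ℂ (TangentSpace I q.2)) :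
    (ℂ × TangentSpace I q.2) [⋀^Fin 2]→L[ℝ] ℝ)

theorem prodForm_apply (σ : FormField I M 2) (q : ℂ × M) (u v : ℂ × TangentSpace I q.2) :
    prodForm σ q ![u, v] = omegaC ![u.1, v.1] + σ q.2 ![u.2, v.2] := by
  change omegaC (_ ∘ ![u, v]) + σ q.2 (_ ∘ ![u, v]) = _
  congr 2 <;> · ext i; fin_cases i <;> rfl

/-- The stabilization map `i : ℒM → ℒ(ℂ × M)`, `(p, U) ↦ ((0, p), ℝ ⊕ U)`. -/
def stabilize {σ : FormField I M 2} (x : LagGr σ) : LagGr (prodForm σ) where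
  pt := (0, x.pt)
  plane := ((Submodule.span ℝ {(1 : ℂ)}).prod x.plane : Submodule ℝ (ℂ × TangentSpace I x.pt))
  isLagrangian := by
    intro u
    change (ℂ × TangentSpace I x.pt) at u
    change u ∈ (Submodule.span ℝ {(1 : ℂ)}).prod x.plane ↔
      ∀ w ∈ ((Submodule.span ℝ {(1 : ℂ)}).prod x.plane : Submodule ℝ (ℂ × TangentSpace I x.pt)),
        prodForm σ (0, x.pt) ![u, w] = 0
    have hz : ∀ z : ℂ, z ∈ Submodule.span ℝ {(1 : ℂ)} ↔ z.im = 0 := by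
      intro z
      rw [Submodule.mem_span_singleton]
      constructor
      · rintro ⟨a, rfl⟩; simp
      · intro h; exact ⟨z.re, by apply Complex.ext <;> simp [h]⟩
    have h0 : ∀ a : TangentSpace I x.pt, σ x.pt ![a, 0] = 0 := fun a =>
      (σ x.pt).map_coord_zero (1 : Fin 2) rfl
    constructor
    · rintro ⟨h1, h2⟩ w ⟨h3, h4⟩
      refine (prodForm_apply σ (0, x.pt) u w).trans ?_
      rw [omegaC_apply, (hz _).1 h1, (hz _).1 h3, (x.isLagrangian u.2).1 h2 w.2 h4]
      simp
    · intro h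
      refine ⟨(hz _).2 ?_, (x.isLagrangian u.2).2 fun w hw => ?_⟩
      · have := (prodForm_apply σ (0, x.pt) u (1, 0)).symm.trans
          (h (1, 0) ⟨(hz _).2 (by simp), Submodule.zero_mem _⟩)
        rw [omegaC_apply, h0] at this
        simpa using this
      · have := (prodForm_apply σ (0, x.pt) u (0, w)).symm.trans
          (h (0, w) ⟨(hz _).2 (by simp), hw⟩)
        rw [omegaC_apply] at this
        simpa using this

variable [IsManifold I ∞ M]

theorem smooth_stabilize [FiniteDimensional ℝ E] (σ : FormField I M 2) :
    @Diffeology.DSmooth (LagGr σ) (LagGr (prodForm σ)) (lagGrDiffeology σ)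
      (lagGrDiffeology (prodForm σ)) stabilize := by
  intro m P hP
  refine ⟨contMDiffOn_const.prodMk hP.1, fun x hx => ?_⟩
  obtain ⟨v, hv, hxv, hvu, N, X, hX, hs⟩ := hP.2 x hx
  let s := (equivTangentBundleProd 𝓘(ℝ, ℂ) ℂ I M).symm
  have hsm : ContMDiff (𝓘(ℝ, ℂ).tangent.prod I.tangent) (𝓘(ℝ, ℂ).prod I).tangent ∞ s :=
    contMDiff_equivTangentBundleProd_symm
  have hz : ContMDiff I I.tangent ∞ (fun q : M => (⟨q, 0⟩ : TangentBundle I M)) :=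
    Bundle.contMDiff_zeroSection ℝ (TangentSpace I : M → Type _)
  refine ⟨v, hv, hxv, hvu, N + 1,
    Fin.cons (fun y => s (⟨0, (1 : ℂ)⟩, ⟨(P y).pt, 0⟩)) (fun i y => s (⟨0, (0 : ℂ)⟩, X i y)),
    fun i => ?_, fun y hy => ⟨fun i => ?_, ?_⟩⟩
  · refine Fin.cases ?_ (fun i => ?_) i
    · exact hsm.comp_contMDiffOn (contMDiffOn_const.prodMk
        (hz.comp_contMDiffOn (hP.1.mono (subset_univ _))))
    · exact hsm.comp_contMDiffOn (contMDiffOn_const.prodMk (hX i))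
  · refine Fin.cases rfl (fun i => ?_) i
    exact Prod.ext rfl ((hs y hy).1 i)
  · change ((Submodule.span ℝ {(1 : ℂ)}).prod (P y).plane :
      Submodule ℝ (ℂ × TangentSpace I (P y).pt)) = Submodule.span ℝ
        {w : ℂ × TangentSpace I (P y).pt | _}
    apply le_antisymm
    · rw [(hs y hy).2]
      rintro ⟨z, w⟩ ⟨hz1, hw⟩
      obtain ⟨a, rfl⟩ := Submodule.mem_span_singleton.1 hz1
      have e : ((a • (1 : ℂ), w) : ℂ × TangentSpace I (P y).pt) =
          a • ((1 : ℂ), (0 : TangentSpace I (P y).pt)) + LinearMap.inr ℝ ℂ _ w := by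
        simp
      change ((a • (1 : ℂ), w) : ℂ × TangentSpace I (P y).pt) ∈ _
      rw [e]
      refine Submodule.add_mem _ (Submodule.smul_mem _ _ (Submodule.subset_span ⟨0, rfl⟩)) ?_
      have hw' := Submodule.mem_map_of_mem (f := LinearMap.inr ℝ ℂ (TangentSpace I (P y).pt)) hw
      rw [Submodule.map_span] at hw'
      refine Submodule.span_mono ?_ hw'
      rintro _ ⟨w', ⟨i, hi⟩, rfl⟩
      refine ⟨i.succ, ?_⟩
      simp only [Fin.cons_succ, hi]
      rfl
    · rw [Submodule.span_le]
      rintro ⟨z, w⟩ ⟨i, hi⟩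
      revert hi
      refine Fin.cases (fun hi => ?_) (fun i hi => ?_) i
      · obtain ⟨rfl, rfl⟩ : z = 1 ∧ w = 0 := by
          have : ((1 : ℂ), (0 : TangentSpace I (P y).pt)) = (z, w) :=
            totalSpace_mk_inj (F := ℂ × E) (V := (TangentSpace (𝓘(ℝ, ℂ).prod I) : ℂ × M → Type _))
              (b := (0, (P y).pt)) hi
          exact ⟨(congrArg Prod.fst this).symm, (congrArg Prod.snd this).symm⟩
        exact ⟨Submodule.mem_span_singleton_self _, Submodule.zero_mem _⟩
      · rcases hX' : X i y with ⟨q, w'⟩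
        have hq : q = (P y).pt := by have := (hs y hy).1 i; rw [hX'] at this; exact this
        subst hq
        obtain ⟨rfl, rfl⟩ : z = 0 ∧ w = w' := by
          have : ((0 : ℂ), w') = (z, w) := by
            simp only [Fin.cons_succ, hX'] at hi
            exact totalSpace_mk_inj (F := ℂ × E)
              (V := (TangentSpace (𝓘(ℝ, ℂ).prod I) : ℂ × M → Type _)) (b := (0, (P y).pt)) hi
          exact ⟨(congrArg Prod.fst this).symm, (congrArg Prod.snd this).symm⟩
        refine ⟨Submodule.zero_mem _, ?_⟩
        rw [(hs y hy).2]
        exact Submodule.subset_span ⟨i, hX'⟩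

end Stabilization

/-! ### Orientations and integration -/

section Orientation

/-- `v` is a positively oriented basis. -/
def IsPosFrame {V : Type*} [AddCommGroup V] [Module ℝ V] {n : ℕ}
    (o : Orientation ℝ V (Fin n)) (v : Fin n → V) : Prop :=
  ∃ b : Basis (Fin n) ℝ V, ⇑b = v ∧ b.orientation = o

/-- An orientation of an `n`-manifold (possibly with boundary): an orientation of each tangent
space such that around every point there is a continuous positively oriented frame. -/
structure ManifoldOrientation {E : Type*} [NormedAddCommGroup E] [NormedSpace ℝ E]
    {H : Type*} [TopologicalSpace H] (I : ModelWithCorners ℝ E H)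
    (M : Type*) [TopologicalSpace M] [ChartedSpace H M] [IsManifold I ∞ M] (n : ℕ) where
  o : ∀ x : M, Orientation ℝ (TangentSpace I x) (Fin n)
  locally_framed : ∀ x : M, ∃ U ∈ 𝓝 x, ∃ s : Fin n → ∀ y : M, TangentSpace I y,
    (∀ i, ContinuousOn (fun y => (⟨y, s i y⟩ : TangentBundle I M)) U) ∧
    ∀ y ∈ U, IsPosFrame (o y) (fun i => s i y)

variable {n : ℕ} {L : Type*} [TopologicalSpace L] [ChartedSpace (EuclideanSpace ℝ (Fin n)) L]

theorem exists_chart_ball (x : L) : ∃ r : ℝ, 0 < r ∧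
    Metric.ball (chartAt (EuclideanSpace ℝ (Fin n)) x x) r ⊆
      (chartAt (EuclideanSpace ℝ (Fin n)) x).target :=
  Metric.isOpen_iff.1 (chartAt (EuclideanSpace ℝ (Fin n)) x).open_target _
    (mem_chart_target _ x)

/-- A parametrization `ℝⁿ → L` of a coordinate ball around `x`. -/
def ballPlot (x : L) (u : EuclideanSpace ℝ (Fin n)) : L :=
  (chartAt (EuclideanSpace ℝ (Fin n)) x).symm
    (OpenPartialHomeomorph.univBall (chartAt (EuclideanSpace ℝ (Fin n)) x x)
      (exists_chart_ball (n := n) x).choose u)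

theorem ballPlot_mem (x : L) (u : EuclideanSpace ℝ (Fin n)) :
    OpenPartialHomeomorph.univBall (chartAt (EuclideanSpace ℝ (Fin n)) x x)
      (exists_chart_ball (n := n) x).choose u ∈ (chartAt (EuclideanSpace ℝ (Fin n)) x).target := by
  have h := (exists_chart_ball (n := n) x).choose_spec
  apply h.2
  rw [← OpenPartialHomeomorph.univBall_target _ h.1]
  exact OpenPartialHomeomorph.map_source _ (by simp)

theorem contMDiff_ballPlot [IsManifold (𝓡 n) ∞ L] (x : L) :
    ContMDiff (𝓡 n) (𝓡 n) ∞ (ballPlot x : EuclideanSpace ℝ (Fin n) → L) := by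
  have h1 : ContMDiffOn (𝓡 n) (𝓡 n) ∞ (chartAt (EuclideanSpace ℝ (Fin n)) x).symm
      (chartAt (EuclideanSpace ℝ (Fin n)) x).target := contMDiffOn_chart_symm
  exact h1.comp_contMDiff (OpenPartialHomeomorph.contDiff_univBall.contMDiff) (ballPlot_mem x)

theorem mem_range_ballPlot (x : L) :
    x ∈ range (ballPlot x : EuclideanSpace ℝ (Fin n) → L) :=
  ⟨0, by simp [ballPlot]⟩

theorem isOpen_range_ballPlot (x : L) :
    IsOpen (range (ballPlot x : EuclideanSpace ℝ (Fin n) → L)) := by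
  have h := (exists_chart_ball (n := n) x).choose_spec
  have e : range (ballPlot x : EuclideanSpace ℝ (Fin n) → L) =
      (chartAt (EuclideanSpace ℝ (Fin n)) x).symm ''
        Metric.ball (chartAt (EuclideanSpace ℝ (Fin n)) x x) (exists_chart_ball (n := n) x).choose := by
    rw [← OpenPartialHomeomorph.univBall_target _ h.1,
      ← OpenPartialHomeomorph.image_source_eq_target, OpenPartialHomeomorph.univBall_source,
      image_univ, ← range_comp]
    rfl
  rw [e]
  exact (chartAt (EuclideanSpace ℝ (Fin n)) x).symm.isOpen_image_of_subset_source
    Metric.isOpen_ball h.2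

theorem exists_ballPartition [IsManifold (𝓡 n) ∞ L] [T2Space L] [CompactSpace L] :
    ∃ ρ : SmoothPartitionOfUnity L (𝓡 n) L univ,
      ρ.IsSubordinate (fun x => range (ballPlot x : EuclideanSpace ℝ (Fin n) → L)) :=
  SmoothPartitionOfUnity.exists_isSubordinate (𝓡 n) isClosed_univ _ isOpen_range_ballPlot
    (fun x _ => mem_iUnion.2 ⟨x, mem_range_ballPlot x⟩)

open scoped Classical in
/-- The integral `∫_L α` of an `n`-form over a closed oriented `n`-manifold `L`: the sum, over
a partition of unity subordinate to coordinate balls, of the integrals in coordinates; each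
coordinate integral carries the sign comparing the coordinates with the orientation. -/
def integralForm [IsManifold (𝓡 n) ∞ L] [T2Space L] [CompactSpace L]
    (o : ManifoldOrientation (𝓡 n) L n) (α : DForm (manifoldDiffeology (𝓡 n) L) n) : ℝ :=
  ∑ᶠ x : L, ∫ u : EuclideanSpace ℝ (Fin n),
    (if IsPosFrame (o.o (ballPlot x u)) (fun i =>
        mfderiv (𝓡 n) (𝓡 n) (ballPlot x) u (EuclideanSpace.single i (1 : ℝ)))
      then (1 : ℝ) else -1) *
    (exists_ballPartition (n := n) (L := L)).choose x (ballPlot x u) *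
    α.val (ballPlot x) (contMDiff_ballPlot x) u (fun i => EuclideanSpace.single i (1 : ℝ))

end Orientation

/-! ### Closed oriented Lagrangians, their characteristic numbers and cobordisms -/

section Lagrangians

universe u v w

/-- An oriented Lagrangian immersion of a closed `n`-manifold into `(M, σ)`. -/
structure OrientedLagrangian {E : Type*} [NormedAddCommGroup E] [NormedSpace ℝ E]
    {H : Type*} [TopologicalSpace H] {I : ModelWithCorners ℝ E H}
    {M : Type*} [TopologicalSpace M] [ChartedSpace H M] (n : ℕ) (σ : FormField I M 2) where
  carrier : Type u
  [top : TopologicalSpace carrier]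
  [charted : ChartedSpace (EuclideanSpace ℝ (Fin n)) carrier]
  [manifold : IsManifold (𝓡 n) ∞ carrier]
  [t2 : T2Space carrier]
  [compact : CompactSpace carrier]
  orientation : ManifoldOrientation (𝓡 n) carrier n
  toFun : carrier → M
  isLagrangianImmersion : IsLagrangianImmersion (𝓡 n) σ toFun

attribute [instance] OrientedLagrangian.top OrientedLagrangian.charted
  OrientedLagrangian.manifold OrientedLagrangian.t2 OrientedLagrangian.compact

variable {E : Type*} [NormedAddCommGroup E] [NormedSpace ℝ E] [FiniteDimensional ℝ E]
  {H : Type*} [TopologicalSpace H] {I : ModelWithCorners ℝ E H}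
  {M : Type*} [TopologicalSpace M] [ChartedSpace H M] [IsManifold I ∞ M]

/-- The Gauss map pulls an action form back to a closed form. -/
theorem closed_pullback_gaussMap {n : ℕ} {σ : SymplecticForm I M}
    {lam : DForm (lagGrDiffeology σ.toFun) 1} (hlam : IsActionForm σ lam)
    {L : Type*} [TopologicalSpace L] [ChartedSpace (EuclideanSpace ℝ (Fin n)) L]
    [IsManifold (𝓡 n) ∞ L] {f : L → M} (hf : IsLagrangianImmersion (𝓡 n) σ.toFun f) :
    DForm.d (DForm.pullback (gaussMap hf) (smooth_gaussMap hf) lam) = 0 := by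
  rw [DForm.d_pullback, hlam]
  refine DForm.ext fun {m} P hP u => ?_
  change σ.toFun.pull (f ∘ P) u = 0
  have hP' : ContMDiff 𝓘(ℝ, EuclideanSpace ℝ (Fin m)) (𝓡 n) ∞ P := hP
  have h0 := mfderiv_comp u (hf.contMDiff.mdifferentiableAt (x := P u) (by simp))
    (hP'.mdifferentiableAt (by simp))
  ext v
  have hv : ∀ i, mfderiv 𝓘(ℝ, EuclideanSpace ℝ (Fin m)) I (f ∘ P) u (v i) ∈
      LinearMap.range (mfderiv (𝓡 n) I f (P u) :
        TangentSpace (𝓡 n) (P u) →ₗ[ℝ] TangentSpace I (f (P u))) := fun i =>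
    ⟨mfderiv 𝓘(ℝ, EuclideanSpace ℝ (Fin m)) (𝓡 n) P u (v i), by rw [h0]; rfl⟩
  have h1 := (hf.lagrangian (P u) _).1 (hv 0) _ (hv 1)
  refine Eq.trans ?_ h1
  change (σ.toFun (f (P u))) _ = (σ.toFun (f (P u))) _
  congr 1
  ext i
  fin_cases i <;> rfl

namespace OrientedLagrangian

variable {n : ℕ} {σ : SymplecticForm I M}

/-- The action class `a_λ(f) = [f̃^*λ] ∈ H¹(L; ℝ)`. -/
def actionClass (f : OrientedLagrangian.{u} n σ.toFun) {lam : DForm (lagGrDiffeology σ.toFun) 1}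
    (hlam : IsActionForm σ lam) : HdR (manifoldDiffeology (𝓡 n) f.carrier) 1 :=
  HdR.mk (DForm.pullback (gaussMap f.isLagrangianImmersion)
    (smooth_gaussMap f.isLagrangianImmersion) lam)
    (closed_pullback_gaussMap hlam f.isLagrangianImmersion)

/-- `c` is a value of the characteristic number `⟨a_λ(f) ∪ f̃^*x, [L]⟩`: it is
`∫_L α ∧ β` for closed forms `α`, `β` representing `a_λ(f)` and `f̃^*x`. -/
def IsCharNumber {k : ℕ} {σ : SymplecticForm I M} (f : OrientedLagrangian.{u} (k + 1) σ.toFun)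
    {lam : DForm (lagGrDiffeology σ.toFun) 1} (hlam : IsActionForm σ lam)
    (x : HdR (lagGrDiffeology σ.toFun) k) (c : ℝ) : Prop :=
  ∃ (α : DForm (manifoldDiffeology (𝓡 (k + 1)) f.carrier) 1) (hα : DForm.d α = 0)
    (β : DForm (manifoldDiffeology (𝓡 (k + 1)) f.carrier) k) (hβ : DForm.d β = 0),
    HdR.mk α hα = f.actionClass hlam ∧
    HdR.mk β hβ = HdR.map k (gaussMap f.isLagrangianImmersion)
      (smooth_gaussMap f.isLagrangianImmersion) x ∧
    c = integralForm f.orientation (α.wedge β)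

end OrientedLagrangian

/-- A class on `ℒM` is stable if it is in the image of the map
`i^* : H^k(ℒ(ℂ × M)) → H^k(ℒM)` induced by stabilization. -/
def IsStableClass {k : ℕ} {σ : FormField I M 2} (x : HdR (lagGrDiffeology σ) k) : Prop :=
  x ∈ LinearMap.range (HdR.map k stabilize (smooth_stabilize σ))

/-- `c : S × L → V` is a collar embedding, for an interval `S` closed at one end: a diffeomorphism
onto an open subset of `V`, which preserves orientations when `S × L` carries the product
orientation. -/
structure IsOrientedCollar {n : ℕ} {L : Type*} [TopologicalSpace L]
    [ChartedSpace (EuclideanSpace ℝ (Fin n)) L] [IsManifold (𝓡 n) ∞ L]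
    {V : Type*} [TopologicalSpace V] [ChartedSpace (EuclideanHalfSpace (n + 1)) V]
    [IsManifold (𝓡∂ (n + 1)) ∞ V]
    (oL : ManifoldOrientation (𝓡 n) L n) (oV : ManifoldOrientation (𝓡∂ (n + 1)) V (n + 1))
    (S : Set ℝ) (c : ℝ × L → V) : Prop where
  smooth : ContMDiffOn (𝓘(ℝ, ℝ).prod (𝓡 n)) (𝓡∂ (n + 1)) ∞ c (S ×ˢ univ)
  isOpen_image : IsOpen (c '' (S ×ˢ univ))
  exists_inverse : ∃ e : V → ℝ × L,
    ContMDiffOn (𝓡∂ (n + 1)) (𝓘(ℝ, ℝ).prod (𝓡 n)) ∞ e (c '' (S ×ˢ univ)) ∧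
    LeftInvOn e c (S ×ˢ univ)
  oriented : ∀ t ∈ S, ∀ (p : L) (v : Fin n → TangentSpace (𝓡 n) p), IsPosFrame (oL.o p) v →
    IsPosFrame (oV.o (c (t, p)))
      (Fin.cons (mfderivWithin (𝓘(ℝ, ℝ).prod (𝓡 n)) (𝓡∂ (n + 1)) c (S ×ˢ univ) (t, p)
          ((1 : ℝ), (0 : TangentSpace (𝓡 n) p)))
        (fun i => mfderivWithin (𝓘(ℝ, ℝ).prod (𝓡 n)) (𝓡∂ (n + 1)) c (S ×ˢ univ) (t, p)
          ((0 : ℝ), v i)))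

/-- An oriented Lagrangian cobordism `(α₁, …, α_r) ⇝ (β₁, …, β_s)`: a compact oriented
Lagrangian immersion `F : V → [0,1] × ℝ × M ⊂ ℂ × M` whose boundary consists of the positive ends
`α_i` and the negative ends `β_j`, and which is cylindrical near the boundary. -/
structure OrientedCobordism {n : ℕ} {σ : FormField I M 2} {r s : ℕ}
    (α : Fin r → OrientedLagrangian.{u} n σ) (β : Fin s → OrientedLagrangian.{v} n σ) where
  V : Type w
  [top : TopologicalSpace V]
  [charted : ChartedSpace (EuclideanHalfSpace (n + 1)) V]
  [manifold : IsManifold (𝓡∂ (n + 1)) ∞ V]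
  [t2 : T2Space V]
  [compact : CompactSpace V]
  orientation : ManifoldOrientation (𝓡∂ (n + 1)) V (n + 1)
  toFun : V → ℂ × M
  isLagrangianImmersion : IsLagrangianImmersion (𝓡∂ (n + 1)) (prodForm σ) toFun
  mem_strip : ∀ x, (toFun x).1.re ∈ Icc (0 : ℝ) 1
  ε : ℝ
  ε_pos : 0 < ε
  posCollar : ∀ i, ℝ × (α i).carrier → V
  negCollar : ∀ j, ℝ × (β j).carrier → V
  isCollar_pos : ∀ i, IsOrientedCollar (α i).orientation orientation (Ioc (1 - ε) 1) (posCollar i)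
  isCollar_neg : ∀ j, IsOrientedCollar (β j).orientation orientation (Ico 0 ε) (negCollar j)
  cylindrical_pos : ∀ i, ∀ t ∈ Ioc (1 - ε) 1, ∀ p,
    toFun (posCollar i (t, p)) = (⟨t, (i : ℕ) + 1⟩, (α i).toFun p)
  cylindrical_neg : ∀ j, ∀ t ∈ Ico 0 ε, ∀ p,
    toFun (negCollar j (t, p)) = (⟨t, (j : ℕ) + 1⟩, (β j).toFun p)
  boundary_eq : (𝓡∂ (n + 1)).boundary V =
    (⋃ i, posCollar i '' ({1} ×ˢ univ)) ∪ (⋃ j, negCollar j '' ({0} ×ˢ univ))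

end Lagrangians

/-! ### Curves on surfaces and holonomy -/

section UnitTangentBundle

variable {E : Type*} [NormedAddCommGroup E] [NormedSpace ℝ E]
  {H : Type*} [TopologicalSpace H] (I : ModelWithCorners ℝ E H)
  (M : Type*) [TopologicalSpace M] [ChartedSpace H M]

/-- The unit tangent bundle `SM`, presented as the bundle of oriented tangent lines
(rays in tangent spaces). On a symplectic surface it is the oriented Lagrangian Grassmannian. -/
structure UnitTangent where
  pt : M
  ray : Module.Ray ℝ (TangentSpace I pt)

variable {I M} [IsManifold I ∞ M]

/-- A map `P : ℝᵐ → SM` is smooth on `u` if its base point is smooth on `u` and, locally on `u`,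
the rays `P y` are spanned by a nowhere zero smooth vector field along it. -/
def UnitTangent.IsPlotOn {m : ℕ} (u : Set (EuclideanSpace ℝ (Fin m)))
    (P : EuclideanSpace ℝ (Fin m) → UnitTangent I M) : Prop :=
  ContMDiffOn 𝓘(ℝ, EuclideanSpace ℝ (Fin m)) I ∞ (fun y => (P y).pt) u ∧
  ∀ x ∈ u, ∃ v, IsOpen v ∧ x ∈ v ∧ v ⊆ u ∧
    ∃ X : EuclideanSpace ℝ (Fin m) → TangentBundle I M,
      ContMDiffOn 𝓘(ℝ, EuclideanSpace ℝ (Fin m)) I.tangent ∞ X v ∧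
      ∀ y ∈ v, ∃ (w : TangentSpace I (P y).pt) (hw : w ≠ 0),
        X y = ⟨(P y).pt, w⟩ ∧ (P y).ray = rayOfNeZero ℝ w hw

variable (I M) in
/-- The smooth structure of the unit tangent bundle. -/
@[reducible] def unitTangentDiffeology : DiffeologicalSpace (UnitTangent I M) :=
  .ofCorePlotsOn {
    isPlotOn := fun {m u} _ P => UnitTangent.IsPlotOn u P
    isPlotOn_congr := by
      have key : ∀ {m : ℕ} {u : Set (EuclideanSpace ℝ (Fin m))}
          {p q : EuclideanSpace ℝ (Fin m) → UnitTangent I M}, Set.EqOn p q u →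
          UnitTangent.IsPlotOn u p → UnitTangent.IsPlotOn u q := by
        rintro m u p q h ⟨h1, h2⟩
        refine ⟨h1.congr fun y hy => by rw [h hy], fun x hx => ?_⟩
        obtain ⟨v, hv, hxv, hvu, X, hX, hs⟩ := h2 x hx
        exact ⟨v, hv, hxv, hvu, X, hX, fun y hy => h (hvu hy) ▸ hs y hy⟩
      intro n u _ p q h
      exact ⟨key h, key h.symm⟩
    isPlot_const := fun x => by
      refine ⟨contMDiffOn_const, fun y _ => ⟨univ, isOpen_univ, mem_univ _, Subset.rfl, ?_⟩⟩
      rcases x with ⟨q, r⟩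
      induction r using Module.Ray.ind with
      | h w hw => exact ⟨fun _ => ⟨q, w⟩, contMDiffOn_const, fun y _ => ⟨w, hw, rfl, rfl⟩⟩
    isPlotOn_reparam := fun {n m u v hu} hv p f h hp hf => by
      refine ⟨hp.1.comp hf.contMDiffOn h.subset_preimage, fun x hx => ?_⟩
      obtain ⟨w, hw, hxw, hwu, X, hX, hs⟩ := hp.2 (f x) (h hx)
      exact ⟨v ∩ f ⁻¹' w, hf.continuousOn.isOpen_inter_preimage hv hw, ⟨hx, hxw⟩,
        inter_subset_left, X ∘ f,
        hX.comp (hf.contMDiffOn.mono inter_subset_left) inter_subset_right,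
        fun y hy => hs (f y) hy.2⟩
    locality := fun {n u} hu p hp => by
      refine ⟨fun x hx => ?_, fun x hx => ?_⟩
      · obtain ⟨v, hv, hxv, h1, -⟩ := hp x hx
        exact ((h1 x hxv).contMDiffAt (hv.mem_nhds hxv)).contMDiffWithinAt
      · obtain ⟨v, hv, hxv, -, h2⟩ := hp x hx
        obtain ⟨w, hw, hxw, hwv, X, hX, hs⟩ := h2 x hxv
        exact ⟨w ∩ u, hw.inter hu, ⟨hxw, hx⟩, inter_subset_right, X,
          hX.mono inter_subset_left, fun y hy => hs y hy.1⟩ }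

/-- The projection `p : SM → M` is smooth. -/
theorem UnitTangent.smooth_pt : @Diffeology.DSmooth (UnitTangent I M) M
    (unitTangentDiffeology I M) (manifoldDiffeology I M) UnitTangent.pt :=
  fun _ _ hP => contMDiffOn_univ.1 hP.1

end UnitTangentBundle

section Circle

/-- The unit vector field `∂_θ` on the circle, pointing counterclockwise. -/
def circleField (p : Circle) : TangentSpace (𝓡 1) p :=
  (mfderiv 𝓘(ℝ, ℝ) (𝓡 1) (fun t : ℝ => p * Circle.exp t) 0 (1 : ℝ) :
    TangentSpace (𝓡 1) (p * Circle.exp 0))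

theorem contMDiff_circleField : ContMDiff (𝓡 1) (𝓡 1).tangent ∞
    (fun p : Circle => (⟨p, circleField p⟩ : TangentBundle (𝓡 1) Circle)) := by
  let F : Circle × ℝ → Circle := fun q => q.1 * Circle.exp q.2
  have hF : ContMDiff ((𝓡 1).prod 𝓘(ℝ, ℝ)) (𝓡 1) ∞ F :=
    contMDiff_fst.mul (contMDiff_circleExp.comp contMDiff_snd)
  have hz : ContMDiff (𝓡 1) (𝓡 1).tangent ∞
      (fun q : Circle => (⟨q, 0⟩ : TangentBundle (𝓡 1) Circle)) :=
    Bundle.contMDiff_zeroSection ℝ (TangentSpace (𝓡 1) : Circle → Type _)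
  have hsm : ContMDiff ((𝓡 1).tangent.prod 𝓘(ℝ, ℝ).tangent) ((𝓡 1).prod 𝓘(ℝ, ℝ)).tangent ∞
      (equivTangentBundleProd (𝓡 1) Circle 𝓘(ℝ, ℝ) ℝ).symm :=
    contMDiff_equivTangentBundleProd_symm
  have h1 := (hF.contMDiff_tangentMap (m := ∞) (by simp)).comp
    (hsm.comp (hz.prodMk (contMDiff_const (c := (⟨0, (1 : ℝ)⟩ : TangentBundle 𝓘(ℝ, ℝ) ℝ)))))
  refine h1.congr fun p => ?_
  have hd : mfderiv 𝓘(ℝ, ℝ) (𝓡 1) (F ∘ fun t : ℝ => (p, t)) 0 = _ :=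
    mfderiv_comp 0 (hF.mdifferentiableAt (x := (p, 0)) (by simp))
      (mdifferentiableAt_const.prodMk mdifferentiableAt_id)
  have key : ∀ (q : Circle) (_ : q = p) (v : EuclideanSpace ℝ (Fin 1)),
      (⟨p, v⟩ : TangentBundle (𝓡 1) Circle) = ⟨q, v⟩ := by
    rintro q rfl v; rfl
  refine (key (p * Circle.exp 0) (by simp) (circleField p)).trans ?_
  change (⟨p * Circle.exp 0, _⟩ : TangentBundle (𝓡 1) Circle) = ⟨p * Circle.exp 0, _⟩
  congr 1
  change mfderiv 𝓘(ℝ, ℝ) (𝓡 1) (F ∘ fun t : ℝ => (p, t)) 0 (1 : ℝ) = _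
  rw [hd, mfderiv_prod_right]
  rfl

theorem circleField_ne_zero (p : Circle) : circleField p ≠ 0 := by
  intro h
  have hc : ContMDiff (𝓡 1) 𝓘(ℝ, ℂ) ∞ (fun q : Circle => (q : ℂ)) :=
    have := finrank_real_complex_fact'
    contMDiff_coe_sphere (E := ℂ) (n := 1)
  have he : ContMDiff 𝓘(ℝ, ℝ) (𝓡 1) ∞ (fun t : ℝ => p * Circle.exp t) :=
    contMDiff_const.mul contMDiff_circleExp
  have hd := mfderiv_comp (0 : ℝ) (hc.mdifferentiableAt (by simp))
    (he.mdifferentiableAt (x := 0) (by simp))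
  have h2 : fderiv ℝ (fun t : ℝ => (p : ℂ) * Complex.exp (t * Complex.I)) 0 (1 : ℝ) = 0 := by
    rw [← mfderiv_eq_fderiv]
    have e : ((fun q : Circle => (q : ℂ)) ∘ fun t : ℝ => p * Circle.exp t) =
        fun t : ℝ => (p : ℂ) * Complex.exp (t * Complex.I) := by
      ext t; simp [Circle.coe_exp]
    rw [e] at hd
    rw [hd]
    change mfderiv (𝓡 1) 𝓘(ℝ, ℂ) (fun q : Circle => (q : ℂ)) (p * Circle.exp 0)
      (circleField p) = 0
    rw [h]
    exact map_zero _
  have h3 : HasDerivAt (fun t : ℝ => (p : ℂ) * Complex.exp (t * Complex.I))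
      ((p : ℂ) * (Complex.exp ((0 : ℝ) * Complex.I) * (1 * Complex.I))) 0 :=
    (((Complex.ofRealCLM.hasDerivAt (x := 0)).mul_const Complex.I).cexp).const_mul _
  rw [fderiv_apply_one_eq_deriv, h3.deriv] at h2
  simp at h2

/-- The standard (counterclockwise) orientation of the circle. -/
def circleOrientation : ManifoldOrientation (𝓡 1) Circle 1 where
  o p := (FiniteDimensional.basisSingleton (Fin 1)
    (show Module.finrank ℝ (TangentSpace (𝓡 1) p) = 1 from finrank_euclideanSpace_fin)
    (circleField p) (circleField_ne_zero p)).orientation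
  locally_framed p := ⟨univ, univ_mem, fun _ q => circleField q,
    fun _ => contMDiff_circleField.continuous.continuousOn,
    fun q _ => ⟨_, by ext i; simp, rfl⟩⟩

/-- The angular parametrization of the circle, as a plot. -/
def anglePlot (u : EuclideanSpace ℝ (Fin 1)) : Circle := Circle.exp (u 0)

theorem contMDiff_anglePlot : ContMDiff 𝓘(ℝ, EuclideanSpace ℝ (Fin 1)) (𝓡 1) ∞ anglePlot :=
  contMDiff_circleExp.comp
    (EuclideanSpace.proj (𝕜 := ℝ) (0 : Fin 1)).contDiff.contMDiff

variable {S : Type*} [TopologicalSpace S] [ChartedSpace (EuclideanSpace ℝ (Fin 2)) S]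

variable (S) in
/-- An immersed closed curve `γ : S¹ → S` on a surface. -/
structure ImmersedCurve where
  toFun : Circle → S
  contMDiff : ContMDiff (𝓡 1) (𝓡 2) ∞ toFun
  injective : ∀ p, Function.Injective (mfderiv (𝓡 1) (𝓡 2) toFun p)

namespace ImmersedCurve

/-- The velocity `γ'`. -/
def velocity (γ : ImmersedCurve S) (p : Circle) : TangentSpace (𝓡 2) (γ.toFun p) :=
  mfderiv (𝓡 1) (𝓡 2) γ.toFun p (circleField p)

theorem velocity_ne_zero (γ : ImmersedCurve S) (p : Circle) : γ.velocity p ≠ 0 := fun h =>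
  circleField_ne_zero p (γ.injective p (h.trans (map_zero _).symm))

/-- The lift `γ̃ : S¹ → SS` of a curve to the unit tangent bundle. -/
def lift (γ : ImmersedCurve S) (p : Circle) : UnitTangent (𝓡 2) S :=
  ⟨γ.toFun p, rayOfNeZero ℝ (γ.velocity p) (γ.velocity_ne_zero p)⟩

theorem isLagrangianImmersion (σ : SymplecticForm (𝓡 2) S) (γ : ImmersedCurve S) :
    IsLagrangianImmersion (𝓡 1) σ.toFun γ.toFun where
  contMDiff := γ.contMDiff
  injective := γ.injective
  lagrangian p := by
    let A : TangentSpace (𝓡 2) (γ.toFun p) [⋀^Fin 2]→L[ℝ] ℝ := σ.toFun (γ.toFun p)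
    let v := γ.velocity p
    have hv : v ≠ 0 := γ.velocity_ne_zero p
    have hf1 : Module.finrank ℝ (TangentSpace (𝓡 1) p) = 1 := finrank_euclideanSpace_fin
    have hf2 : Module.finrank ℝ (TangentSpace (𝓡 2) (γ.toFun p)) = 2 := finrank_euclideanSpace_fin
    have hr : LinearMap.range (mfderiv (𝓡 1) (𝓡 2) γ.toFun p :
        TangentSpace (𝓡 1) p →ₗ[ℝ] TangentSpace (𝓡 2) (γ.toFun p)) = Submodule.span ℝ {v} := by
      apply le_antisymm
      · rintro _ ⟨w, rfl⟩
        obtain ⟨c, rfl⟩ := (finrank_eq_one_iff_of_nonzero' _ (circleField_ne_zero p)).1 hf1 w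
        exact Submodule.mem_span_singleton.2 ⟨c, (map_smul _ _ _).symm⟩
      · rw [Submodule.span_le, Set.singleton_subset_iff]
        exact ⟨circleField p, rfl⟩
    have hadd : ∀ a b c, A ![a + b, c] = A ![a, c] + A ![b, c] := fun a b c => by
      simpa using A.vecCons_add ![c] a b
    have hsmul : ∀ (r : ℝ) a c, A ![r • a, c] = r * A ![a, c] := fun r a c => by
      simpa using A.vecCons_smul ![c] r a
    have hupd : ∀ a x : TangentSpace (𝓡 2) (γ.toFun p),
        Function.update ![a, 0] 1 x = ![a, x] := fun a x => by
      ext i; fin_cases i <;> rfl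
    have hself : ∀ a, A ![a, a] = 0 := fun a =>
      A.map_eq_zero_of_eq _ (i := 0) (j := 1) rfl (by decide)
    have hswap : ∀ a b, A ![a, b] = - A ![b, a] := fun a b => by
      have h := hself (a + b)
      have e : A ![a, a + b] = A ![a, b] := by
        have h2 : A ![a, a + b] = A ![a, a] + A ![a, b] := by
          have := A.map_update_add ![a, 0] 1 a b
          rwa [hupd, hupd, hupd] at this
        rw [h2, hself, zero_add]
      have e' : A ![b, a + b] = A ![b, a] := by
        have h2 : A ![b, a + b] = A ![b, a] + A ![b, b] := by
          have := A.map_update_add ![b, 0] 1 a b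
          rwa [hupd, hupd, hupd] at this
        rw [h2, hself, add_zero]
      rw [hadd, e, e'] at h
      linarith
    intro u
    rw [hr]
    constructor
    · intro hu w hw
      obtain ⟨a, rfl⟩ := Submodule.mem_span_singleton.1 hu
      obtain ⟨b, rfl⟩ := Submodule.mem_span_singleton.1 hw
      change A ![a • v, b • v] = 0
      rw [hsmul, hswap, hsmul, hself]
      simp
    · intro h
      by_contra hu
      have h0 : A ![u, v] = 0 := h v (Submodule.mem_span_singleton_self v)
      have hli : LinearIndependent ℝ ![v, u] := by
        rw [LinearIndependent.pair_iff' hv]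
        intro a ha
        exact hu (Submodule.mem_span_singleton.2 ⟨a, ha⟩)
      have : FiniteDimensional ℝ (TangentSpace (𝓡 2) (γ.toFun p)) :=
        inferInstanceAs (FiniteDimensional ℝ (EuclideanSpace ℝ (Fin 2)))
      have hspan := hli.span_eq_top_of_card_eq_finrank' (by simp [hf2])
      refine hv (σ.nondegenerate _ v fun w => ?_)
      have hw : w ∈ Submodule.span ℝ (range ![v, u]) := by rw [hspan]; trivial
      rw [Matrix.range_cons, Matrix.range_cons, Matrix.range_empty, union_empty,
        singleton_union, Submodule.mem_span_pair] at hw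
      obtain ⟨a, b, rfl⟩ := hw
      change A ![v, a • v + b • u] = 0
      rw [hswap, hadd, hsmul, hsmul, hself, h0]
      simp

/-- A curve on a symplectic surface, as an oriented Lagrangian. -/
def toOrientedLagrangian (σ : SymplecticForm (𝓡 2) S) (γ : ImmersedCurve S) :
    OrientedLagrangian.{0} 1 σ.toFun where
  carrier := Circle
  orientation := circleOrientation
  toFun := γ.toFun
  isLagrangianImmersion := γ.isLagrangianImmersion σ

variable [IsManifold (𝓡 2) ∞ S]

theorem smooth_lift (γ : ImmersedCurve S) : @Diffeology.DSmooth Circle (UnitTangent (𝓡 2) S)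
    (manifoldDiffeology (𝓡 1) Circle) (unitTangentDiffeology (𝓡 2) S) γ.lift := by
  intro m P hP
  have hP' : ContMDiff 𝓘(ℝ, EuclideanSpace ℝ (Fin m)) (𝓡 1) ∞ P := hP
  refine ⟨(γ.contMDiff.comp hP').contMDiffOn, fun x _ => ⟨univ, isOpen_univ, mem_univ _,
    subset_univ _, fun y => tangentMap (𝓡 1) (𝓡 2) γ.toFun ⟨P y, circleField (P y)⟩, ?_,
    fun y _ => ⟨γ.velocity (P y), γ.velocity_ne_zero _, rfl, rfl⟩⟩⟩
  exact ((γ.contMDiff.contMDiff_tangentMap (m := ∞) (by simp)).comp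
    (contMDiff_circleField.comp hP')).contMDiffOn

/-- The holonomy `hol_λ(γ) = ∫_{S¹} γ̃^*λ` with respect to a `1`-form `λ` on the unit tangent
bundle. -/
def holonomy (lam : DForm (unitTangentDiffeology (𝓡 2) S) 1) (γ : ImmersedCurve S) : ℝ :=
  ∫ t in (0 : ℝ)..(2 * Real.pi),
    (DForm.pullback γ.lift γ.smooth_lift lam).val anglePlot contMDiff_anglePlot
      (EuclideanSpace.single 0 t) (fun _ => EuclideanSpace.single 0 1)

end ImmersedCurve

end Circle

end

noncomputable section

/-! ### Locality of forms on plots -/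

theorem exists_squash {m : ℕ} (x : EuclideanSpace ℝ (Fin m)) {U : Set (EuclideanSpace ℝ (Fin m))}
    (hU : U ∈ 𝓝 x) : ∃ g : EuclideanSpace ℝ (Fin m) → EuclideanSpace ℝ (Fin m),
      ContDiff ℝ ∞ g ∧ (∀ y, g y ∈ U) ∧ g =ᶠ[𝓝 x] id := by
  obtain ⟨r, hr, hrU⟩ := Metric.mem_nhds_iff.1 hU
  let χ : ContDiffBump x := ⟨r / 2, r, by positivity, by linarith⟩
  refine ⟨fun y => x + χ y • (y - x), ?_, fun y => hrU ?_, ?_⟩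
  · exact contDiff_const.add (χ.contDiff.smul (contDiff_id.sub contDiff_const))
  · by_cases hy : y ∈ Metric.ball x r
    · rw [Metric.mem_ball, dist_eq_norm, add_sub_cancel_left, norm_smul, Real.norm_eq_abs,
        abs_of_nonneg χ.nonneg]
      rw [Metric.mem_ball, dist_eq_norm] at hy
      calc χ y * ‖y - x‖ ≤ 1 * ‖y - x‖ := by gcongr; exact χ.le_one
        _ < r := by simpa using hy
    · have : χ y = 0 := χ.zero_of_le_dist (by simpa using hy)
      simp [this, hr]
  · filter_upwards [χ.eventuallyEq_one] with y hy
    simp [hy]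

theorem fderiv_of_eventuallyEq_id {m : ℕ} {x : EuclideanSpace ℝ (Fin m)}
    {g : EuclideanSpace ℝ (Fin m) → EuclideanSpace ℝ (Fin m)} (h : g =ᶠ[𝓝 x] id) :
    fderiv ℝ g x = ContinuousLinearMap.id ℝ _ := by
  rw [h.fderiv_eq, fderiv_id]

namespace DForm

variable {X Y : Type*} {D : DiffeologicalSpace X} {D' : DiffeologicalSpace Y} {k : ℕ}

theorem val_of_eq (α : DForm D k) {m : ℕ} {P Q : EuclideanSpace ℝ (Fin m) → X}
    (hP : P ∈ D.plots m) (hQ : Q ∈ D.plots m) (h : P = Q) (u : EuclideanSpace ℝ (Fin m)) :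
    α.val P hP u = α.val Q hQ u := by
  subst h; rfl

theorem val_congr (α : DForm D k) {m : ℕ} {P Q : EuclideanSpace ℝ (Fin m) → X}
    (hP : P ∈ D.plots m) (hQ : Q ∈ D.plots m) {u : EuclideanSpace ℝ (Fin m)}
    (h : P =ᶠ[𝓝 u] Q) : α.val P hP u = α.val Q hQ u := by
  obtain ⟨g, hg, hgU, hgu⟩ := exists_squash u h
  have hu : g u = u := hgu.eq_of_nhds
  have key : ∀ (R : EuclideanSpace ℝ (Fin m) → X) (hR : R ∈ D.plots m),
      α.val (R ∘ g) (D.plot_reparam hR hg) u = α.val R hR u := fun R hR => by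
    rw [α.natural R hR g hg u, hu, fderiv_of_eventuallyEq_id hgu]
    ext v; rfl
  rw [← key P hP, ← key Q hQ]
  exact α.val_of_eq _ _ (funext fun y => hgU y) u

theorem val_comp (α : DForm D k) {m m' : ℕ} {P : EuclideanSpace ℝ (Fin m) → X}
    {Q : EuclideanSpace ℝ (Fin m') → X} (hP : P ∈ D.plots m) (hQ : Q ∈ D.plots m')
    {g : EuclideanSpace ℝ (Fin m') → EuclideanSpace ℝ (Fin m)} {u : EuclideanSpace ℝ (Fin m')}
    {s : Set (EuclideanSpace ℝ (Fin m'))} (hs : s ∈ 𝓝 u) (hg : ContDiffOn ℝ ∞ g s)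
    (h : Q =ᶠ[𝓝 u] P ∘ g) :
    α.val Q hQ u = (α.val P hP (g u)).compContinuousLinearMap (fderiv ℝ g u) := by
  obtain ⟨σ, hσ, hσU, hσu⟩ := exists_squash u hs
  have hu : σ u = u := hσu.eq_of_nhds
  have hgσ : ContDiff ℝ ∞ (g ∘ σ) := contDiffOn_univ.1 (hg.comp hσ.contDiffOn fun y _ => hσU y)
  have e : g ∘ σ =ᶠ[𝓝 u] g := hσu.fun_comp g
  have h1 : Q =ᶠ[𝓝 u] P ∘ (g ∘ σ) := h.trans (e.fun_comp P).symm
  rw [α.val_congr hQ (D.plot_reparam hP hgσ) h1, α.natural P hP _ hgσ, e.fderiv_eq]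
  simp [hu]

/-- Construct a form from local models. -/
theorem exists_ofLocal (D : DiffeologicalSpace X) (k : ℕ)
    (Lift : ∀ {m : ℕ}, (EuclideanSpace ℝ (Fin m) → X) → EuclideanSpace ℝ (Fin m) →
      (EuclideanSpace ℝ (Fin m) → EuclideanSpace ℝ (Fin m) [⋀^Fin k]→L[ℝ] ℝ) → Prop)
    (hex : ∀ {m : ℕ} (P : EuclideanSpace ℝ (Fin m) → X), P ∈ D.plots m → ∀ u,
      ∃ W, Lift P u W)
    (hsm : ∀ {m : ℕ} (P : EuclideanSpace ℝ (Fin m) → X), P ∈ D.plots m → ∀ u W,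
      Lift P u W → ContDiffAt ℝ ∞ W u)
    (hopen : ∀ {m : ℕ} (P : EuclideanSpace ℝ (Fin m) → X), P ∈ D.plots m → ∀ u W,
      Lift P u W → ∀ᶠ u' in 𝓝 u, Lift P u' W)
    (huniq : ∀ {m : ℕ} (P : EuclideanSpace ℝ (Fin m) → X), P ∈ D.plots m → ∀ u W W',
      Lift P u W → Lift P u W' → W u = W' u)
    (hnat : ∀ {m m' : ℕ} (P : EuclideanSpace ℝ (Fin m) → X), P ∈ D.plots m →
      ∀ (g : EuclideanSpace ℝ (Fin m') → EuclideanSpace ℝ (Fin m)), ContDiff ℝ ∞ g → ∀ u W,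
      Lift P (g u) W → ∃ W', Lift (P ∘ g) u W' ∧
        W' u = (W (g u)).compContinuousLinearMap (fderiv ℝ g u)) :
    ∃ α : DForm D k, ∀ {m : ℕ} (P : EuclideanSpace ℝ (Fin m) → X) (hP : P ∈ D.plots m) u W,
      Lift P u W → α.val P hP =ᶠ[𝓝 u] W := by
  choose V hV using @hex
  have hval : ∀ {m : ℕ} (P : EuclideanSpace ℝ (Fin m) → X) (hP : P ∈ D.plots m) u W,
      Lift P u W → (fun y => V P hP y y) =ᶠ[𝓝 u] W := fun P hP u W h => by
    filter_upwards [hopen P hP u W h] with y hy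
    exact huniq P hP y _ _ (hV P hP y) hy
  refine ⟨⟨fun P hP u => V P hP u u, fun P hP => ?_, fun P hP g hg u => ?_⟩, hval⟩
  · refine contDiff_iff_contDiffAt.2 fun u => ?_
    exact (hsm P hP u _ (hV P hP u)).congr_of_eventuallyEq (hval P hP u _ (hV P hP u))
  · obtain ⟨W', h1, h2⟩ := hnat P hP g hg u _ (hV P hP (g u))
    rw [← h2]
    exact huniq _ (D.plot_reparam hP hg) u _ _ (hV _ _ u) h1

/-- The `0`-form given by a smooth function. -/
def ofFun (f : X → ℝ)
    (hf : ∀ {m : ℕ} (P : EuclideanSpace ℝ (Fin m) → X), P ∈ D.plots m → ContDiff ℝ ∞ (f ∘ P)) :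
    DForm D 0 where
  val P _ u := ContinuousAlternatingMap.constOfIsEmpty ℝ _ (Fin 0) (f (P u))
  smooth P hP := (ContinuousAlternatingMap.constOfIsEmptyLIE ℝ
    (EuclideanSpace ℝ (Fin _)) ℝ (Fin 0)).contDiff.comp (hf P hP)
  natural P hP g hg u := by ext v; rfl

theorem d_ofFun_val (f : X → ℝ)
    (hf : ∀ {m : ℕ} (P : EuclideanSpace ℝ (Fin m) → X), P ∈ D.plots m → ContDiff ℝ ∞ (f ∘ P))
    {m : ℕ} (P : EuclideanSpace ℝ (Fin m) → X) (hP : P ∈ D.plots m) (u) :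
    (d (ofFun (D := D) f hf)).val P hP u =
      ContinuousAlternatingMap.ofSubsingleton ℝ _ ℝ (0 : Fin 1) (fderiv ℝ (f ∘ P) u) := by
  rw [d_val]
  exact extDeriv_constOfIsEmpty (f ∘ P) u

/-- The function of a `0`-form. -/
def toFun (α : DForm D 0) (x : X) : ℝ :=
  α.val (fun _ : EuclideanSpace ℝ (Fin 0) => x) (D.constant_plots x) 0 0

theorem val_eq_toFun (α : DForm D 0) {m : ℕ} (P : EuclideanSpace ℝ (Fin m) → X)
    (hP : P ∈ D.plots m) (u) (v : Fin 0 → EuclideanSpace ℝ (Fin m)) :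
    α.val P hP u v = α.toFun (P u) := by
  have h := α.natural P hP (fun _ : EuclideanSpace ℝ (Fin 0) => u) contDiff_const 0
  have h2 := congrArg (fun A => A 0) h
  simp only [ContinuousAlternatingMap.compContinuousLinearMap_apply] at h2
  rw [toFun]
  refine Eq.trans ?_ h2.symm
  congr 1
  exact Subsingleton.elim _ _

theorem contDiff_toFun (α : DForm D 0) {m : ℕ} (P : EuclideanSpace ℝ (Fin m) → X)
    (hP : P ∈ D.plots m) : ContDiff ℝ ∞ (α.toFun ∘ P) := by
  have h := (ContinuousAlternatingMap.constOfIsEmptyLIE ℝ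
    (EuclideanSpace ℝ (Fin m)) ℝ (Fin 0)).symm.contDiff.comp (α.smooth P hP)
  have e : α.toFun ∘ P = fun u => (ContinuousAlternatingMap.constOfIsEmptyLIE ℝ
      (EuclideanSpace ℝ (Fin m)) ℝ (Fin 0)).symm (α.val P hP u) :=
    funext fun u => (α.val_eq_toFun P hP u _).symm
  rw [e]
  exact h

theorem eq_ofFun_toFun (α : DForm D 0) : α = ofFun α.toFun α.contDiff_toFun := by
  refine DForm.ext fun P hP u => ?_
  ext v
  exact α.val_eq_toFun P hP u v

/-- The product of a smooth function and a form. -/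
def smulFun (f : X → ℝ)
    (hf : ∀ {m : ℕ} (P : EuclideanSpace ℝ (Fin m) → X), P ∈ D.plots m → ContDiff ℝ ∞ (f ∘ P))
    (β : DForm D k) : DForm D k where
  val P hP u := f (P u) • β.val P hP u
  smooth P hP := (hf P hP).smul (β.smooth P hP)
  natural P hP g hg u := by
    rw [β.natural P hP g hg u]; ext v; rfl

theorem _root_.extDeriv_fun_smul_form {m k : ℕ} {f : EuclideanSpace ℝ (Fin m) → ℝ}
    {A : EuclideanSpace ℝ (Fin m) → EuclideanSpace ℝ (Fin m) [⋀^Fin k]→L[ℝ] ℝ}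
    {u : EuclideanSpace ℝ (Fin m)} (hf : DifferentiableAt ℝ f u) (hA : DifferentiableAt ℝ A u) :
    extDeriv (fun y => f y • A y) u =
      wedgeOne (ContinuousAlternatingMap.ofSubsingleton ℝ _ ℝ (0 : Fin 1) (fderiv ℝ f u)) (A u)
        + f u • extDeriv A u := by
  ext v
  rw [extDeriv, fderiv_fun_smul hf hA, ContinuousAlternatingMap.add_apply, wedgeOne_apply,
    ContinuousAlternatingMap.smul_apply, extDeriv]
  simp only [ContinuousAlternatingMap.alternatizeUncurryFin_apply]
  rw [Finset.smul_sum, ← Finset.sum_add_distrib]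
  refine Finset.sum_congr rfl fun i _ => ?_
  simp [zsmul_eq_mul]
  ring

theorem d_smulFun (f : X → ℝ)
    (hf : ∀ {m : ℕ} (P : EuclideanSpace ℝ (Fin m) → X), P ∈ D.plots m → ContDiff ℝ ∞ (f ∘ P))
    (β : DForm D k) :
    d (smulFun f hf β) = (d (ofFun (D := D) f hf)).wedge β + smulFun f hf (d β) := by
  refine DForm.ext fun P hP u => ?_
  rw [d_val]
  refine (extDeriv_fun_smul_form (f := f ∘ P) ((hf P hP).differentiable (by simp) u)
    ((β.smooth P hP).differentiable (by simp) u)).trans ?_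
  rw [add_val]
  congr 1
  change _ = wedgeOne _ _
  rw [d_ofFun_val]

theorem wedge_add_left (α α' : DForm D 1) (β : DForm D k) :
    (α + α').wedge β = α.wedge β + α'.wedge β := by
  refine DForm.ext fun P hP u => ?_
  ext v
  change wedgeOne (α.val P hP u + α'.val P hP u) (β.val P hP u) v =
    wedgeOne (α.val P hP u) (β.val P hP u) v + wedgeOne (α'.val P hP u) (β.val P hP u) v
  simp only [wedgeOne_apply, ContinuousAlternatingMap.add_apply]
  rw [← Finset.sum_add_distrib]
  exact Finset.sum_congr rfl fun i _ => by ring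

theorem wedge_add_right (α : DForm D 1) (β β' : DForm D k) :
    α.wedge (β + β') = α.wedge β + α.wedge β' := by
  refine DForm.ext fun P hP u => ?_
  ext v
  change wedgeOne (α.val P hP u) (β.val P hP u + β'.val P hP u) v =
    wedgeOne (α.val P hP u) (β.val P hP u) v + wedgeOne (α.val P hP u) (β'.val P hP u) v
  simp only [wedgeOne_apply, ContinuousAlternatingMap.add_apply]
  rw [← Finset.sum_add_distrib]
  exact Finset.sum_congr rfl fun i _ => by ring

theorem wedge_zero_right (α : DForm D 1) : α.wedge (0 : DForm D k) = 0 := by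
  have h := wedge_add_right α (0 : DForm D k) 0
  rw [add_zero] at h
  exact left_eq_add.1 h

theorem pullback_wedge (f : X → Y) (hf : @Diffeology.DSmooth X Y D D' f) (α : DForm D' 1)
    (β : DForm D' k) : pullback f hf (α.wedge β) = (pullback f hf α).wedge (pullback f hf β) := rfl

theorem exists_primitive_of_closed {m : ℕ}
    {A : EuclideanSpace ℝ (Fin m) → EuclideanSpace ℝ (Fin m) [⋀^Fin 1]→L[ℝ] ℝ}
    (hA : ContDiff ℝ ∞ A) (hd : extDeriv A = 0) :
    ∃ f : EuclideanSpace ℝ (Fin m) → ℝ, ContDiff ℝ ∞ f ∧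
      ∀ u, A u = ContinuousAlternatingMap.ofSubsingleton ℝ _ ℝ (0 : Fin 1) (fderiv ℝ f u) := by
  let L := (ContinuousAlternatingMap.ofSubsingletonLIE (𝕜 := ℝ)
    (E := EuclideanSpace ℝ (Fin m)) (F := ℝ) (0 : Fin 1))
  let η : EuclideanSpace ℝ (Fin m) → (EuclideanSpace ℝ (Fin m) →L[ℝ] ℝ) := fun u => L.symm (A u)
  have hη : ContDiff ℝ ∞ η := L.symm.contDiff.comp hA
  have hdη : ∀ a x, fderiv ℝ η a x = L.symm (fderiv ℝ A a x) := fun a x => by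
    have := (L.symm.toContinuousLinearEquiv.toContinuousLinearMap.hasFDerivAt.comp a
      ((hA.differentiable (by simp) a).hasFDerivAt)).fderiv
    exact congrArg (fun B => B x) this
  obtain ⟨f, hf⟩ := Convex.exists_forall_hasFDerivAt_of_fderiv_symmetric 
    (convex_univ (𝕜 := ℝ) (E := EuclideanSpace ℝ (Fin m))) isOpen_univ (hη.differentiable (by simp)).differentiableOn
    (fun a _ x y => by
      have h := congrArg (fun B => B ![x, y]) (congrFun hd a)
      rw [extDeriv, ContinuousAlternatingMap.alternatizeUncurryFin_apply] at h
      replace h := (Fin.sum_univ_two _).symm.trans h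
      have e1 : fderiv ℝ A a x (Fin.removeNth 0 ![x, y]) = fderiv ℝ η a x y := by
        rw [hdη]
        change _ = fderiv ℝ A a x fun _ => y
        congr 1
        ext i; fin_cases i; rfl
      have e2 : fderiv ℝ A a y (Fin.removeNth 1 ![x, y]) = fderiv ℝ η a y x := by
        rw [hdη]
        change _ = fderiv ℝ A a y fun _ => x
        congr 1
        ext i; fin_cases i; rfl
      have h' : (-1 : ℤ) ^ 0 • fderiv ℝ A a x (Fin.removeNth 0 ![x, y]) +
          (-1 : ℤ) ^ 1 • fderiv ℝ A a y (Fin.removeNth 1 ![x, y]) = 0 := h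
      rw [e1, e2] at h'
      simp at h'
      linarith)
  have hf' : ∀ u, fderiv ℝ f u = η u := fun u => (hf u trivial).fderiv
  refine ⟨f, ?_, fun u => ?_⟩
  · refine (contDiff_infty_iff_fderiv (𝕜 := ℝ)).2 ⟨fun u => (hf u trivial).differentiableAt, ?_⟩
    rw [funext hf']
    exact hη
  · rw [hf']
    exact (L.apply_symm_apply (A u)).symm

theorem d_wedge_of_closed (α : DForm D 1) (hα : d α = 0) (γ : DForm D k) :
    d (α.wedge γ) = - α.wedge (d γ) := by
  refine DForm.ext fun {m} P hP u => ?_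
  have h0 : extDeriv (α.val P hP) = 0 := by
    rw [← d_val, hα]; rfl
  obtain ⟨f, hf, hfα⟩ := exists_primitive_of_closed (α.smooth P hP) h0
  have hγ := γ.smooth P hP
  have hdγ := (d γ).smooth P hP
  have e : ∀ y, (α.wedge γ).val P hP y =
      extDeriv (fun y => f y • γ.val P hP y) y + (-1 : ℝ) • (f y • (d γ).val P hP y) := fun y => by
    rw [extDeriv_fun_smul_form (hf.differentiable (by simp) y) (hγ.differentiable (by simp) y),
      ← hfα y, d_val]
    change wedgeOne _ _ = _
    ext v; simp
  have hfγ : ContDiff ℝ ∞ (fun y => f y • γ.val P hP y) := hf.smul hγ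
  have hext : ContDiff ℝ ∞ (extDeriv (fun y => f y • γ.val P hP y)) :=
    by
    have h := hfγ.fderiv_right (m := ∞) (by simp)
    exact (ContinuousAlternatingMap.alternatizeUncurryFinCLM ℝ _ ℝ).contDiff.comp h
  have hfd : ContDiff ℝ ∞ (fun y => f y • (d γ).val P hP y) := hf.smul hdγ
  have hcfd : ContDiff ℝ ∞ (fun y => (-1 : ℝ) • f y • (d γ).val P hP y) :=
    (contDiff_const (c := (-1 : ℝ))).smul hfd
  have hs : extDeriv (fun y => (-1 : ℝ) • f y • (d γ).val P hP y) u =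
      (-1 : ℝ) • extDeriv (fun y => f y • (d γ).val P hP y) u :=
    extDeriv_smul (-1 : ℝ) (fun y => f y • (d γ).val P hP y)
  rw [d_val, funext e,
    extDeriv_fun_add (hext.differentiable (by simp) u) (hcfd.differentiable (by simp) u),
    hs, extDeriv_extDeriv hfγ (by simp; exact WithTop.coe_le_coe.2 le_top),
    extDeriv_fun_smul_form (hf.differentiable (by simp) u) (hdγ.differentiable (by simp) u),
    ← hfα u]
  have h1 : extDeriv ((d γ).val P hP) u = 0 := by
    rw [← d_val, d_d]; rfl
  rw [h1, neg_val]
  ext v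
  simp
  rfl

theorem d_wedge_closed (α : DForm D 1) (hα : d α = 0) (β : DForm D k) (hβ : d β = 0) :
    d (α.wedge β) = 0 := by
  rw [d_wedge_of_closed α hα β, hβ, wedge_zero_right, neg_zero]

end DForm

/-! ### Orientation signs -/

open scoped Classical in
/-- The sign of a frame with respect to an orientation. -/
def frameSign {V : Type*} [AddCommGroup V] [Module ℝ V] {n : ℕ}
    (o : Orientation ℝ V (Fin n)) (v : Fin n → V) : ℝ := if IsPosFrame o v then 1 else -1

section FrameSign

variable {V : Type*} [AddCommGroup V] [Module ℝ V] {n : ℕ} (o : Orientation ℝ V (Fin n))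

theorem isPosFrame_basis_iff (b : Basis (Fin n) ℝ V) : IsPosFrame o b ↔ b.orientation = o := by
  constructor
  · rintro ⟨b', h, h'⟩
    rw [← DFunLike.coe_injective h]; exact h'
  · exact fun h => ⟨b, rfl, h⟩

theorem frameSign_of_pos {v : Fin n → V} (h : IsPosFrame o v) : frameSign o v = 1 := if_pos h

open scoped Classical in
theorem frameSign_basis_eq (b : Basis (Fin n) ℝ V) :
    frameSign o b = if b.orientation = o then 1 else -1 := by
  by_cases h : IsPosFrame o b
  · rw [if_pos ((isPosFrame_basis_iff o b).1 h)]; exact if_pos h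
  · rw [if_neg (fun h' => h ((isPosFrame_basis_iff o b).2 h'))]; exact if_neg h

theorem frameSign_basis (b b' : Basis (Fin n) ℝ V) :
    frameSign o b' = frameSign o b * SignType.sign (b.det b') := by
  have hdet : b.det b' ≠ 0 := (b.isUnit_det b').ne_zero
  rw [frameSign_basis_eq, frameSign_basis_eq]
  have h1 := b.orientation_eq_iff_det_pos b'
  rcases lt_or_gt_of_ne hdet with h | h
  · have h2 : b'.orientation = -b.orientation := by
      refine (b.orientation_eq_or_eq_neg b'.orientation).resolve_left fun h3 => ?_
      exact absurd (h1.1 h3.symm) (not_lt.2 h.le)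
    rw [sign_neg h, h2]
    have h0 : b.orientation ≠ - b.orientation := fun h3 => by
      have := (b.orientation_ne_iff_eq_neg (-b.orientation)).2 rfl
      exact this h3.symm
    rcases b.orientation_eq_or_eq_neg o with rfl | rfl
    · rw [if_neg h0.symm, if_pos rfl]; simp
    · rw [if_pos rfl, if_neg h0]; simp
  · rw [sign_pos h, h1.2 h]; simp

theorem frameSign_mul_self (v : Fin n → V) : frameSign o v * frameSign o v = 1 := by
  unfold frameSign; split_ifs <;> norm_num

end FrameSign

/-- The standard basis of `ℝᴺ`. -/
abbrev stdBasis (N : ℕ) : Basis (Fin N) ℝ (EuclideanSpace ℝ (Fin N)) :=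
  (EuclideanSpace.basisFun (Fin N) ℝ).toBasis

theorem coe_stdBasis (N : ℕ) : ⇑(stdBasis N) = fun i => EuclideanSpace.single i (1 : ℝ) := by
  ext i; simp

theorem alternating_apply_comp_std {N : ℕ}
    (A : EuclideanSpace ℝ (Fin N) [⋀^Fin N]→L[ℝ] ℝ)
    (L : EuclideanSpace ℝ (Fin N) →L[ℝ] EuclideanSpace ℝ (Fin N)) :
    A.compContinuousLinearMap L (fun i => EuclideanSpace.single i (1 : ℝ)) =
      L.det * A (fun i => EuclideanSpace.single i (1 : ℝ)) := by
  have h := AlternatingMap.eq_smul_basis_det (stdBasis N) A.toAlternatingMap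
  have h1 : ∀ v, A v = A (stdBasis N) * (stdBasis N).det v := fun v =>
    congrArg (fun B : EuclideanSpace ℝ (Fin N) [⋀^Fin N]→ₗ[ℝ] ℝ => B v) h
  rw [← coe_stdBasis]
  change A (L ∘ stdBasis N) = _
  rw [h1]
  change _ * (stdBasis N).det ((L : EuclideanSpace ℝ (Fin N) →ₗ[ℝ] _) ∘ stdBasis N) = _
  rw [Basis.det_comp, Basis.det_self, mul_one, mul_comm]

/-! ### Chart plots -/

section ChartPlot

variable {N : ℕ} {H : Type*} [TopologicalSpace H]
  (I : ModelWithCorners ℝ (EuclideanSpace ℝ (Fin N)) H)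
  {X : Type*} [TopologicalSpace X] [ChartedSpace H X]

/-- `P : ℝᴺ → X` is a diffeomorphism onto an open set, with inverse `e`. -/
structure IsChartPlot (P : EuclideanSpace ℝ (Fin N) → X) (e : X → EuclideanSpace ℝ (Fin N)) :
    Prop where
  contMDiff : ContMDiff 𝓘(ℝ, EuclideanSpace ℝ (Fin N)) I ∞ P
  isOpen_range : IsOpen (range P)
  left_inv : ∀ u, e (P u) = u
  contMDiffOn : ContMDiffOn I 𝓘(ℝ, EuclideanSpace ℝ (Fin N)) ∞ e (range P)

variable {I} {P Q : EuclideanSpace ℝ (Fin N) → X} {e e' : X → EuclideanSpace ℝ (Fin N)}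

namespace IsChartPlot

theorem right_inv (hP : IsChartPlot I P e) {x : X} (hx : x ∈ range P) : P (e x) = x := by
  obtain ⟨u, rfl⟩ := hx
  rw [hP.left_inv]

theorem contDiffOn_inv_comp (hP : IsChartPlot I P e) {m : ℕ} {Q : EuclideanSpace ℝ (Fin m) → X}
    (hQ : ContMDiff 𝓘(ℝ, EuclideanSpace ℝ (Fin m)) I ∞ Q) :
    ContDiffOn ℝ ∞ (e ∘ Q) (Q ⁻¹' range P) :=
  (hP.contMDiffOn.comp hQ.contMDiffOn Subset.rfl).contDiffOn

theorem contMDiffAt_inv (hP : IsChartPlot I P e) (u : EuclideanSpace ℝ (Fin N)) :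
    ContMDiffAt I 𝓘(ℝ, EuclideanSpace ℝ (Fin N)) ∞ e (P u) :=
  hP.contMDiffOn.contMDiffAt (hP.isOpen_range.mem_nhds ⟨u, rfl⟩)

theorem mfderiv_inv_comp (hP : IsChartPlot I P e) (u : EuclideanSpace ℝ (Fin N))
    (v : EuclideanSpace ℝ (Fin N)) :
    mfderiv I 𝓘(ℝ, EuclideanSpace ℝ (Fin N)) e (P u)
      (mfderiv 𝓘(ℝ, EuclideanSpace ℝ (Fin N)) I P u v) = v := by
  have h := mfderiv_comp u ((hP.contMDiffAt_inv u).mdifferentiableAt (by simp))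
    (hP.contMDiff.mdifferentiableAt (by simp))
  have h2 : e ∘ P = id := funext hP.left_inv
  rw [h2, mfderiv_id] at h
  exact (congrArg (fun A => A v) h).symm

theorem mfderiv_comp_inv (hP : IsChartPlot I P e) (u : EuclideanSpace ℝ (Fin N))
    (v : TangentSpace I (P u)) :
    mfderiv 𝓘(ℝ, EuclideanSpace ℝ (Fin N)) I P u
      (mfderiv I 𝓘(ℝ, EuclideanSpace ℝ (Fin N)) e (P u) v) = v := by
  have h := mfderiv_comp_of_eq (x := P u) (y := u) (hP.contMDiff.mdifferentiableAt (by simp))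
    ((hP.contMDiffAt_inv u).mdifferentiableAt (by simp)) (hP.left_inv u)
  have h2 : P ∘ e =ᶠ[𝓝 (P u)] id := by
    filter_upwards [hP.isOpen_range.mem_nhds ⟨u, rfl⟩] with x hx
    exact hP.right_inv hx
  rw [h2.mfderiv_eq, mfderiv_id] at h
  have key : ∀ w, w = u → ∀ x : EuclideanSpace ℝ (Fin N),
      (mfderiv 𝓘(ℝ, EuclideanSpace ℝ (Fin N)) I P w x : EuclideanSpace ℝ (Fin N)) =
        mfderiv 𝓘(ℝ, EuclideanSpace ℝ (Fin N)) I P u x := by rintro _ rfl _; rfl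
  exact (key _ (hP.left_inv u) _).symm.trans (congrArg (fun A => A v) h).symm

/-- The derivative of a chart plot as a linear equivalence. -/
def derivEquiv (hP : IsChartPlot I P e) (u : EuclideanSpace ℝ (Fin N)) :
    EuclideanSpace ℝ (Fin N) ≃ₗ[ℝ] TangentSpace I (P u) where
  toFun := mfderiv 𝓘(ℝ, EuclideanSpace ℝ (Fin N)) I P u
  map_add' := map_add _
  map_smul' := map_smul _
  invFun := mfderiv I 𝓘(ℝ, EuclideanSpace ℝ (Fin N)) e (P u)
  left_inv := hP.mfderiv_inv_comp u
  right_inv := hP.mfderiv_comp_inv u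

end IsChartPlot

variable (I) in
/-- The image of the standard frame. -/
def plotFrame (P : EuclideanSpace ℝ (Fin N) → X) (u : EuclideanSpace ℝ (Fin N)) (i : Fin N) :
    TangentSpace I (P u) :=
  mfderiv 𝓘(ℝ, EuclideanSpace ℝ (Fin N)) I P u (EuclideanSpace.single i (1 : ℝ))

theorem IsChartPlot.plotFrame_eq (hP : IsChartPlot I P e) (u : EuclideanSpace ℝ (Fin N)) :
    plotFrame I P u = (stdBasis N).map (hP.derivEquiv u) := by
  ext i
  simp only [Basis.map_apply, coe_stdBasis]
  rfl

variable [IsManifold I ∞ X] (o : ManifoldOrientation I X N)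

/-- The sign comparing a plot with the orientation. -/
def chartSign (P : EuclideanSpace ℝ (Fin N) → X) (u : EuclideanSpace ℝ (Fin N)) : ℝ :=
  frameSign (o.o (P u)) (plotFrame I P u)

theorem chartSign_eq_mul (hP : IsChartPlot I P e) (u : EuclideanSpace ℝ (Fin N))
    (b : Basis (Fin N) ℝ (TangentSpace I (P u))) :
    frameSign (o.o (P u)) b = chartSign o P u *
      SignType.sign ((stdBasis N).det
        (fun i => mfderiv I 𝓘(ℝ, EuclideanSpace ℝ (Fin N)) e (P u) (b i))) := by
  rw [chartSign, hP.plotFrame_eq, frameSign_basis _ ((stdBasis N).map (hP.derivEquiv u)) b,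
    Basis.det_map]
  rfl

theorem eventually_chartSign_eq (hP : IsChartPlot I P e) (u₀ : EuclideanSpace ℝ (Fin N)) :
    ∀ᶠ u in 𝓝 u₀, chartSign o P u = chartSign o P u₀ := by
  obtain ⟨U, hU, s, hs, hpos⟩ := o.locally_framed (P u₀)
  have hPc : Continuous P := hP.contMDiff.continuous
  let c : EuclideanSpace ℝ (Fin N) → Fin N → EuclideanSpace ℝ (Fin N) := fun u i =>
    mfderiv I 𝓘(ℝ, EuclideanSpace ℝ (Fin N)) e (P u) (s i (P u))
  have hone : IsManifold I 1 X := IsManifold.of_le (n := ∞) (by simp)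
  have hc : ∀ i, ContinuousAt (fun u => c u i) u₀ := fun i => by
    have h1 : ContinuousAt (fun u => (⟨P u, s i (P u)⟩ : TangentBundle I X)) u₀ :=
      ((hs i).continuousAt hU).comp hPc.continuousAt
    have h2 : ContinuousOn (tangentMapWithin I 𝓘(ℝ, EuclideanSpace ℝ (Fin N)) e (range P))
        (TotalSpace.proj ⁻¹' range P) :=
      hP.contMDiffOn.continuousOn_tangentMapWithin (by simp) hP.isOpen_range.uniqueMDiffOn
    have hopen : IsOpen (TotalSpace.proj ⁻¹' range P : Set (TangentBundle I X)) :=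
      hP.isOpen_range.preimage (FiberBundle.continuous_proj _ _)
    have h3 := ContinuousAt.comp (x := u₀)
      (f := fun u => (⟨P u, s i (P u)⟩ : TangentBundle I X)) (h2.continuousAt (hopen.mem_nhds
      (show (⟨P u₀, s i (P u₀)⟩ : TangentBundle I X) ∈ _ from ⟨u₀, rfl⟩))) h1
    have hsnd : Continuous fun p : TangentBundle 𝓘(ℝ, EuclideanSpace ℝ (Fin N))
        (EuclideanSpace ℝ (Fin N)) => (p.2 : EuclideanSpace ℝ (Fin N)) :=
      continuous_snd.comp
        (tangentBundleModelSpaceHomeomorph 𝓘(ℝ, EuclideanSpace ℝ (Fin N))).continuous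
    have h4 := ContinuousAt.comp (x := u₀) (hsnd.continuousAt) h3
    refine h4.congr (Eventually.of_forall fun u => ?_)
    change mfderivWithin I 𝓘(ℝ, EuclideanSpace ℝ (Fin N)) e (range P) (P u) (s i (P u)) = c u i
    rw [mfderivWithin_of_isOpen hP.isOpen_range ⟨u, rfl⟩]
  have hdet : ContinuousAt (fun u => (stdBasis N).det (c u)) u₀ := by
    have : Continuous fun w : Fin N → EuclideanSpace ℝ (Fin N) => (stdBasis N).det w :=
      by
      simp only [Basis.det_apply]
      refine Continuous.matrix_det (continuous_matrix fun i j => ?_)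
      simp only [Basis.toMatrix_apply, OrthonormalBasis.coe_toBasis_repr_apply,
        EuclideanSpace.basisFun_repr]
      fun_prop
    exact this.continuousAt.comp (continuousAt_pi.2 hc)
  have key : ∀ u, P u ∈ U → chartSign o P u = SignType.sign ((stdBasis N).det (c u)) ∧
      (stdBasis N).det (c u) ≠ 0 := fun u hu => by
    obtain ⟨b, hb, -⟩ := id (hpos _ hu)
    have h1 := chartSign_eq_mul o hP u b
    have h2 := frameSign_of_pos _ (hpos _ hu)
    rw [← hb] at h2
    rw [h2] at h1
    have h3 : (fun i => mfderiv I 𝓘(ℝ, EuclideanSpace ℝ (Fin N)) e (P u) (b i)) = c u := by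
      rw [hb]
    rw [h3] at h1
    refine ⟨?_, fun h0 => ?_⟩
    · have h4 := frameSign_mul_self (o.o (P u)) (plotFrame I P u)
      change chartSign o P u * chartSign o P u = 1 at h4
      have h5 : chartSign o P u = chartSign o P u * 1 := (mul_one _).symm
      rw [h5, h1, ← mul_assoc, h4, one_mul]
    · rw [h0] at h1; simp at h1
  have h0 := key u₀ (mem_of_mem_nhds hU)
  have hsign : ∀ᶠ u in 𝓝 u₀, SignType.sign ((stdBasis N).det (c u)) =
      SignType.sign ((stdBasis N).det (c u₀)) := by
    rcases lt_or_gt_of_ne h0.2 with h | h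
    · filter_upwards [hdet.eventually (gt_mem_nhds h)] with u hu
      rw [sign_neg h, sign_neg hu]
    · filter_upwards [hdet.eventually (lt_mem_nhds h)] with u hu
      rw [sign_pos h, sign_pos hu]
  filter_upwards [hsign, hPc.continuousAt hU] with u h1 h2
  rw [(key u h2).1, h0.1, h1]

theorem chartSign_eq (hP : IsChartPlot I P e) (u v : EuclideanSpace ℝ (Fin N)) :
    chartSign o P u = chartSign o P v := by
  have : IsLocallyConstant (chartSign o P) :=
    (IsLocallyConstant.iff_eventually_eq _).2 (eventually_chartSign_eq o hP)
  exact this.apply_eq_of_preconnectedSpace u v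

/-- The integral of a top degree form over a plot. -/
def chartIntegral (P : EuclideanSpace ℝ (Fin N) → X)
    (hP : P ∈ (manifoldDiffeology I X).plots N) (A : DForm (manifoldDiffeology I X) N) : ℝ :=
  ∫ u, chartSign o P u * A.val P hP u (fun i => EuclideanSpace.single i (1 : ℝ))

/-- The form `A` vanishes outside `S`. -/
def DForm.VanishesOff {k : ℕ} {X : Type*} {D : DiffeologicalSpace X} (A : DForm D k)
    (S : Set X) : Prop :=
  ∀ ⦃m : ℕ⦄ (R : EuclideanSpace ℝ (Fin m) → X) (hR : R ∈ D.plots m) (u), R u ∉ S → A.val R hR u = 0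

theorem chartIntegral_eq (hP : IsChartPlot I P e) (hQ : IsChartPlot I Q e')
    (A : DForm (manifoldDiffeology I X) N) (hA : A.VanishesOff (range P ∩ range Q)) :
    chartIntegral o P hP.contMDiff A = chartIntegral o Q hQ.contMDiff A := by
  set F : EuclideanSpace ℝ (Fin N) → ℝ := fun u =>
    chartSign o P u * A.val P hP.contMDiff u (fun i => EuclideanSpace.single i (1 : ℝ))
  set G : EuclideanSpace ℝ (Fin N) → ℝ := fun u =>
    chartSign o Q u * A.val Q hQ.contMDiff u (fun i => EuclideanSpace.single i (1 : ℝ))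
  let s := P ⁻¹' range Q
  let t := Q ⁻¹' range P
  have hs : IsOpen s := hQ.isOpen_range.preimage hP.contMDiff.continuous
  have hF : ∫ u in s, F u = ∫ u, F u := by
    refine MeasureTheory.setIntegral_eq_integral_of_forall_compl_eq_zero fun u hu => ?_
    simp only [F]
    rw [hA P hP.contMDiff u (fun h => hu h.2)]; simp
  have hG : ∫ u in t, G u = ∫ u, G u := by
    refine MeasureTheory.setIntegral_eq_integral_of_forall_compl_eq_zero fun u hu => ?_
    simp only [G]
    rw [hA Q hQ.contMDiff u (fun h => hu h.1)]; simp
  have hf := hQ.contDiffOn_inv_comp hP.contMDiff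
  have himg : (e' ∘ P) '' s = t := by
    ext v; constructor
    · rintro ⟨u, hu, rfl⟩
      exact ⟨u, (hQ.right_inv hu).symm⟩
    · rintro ⟨u, hu⟩
      exact ⟨u, ⟨v, hu.symm⟩, by simp [hu, hQ.left_inv]⟩
  have hinj : InjOn (e' ∘ P) s := fun u hu v hv h => by
    have h1 : P u = P v := by
      rw [← hQ.right_inv hu, ← hQ.right_inv hv]; exact congrArg Q h
    rw [← hP.left_inv u, ← hP.left_inv v, h1]
  have hfd : ∀ u ∈ s, HasFDerivWithinAt (e' ∘ P) (fderiv ℝ (e' ∘ P) u) s u := fun u hu =>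
    ((hf.contDiffAt (hs.mem_nhds hu)).differentiableAt (by simp)).hasFDerivAt.hasFDerivWithinAt
  have hcv := MeasureTheory.integral_image_eq_integral_abs_det_fderiv_smul MeasureTheory.volume
    hs.measurableSet hfd hinj G
  change ∫ u, F u = ∫ u, G u
  rw [← hF, ← hG, ← himg, hcv]
  refine MeasureTheory.setIntegral_congr_fun hs.measurableSet fun u hu => ?_
  set f := e' ∘ P
  have hQf : Q (f u) = P u := hQ.right_inv hu
  have hval : A.val P hP.contMDiff u =
      (A.val Q hQ.contMDiff (f u)).compContinuousLinearMap (fderiv ℝ f u) := by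
    refine A.val_comp hQ.contMDiff hP.contMDiff (hs.mem_nhds hu) hf ?_
    filter_upwards [hs.mem_nhds hu] with v hv
    exact (hQ.right_inv hv).symm
  have hsg : chartSign o P u = chartSign o Q (f u) * SignType.sign (fderiv ℝ f u).det := by
    have h1 := chartSign_eq_mul o hP u ((stdBasis N).map (hP.derivEquiv u))
    have h2 : ∀ (w : EuclideanSpace ℝ (Fin N)) (hw : Q w = P u)
        (b : Basis (Fin N) ℝ (TangentSpace I (P u))),
        frameSign (o.o (P u)) b = chartSign o Q w *
          SignType.sign ((stdBasis N).det
            (fun i => mfderiv I 𝓘(ℝ, EuclideanSpace ℝ (Fin N)) e' (P u) (b i))) := by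
      intro w hw
      rw [← hw]
      exact fun b => chartSign_eq_mul o hQ w b
    have h3 := h2 (f u) hQf ((stdBasis N).map (hP.derivEquiv u))
    rw [← hP.plotFrame_eq] at h3
    change chartSign o P u = _ at h3
    rw [h3]
    congr 3
    have h4 : (fun i => (mfderiv I 𝓘(ℝ, EuclideanSpace ℝ (Fin N)) e' (P u) (plotFrame I P u i) :
        EuclideanSpace ℝ (Fin N))) = (fderiv ℝ f u).toLinearMap ∘ stdBasis N := by
      ext1 i
      have he' : MDifferentiableAt I 𝓘(ℝ, EuclideanSpace ℝ (Fin N)) e' (P u) :=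
        (hQ.contMDiffOn.contMDiffAt (hQ.isOpen_range.mem_nhds hu)).mdifferentiableAt (by simp)
      have h5 := mfderiv_comp u he' (hP.contMDiff.mdifferentiableAt (by simp))
      rw [mfderiv_eq_fderiv] at h5
      simp only [Function.comp_apply, coe_stdBasis]
      exact (congrArg (fun B => B (EuclideanSpace.single i (1 : ℝ))) h5).symm
    refine (congrArg _ h4).trans ?_
    rw [Basis.det_comp, Basis.det_self, mul_one]
  simp only [F, G]
  rw [hval, alternating_apply_comp_std, hsg, smul_eq_mul, ← self_mul_sign (fderiv ℝ f u).det]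
  ring

end ChartPlot

/-! ### Integration of compactly supported forms -/

theorem fderiv_integral_eq_zero {m : ℕ} {f : EuclideanSpace ℝ (Fin m) → ℝ} (hf : ContDiff ℝ ∞ f)
    (hc : HasCompactSupport f) (v : EuclideanSpace ℝ (Fin m)) : ∫ u, fderiv ℝ f u v = 0 := by
  have hd : Continuous fun u => fderiv ℝ f u v :=
    (hf.continuous_fderiv (by simp)).clm_apply continuous_const
  have hdc : HasCompactSupport fun u => fderiv ℝ f u v :=
    (hc.fderiv (𝕜 := ℝ)).comp_left
      (g := fun L : EuclideanSpace ℝ (Fin m) →L[ℝ] ℝ => L v) rfl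
  have h := integral_mul_fderiv_eq_neg_fderiv_mul_of_integrable (μ := MeasureTheory.volume)
    (f := fun _ : EuclideanSpace ℝ (Fin m) => (1 : ℝ)) (g := f) (v := v)
    (by simp) (by simpa using hd.integrable_of_hasCompactSupport hdc)
    (by simpa using hf.continuous.integrable_of_hasCompactSupport hc)
    (fun x _ => differentiableAt_const _) (fun x _ => hf.differentiable (by simp) x)
  simpa using h

theorem integral_extDeriv_eq_zero {n : ℕ}
    {A : EuclideanSpace ℝ (Fin (n + 1)) → EuclideanSpace ℝ (Fin (n + 1)) [⋀^Fin n]→L[ℝ] ℝ}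
    (hA : ContDiff ℝ ∞ A) (hc : HasCompactSupport A)
    (v : Fin (n + 1) → EuclideanSpace ℝ (Fin (n + 1))) : ∫ u, extDeriv A u v = 0 := by
  have hAv : ∀ w : Fin n → EuclideanSpace ℝ (Fin (n + 1)), ContDiff ℝ ∞ fun u => A u w := fun w =>
    (ContinuousAlternatingMap.apply ℝ _ ℝ w).contDiff.comp hA
  have hcv : ∀ w : Fin n → EuclideanSpace ℝ (Fin (n + 1)), HasCompactSupport fun u => A u w :=
    fun w => hc.comp_left
      (g := fun B : EuclideanSpace ℝ (Fin (n + 1)) [⋀^Fin n]→L[ℝ] ℝ => B w) rfl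
  have e : ∀ u, extDeriv A u v =
      ∑ i : Fin (n + 1), (-1 : ℝ) ^ i.val * fderiv ℝ (fun u => A u (i.removeNth v)) u (v i) :=
    fun u => by
      rw [extDeriv_apply (hA.differentiable (by simp) u)]
      exact Finset.sum_congr rfl fun i _ => by simp [zsmul_eq_mul]
  simp_rw [e]
  rw [MeasureTheory.integral_finsetSum]
  · refine Finset.sum_eq_zero fun i _ => ?_
    rw [MeasureTheory.integral_const_mul, fderiv_integral_eq_zero (hAv _) (hcv _), mul_zero]
  · intro i _
    refine MeasureTheory.Integrable.const_mul ?_ _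
    have hd : Continuous fun u => fderiv ℝ (fun u => A u (i.removeNth v)) u (v i) :=
      ((hAv _).continuous_fderiv (by simp)).clm_apply continuous_const
    exact hd.integrable_of_hasCompactSupport
      (((hcv (i.removeNth v)).fderiv (𝕜 := ℝ)).comp_left
        (g := fun L : EuclideanSpace ℝ (Fin (n + 1)) →L[ℝ] ℝ => L (v i)) rfl)

namespace DForm

section

variable {X : Type*} {D : DiffeologicalSpace X} {k : ℕ}

theorem sum_val {ι : Type*} (t : Finset ι) (α : ι → DForm D k) {m : ℕ}
    (P : EuclideanSpace ℝ (Fin m) → X) (hP : P ∈ D.plots m) (u) :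
    (∑ i ∈ t, α i).val P hP u = ∑ i ∈ t, (α i).val P hP u := by
  classical
  induction t using Finset.induction_on with
  | empty => simp
  | insert a s ha ih => rw [Finset.sum_insert ha, Finset.sum_insert ha, add_val, ih]

theorem VanishesOff.mono {A : DForm D k} {S T : Set X} (h : A.VanishesOff S) (hST : S ⊆ T) :
    A.VanishesOff T := fun _ R hR u hu => h R hR u fun h' => hu (hST h')

theorem VanishesOff.d [TopologicalSpace X] {A : DForm D k} {S : Set X} (h : A.VanishesOff S)
    (hcont : ∀ {m : ℕ} (R : EuclideanSpace ℝ (Fin m) → X), R ∈ D.plots m → Continuous R)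
    (hS : IsClosed S) : (DForm.d A).VanishesOff S := fun _ R hR u hu => by
  have h0 : A.val R hR =ᶠ[𝓝 u] 0 := by
    filter_upwards [(hS.isOpen_compl.preimage (hcont R hR)).mem_nhds hu] with v hv
    exact h R hR v hv
  rw [d_val, h0.extDeriv_eq]
  ext v
  rw [extDeriv_apply (by exact differentiableAt_const _)]
  simp

end

section

variable {E : Type*} [NormedAddCommGroup E] [NormedSpace ℝ E]
  {H : Type*} [TopologicalSpace H] {I : ModelWithCorners ℝ E H}
  {X : Type*} [TopologicalSpace X] [ChartedSpace H X] {k : ℕ}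

/-- The product of a smooth function and a form on a manifold. -/
def smulSmooth (f : C^∞⟮I, X; 𝓘(ℝ, ℝ), ℝ⟯) (β : DForm (manifoldDiffeology I X) k) :
    DForm (manifoldDiffeology I X) k :=
  smulFun f (fun P hP => (f.contMDiff.comp ((mem_manifoldDiffeology_plots I X P).1 hP)).contDiff) β

@[simp] theorem smulSmooth_val (f : C^∞⟮I, X; 𝓘(ℝ, ℝ), ℝ⟯) (β : DForm (manifoldDiffeology I X) k)
    {m : ℕ} (P : EuclideanSpace ℝ (Fin m) → X) (hP : P ∈ (manifoldDiffeology I X).plots m) (u) :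
    (smulSmooth f β).val P hP u = f (P u) • β.val P hP u := rfl

theorem VanishesOff.smulSmooth {β : DForm (manifoldDiffeology I X) k} {S : Set X}
    (h : β.VanishesOff S) (f : C^∞⟮I, X; 𝓘(ℝ, ℝ), ℝ⟯) {T : Set X}
    (hT : Function.support f ⊆ T) : (smulSmooth f β).VanishesOff (S ∩ T) := fun _ R hR u hu => by
  rw [smulSmooth_val]
  by_cases h1 : R u ∈ S
  · have : f (R u) = 0 := by
      by_contra h2
      exact hu ⟨h1, hT h2⟩
    rw [this, zero_smul]
  · rw [h R hR u h1, smul_zero]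

end

end DForm

section ChartForm

variable {N : ℕ} {H : Type*} [TopologicalSpace H]
  (I : ModelWithCorners ℝ (EuclideanSpace ℝ (Fin N)) H)
  (X : Type*) [TopologicalSpace X] [ChartedSpace H X]

/-- A top degree form with compact support in the range of a chart plot. -/
structure ChartForm where
  plot : EuclideanSpace ℝ (Fin N) → X
  inv : X → EuclideanSpace ℝ (Fin N)
  isChartPlot : IsChartPlot I plot inv
  form : DForm (manifoldDiffeology I X) N
  supp : Set X
  isCompact_supp : IsCompact supp
  supp_subset : supp ⊆ range plot
  vanishesOff : form.VanishesOff supp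

variable {I X}

theorem IsChartPlot.isCompact_preimage {P : EuclideanSpace ℝ (Fin N) → X}
    {e : X → EuclideanSpace ℝ (Fin N)} (hP : IsChartPlot I P e) {K : Set X} (hK : IsCompact K)
    (hKP : K ⊆ range P) : IsCompact (P ⁻¹' K) := by
  have : P ⁻¹' K = e '' K := by
    ext u; constructor
    · intro hu; exact ⟨P u, hu, hP.left_inv u⟩
    · rintro ⟨x, hx, rfl⟩
      change P (e x) ∈ K
      rwa [hP.right_inv (hKP hx)]
  rw [this]
  exact hK.image_of_continuousOn (hP.contMDiffOn.continuousOn.mono hKP)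

variable [IsManifold I ∞ X] (o : ManifoldOrientation I X N)

/-- The integral of a form supported in a chart. -/
def ChartForm.integral (S : ChartForm I X) : ℝ :=
  chartIntegral o S.plot S.isChartPlot.contMDiff S.form

theorem IsChartPlot.chartIntegral_eq_sign_mul {P : EuclideanSpace ℝ (Fin N) → X}
    {e : X → EuclideanSpace ℝ (Fin N)} (hP : IsChartPlot I P e)
    (A : DForm (manifoldDiffeology I X) N) :
    chartIntegral o P hP.contMDiff A = chartSign o P 0 *
      ∫ u, A.val P hP.contMDiff u (fun i => EuclideanSpace.single i (1 : ℝ)) := by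
  rw [← MeasureTheory.integral_const_mul]
  refine MeasureTheory.integral_congr_ae (Eventually.of_forall fun u => ?_)
  simp only [chartSign_eq o hP u 0]

theorem IsChartPlot.integrable_val {P : EuclideanSpace ℝ (Fin N) → X}
    {e : X → EuclideanSpace ℝ (Fin N)} (hP : IsChartPlot I P e) {K : Set X} (hK : IsCompact K)
    (hKP : K ⊆ range P) {A : DForm (manifoldDiffeology I X) N} (hA : A.VanishesOff K)
    (v : Fin N → EuclideanSpace ℝ (Fin N)) :
    MeasureTheory.Integrable fun u => A.val P hP.contMDiff u v := by
  refine Continuous.integrable_of_hasCompactSupport ?_ ?_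
  · exact ((ContinuousAlternatingMap.apply ℝ _ ℝ v).contDiff.comp
      (A.smooth P hP.contMDiff)).continuous
  · exact HasCompactSupport.intro (hP.isCompact_preimage hK hKP) fun u hu => by
      rw [hA _ _ u hu]; rfl

theorem IsChartPlot.chartIntegral_sum {P : EuclideanSpace ℝ (Fin N) → X}
    {e : X → EuclideanSpace ℝ (Fin N)} (hP : IsChartPlot I P e) {ι : Type*} (t : Finset ι)
    (A : ι → DForm (manifoldDiffeology I X) N)
    (hA : ∀ i ∈ t, ∃ K, IsCompact K ∧ K ⊆ range P ∧ (A i).VanishesOff K) :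
    chartIntegral o P hP.contMDiff (∑ i ∈ t, A i) =
      ∑ i ∈ t, chartIntegral o P hP.contMDiff (A i) := by
  simp only [hP.chartIntegral_eq_sign_mul]
  rw [← Finset.mul_sum]
  congr 1
  rw [← MeasureTheory.integral_finsetSum]
  · congr 1
    ext u
    rw [DForm.sum_val, ContinuousAlternatingMap.sum_apply]
  · intro i hi
    obtain ⟨K, hK, hKP, hv⟩ := hA i hi
    exact hP.integrable_val hK hKP hv _

section Fin

variable [T2Space X] [SigmaCompactSpace X]

theorem ChartForm.sum_integral_eq_zero {ι : Type*} [Fintype ι] (S : ι → ChartForm I X)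
    (h : ∑ i, (S i).form = 0) : ∑ i, (S i).integral o = 0 := by
  have hKc : IsClosed (⋃ i, (S i).supp) :=
    isClosed_iUnion_of_finite fun i => (S i).isCompact_supp.isClosed
  obtain ⟨ρ, hρ⟩ := SmoothPartitionOfUnity.exists_isSubordinate I hKc
    (fun i => range (S i).plot) (fun i => (S i).isChartPlot.isOpen_range)
    (iUnion_mono fun i => (S i).supp_subset)
  have hvan : ∀ i j, (DForm.smulSmooth (ρ j) (S i).form).VanishesOff
      ((S i).supp ∩ tsupport (ρ j)) := fun i j =>
    (S i).vanishesOff.smulSmooth (ρ j) (subset_tsupport _)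
  have hcpt : ∀ i j, IsCompact ((S i).supp ∩ tsupport (ρ j)) := fun i j =>
    (S i).isCompact_supp.inter_right (isClosed_tsupport _)
  have hdec : ∀ i, (S i).form = ∑ j, DForm.smulSmooth (ρ j) (S i).form := fun i => by
    refine DForm.ext fun P hP u => ?_
    rw [DForm.sum_val]
    simp only [DForm.smulSmooth_val]
    rw [← Finset.sum_smul]
    by_cases hu : P u ∈ (S i).supp
    · have := ρ.sum_eq_one (mem_iUnion.2 ⟨i, hu⟩)
      rw [finsum_eq_sum_of_fintype] at this
      rw [this, one_smul]
    · rw [(S i).vanishesOff P hP u hu, smul_zero]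
  have h1 : ∀ i, (S i).integral o = ∑ j, chartIntegral o (S j).plot (S j).isChartPlot.contMDiff
      (DForm.smulSmooth (ρ j) (S i).form) := fun i => by
    rw [ChartForm.integral]
    conv_lhs => rw [hdec i]
    rw [(S i).isChartPlot.chartIntegral_sum o]
    · refine Finset.sum_congr rfl fun j _ => ?_
      exact chartIntegral_eq o (S i).isChartPlot (S j).isChartPlot _ ((hvan i j).mono
        (inter_subset_inter (S i).supp_subset (hρ j)))
    · intro j _
      exact ⟨_, hcpt i j, inter_subset_left.trans (S i).supp_subset, hvan i j⟩
  simp_rw [h1]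
  rw [Finset.sum_comm]
  refine Finset.sum_eq_zero fun j _ => ?_
  rw [← (S j).isChartPlot.chartIntegral_sum o]
  · have : ∑ i, DForm.smulSmooth (ρ j) (S i).form = 0 := by
      refine DForm.ext fun P hP u => ?_
      rw [DForm.sum_val]
      simp only [DForm.smulSmooth_val]
      rw [← Finset.smul_sum, ← DForm.sum_val, h]
      simp
    rw [this, (S j).isChartPlot.chartIntegral_eq_sign_mul]
    simp
  · intro i _
    exact ⟨_, hcpt i j, inter_subset_right.trans (hρ j), hvan i j⟩

end Fin

end ChartForm

section Stokes

variable {n : ℕ} {H : Type*} [TopologicalSpace H]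
  {I : ModelWithCorners ℝ (EuclideanSpace ℝ (Fin (n + 1))) H}
  {X : Type*} [TopologicalSpace X] [ChartedSpace H X]

theorem continuous_of_mem_plots {m : ℕ} (R : EuclideanSpace ℝ (Fin m) → X)
    (hR : R ∈ (manifoldDiffeology I X).plots m) : Continuous R :=
  ((mem_manifoldDiffeology_plots I X R).1 hR).continuous

variable [IsManifold I ∞ X] (o : ManifoldOrientation I X (n + 1))

theorem IsChartPlot.chartIntegral_d {P : EuclideanSpace ℝ (Fin (n + 1)) → X}
    {e : X → EuclideanSpace ℝ (Fin (n + 1))} (hP : IsChartPlot I P e) {K : Set X}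
    (hK : IsCompact K) (hKP : K ⊆ range P) {η : DForm (manifoldDiffeology I X) n}
    (hη : η.VanishesOff K) : chartIntegral o P hP.contMDiff (DForm.d η) = 0 := by
  rw [hP.chartIntegral_eq_sign_mul, DForm.d_val, integral_extDeriv_eq_zero (η.smooth _ _), mul_zero]
  exact HasCompactSupport.intro (hP.isCompact_preimage hK hKP) fun u hu => hη _ _ u hu

/-- **Stokes' theorem** for forms with compact support in the union of the ranges of charts. -/
theorem ChartForm.sum_integral_eq_zero_of_eq_d [T2Space X] [SigmaCompactSpace X] {ι : Type*} [Fintype ι]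
    (S : ι → ChartForm I X) (η : DForm (manifoldDiffeology I X) n) {K : Set X} (hK : IsCompact K)
    (hη : η.VanishesOff K) (hcov : ∀ x ∈ K, ∃ P e, IsChartPlot I P e ∧ x ∈ range P)
    (h : ∑ i, (S i).form = DForm.d η) : ∑ i, (S i).integral o = 0 := by
  choose P e hPe hxP using fun x : K => hcov x x.2
  obtain ⟨t, ht⟩ := hK.elim_finite_subcover (fun x : K => range (P x))
    (fun x => (hPe x).isOpen_range) (fun x hx => mem_iUnion.2 ⟨⟨x, hx⟩, hxP ⟨x, hx⟩⟩)
  obtain ⟨ρ, hρ⟩ := SmoothPartitionOfUnity.exists_isSubordinate I hK.isClosed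
    (fun i : t => range (P i)) (fun i => (hPe i).isOpen_range)
    (ht.trans (iUnion₂_subset fun i hi => subset_iUnion (fun j : t => range (P j)) ⟨i, hi⟩))
  have hvan : ∀ j, (DForm.smulSmooth (ρ j) η).VanishesOff (K ∩ tsupport (ρ j)) := fun j =>
    hη.smulSmooth (ρ j) (subset_tsupport _)
  have hcpt : ∀ j, IsCompact (K ∩ tsupport (ρ j)) := fun j =>
    hK.inter_right (isClosed_tsupport _)
  let T : t → ChartForm I X := fun j =>
    { plot := P j, inv := e j, isChartPlot := hPe j,
      form := DForm.d (-DForm.smulSmooth (ρ j) η)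
      supp := K ∩ tsupport (ρ j)
      isCompact_supp := hcpt j
      supp_subset := inter_subset_right.trans (hρ j)
      vanishesOff := DForm.VanishesOff.d (fun _ R hR u hu => by
        rw [DForm.neg_val, hvan j R hR u hu, smul_zero]) continuous_of_mem_plots
          (hcpt j).isClosed }
  have hT : ∀ j, (T j).integral o = 0 := fun j =>
    (hPe j).chartIntegral_d o (hcpt j) (T j).supp_subset (fun _ R hR u hu => by
      rw [DForm.neg_val, hvan j R hR u hu, smul_zero])
  have hdec : η = ∑ j, DForm.smulSmooth (ρ j) η := by
    refine DForm.ext fun P hP u => ?_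
    rw [DForm.sum_val]
    simp only [DForm.smulSmooth_val]
    rw [← Finset.sum_smul]
    by_cases hu : P u ∈ K
    · have := ρ.sum_eq_one hu
      rw [finsum_eq_sum_of_fintype] at this
      rw [this, one_smul]
    · rw [hη P hP u hu, smul_zero]
  have key := ChartForm.sum_integral_eq_zero o (Sum.elim S T) (by
    rw [Fintype.sum_sum_type]
    simp only [Sum.elim_inl, Sum.elim_inr]
    rw [h]
    change _ + ∑ j, DForm.d (-DForm.smulSmooth (ρ j) η) = 0
    rw [← map_sum, Finset.sum_neg_distrib, ← hdec, map_neg, add_neg_cancel])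
  rw [Fintype.sum_sum_type] at key
  simpa [hT] using key

end Stokes

/-! ### The integral over a closed manifold -/

section Closed

variable {n : ℕ} {L : Type*} [TopologicalSpace L] [ChartedSpace (EuclideanSpace ℝ (Fin n)) L]
  [IsManifold (𝓡 n) ∞ L]

theorem exists_isChartPlot_ballPlot (x : L) : ∃ e, IsChartPlot (𝓡 n) (ballPlot x) e := by
  have h := (exists_chart_ball (n := n) x).choose_spec
  set c := chartAt (EuclideanSpace ℝ (Fin n)) x
  set b := OpenPartialHomeomorph.univBall (c x) (exists_chart_ball (n := n) x).choose
  have hbt : b.target = Metric.ball (c x) (exists_chart_ball (n := n) x).choose :=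
    OpenPartialHomeomorph.univBall_target _ h.1
  have hbs : b.source = univ := OpenPartialHomeomorph.univBall_source _ _
  have hu : ∀ u, b u ∈ c.target := ballPlot_mem x
  refine ⟨b.symm ∘ c, contMDiff_ballPlot x, isOpen_range_ballPlot x, fun u => ?_, ?_⟩
  · change b.symm (c (c.symm (b u))) = u
    rw [c.right_inv (hu u), b.left_inv (by simp [hbs])]
  · have h1 : ContMDiffOn (𝓡 n) (𝓡 n) ∞ c c.source := contMDiffOn_chart
    have h2 : ContMDiffOn (𝓡 n) (𝓡 n) ∞ b.symm b.target := by
      rw [hbt]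
      exact OpenPartialHomeomorph.contDiffOn_univBall_symm.contMDiffOn
    refine h2.comp (h1.mono ?_) ?_
    · rintro _ ⟨u, rfl⟩
      exact c.map_target (hu u)
    · rintro _ ⟨u, rfl⟩
      change c (c.symm (b u)) ∈ b.target
      rw [c.right_inv (hu u)]
      exact b.map_source (by simp [hbs])

variable [T2Space L] [CompactSpace L] (o : ManifoldOrientation (𝓡 n) L n)

/-- The pieces of a form on a closed manifold in coordinate balls. -/
def ballPiece (α : DForm (manifoldDiffeology (𝓡 n) L) n) (x : L) : ChartForm (𝓡 n) L where
  plot := ballPlot x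
  inv := (exists_isChartPlot_ballPlot x).choose
  isChartPlot := (exists_isChartPlot_ballPlot x).choose_spec
  form := DForm.smulSmooth ((exists_ballPartition (n := n) (L := L)).choose x) α
  supp := tsupport ((exists_ballPartition (n := n) (L := L)).choose x)
  isCompact_supp := (isClosed_tsupport _).isCompact
  supp_subset := (exists_ballPartition (n := n) (L := L)).choose_spec x
  vanishesOff := by
    have h := DForm.VanishesOff.smulSmooth (β := α) (S := univ)
      (fun _ R hR u hu => absurd (mem_univ _) hu)
      ((exists_ballPartition (n := n) (L := L)).choose x) (subset_tsupport _)
    rwa [univ_inter] at h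

variable (n L) in
theorem finite_ballPartition : {x : L | ((exists_ballPartition (n := n) (L := L)).choose x :
    L → ℝ) ≠ 0}.Finite := by
  refine ((exists_ballPartition (n := n)
    (L := L)).choose.locallyFinite.finite_nonempty_of_compact).subset fun x hx => ?_
  exact Function.support_nonempty_iff.2 hx

variable (n L) in
/-- The centers of the balls of the partition. -/
def ballCenters : Finset L := (finite_ballPartition n L).toFinset

theorem ballPartition_eq_zero {x : L} (hx : x ∉ ballCenters n L) (y : L) :
    (exists_ballPartition (n := n) (L := L)).choose x y = 0 := by
  by_contra h
  refine hx ((finite_ballPartition n L).mem_toFinset.2 fun h0 => h ?_)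
  exact congrFun h0 y

theorem sum_ballPartition (y : L) :
    ∑ x ∈ ballCenters n L, (exists_ballPartition (n := n) (L := L)).choose x y = 1 := by
  rw [← (exists_ballPartition (n := n) (L := L)).choose.sum_eq_one (mem_univ y)]
  refine (finsum_eq_sum_of_support_subset _ fun x hx => ?_).symm
  by_contra h
  exact hx (ballPartition_eq_zero h y)

theorem sum_ballPiece (α : DForm (manifoldDiffeology (𝓡 n) L) n) :
    ∑ x ∈ ballCenters n L, (ballPiece α x).form = α := by
  refine DForm.ext fun P hP u => ?_
  rw [DForm.sum_val]
  simp only [ballPiece, DForm.smulSmooth_val]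
  rw [← Finset.sum_smul, sum_ballPartition, one_smul]

theorem integralForm_eq_sum (α : DForm (manifoldDiffeology (𝓡 n) L) n) :
    integralForm o α = ∑ x ∈ ballCenters n L, (ballPiece α x).integral o := by
  have h : ∀ x, (ballPiece α x).integral o = ∫ u : EuclideanSpace ℝ (Fin n),
      chartSign o (ballPlot x) u *
      (exists_ballPartition (n := n) (L := L)).choose x (ballPlot x u) *
      α.val (ballPlot x) (contMDiff_ballPlot x) u (fun i => EuclideanSpace.single i (1 : ℝ)) :=
    fun x => by
      refine MeasureTheory.integral_congr_ae (Eventually.of_forall fun u => ?_)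
      simp only [ballPiece, DForm.smulSmooth_val, ContinuousAlternatingMap.smul_apply, smul_eq_mul]
      ring
  simp_rw [h]
  refine finsum_eq_sum_of_support_subset _ fun x hx => ?_
  by_contra h'
  refine hx ?_
  simp only [ballPartition_eq_zero h', mul_zero, zero_mul, MeasureTheory.integral_zero]

theorem integralForm_add (α β : DForm (manifoldDiffeology (𝓡 n) L) n) :
    integralForm o (α + β) = integralForm o α + integralForm o β := by
  rw [integralForm_eq_sum, integralForm_eq_sum, integralForm_eq_sum, ← Finset.sum_add_distrib]
  refine Finset.sum_congr rfl fun x _ => ?_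
  have hP := (exists_isChartPlot_ballPlot (n := n) x).choose_spec
  have e : (ballPiece (α + β) x).form = (ballPiece α x).form + (ballPiece β x).form :=
    DForm.ext fun P hP u => smul_add _ _ _
  simp only [ChartForm.integral]
  refine (hP.chartIntegral_eq_sign_mul o _).trans ?_
  rw [(ballPiece α x).isChartPlot.chartIntegral_eq_sign_mul,
    (ballPiece β x).isChartPlot.chartIntegral_eq_sign_mul, e]
  change _ = chartSign o (ballPlot x) 0 * _ + chartSign o (ballPlot x) 0 * _
  rw [← mul_add, ← MeasureTheory.integral_add]
  · rfl
  · exact hP.integrable_val (ballPiece α x).isCompact_supp (ballPiece α x).supp_subset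
      (ballPiece α x).vanishesOff _
  · exact hP.integrable_val (ballPiece β x).isCompact_supp (ballPiece β x).supp_subset
      (ballPiece β x).vanishesOff _

/-- The integral over a closed manifold can be computed from any decomposition into pieces
supported in charts. -/
theorem integralForm_eq_sum_chartForm {ι : Type*} [Fintype ι] (S : ι → ChartForm (𝓡 n) L)
    (α : DForm (manifoldDiffeology (𝓡 n) L) n) (h : ∑ i, (S i).form = α) :
    integralForm o α = ∑ i, (S i).integral o := by
  let T : ballCenters n L → ChartForm (𝓡 n) L := fun x =>
    { ballPiece α x with
      form := -(ballPiece α x).form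
      vanishesOff := fun _ R hR u hu => by
        rw [DForm.neg_val, (ballPiece α x).vanishesOff R hR u hu, smul_zero] }
  have hT : ∀ x, (T x).integral o = -(ballPiece α x).integral o := fun x => by
    simp only [ChartForm.integral]
    rw [IsChartPlot.chartIntegral_eq_sign_mul o (ballPiece α x).isChartPlot,
      IsChartPlot.chartIntegral_eq_sign_mul o (ballPiece α x).isChartPlot, ← mul_neg,
      ← MeasureTheory.integral_neg]
    congr 2
    ext u
    simp [T]
  have key := ChartForm.sum_integral_eq_zero o (Sum.elim S T) (by
    rw [Fintype.sum_sum_type]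
    simp only [Sum.elim_inl, Sum.elim_inr]
    change _ + ∑ x : ballCenters n L, -(ballPiece α x).form = 0
    rw [h, Finset.sum_neg_distrib, Finset.sum_coe_sort (ballCenters n L)
      (fun x => (ballPiece α x).form), sum_ballPiece, add_neg_cancel])
  rw [Fintype.sum_sum_type] at key
  simp only [Sum.elim_inl, Sum.elim_inr, hT, Finset.sum_neg_distrib] at key
  rw [integralForm_eq_sum, ← Finset.sum_coe_sort]
  linarith

end Closed

section ClosedStokes

variable {n : ℕ} {L : Type*} [TopologicalSpace L]
  [ChartedSpace (EuclideanSpace ℝ (Fin (n + 1))) L]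
  [IsManifold (𝓡 (n + 1)) ∞ L] [T2Space L] [CompactSpace L]
  (o : ManifoldOrientation (𝓡 (n + 1)) L (n + 1))

theorem integralForm_d (η : DForm (manifoldDiffeology (𝓡 (n + 1)) L) n) :
    integralForm o (DForm.d η) = 0 := by
  rw [integralForm_eq_sum, ← Finset.sum_coe_sort]
  refine ChartForm.sum_integral_eq_zero_of_eq_d o (fun x : ballCenters (n + 1) L =>
    ballPiece (DForm.d η) x) η (K := univ) isCompact_univ
    (fun _ R hR u hu => absurd (mem_univ _) hu) (fun x _ => ?_) ?_
  · obtain ⟨e, he⟩ := exists_isChartPlot_ballPlot (n := n + 1) x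
    exact ⟨_, e, he, mem_range_ballPlot x⟩
  · exact (Finset.sum_coe_sort (ballCenters (n + 1) L) fun x =>
      (ballPiece (DForm.d η) x).form).trans (sum_ballPiece _)

end ClosedStokes

/-! ### Splitting off the first coordinate -/

section Split

variable {n : ℕ}

/-- The last `n` coordinates. -/
def tailL (n : ℕ) : EuclideanSpace ℝ (Fin (n + 1)) →L[ℝ] EuclideanSpace ℝ (Fin n) :=
  LinearMap.toContinuousLinearMap
    { toFun := fun u => WithLp.toLp 2 fun i => u i.succ
      map_add' := fun _ _ => rfl
      map_smul' := fun _ _ => rfl }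

/-- The vector with given first coordinate and remaining coordinates. -/
def joinL (n : ℕ) : ℝ × EuclideanSpace ℝ (Fin n) →L[ℝ] EuclideanSpace ℝ (Fin (n + 1)) :=
  LinearMap.toContinuousLinearMap
    { toFun := fun p => WithLp.toLp 2 (Fin.cons p.1 (fun i => p.2 i))
      map_add' := fun p q => by
        ext i; refine Fin.cases ?_ (fun i => ?_) i <;> simp
      map_smul' := fun c p => by
        ext i; refine Fin.cases ?_ (fun i => ?_) i <;> simp }

@[simp] theorem tailL_apply (u : EuclideanSpace ℝ (Fin (n + 1))) (i : Fin n) :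
    tailL n u i = u i.succ := rfl
@[simp] theorem joinL_zero (p : ℝ × EuclideanSpace ℝ (Fin n)) : joinL n p 0 = p.1 := rfl
@[simp] theorem joinL_succ (p : ℝ × EuclideanSpace ℝ (Fin n)) (i : Fin n) :
    joinL n p i.succ = p.2 i := rfl

@[simp] theorem tailL_joinL (p : ℝ × EuclideanSpace ℝ (Fin n)) : tailL n (joinL n p) = p.2 := by
  ext i; simp

@[simp] theorem joinL_tailL (u : EuclideanSpace ℝ (Fin (n + 1))) :
    joinL n (u 0, tailL n u) = u := by
  ext i; refine Fin.cases ?_ (fun i => ?_) i <;> simp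

theorem tailL_single_zero (a : ℝ) : tailL n (EuclideanSpace.single 0 a) = 0 := by
  ext i; simp

theorem tailL_single_succ (i : Fin n) (a : ℝ) :
    tailL n (EuclideanSpace.single i.succ a) = EuclideanSpace.single i a := by
  ext j; simp

theorem joinL_single (i : Fin n) (a : ℝ) :
    joinL n (0, EuclideanSpace.single i a) = EuclideanSpace.single i.succ a := by
  ext j; refine Fin.cases ?_ (fun j => ?_) j
  · simp [(Fin.succ_ne_zero i).symm]
  · simp

theorem measurePreserving_split (n : ℕ) : MeasureTheory.MeasurePreserving
    (fun u : EuclideanSpace ℝ (Fin (n + 1)) => (u 0, tailL n u)) := by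
  have h1 := PiLp.volume_preserving_ofLp (Fin (n + 1))
  have h2 := MeasureTheory.volume_preserving_piFinSuccAbove (fun _ : Fin (n + 1) => ℝ) 0
  have h3 := (MeasureTheory.MeasurePreserving.id (MeasureTheory.volume : MeasureTheory.Measure ℝ)).prod
    (PiLp.volume_preserving_toLp (Fin n))
  exact h3.comp (h2.comp h1)

theorem integral_split (F : ℝ × EuclideanSpace ℝ (Fin n) → ℝ) :
    ∫ u : EuclideanSpace ℝ (Fin (n + 1)), F (u 0, tailL n u) = ∫ p, F p := by
  let φ : EuclideanSpace ℝ (Fin (n + 1)) ≃L[ℝ] ℝ × EuclideanSpace ℝ (Fin n) :=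
    ContinuousLinearEquiv.equivOfInverse ((EuclideanSpace.proj 0).prod (tailL n)) (joinL n)
      joinL_tailL (fun p => by simp)
  exact (measurePreserving_split n).integral_comp φ.toHomeomorph.measurableEmbedding F

end Split

/-! ### A diffeomorphism from the line to an interval -/

/-- A diffeomorphism from `ℝ` onto `(m - 3w, m + 3w)`. -/
def intervalMap (m w s : ℝ) : ℝ := m + 6 * w / Real.pi * Real.arctan s

/-- The inverse of `intervalMap`. -/
def intervalInv (m w t : ℝ) : ℝ := Real.tan ((t - m) * (Real.pi / (6 * w)))

section Interval

variable {m w : ℝ}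

theorem contDiff_intervalMap : ContDiff ℝ ∞ (intervalMap m w) :=
  contDiff_const.add (contDiff_const.mul Real.contDiff_arctan)

theorem hasDerivAt_intervalMap (s : ℝ) :
    HasDerivAt (intervalMap m w) (6 * w / Real.pi * (1 / (1 + s ^ 2))) s :=
  ((Real.hasDerivAt_arctan s).const_mul _).const_add _

theorem intervalMap_mem (hw : 0 < w) (s : ℝ) :
    intervalMap m w s ∈ Ioo (m - 3 * w) (m + 3 * w) := by
  have hπ := Real.pi_pos
  have h1 := Real.arctan_lt_pi_div_two s
  have h2 := Real.neg_pi_div_two_lt_arctan s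
  have hc : 0 < 6 * w / Real.pi := by positivity
  have e : 6 * w / Real.pi * (Real.pi / 2) = 3 * w := by field_simp; norm_num
  constructor
  · have := mul_lt_mul_of_pos_left h2 hc
    unfold intervalMap
    nlinarith
  · have := mul_lt_mul_of_pos_left h1 hc
    unfold intervalMap
    nlinarith

theorem intervalInv_intervalMap (hw : 0 < w) (s : ℝ) :
    intervalInv m w (intervalMap m w s) = s := by
  have hπ := Real.pi_pos
  unfold intervalInv intervalMap
  rw [show (m + 6 * w / Real.pi * Real.arctan s - m) * (Real.pi / (6 * w)) = Real.arctan s by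
    field_simp; ring, Real.tan_arctan]

theorem angle_mem (hw : 0 < w) {t : ℝ} (ht : t ∈ Ioo (m - 3 * w) (m + 3 * w)) :
    (t - m) * (Real.pi / (6 * w)) ∈ Ioo (-(Real.pi / 2)) (Real.pi / 2) := by
  have hπ := Real.pi_pos
  have hc : 0 < Real.pi / (6 * w) := by positivity
  have e : 3 * w * (Real.pi / (6 * w)) = Real.pi / 2 := by field_simp; norm_num
  constructor
  · have := mul_lt_mul_of_pos_right (show -(3 * w) < t - m by linarith [ht.1]) hc
    linarith
  · have := mul_lt_mul_of_pos_right (show t - m < 3 * w by linarith [ht.2]) hc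
    linarith

theorem intervalMap_intervalInv (hw : 0 < w) {t : ℝ} (ht : t ∈ Ioo (m - 3 * w) (m + 3 * w)) :
    intervalMap m w (intervalInv m w t) = t := by
  have hπ := Real.pi_pos
  have h := angle_mem hw ht
  unfold intervalInv intervalMap
  rw [Real.arctan_tan h.1 h.2]
  field_simp
  ring

theorem contDiffOn_intervalInv (hw : 0 < w) :
    ContDiffOn ℝ ∞ (intervalInv m w) (Ioo (m - 3 * w) (m + 3 * w)) := fun t ht => by
  have h : ContDiffAt ℝ ∞ Real.tan ((t - m) * (Real.pi / (6 * w))) :=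
    Real.contDiffAt_tan.2 (Real.cos_pos_of_mem_Ioo (angle_mem hw ht)).ne'
  have h2 : ContDiffAt ℝ ∞ (fun t : ℝ => (t - m) * (Real.pi / (6 * w))) t :=
    (contDiffAt_id.sub contDiffAt_const).mul contDiffAt_const
  exact (ContDiffAt.comp t h h2).contDiffWithinAt

theorem tendsto_intervalMap_atTop (hw : 0 < w) :
    Tendsto (intervalMap m w) atTop (𝓝 (m + 3 * w)) := by
  have h : Tendsto Real.arctan atTop (𝓝 (Real.pi / 2)) :=
    Real.tendsto_arctan_atTop.mono_right nhdsWithin_le_nhds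
  have h2 := (h.const_mul (6 * w / Real.pi)).const_add m
  have e : 6 * w / Real.pi * (Real.pi / 2) = 3 * w := by
    have := Real.pi_pos; field_simp; norm_num
  rwa [e] at h2

theorem tendsto_intervalMap_atBot (hw : 0 < w) :
    Tendsto (intervalMap m w) atBot (𝓝 (m - 3 * w)) := by
  have h : Tendsto Real.arctan atBot (𝓝 (-(Real.pi / 2))) :=
    Real.tendsto_arctan_atBot.mono_right nhdsWithin_le_nhds
  have h2 := (h.const_mul (6 * w / Real.pi)).const_add m
  have e : m + 6 * w / Real.pi * -(Real.pi / 2) = m - 3 * w := by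
    have := Real.pi_pos; field_simp; ring
  rwa [e] at h2

end Interval

/-! ### Charts around interior points -/

section Interior

variable {N : ℕ} {H : Type*} [TopologicalSpace H]
  {I : ModelWithCorners ℝ (EuclideanSpace ℝ (Fin N)) H}
  {X : Type*} [TopologicalSpace X] [ChartedSpace H X] [IsManifold I ∞ X]

theorem exists_isChartPlot_of_isInteriorPoint {x : X} (hx : I.IsInteriorPoint x) :
    ∃ P e, IsChartPlot I P e ∧ x ∈ range P := by
  have ht : (extChartAt I x).target ∈ 𝓝 (extChartAt I x x) := by
    have h := extChartAt_target_mem_nhdsWithin (I := I) x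
    rwa [nhdsWithin_eq_nhds.2 (mem_interior_iff_mem_nhds.1 hx)] at h
  obtain ⟨r, hr, hball⟩ := Metric.mem_nhds_iff.1 ht
  set b := OpenPartialHomeomorph.univBall (extChartAt I x x) r
  have hbt : b.target = Metric.ball (extChartAt I x x) r := OpenPartialHomeomorph.univBall_target _ hr
  have hbs : b.source = univ := OpenPartialHomeomorph.univBall_source _ _
  have hbm : ∀ u, b u ∈ Metric.ball (extChartAt I x x) r := fun u => by
    rw [← hbt]; exact b.map_source (by simp [hbs])
  have hrange : range ((extChartAt I x).symm ∘ b) =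
      (chartAt H x).source ∩ extChartAt I x ⁻¹' Metric.ball (extChartAt I x x) r := by
    ext y; constructor
    · rintro ⟨u, rfl⟩
      have h := hball (hbm u)
      refine ⟨?_, ?_⟩
      · have := (extChartAt I x).map_target h
        rwa [extChartAt_source] at this
      · change extChartAt I x ((extChartAt I x).symm (b u)) ∈ Metric.ball (extChartAt I x x) r
        rw [(extChartAt I x).right_inv h]; exact hbm u
    · rintro ⟨h1, h2⟩
      refine ⟨b.symm (extChartAt I x y), ?_⟩
      change (extChartAt I x).symm (b (b.symm (extChartAt I x y))) = y
      rw [b.right_inv (by rw [hbt]; exact h2), (extChartAt I x).left_inv (by rwa [extChartAt_source])]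
  refine ⟨(extChartAt I x).symm ∘ b, b.symm ∘ extChartAt I x, ⟨?_, ?_, fun u => ?_, ?_⟩, ⟨0, ?_⟩⟩
  · exact (contMDiffOn_extChartAt_symm x).comp_contMDiff
      (OpenPartialHomeomorph.contDiff_univBall.contMDiff) (fun u => hball (hbm u))
  · rw [hrange]
    have h := (continuousOn_extChartAt (I := I) x).isOpen_inter_preimage (by
      rw [extChartAt_source]; exact (chartAt H x).open_source)
      (Metric.isOpen_ball (x := extChartAt I x x) (ε := r))
    rwa [extChartAt_source] at h
  · change b.symm (extChartAt I x ((extChartAt I x).symm (b u))) = u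
    rw [(extChartAt I x).right_inv (hball (hbm u)), b.left_inv (by simp [hbs])]
  · rw [hrange]
    have h2 : ContMDiffOn 𝓘(ℝ, EuclideanSpace ℝ (Fin N)) 𝓘(ℝ, EuclideanSpace ℝ (Fin N)) ∞ b.symm
        (Metric.ball (extChartAt I x x) r) :=
      OpenPartialHomeomorph.contDiffOn_univBall_symm.contMDiffOn
    exact h2.comp (contMDiffOn_extChartAt.mono inter_subset_left) inter_subset_right
  · change (extChartAt I x).symm (b 0) = x
    rw [OpenPartialHomeomorph.univBall_apply_zero, extChartAt_to_inv]

end Interior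

/-! ### Orientation signs of rescaled frames -/

section Rescale

variable {V : Type*} [AddCommGroup V] [Module ℝ V] {n : ℕ} (o : Orientation ℝ V (Fin n))

theorem isPosFrame_of_frameSign_eq_one {v : Fin n → V} (h : frameSign o v = 1) :
    IsPosFrame o v := by
  by_contra h'
  rw [frameSign, if_neg h'] at h
  norm_num at h

theorem frameSign_eq_or (v : Fin n → V) : frameSign o v = 1 ∨ frameSign o v = -1 := by
  unfold frameSign; split_ifs <;> simp

theorem frameSign_unitsSMul (b : Basis (Fin n) ℝ V) (w : Fin n → ℝˣ) :
    frameSign o (fun i => (w i : ℝ) • b i) =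
      frameSign o b * SignType.sign (∏ i, (w i : ℝ)) := by
  have h : (fun i => (w i : ℝ) • b i) = b.unitsSMul w := by
    ext i; rw [Basis.unitsSMul_apply]; rfl
  rw [h, frameSign_basis o b, Basis.det_unitsSMul_self]

end Rescale

/-! ### Extending functions from collars -/

section Collar

variable {n : ℕ} {L : Type*} [TopologicalSpace L] [ChartedSpace (EuclideanSpace ℝ (Fin n)) L]
  [IsManifold (𝓡 n) ∞ L] [CompactSpace L]
  {V : Type*} [TopologicalSpace V] [ChartedSpace (EuclideanHalfSpace (n + 1)) V]
  [IsManifold (𝓡∂ (n + 1)) ∞ V] [T2Space V]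
  {oL : ManifoldOrientation (𝓡 n) L n} {oV : ManifoldOrientation (𝓡∂ (n + 1)) V (n + 1)}
  {S : Set ℝ} {c : ℝ × L → V}

theorem IsOrientedCollar.isClosed_image (hc : IsOrientedCollar oL oV S c) {J : Set ℝ}
    (hJ : IsCompact J) (hJS : J ⊆ S) : IsClosed (c '' (J ×ˢ univ)) :=
  ((hJ.prod isCompact_univ).image_of_continuousOn
    (hc.smooth.continuousOn.mono (prod_mono hJS Subset.rfl))).isClosed

theorem IsOrientedCollar.exists_extend (hc : IsOrientedCollar oL oV S c) {J : Set ℝ}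
    (hJ : IsCompact J) (hJS : J ⊆ S) {φ : ℝ × L → ℝ}
    (hφ : ContMDiff (𝓘(ℝ, ℝ).prod (𝓡 n)) 𝓘(ℝ, ℝ) ∞ φ) (hφJ : ∀ t p, t ∈ S → t ∉ J → φ (t, p) = 0) :
    ∃ F : C^∞⟮𝓡∂ (n + 1), V; 𝓘(ℝ, ℝ), ℝ⟯, (∀ t ∈ S, ∀ p, F (c (t, p)) = φ (t, p)) ∧
      ∀ x ∉ c '' (J ×ˢ univ), F x = 0 := by
  classical
  obtain ⟨e, he, hec⟩ := hc.exists_inverse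
  let F : V → ℝ := fun x => if x ∈ c '' (S ×ˢ univ) then φ (e x) else 0
  have hFc : ∀ t ∈ S, ∀ p, F (c (t, p)) = φ (t, p) := fun t ht p => by
    have h1 : (t, p) ∈ S ×ˢ (univ : Set L) := ⟨ht, trivial⟩
    simp only [F]
    rw [if_pos ⟨_, h1, rfl⟩, hec h1]
  have hF0 : ∀ x ∉ c '' (J ×ˢ univ), F x = 0 := fun x hx => by
    by_cases h : x ∈ c '' (S ×ˢ univ)
    · obtain ⟨⟨t, p⟩, ⟨ht, -⟩, rfl⟩ := h
      rw [hFc t ht]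
      exact hφJ t p ht fun h' => hx ⟨(t, p), ⟨h', trivial⟩, rfl⟩
    · simp only [F]; rw [if_neg h]
  refine ⟨⟨F, fun x => ?_⟩, hFc, hF0⟩
  by_cases h : x ∈ c '' (S ×ˢ univ)
  · have h1 : ContMDiffAt (𝓡∂ (n + 1)) 𝓘(ℝ, ℝ) ∞ (φ ∘ e) x :=
      hφ.contMDiffAt.comp x (he.contMDiffAt (hc.isOpen_image.mem_nhds h))
    refine h1.congr_of_eventuallyEq ?_
    filter_upwards [hc.isOpen_image.mem_nhds h] with y hy
    simp only [F]; rw [if_pos hy]; rfl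
  · have h2 : (c '' (J ×ˢ univ))ᶜ ∈ 𝓝 x := (hc.isClosed_image hJ hJS).isOpen_compl.mem_nhds
      fun h' => h (image_mono (prod_mono hJS Subset.rfl) h')
    refine (contMDiffAt_const (c := (0 : ℝ))).congr_of_eventuallyEq ?_
    filter_upwards [h2] with y hy
    exact hF0 y hy

end Collar

/-! ### Integration over collars -/

section CollarChart

variable {n : ℕ} {L : Type*} [TopologicalSpace L] [ChartedSpace (EuclideanSpace ℝ (Fin n)) L]
  [IsManifold (𝓡 n) ∞ L]
  {V : Type*} [TopologicalSpace V] [ChartedSpace (EuclideanHalfSpace (n + 1)) V]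
  [IsManifold (𝓡∂ (n + 1)) ∞ V]
  {oL : ManifoldOrientation (𝓡 n) L n} {oV : ManifoldOrientation (𝓡∂ (n + 1)) V (n + 1)}
  {S : Set ℝ} {c : ℝ × L → V} {m w : ℝ}

/-- The plot of `ℝ × L` given by `intervalMap` and a coordinate ball. -/
def cylinderPlot (m w : ℝ) (x : L) (u : EuclideanSpace ℝ (Fin (n + 1))) : ℝ × L :=
  (intervalMap m w (u 0), ballPlot x (tailL n u))

theorem contMDiff_cylinderPlot (m w : ℝ) (x : L) :
    ContMDiff (𝓡 (n + 1)) (𝓘(ℝ, ℝ).prod (𝓡 n)) ∞ (cylinderPlot (n := n) m w x) := by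
  refine ContMDiff.prodMk ?_ ((contMDiff_ballPlot x).comp (tailL n).contDiff.contMDiff)
  exact (contDiff_intervalMap.comp
    (EuclideanSpace.proj (𝕜 := ℝ) (0 : Fin (n + 1))).contDiff).contMDiff

theorem range_cylinderPlot (hw : 0 < w) (x : L) : range (cylinderPlot (n := n) m w x) =
    Ioo (m - 3 * w) (m + 3 * w) ×ˢ range (ballPlot x : EuclideanSpace ℝ (Fin n) → L) := by
  ext ⟨t, p⟩; constructor
  · rintro ⟨u, hu⟩
    cases hu
    exact ⟨intervalMap_mem hw _, ⟨_, rfl⟩⟩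
  · rintro ⟨ht, ⟨v, hv⟩⟩
    exact ⟨joinL n (intervalInv m w t, v), Prod.ext (by simp [cylinderPlot, intervalMap_intervalInv hw ht])
      (by simpa [cylinderPlot] using hv)⟩

theorem IsOrientedCollar.smooth_slice (hc : IsOrientedCollar oL oV S c) {t : ℝ} (ht : t ∈ S) :
    @Diffeology.DSmooth L V (manifoldDiffeology (𝓡 n) L) (manifoldDiffeology (𝓡∂ (n + 1)) V)
      (fun p => c (t, p)) := fun m P hP =>
  hc.smooth.comp_contMDiff (contMDiff_const.prodMk ((mem_manifoldDiffeology_plots _ _ _).1 hP))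
    fun _ => ⟨ht, trivial⟩

theorem IsOrientedCollar.isChartPlot (hc : IsOrientedCollar oL oV S c) (hw : 0 < w)
    (hS : Ioo (m - 3 * w) (m + 3 * w) ⊆ S) (x : L) :
    ∃ e, IsChartPlot (𝓡∂ (n + 1)) (c ∘ cylinderPlot (n := n) m w x) e := by
  obtain ⟨e, he, hec⟩ := hc.exists_inverse
  obtain ⟨ex, hx⟩ := exists_isChartPlot_ballPlot (n := n) x
  have hmem : ∀ u, cylinderPlot (n := n) m w x u ∈ S ×ˢ (univ : Set L) := fun u =>
    ⟨hS (intervalMap_mem hw _), trivial⟩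
  have hopen : IsOpen (range (cylinderPlot (n := n) m w x)) := by
    rw [range_cylinderPlot hw]
    exact isOpen_Ioo.prod (isOpen_range_ballPlot x)
  have hrange : range (c ∘ cylinderPlot (n := n) m w x) =
      c '' (S ×ˢ univ) ∩ e ⁻¹' range (cylinderPlot (n := n) m w x) := by
    ext y; constructor
    · rintro ⟨u, rfl⟩
      refine ⟨⟨_, hmem u, rfl⟩, u, ?_⟩
      exact (hec (hmem u)).symm
    · rintro ⟨⟨q, hq, rfl⟩, ⟨u, hu⟩⟩
      rw [hec hq] at hu
      exact ⟨u, congrArg c hu⟩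
  refine ⟨fun y => joinL n (intervalInv m w (e y).1, ex (e y).2), ?_, ?_, fun u => ?_, ?_⟩
  · exact hc.smooth.comp_contMDiff (contMDiff_cylinderPlot m w x) hmem
  · rw [hrange]
    exact he.continuousOn.isOpen_inter_preimage hc.isOpen_image hopen
  · simp only [Function.comp_apply]
    rw [hec (hmem u)]
    simp only [cylinderPlot]
    rw [intervalInv_intervalMap hw, hx.left_inv, joinL_tailL]
  · rw [hrange]
    have h1 : ContMDiffOn (𝓘(ℝ, ℝ).prod (𝓡 n)) 𝓘(ℝ, ℝ × EuclideanSpace ℝ (Fin n)) ∞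
        (fun q : ℝ × L => (intervalInv m w q.1, ex q.2)) (range (cylinderPlot (n := n) m w x)) := by
      rw [range_cylinderPlot hw]
      exact ((contDiffOn_intervalInv hw).contMDiffOn.comp contMDiffOn_fst fun q hq => hq.1).prodMk_space
        (hx.contMDiffOn.comp contMDiffOn_snd fun q hq => hq.2)
    exact (joinL n).contDiff.contMDiff.comp_contMDiffOn (h1.comp (he.mono inter_subset_left) fun y hy => hy.2)

theorem mfderiv_cylinderPlot (x : L) (u v : EuclideanSpace ℝ (Fin (n + 1))) :
    mfderiv (𝓡 (n + 1)) (𝓘(ℝ, ℝ).prod (𝓡 n)) (cylinderPlot m w x) u v =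
      (((6 * w / Real.pi * (1 / (1 + (u 0) ^ 2))) * v 0 : ℝ),
        mfderiv (𝓡 n) (𝓡 n) (ballPlot x) (tailL n u) (tailL n v)) := by
  have h1 : HasMFDerivAt (𝓡 (n + 1)) 𝓘(ℝ, ℝ) (fun u : EuclideanSpace ℝ (Fin (n + 1)) =>
      intervalMap m w (u 0)) u
      ((6 * w / Real.pi * (1 / (1 + (u 0) ^ 2))) • EuclideanSpace.proj (𝕜 := ℝ) (0 : Fin (n + 1))) := by
    refine HasFDerivAt.hasMFDerivAt ?_
    have h0 := HasDerivAt.comp_hasFDerivAt (h₂ := intervalMap m w) u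
      (hasDerivAt_intervalMap (m := m) (w := w)
        (EuclideanSpace.proj (𝕜 := ℝ) (0 : Fin (n + 1)) u))
      (EuclideanSpace.proj (𝕜 := ℝ) (0 : Fin (n + 1))).hasFDerivAt
    exact h0
  have h2 : HasMFDerivAt (𝓡 (n + 1)) (𝓡 n) (fun u : EuclideanSpace ℝ (Fin (n + 1)) =>
      ballPlot x (tailL n u)) u
      ((mfderiv (𝓡 n) (𝓡 n) (ballPlot x) (tailL n u)).comp (tailL n)) :=
    (((contMDiff_ballPlot x).mdifferentiableAt (by simp)).hasMFDerivAt).comp u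
      (tailL n).hasFDerivAt.hasMFDerivAt
  exact congrArg (fun A => A v) (h1.prodMk h2).mfderiv

theorem IsOrientedCollar.plotFrame_eq (hc : IsOrientedCollar oL oV S c) (hw : 0 < w)
    (hS : Ioo (m - 3 * w) (m + 3 * w) ⊆ S) (x : L) (u : EuclideanSpace ℝ (Fin (n + 1)))
    (v : EuclideanSpace ℝ (Fin (n + 1))) :
    mfderiv (𝓡 (n + 1)) (𝓡∂ (n + 1)) (c ∘ cylinderPlot m w x) u v =
      mfderivWithin (𝓘(ℝ, ℝ).prod (𝓡 n)) (𝓡∂ (n + 1)) c (S ×ˢ univ) (cylinderPlot m w x u)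
        (((6 * w / Real.pi * (1 / (1 + (u 0) ^ 2))) * v 0 : ℝ),
        mfderiv (𝓡 n) (𝓡 n) (ballPlot x) (tailL n u) (tailL n v)) := by
  have hn : S ×ˢ (univ : Set L) ∈ 𝓝 (cylinderPlot m w x u) :=
    prod_mem_nhds (mem_of_superset (isOpen_Ioo.mem_nhds (intervalMap_mem hw _)) hS) univ_mem
  rw [mfderivWithin_of_mem_nhds hn]
  have h := mfderiv_comp u ((hc.smooth.contMDiffAt hn).mdifferentiableAt (by simp))
    ((contMDiff_cylinderPlot (n := n) m w x).mdifferentiableAt (by simp))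
  exact (congrArg (fun A => A v) h).trans (congrArg
    (mfderiv (𝓘(ℝ, ℝ).prod (𝓡 n)) (𝓡∂ (n + 1)) c (cylinderPlot m w x u))
    (mfderiv_cylinderPlot x u v))

end CollarChart

section CollarSign

variable {k : ℕ} {L : Type*} [TopologicalSpace L]
  [ChartedSpace (EuclideanSpace ℝ (Fin (k + 1))) L] [IsManifold (𝓡 (k + 1)) ∞ L]
  {V : Type*} [TopologicalSpace V] [ChartedSpace (EuclideanHalfSpace (k + 1 + 1)) V]
  [IsManifold (𝓡∂ (k + 1 + 1)) ∞ V]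
  {oL : ManifoldOrientation (𝓡 (k + 1)) L (k + 1)}
  {oV : ManifoldOrientation (𝓡∂ (k + 1 + 1)) V (k + 1 + 1)}
  {S : Set ℝ} {c : ℝ × L → V} {m w : ℝ}

theorem IsOrientedCollar.chartSign_eq (hc : IsOrientedCollar oL oV S c) (hw : 0 < w)
    (hS : Ioo (m - 3 * w) (m + 3 * w) ⊆ S) (x : L) (u : EuclideanSpace ℝ (Fin (k + 1 + 1))) :
    chartSign oV (c ∘ cylinderPlot m w x) u = chartSign oL (ballPlot x) (tailL (k + 1) u) := by
  obtain ⟨ex, hx⟩ := exists_isChartPlot_ballPlot (n := k + 1) x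
  set p := ballPlot x (tailL (k + 1) u)
  set t := intervalMap m w (u 0)
  have ht : t ∈ S := hS (intervalMap_mem hw _)
  let A := mfderivWithin (𝓘(ℝ, ℝ).prod (𝓡 (k + 1))) (𝓡∂ (k + 1 + 1)) c (S ×ˢ univ) (t, p)
  let A' : ℝ × TangentSpace (𝓡 (k + 1)) p →L[ℝ] TangentSpace (𝓡∂ (k + 1 + 1)) (c (t, p)) := A
  let b := (stdBasis (k + 1)).map (hx.derivEquiv (tailL (k + 1) u))
  have hb : plotFrame (𝓡 (k + 1)) (ballPlot x) (tailL (k + 1) u) = b := hx.plotFrame_eq _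
  have hτ : 0 < 6 * w / Real.pi * (1 / (1 + (u 0) ^ 2)) := by
    have := Real.pi_pos
    positivity
  set τ := 6 * w / Real.pi * (1 / (1 + (u 0) ^ 2))
  let D : EuclideanSpace ℝ (Fin (k + 1)) →L[ℝ] TangentSpace (𝓡 (k + 1)) p :=
    mfderiv (𝓡 (k + 1)) (𝓡 (k + 1)) (ballPlot x) (tailL (k + 1) u)
  have hframe : plotFrame (𝓡∂ (k + 1 + 1)) (c ∘ cylinderPlot m w x) u =
      Fin.cons (τ • A' (1, 0)) (fun i => A' (0, b i)) := by
    ext1 i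
    refine (hc.plotFrame_eq hw hS x u _).trans ?_
    refine Fin.cases ?_ (fun i => ?_) i
    · refine Eq.trans ?_ (map_smul A' τ (1, 0))
      change A' _ = A' _
      refine congrArg A' (Prod.ext ?_ ?_)
      · simp [τ]
      · refine (congrArg (D : EuclideanSpace ℝ (Fin (k + 1)) → TangentSpace (𝓡 (k + 1)) p)
          (tailL_single_zero (n := k + 1) 1)).trans ((map_zero D).trans ?_)
        simp
    · change A' _ = A' (0, b i)
      rw [← hb]
      refine congrArg A' (Prod.ext ?_ ?_)
      · simp
      · exact congrArg (D : EuclideanSpace ℝ (Fin (k + 1)) → TangentSpace (𝓡 (k + 1)) p)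
          (tailL_single_succ i 1)
  have key : ∀ (ε : ℝˣ), (ε : ℝ) = 1 ∨ (ε : ℝ) = -1 → frameSign (oL.o p) b = (ε : ℝ) →
      frameSign (oV.o (c (t, p))) (Fin.cons (τ • A' (1, 0)) (fun i => A' (0, b i))) = (ε : ℝ) := by
    intro ε hε hs
    let w0 : Fin (k + 1) → ℝˣ := Fin.cons ε (fun _ => 1)
    have hpos : IsPosFrame (oL.o p) (fun i => (w0 i : ℝ) • b i) := by
      refine isPosFrame_of_frameSign_eq_one _ ?_
      rw [frameSign_unitsSMul, hs, Fin.prod_univ_succ]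
      simp only [w0, Fin.cons_zero, Fin.cons_succ, Units.val_one, Finset.prod_const_one, mul_one]
      rcases hε with h | h <;> rw [h] <;> simp
    obtain ⟨B, hB, hBo⟩ := hc.oriented t ht p _ hpos
    have hB1 : frameSign (oV.o (c (t, p))) B = 1 :=
      frameSign_of_pos _ ⟨B, rfl, hBo⟩
    let w1 : Fin (k + 1 + 1) → ℝˣ := Fin.cons (Units.mk0 τ hτ.ne') w0
    have hww : ∀ i, (w0 i : ℝ) * (w0 i : ℝ) = 1 := fun i => by
      refine Fin.cases ?_ (fun i => ?_) i
      · simp only [w0, Fin.cons_zero]; rcases hε with h | h <;> rw [h] <;> norm_num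
      · simp [w0]
    have hcons : (Fin.cons (τ • A' (1, 0)) (fun i => A' (0, b i)) :
        Fin (k + 1 + 1) → TangentSpace (𝓡∂ (k + 1 + 1)) (c (t, p))) =
        fun i => (w1 i : ℝ) • B i := by
      ext1 i
      rw [hB]
      refine Fin.cases ?_ (fun i => ?_) i
      · rfl
      · have e : ((0 : ℝ), b i) = (w0 i : ℝ) • ((0 : ℝ), (w0 i : ℝ) • b i) := by
          rw [Prod.smul_mk, smul_zero, smul_smul, hww, one_smul]
        rw [Fin.cons_succ, Fin.cons_succ, e, map_smul]
        rfl
    rw [hcons, frameSign_unitsSMul, hB1, Fin.prod_univ_succ, Fin.prod_univ_succ]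
    simp only [w1, w0, Fin.cons_zero, Fin.cons_succ, Units.val_one, Finset.prod_const_one, mul_one,
      Units.val_mk0, one_mul, sign_mul, sign_pos hτ]
    rcases hε with h | h <;> rw [h] <;> simp
  rw [chartSign, chartSign, hframe, hb]
  rcases frameSign_eq_or (oL.o p) b with h | h
  · exact (key 1 (Or.inl rfl) h).trans h.symm
  · exact (key (-1) (Or.inr (by simp)) (h.trans (by simp))).trans (h.trans (by simp)).symm

end CollarSign

namespace DForm

variable {E : Type*} [NormedAddCommGroup E] [NormedSpace ℝ E]
  {H : Type*} [TopologicalSpace H] {I : ModelWithCorners ℝ E H}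
  {X : Type*} [TopologicalSpace X] [ChartedSpace H X] {k : ℕ}

/-- The differential of a smooth function. -/
def dSmooth (f : C^∞⟮I, X; 𝓘(ℝ, ℝ), ℝ⟯) : DForm (manifoldDiffeology I X) 1 :=
  d (ofFun f fun P hP => (f.contMDiff.comp ((mem_manifoldDiffeology_plots I X P).1 hP)).contDiff)

theorem dSmooth_val (f : C^∞⟮I, X; 𝓘(ℝ, ℝ), ℝ⟯) {m : ℕ} (P : EuclideanSpace ℝ (Fin m) → X)
    (hP : P ∈ (manifoldDiffeology I X).plots m) (u) (v : Fin 1 → EuclideanSpace ℝ (Fin m)) :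
    (dSmooth f).val P hP u v = fderiv ℝ (f ∘ P) u (v 0) := by
  have h := d_ofFun_val f (fun P hP =>
    (f.contMDiff.comp ((mem_manifoldDiffeology_plots I X P).1 hP)).contDiff) P hP u
  exact congrArg (fun B => B v) h

theorem d_smulSmooth (f : C^∞⟮I, X; 𝓘(ℝ, ℝ), ℝ⟯) (β : DForm (manifoldDiffeology I X) k) :
    d (smulSmooth f β) = (dSmooth f).wedge β + smulSmooth f (d β) :=
  d_smulFun f (fun P hP =>
    (f.contMDiff.comp ((mem_manifoldDiffeology_plots I X P).1 hP)).contDiff) β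

theorem wedge_val {Y : Type*} {D : DiffeologicalSpace Y} (α : DForm D 1) (β : DForm D k) {m : ℕ}
    (P : EuclideanSpace ℝ (Fin m) → Y) (hP : P ∈ D.plots m) (u) (v) :
    (α.wedge β).val P hP u v = ∑ i : Fin (k + 1),
      (-1) ^ (i : ℕ) * (α.val P hP u (fun _ => v i) * β.val P hP u (i.removeNth v)) :=
  wedgeOne_apply _ _ _

theorem wedge_val_eq_zero {Y : Type*} {D : DiffeologicalSpace Y} {α : DForm D 1} (β : DForm D k)
    {m : ℕ} {P : EuclideanSpace ℝ (Fin m) → Y} {hP : P ∈ D.plots m} {u} (h : α.val P hP u = 0) :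
    (α.wedge β).val P hP u = 0 := by
  ext v
  rw [wedge_val, h]
  simp

end DForm

section CollarForms

variable {k : ℕ} {L : Type*} [TopologicalSpace L]
  [ChartedSpace (EuclideanSpace ℝ (Fin (k + 1))) L] [IsManifold (𝓡 (k + 1)) ∞ L]
  {V : Type*} [TopologicalSpace V] [ChartedSpace (EuclideanHalfSpace (k + 1 + 1)) V]
  [IsManifold (𝓡∂ (k + 1 + 1)) ∞ V]
  {oL : ManifoldOrientation (𝓡 (k + 1)) L (k + 1)}
  {oV : ManifoldOrientation (𝓡∂ (k + 1 + 1)) V (k + 1 + 1)}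
  {S : Set ℝ} {c : ℝ × L → V} {m w : ℝ}

theorem IsOrientedCollar.val_cylinderPlot (hc : IsOrientedCollar oL oV S c) (x : L) (s : ℝ)
    (hs : intervalMap m w s ∈ S)
    (hP : c ∘ cylinderPlot m w x ∈ (manifoldDiffeology (𝓡∂ (k + 1 + 1)) V).plots (k + 1 + 1))
    (v : EuclideanSpace ℝ (Fin (k + 1)))
    (Θ : DForm (manifoldDiffeology (𝓡∂ (k + 1 + 1)) V) (k + 1)) :
    Θ.val (c ∘ cylinderPlot m w x) hP (joinL (k + 1) (s, v))
        (fun i => EuclideanSpace.single i.succ (1 : ℝ)) =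
      (DForm.pullback _ (hc.smooth_slice hs) Θ).val (ballPlot x) (contMDiff_ballPlot x) v
        (fun i => EuclideanSpace.single i (1 : ℝ)) := by
  let g : EuclideanSpace ℝ (Fin (k + 1)) → EuclideanSpace ℝ (Fin (k + 1 + 1)) :=
    fun v => joinL (k + 1) (s, v)
  have hg : ContDiff ℝ ∞ g := (joinL (k + 1)).contDiff.comp (contDiff_const.prodMk contDiff_id)
  have hd : fderiv ℝ g v = (joinL (k + 1)).comp (ContinuousLinearMap.inr ℝ ℝ _) :=
    ((joinL (k + 1)).hasFDerivAt.comp v (hasFDerivAt_prodMk_right s v)).fderiv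
  have h := Θ.natural _ hP g hg v
  rw [hd] at h
  have e : (fun p => c (intervalMap m w s, p)) ∘ ballPlot x =
      (c ∘ cylinderPlot m w x) ∘ g := by
    ext1 v
    simp [g, cylinderPlot]
  have h2 : (DForm.pullback _ (hc.smooth_slice hs) Θ).val (ballPlot x) (contMDiff_ballPlot x) v =
      _ := (Θ.val_of_eq (hc.smooth_slice hs _ _ (contMDiff_ballPlot x))
        ((manifoldDiffeology (𝓡∂ (k + 1 + 1)) V).plot_reparam hP hg) e v).trans h
  rw [h2, ContinuousAlternatingMap.compContinuousLinearMap_apply]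
  congr 1
  ext1 i
  exact (joinL_single i 1).symm

variable [T2Space L] [CompactSpace L] [T2Space V]

theorem dSmooth_val_eq_zero_of_collar (hc : IsOrientedCollar oL oV S c)
    {h : C^∞⟮𝓡∂ (k + 1 + 1), V; 𝓘(ℝ, ℝ), ℝ⟯} {G : ℝ → ℝ} (hG : ContDiff ℝ ∞ G)
    (hG0 : ∀ t, w < |t - m| → deriv G t = 0) (hh : ∀ t ∈ S, ∀ p, h (c (t, p)) = G t)
    {J : Set ℝ} (hJ : IsCompact J) (hJS : J ⊆ S) (hhJ : ∀ x ∉ c '' (J ×ˢ univ), h x = 0)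
    {N : ℕ} {P : EuclideanSpace ℝ (Fin N) → V}
    (hP : P ∈ (manifoldDiffeology (𝓡∂ (k + 1 + 1)) V).plots N) {u : EuclideanSpace ℝ (Fin N)}
    (hu : ∀ t ∈ S, ∀ p, P u = c (t, p) → w < |t - m|) :
    (DForm.dSmooth h).val P hP u = 0 := by
  have hPc : Continuous P := continuous_of_mem_plots P hP
  ext v
  rw [DForm.dSmooth_val]
  suffices hsuff : fderiv ℝ (h ∘ P) u = 0 by rw [hsuff]; rfl
  by_cases h1 : P u ∈ c '' (S ×ˢ univ)
  · obtain ⟨e, he, hec⟩ := hc.exists_inverse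
    obtain ⟨⟨t, p⟩, ⟨ht, -⟩, htp⟩ := h1
    have h1 : P u ∈ c '' (S ×ˢ univ) := ⟨(t, p), ⟨ht, trivial⟩, htp⟩
    have het : e (P u) = (t, p) := by rw [← htp]; exact hec ⟨ht, trivial⟩
    have hn : P ⁻¹' (c '' (S ×ˢ univ)) ∈ 𝓝 u := (hc.isOpen_image.preimage hPc).mem_nhds h1
    have hf : ContDiffAt ℝ ∞ (fun y => (e (P y)).1) u := by
      have h2 : ContMDiffAt 𝓘(ℝ, EuclideanSpace ℝ (Fin N)) (𝓘(ℝ, ℝ).prod (𝓡 (k + 1))) ∞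
          (e ∘ P) u := (he.contMDiffAt (hc.isOpen_image.mem_nhds h1)).comp u
        ((mem_manifoldDiffeology_plots _ _ P).1 hP).contMDiffAt
      exact (contMDiffAt_fst.comp u h2).contDiffAt
    have heq : h ∘ P =ᶠ[𝓝 u] fun y => G (e (P y)).1 := by
      filter_upwards [hn] with y hy
      obtain ⟨⟨t, p⟩, ⟨ht, -⟩, hy⟩ := hy
      rw [Function.comp_apply, ← hy, hh t ht, hec ⟨ht, trivial⟩]
    rw [heq.fderiv_eq]
    have hd : HasDerivAt G 0 ((fun y => (e (P y)).1) u) := by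
      simp only [het]
      rw [← hG0 t (hu t ht p htp.symm)]
      exact (hG.differentiable (by simp) t).hasDerivAt
    have := (HasDerivAt.comp_hasFDerivAt (h₂ := G) u hd
      (hf.differentiableAt (by simp)).hasFDerivAt).fderiv
    rw [zero_smul] at this
    exact this
  · have h2 : P u ∉ c '' (J ×ˢ univ) := fun h' => h1 (image_mono (prod_mono hJS Subset.rfl) h')
    have heq : h ∘ P =ᶠ[𝓝 u] fun _ => 0 := by
      filter_upwards [((hc.isClosed_image hJ hJS).isOpen_compl.preimage hPc).mem_nhds h2] with y hy
      exact hhJ _ hy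
    rw [heq.fderiv_eq, fderiv_fun_const]
    rfl

theorem IsOrientedCollar.exists_chartForms (hc : IsOrientedCollar oL oV S c) (hw : 0 < w)
    (hS : Ioo (m - 3 * w) (m + 3 * w) ⊆ S)
    {h : C^∞⟮𝓡∂ (k + 1 + 1), V; 𝓘(ℝ, ℝ), ℝ⟯} {G : ℝ → ℝ} (hG : ContDiff ℝ ∞ G)
    (hG0 : ∀ t, w < |t - m| → deriv G t = 0) (hh : ∀ t ∈ S, ∀ p, h (c (t, p)) = G t)
    {J : Set ℝ} (hJ : IsCompact J) (hJS : J ⊆ S) (hhJ : ∀ x ∉ c '' (J ×ˢ univ), h x = 0)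
    (Θ : DForm (manifoldDiffeology (𝓡∂ (k + 1 + 1)) V) (k + 1)) {ν : ℝ}
    (hν : ∀ t (ht : t ∈ S), integralForm oL (DForm.pullback _ (hc.smooth_slice ht) Θ) = ν) :
    ∃ (N : ℕ) (T : Fin N → ChartForm (𝓡∂ (k + 1 + 1)) V),
      ∑ i, (T i).form = (DForm.dSmooth h).wedge Θ ∧
      ∑ i, (T i).integral oV = ν * (G (m + 3 * w) - G (m - 3 * w)) := by
  let ψ : ContDiffBump m := ⟨w, 2 * w, hw, by linarith⟩
  have hJ2 : Icc (m - 2 * w) (m + 2 * w) ⊆ Ioo (m - 3 * w) (m + 3 * w) :=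
    Icc_subset_Ioo (by linarith) (by linarith)
  have hψ0 : ∀ t, t ∉ Icc (m - 2 * w) (m + 2 * w) → ψ t = 0 := fun t ht => by
    refine ψ.zero_of_le_dist ?_
    rw [← Real.closedBall_eq_Icc, Metric.mem_closedBall, not_le] at ht
    exact ht.le
  set ρ := (exists_ballPartition (n := k + 1) (L := L)).choose
  have hφ : ∀ x : L, ContMDiff (𝓘(ℝ, ℝ).prod (𝓡 (k + 1))) 𝓘(ℝ, ℝ) ∞
      fun q : ℝ × L => ψ q.1 * ρ x q.2 := fun x => by
    have h1 : ContMDiff (𝓘(ℝ, ℝ).prod (𝓡 (k + 1))) 𝓘(ℝ, ℝ) ∞ fun q : ℝ × L => ψ q.1 :=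
      (ψ.contDiff.contMDiff).comp contMDiff_fst
    have h2 : ContMDiff (𝓘(ℝ, ℝ).prod (𝓡 (k + 1))) 𝓘(ℝ, ℝ) ∞ fun q : ℝ × L => ρ x q.2 :=
      (ρ x).contMDiff.comp contMDiff_snd
    exact h1.mul h2
  choose Ψ hΨ hΨ0 using fun x : L => hc.exists_extend isCompact_Icc (hJ2.trans hS) (hφ x)
    fun t p _ ht => by rw [hψ0 t ht, zero_mul]
  choose e he using fun x : L => hc.isChartPlot hw hS x
  let A := (DForm.dSmooth h).wedge Θ
  let T : ballCenters (k + 1) L → ChartForm (𝓡∂ (k + 1 + 1)) V := fun x =>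
    { plot := c ∘ cylinderPlot m w x.1
      inv := e x
      isChartPlot := he x
      form := DForm.smulSmooth (Ψ x) A
      supp := c '' (Icc (m - 2 * w) (m + 2 * w) ×ˢ tsupport (ρ x.1))
      isCompact_supp := (isCompact_Icc.prod (isClosed_tsupport _).isCompact).image_of_continuousOn
        (hc.smooth.continuousOn.mono (prod_mono (hJ2.trans hS) (subset_univ _)))
      supp_subset := by
        rw [range_comp, range_cylinderPlot hw]
        exact image_mono (prod_mono hJ2
          ((exists_ballPartition (n := k + 1) (L := L)).choose_spec x.1))
      vanishesOff := fun _ R hR u hu => by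
        rw [DForm.smulSmooth_val]
        suffices hz : Ψ x (R u) = 0 by rw [hz, zero_smul]
        by_cases h1 : R u ∈ c '' (Icc (m - 2 * w) (m + 2 * w) ×ˢ univ)
        · obtain ⟨⟨t, p⟩, ⟨ht, -⟩, htp⟩ := h1
          rw [← htp, hΨ _ t (hS (hJ2 ht))]
          have : ρ x.1 p = 0 := by
            by_contra h2
            exact hu ⟨(t, p), ⟨ht, subset_tsupport _ h2⟩, htp⟩
          simp only [this, mul_zero]
        · exact hΨ0 _ _ h1 }
  have hsum : ∑ x, (T x).form = A := by
    refine DForm.ext fun P hP u => ?_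
    rw [DForm.sum_val]
    change ∑ x : ballCenters (k + 1) L, (Ψ x) (P u) • A.val P hP u = _
    rw [← Finset.sum_smul]
    by_cases hu : ∀ t ∈ S, ∀ p, P u = c (t, p) → w < |t - m|
    · have h0 : A.val P hP u = 0 := DForm.wedge_val_eq_zero Θ
        (dSmooth_val_eq_zero_of_collar hc hG hG0 hh hJ hJS hhJ hP hu)
      rw [h0, smul_zero]
    · push Not at hu
      obtain ⟨t, ht, p, htp, htm⟩ := hu
      have h1 : ψ t = 1 := ψ.one_of_mem_closedBall (by
        rw [Metric.mem_closedBall, Real.dist_eq]; exact htm)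
      have h2 : ∑ x : ballCenters (k + 1) L, Ψ x (P u) = 1 := by
        simp_rw [htp, hΨ _ t ht, h1, one_mul]
        rw [Finset.sum_coe_sort (ballCenters (k + 1) L) fun x => ρ x p]
        exact sum_ballPartition p
      rw [h2, one_smul]
  let τ : ℝ → ℝ := intervalMap m w
  have hGτ : ContDiff ℝ ∞ (G ∘ τ) := hG.comp contDiff_intervalMap
  let g : ℝ → ℝ := deriv (G ∘ τ)
  have hg0 : ∀ s, ψ (τ s) * g s = g s := fun s => by
    by_cases hs : w < |τ s - m|
    · have hd : HasDerivAt G 0 (τ s) := by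
        rw [← hG0 _ hs]; exact (hG.differentiable (by simp) _).hasDerivAt
      have : g s = 0 := by
        have := (hd.comp s (hasDerivAt_intervalMap s)).deriv
        rwa [zero_mul] at this
      rw [this, mul_zero]
    · rw [ψ.one_of_mem_closedBall (by
        rw [Metric.mem_closedBall, Real.dist_eq]; exact not_lt.1 hs), one_mul]
  let F : L → ℝ × EuclideanSpace ℝ (Fin (k + 1)) → ℝ := fun x q =>
    ψ (τ q.1) * ρ x (ballPlot x q.2) * (g q.1 *
      Θ.val (c ∘ cylinderPlot m w x) (he x).contMDiff (joinL (k + 1) q)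
        (fun i => EuclideanSpace.single i.succ (1 : ℝ)))
  have hτS : ∀ s, τ s ∈ S := fun s => hS (intervalMap_mem hw s)
  have hval : ∀ (x : ballCenters (k + 1) L) u, (T x).form.val (T x).plot (T x).isChartPlot.contMDiff u
      (fun i => EuclideanSpace.single i (1 : ℝ)) = F x (u 0, tailL (k + 1) u) := fun x u => by
    change (Ψ x (c (cylinderPlot m w x.1 u)) • A.val _ _ u) _ = _
    rw [ContinuousAlternatingMap.smul_apply, smul_eq_mul]
    have h1 : Ψ x (c (cylinderPlot m w x.1 u)) =
        ψ (τ (u 0)) * ρ x.1 (ballPlot x.1 (tailL (k + 1) u)) := hΨ x _ (hτS (u 0)) _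
    rw [h1]
    simp only [F, joinL_tailL]
    congr 1
    have h2 : ∀ v : EuclideanSpace ℝ (Fin (k + 1 + 1)),
        fderiv ℝ (h ∘ (c ∘ cylinderPlot m w x.1)) u v = g (u 0) * v 0 := fun v => by
      have e1 : h ∘ (c ∘ cylinderPlot m w x.1) =
          (G ∘ τ) ∘ EuclideanSpace.proj (𝕜 := ℝ) (0 : Fin (k + 1 + 1)) := by
        ext1 y; exact hh _ (hτS (y 0)) _
      rw [e1]
      have h3 := HasDerivAt.comp_hasFDerivAt (h₂ := G ∘ τ) u
        (hGτ.differentiable (by simp) (EuclideanSpace.proj (𝕜 := ℝ) (0 : Fin (k + 1 + 1)) u)).hasDerivAt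
        (EuclideanSpace.proj (𝕜 := ℝ) (0 : Fin (k + 1 + 1))).hasFDerivAt
      exact congrArg (fun B => B v) h3.fderiv
    change ((DForm.dSmooth h).wedge Θ).val _ _ u _ = _
    rw [DForm.wedge_val, Fin.sum_univ_succ, Finset.sum_eq_zero]
    · rw [DForm.dSmooth_val, h2]
      simp only [Fin.val_zero, pow_zero, one_mul, add_zero, PiLp.single_apply, if_true, mul_one]
      rfl
    · intro i _
      rw [DForm.dSmooth_val, h2]
      simp
  have hint : ∀ x : ballCenters (k + 1) L, MeasureTheory.Integrable (F x) := fun x => by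
    have h1 := (T x).isChartPlot.integrable_val (T x).isCompact_supp (T x).supp_subset
      (T x).vanishesOff (fun i => EuclideanSpace.single i (1 : ℝ))
    simp_rw [hval x] at h1
    let φ : EuclideanSpace ℝ (Fin (k + 1 + 1)) ≃L[ℝ] ℝ × EuclideanSpace ℝ (Fin (k + 1)) :=
      ContinuousLinearEquiv.equivOfInverse ((EuclideanSpace.proj 0).prod (tailL (k + 1)))
        (joinL (k + 1)) joinL_tailL (fun p => by simp)
    exact ((measurePreserving_split (k + 1)).integrable_comp_emb
      φ.toHomeomorph.measurableEmbedding).1 h1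
  have hTint : ∀ x, (T x).integral oV =
      ∫ s, chartSign oL (ballPlot x.1) 0 * ∫ v, F x (s, v) := fun x => by
    rw [ChartForm.integral, (T x).isChartPlot.chartIntegral_eq_sign_mul oV]
    simp_rw [hval x]
    rw [integral_split (F x), MeasureTheory.integral_const_mul]
    congr 1
    · refine (hc.chartSign_eq hw hS x.1 0).trans ?_
      rw [map_zero]
    · exact MeasureTheory.integral_prod _ (hint x)
  have hslice : ∀ s, ∑ x : ballCenters (k + 1) L,
      chartSign oL (ballPlot x.1) 0 * ∫ v, F x (s, v) = g s * ν := fun s => by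
    have h0 : ν = ∑ x : ballCenters (k + 1) L,
        (ballPiece (DForm.pullback _ (hc.smooth_slice (hτS s)) Θ) x.1).integral oL := by
      rw [← hν (τ s) (hτS s), integralForm_eq_sum, ← Finset.sum_coe_sort]
    rw [h0, Finset.mul_sum]
    refine Finset.sum_congr rfl fun x _ => ?_
    obtain ⟨ex, hx⟩ := exists_isChartPlot_ballPlot (n := k + 1) x.1
    have h1 : (ballPiece (DForm.pullback _ (hc.smooth_slice (hτS s)) Θ) x.1).integral oL =
        _ * _ := hx.chartIntegral_eq_sign_mul oL _
    rw [h1, mul_left_comm]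
    congr 1
    rw [← MeasureTheory.integral_const_mul]
    congr 1
    ext v
    have h2 := hc.val_cylinderPlot x.1 s (hτS s) (he x).contMDiff v Θ
    simp only [F]
    rw [h2]
    set B := (DForm.pullback _ (hc.smooth_slice (hτS s)) Θ).val (ballPlot x.1)
      (contMDiff_ballPlot x.1) v (fun i => EuclideanSpace.single i (1 : ℝ))
    change ψ (τ s) * ρ x.1 (ballPlot x.1 v) * (g s * B) = g s * (ρ x.1 (ballPlot x.1 v) * B)
    linear_combination (ρ x.1 (ballPlot x.1 v) * B) * hg0 s
  have hgint : ∫ s : ℝ, g s = G (m + 3 * w) - G (m - 3 * w) := by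
    refine MeasureTheory.integral_of_hasDerivAt_of_tendsto
      (fun s => (hGτ.differentiable (by simp) s).hasDerivAt) ?_ ?_ ?_
    · have hgc : Continuous g := hGτ.continuous_deriv (by simp)
      refine hgc.integrable_of_hasCompactSupport ?_
      have hK : IsCompact (intervalInv m w '' Icc (m - 2 * w) (m + 2 * w)) :=
        isCompact_Icc.image_of_continuousOn ((contDiffOn_intervalInv hw).continuousOn.mono hJ2)
      refine HasCompactSupport.intro hK fun s hs => ?_
      rw [← hg0 s, hψ0 _ fun h' => hs ⟨τ s, h', intervalInv_intervalMap hw s⟩, zero_mul]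
    · exact (hG.continuous.tendsto _).comp (tendsto_intervalMap_atBot hw)
    · exact (hG.continuous.tendsto _).comp (tendsto_intervalMap_atTop hw)
  have htot : ∑ x, (T x).integral oV = ν * (G (m + 3 * w) - G (m - 3 * w)) := by
    simp_rw [hTint]
    rw [← MeasureTheory.integral_finsetSum]
    · simp_rw [hslice]
      rw [MeasureTheory.integral_mul_const, hgint, mul_comm]
    · intro x _
      exact ((hint x).integral_prod_left).const_mul _
  let eq := (Fintype.equivFin (ballCenters (k + 1) L)).symm
  exact ⟨_, fun i => T (eq i), (eq.sum_comp fun x => (T x).form).trans hsum,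
    (eq.sum_comp fun x => (T x).integral oV).trans htot⟩

end CollarForms

section Ends

variable {n : ℕ} {V : Type*} [TopologicalSpace V] [ChartedSpace (EuclideanHalfSpace (n + 1)) V]
  [IsManifold (𝓡∂ (n + 1)) ∞ V] [T2Space V] [CompactSpace V]

theorem sum_ends_eq_zero (oV : ManifoldOrientation (𝓡∂ (n + 1)) V (n + 1))
    {ι : Type*} [Fintype ι] (h : ι → C^∞⟮𝓡∂ (n + 1), V; 𝓘(ℝ, ℝ), ℝ⟯)
    {U : Set V} (hU : IsOpen U) (hUb : (𝓡∂ (n + 1)).boundary V ⊆ U)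
    (h1 : ∀ x ∈ U, ∑ i, h i x = 1)
    (Θ : DForm (manifoldDiffeology (𝓡∂ (n + 1)) V) n) (hΘ : DForm.d Θ = 0)
    (N : ι → ℕ) (T : ∀ i, Fin (N i) → ChartForm (𝓡∂ (n + 1)) V)
    (hT : ∀ i, ∑ j, (T i j).form = (DForm.dSmooth (h i)).wedge Θ) :
    ∑ i, ∑ j, (T i j).integral oV = 0 := by
  let χ : C^∞⟮𝓡∂ (n + 1), V; 𝓘(ℝ, ℝ), ℝ⟯ := ∑ i, h i - 1
  have hχ : ∀ x, χ x = ∑ i, h i x - 1 := fun x => by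
    have : (∑ i, h i : C^∞⟮𝓡∂ (n + 1), V; 𝓘(ℝ, ℝ), ℝ⟯) x = ∑ i, h i x :=
      map_sum (ContMDiffMap.evalRingHom (I := 𝓡∂ (n + 1)) (n := ∞) (R := ℝ) x) h Finset.univ
    change (∑ i, h i : C^∞⟮𝓡∂ (n + 1), V; 𝓘(ℝ, ℝ), ℝ⟯) x - 1 = _
    rw [this]
  have key := ChartForm.sum_integral_eq_zero_of_eq_d oV (fun p : Σ i, Fin (N i) => T p.1 p.2)
    (DForm.smulSmooth χ Θ) (K := Uᶜ) hU.isClosed_compl.isCompact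
    (fun _ R hR u hu => by
      rw [DForm.smulSmooth_val, hχ, h1 _ (not_not.1 hu), sub_self, zero_smul])
    (fun x hx => exists_isChartPlot_of_isInteriorPoint (by
      by_contra h'
      exact hx (hUb (ModelWithCorners.isInteriorPoint_or_isBoundaryPoint x |>.resolve_left h')))) ?_
  · rw [Fintype.sum_sigma] at key
    exact key
  · rw [Fintype.sum_sigma, DForm.d_smulSmooth, hΘ]
    simp_rw [hT]
    refine DForm.ext fun P hP u => ?_
    ext v
    rw [DForm.sum_val, DForm.add_val, DForm.smulSmooth_val, DForm.zero_val, smul_zero, add_zero,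
      ContinuousAlternatingMap.sum_apply]
    simp only [DForm.wedge_val]
    rw [Finset.sum_comm]
    refine Finset.sum_congr rfl fun i _ => ?_
    rw [← Finset.mul_sum, ← Finset.sum_mul]
    congr 2
    simp only [DForm.dSmooth_val]
    have e : χ ∘ P = fun y => ∑ i, (h i ∘ P) y - 1 := funext fun y => hχ (P y)
    rw [e, fderiv_sub_const, fderiv_fun_sum]
    · rw [sum_apply]
    · intro j _
      exact (((h j).contMDiff.comp ((mem_manifoldDiffeology_plots _ _ P).1 hP)).contDiff).differentiable
        (by simp) u

end Ends

attribute [instance] OrientedCobordism.top OrientedCobordism.charted OrientedCobordism.manifold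
  OrientedCobordism.t2 OrientedCobordism.compact

/-- A smooth step from `0` to `1` on `[m - w, m + w]`. -/
def stepFun (m w t : ℝ) : ℝ := Real.smoothTransition ((t - (m - w)) / (2 * w))

section Step

variable {m w : ℝ}

theorem contDiff_stepFun : ContDiff ℝ ∞ (stepFun m w) :=
  Real.smoothTransition.contDiff.comp ((contDiff_id.sub contDiff_const).div_const _)

theorem stepFun_eq_zero (hw : 0 < w) {t : ℝ} (ht : t ≤ m - w) : stepFun m w t = 0 :=
  Real.smoothTransition.zero_of_nonpos (div_nonpos_of_nonpos_of_nonneg (by linarith) (by linarith))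

theorem stepFun_eq_one (hw : 0 < w) {t : ℝ} (ht : m + w ≤ t) : stepFun m w t = 1 :=
  Real.smoothTransition.one_of_one_le (by rw [le_div_iff₀ (by linarith)]; linarith)

theorem deriv_stepFun (hw : 0 < w) {t : ℝ} (ht : w < |t - m|) : deriv (stepFun m w) t = 0 := by
  rcases lt_abs.1 ht with h | h
  · have e : stepFun m w =ᶠ[𝓝 t] fun _ => 1 := by
      filter_upwards [Ioi_mem_nhds (show m + w < t by linarith)] with y hy
      exact stepFun_eq_one hw (le_of_lt hy)
    rw [e.deriv_eq, deriv_const]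
  · have e : stepFun m w =ᶠ[𝓝 t] fun _ => 0 := by
      filter_upwards [Iio_mem_nhds (show t < m - w by linarith)] with y hy
      exact stepFun_eq_zero hw (le_of_lt hy)
    rw [e.deriv_eq, deriv_const]

end Step

section Cobordism

universe u v w

variable {E : Type*} [NormedAddCommGroup E] [NormedSpace ℝ E] [FiniteDimensional ℝ E]
  {H : Type*} [TopologicalSpace H] {I : ModelWithCorners ℝ E H}
  {M : Type*} [TopologicalSpace M] [ChartedSpace H M]
  {k : ℕ} {σ : FormField I M 2} {r s : ℕ}
  {α : Fin r → OrientedLagrangian.{u} (k + 1) σ} {β : Fin s → OrientedLagrangian.{v} (k + 1) σ}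

theorem IsOrientedCollar.isOpen_image_inter {n : ℕ} {L : Type*} [TopologicalSpace L]
    [ChartedSpace (EuclideanSpace ℝ (Fin n)) L] [IsManifold (𝓡 n) ∞ L]
    {V : Type*} [TopologicalSpace V] [ChartedSpace (EuclideanHalfSpace (n + 1)) V]
    [IsManifold (𝓡∂ (n + 1)) ∞ V]
    {oL : ManifoldOrientation (𝓡 n) L n} {oV : ManifoldOrientation (𝓡∂ (n + 1)) V (n + 1)}
    {S : Set ℝ} {c : ℝ × L → V} (hc : IsOrientedCollar oL oV S c) {O : Set ℝ} (hO : IsOpen O) :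
    IsOpen (c '' ((S ∩ O) ×ˢ univ)) := by
  obtain ⟨e, he, hec⟩ := hc.exists_inverse
  have : c '' ((S ∩ O) ×ˢ univ) = c '' (S ×ˢ univ) ∩ e ⁻¹' (O ×ˢ univ) := by
    ext y; constructor
    · rintro ⟨⟨t, p⟩, ⟨⟨h1, h2⟩, -⟩, rfl⟩
      refine ⟨⟨(t, p), ⟨h1, trivial⟩, rfl⟩, ?_⟩
      rw [mem_preimage, hec ⟨h1, trivial⟩]
      exact ⟨h2, trivial⟩
    · rintro ⟨⟨⟨t, p⟩, ⟨h1, -⟩, rfl⟩, h2⟩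
      rw [mem_preimage, hec ⟨h1, trivial⟩] at h2
      exact ⟨(t, p), ⟨⟨h1, h2.1⟩, trivial⟩, rfl⟩
  rw [this]
  exact he.continuousOn.isOpen_inter_preimage hc.isOpen_image (hO.prod isOpen_univ)

theorem OrientedCobordism.sum_eq_sum (C : OrientedCobordism.{u, v, w} α β)
    (Θ : DForm (manifoldDiffeology (𝓡∂ (k + 1 + 1)) C.V) (k + 1)) (hΘ : DForm.d Θ = 0)
    (a : Fin r → ℝ) (b : Fin s → ℝ)
    (ha : ∀ i t (ht : t ∈ Ioc (1 - C.ε) 1), integralForm (α i).orientation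
      (DForm.pullback _ ((C.isCollar_pos i).smooth_slice ht) Θ) = a i)
    (hb : ∀ j t (ht : t ∈ Ico 0 C.ε), integralForm (β j).orientation
      (DForm.pullback _ ((C.isCollar_neg j).smooth_slice ht) Θ) = b j) :
    ∑ i, a i = ∑ j, b j := by
  set ε := min C.ε (1 / 2)
  have hε : 0 < ε := lt_min C.ε_pos (by norm_num)
  have hε1 : ε ≤ C.ε := min_le_left _ _
  have hε2 : ε ≤ 1 / 2 := min_le_right _ _
  set w := ε / 8 with hw_def
  have hw : 0 < w := by positivity
  set m := 1 - ε / 2 with hm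
  set m' := ε / 2 with hm'
  have hposS : Ioo (m - 3 * w) (m + 3 * w) ⊆ Ioc (1 - C.ε) 1 := fun t ht =>
    ⟨by linarith [ht.1], by linarith [ht.2]⟩
  have hnegS : Ioo (m' - 3 * w) (m' + 3 * w) ⊆ Ico 0 C.ε := fun t ht =>
    ⟨by linarith [ht.1], by linarith [ht.2]⟩
  have hposJ : Icc (m - w) 1 ⊆ Ioc (1 - C.ε) 1 := fun t ht => ⟨by linarith [ht.1], ht.2⟩
  have hnegJ : Icc 0 (m' + w) ⊆ Ico 0 C.ε := fun t ht => ⟨ht.1, by linarith [ht.2]⟩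
  choose h hh hh0 using fun i => (C.isCollar_pos i).exists_extend isCompact_Icc hposJ
    (φ := fun q => stepFun m w q.1) ((contDiff_stepFun.contMDiff).comp contMDiff_fst)
    (fun t p ht htJ => stepFun_eq_zero hw (by
      by_contra hlt
      exact htJ ⟨(not_le.1 hlt).le, ht.2⟩))
  choose h' hh' hh0' using fun j => (C.isCollar_neg j).exists_extend isCompact_Icc hnegJ
    (φ := fun q => 1 - stepFun m' w q.1)
    (((contDiff_const.sub contDiff_stepFun).contMDiff (f := fun t => 1 - stepFun m' w t)).comp
      contMDiff_fst)
    (fun t p ht htJ => by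
      rw [stepFun_eq_one hw, sub_self]
      by_contra hlt
      exact htJ ⟨ht.1, (not_le.1 hlt).le⟩)
  choose N T hT1 hT2 using fun i => (C.isCollar_pos i).exists_chartForms hw hposS
    (contDiff_stepFun (m := m) (w := w)) (fun t ht => deriv_stepFun hw ht) (hh i) isCompact_Icc
    hposJ (hh0 i) Θ (ha i)
  choose N' T' hT1' hT2' using fun j => (C.isCollar_neg j).exists_chartForms hw hnegS
    (G := fun t => 1 - stepFun m' w t) (contDiff_const.sub contDiff_stepFun)
    (fun t ht => by rw [deriv_const_sub, deriv_stepFun hw ht, neg_zero]) (hh' j) isCompact_Icc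
    hnegJ (hh0' j) Θ (hb j)
  have hpp : ∀ i i' t p, i ≠ i' → t ∈ Ioc (1 - C.ε) 1 → h i' (C.posCollar i (t, p)) = 0 := by
    intro i i' t p hii ht
    refine hh0 i' _ ?_
    rintro ⟨⟨t', p'⟩, ⟨ht', -⟩, heq⟩
    have h1 := C.cylindrical_pos i t ht p
    rw [← heq, C.cylindrical_pos i' t' (hposJ ht') p'] at h1
    have h2 := congrArg (fun q : ℂ × M => q.1.im) h1
    simp only [add_left_inj, Nat.cast_inj] at h2
    exact hii (Fin.ext h2.symm)
  have hnn : ∀ j j' t p, j ≠ j' → t ∈ Ico 0 C.ε → h' j' (C.negCollar j (t, p)) = 0 := by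
    intro i i' t p hii ht
    refine hh0' i' _ ?_
    rintro ⟨⟨t', p'⟩, ⟨ht', -⟩, heq⟩
    have h1 := C.cylindrical_neg i t ht p
    rw [← heq, C.cylindrical_neg i' t' (hnegJ ht') p'] at h1
    have h2 := congrArg (fun q : ℂ × M => q.1.im) h1
    simp only [add_left_inj, Nat.cast_inj] at h2
    exact hii (Fin.ext h2.symm)
  have hpn : ∀ i j t p, t ∈ Ioc (1 - C.ε) 1 → 1 / 2 ≤ t → h' j (C.posCollar i (t, p)) = 0 := by
    intro i j t p ht ht2
    refine hh0' j _ ?_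
    rintro ⟨⟨t', p'⟩, ⟨ht', -⟩, heq⟩
    have h1 := C.cylindrical_pos i t ht p
    rw [← heq, C.cylindrical_neg j t' (hnegJ ht') p'] at h1
    have h2 := congrArg (fun q : ℂ × M => q.1.re) h1
    simp only at h2
    have := ht'.2
    simp only at this
    linarith
  have hnp : ∀ j i t p, t ∈ Ico 0 C.ε → t ≤ 1 / 2 → h i (C.negCollar j (t, p)) = 0 := by
    intro j i t p ht ht2
    refine hh0 i _ ?_
    rintro ⟨⟨t', p'⟩, ⟨ht', -⟩, heq⟩
    have h1 := C.cylindrical_neg j t ht p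
    rw [← heq, C.cylindrical_pos i t' (hposJ ht') p'] at h1
    have h2 := congrArg (fun q : ℂ × M => q.1.re) h1
    simp only at h2
    have := ht'.1
    simp only at this
    linarith
  have key := sum_ends_eq_zero C.orientation (Sum.elim h h')
    (U := (⋃ i, C.posCollar i '' ((Ioc (1 - C.ε) 1 ∩ Ioi (m + w)) ×ˢ univ)) ∪
      ⋃ j, C.negCollar j '' ((Ico 0 C.ε ∩ Iio (m' - w)) ×ˢ univ))
    ((isOpen_iUnion fun i => (C.isCollar_pos i).isOpen_image_inter isOpen_Ioi).union
      (isOpen_iUnion fun j => (C.isCollar_neg j).isOpen_image_inter isOpen_Iio))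
    (by
      rw [C.boundary_eq]
      refine union_subset_union (iUnion_mono fun i => image_mono (prod_mono ?_ Subset.rfl))
        (iUnion_mono fun j => image_mono (prod_mono ?_ Subset.rfl))
      · rw [singleton_subset_iff]
        exact ⟨⟨by linarith, le_rfl⟩, show m + w < 1 by linarith⟩
      · rw [singleton_subset_iff]
        exact ⟨⟨le_rfl, by linarith⟩, show 0 < m' - w by linarith⟩)
    (by
      intro x hx
      rw [Fintype.sum_sum_type]
      simp only [Sum.elim_inl, Sum.elim_inr]
      rcases hx with hx | hx
      · obtain ⟨i, ⟨t, p⟩, ⟨⟨ht, htm⟩, -⟩, rfl⟩ := mem_iUnion.1 hx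
        have htm : m + w < t := htm
        rw [Finset.sum_eq_single i (fun i' _ hii => hpp i i' t p hii.symm ht)
          (fun hi => absurd (Finset.mem_univ i) hi), hh i t ht p,
          Finset.sum_eq_zero fun j _ => hpn i j t p ht (by linarith),
          stepFun_eq_one hw htm.le, add_zero]
      · obtain ⟨j, ⟨t, p⟩, ⟨⟨ht, htm⟩, -⟩, rfl⟩ := mem_iUnion.1 hx
        have htm : t < m' - w := htm
        rw [Finset.sum_eq_single (M := ℝ) j (fun j' _ hjj => hnn j j' t p hjj.symm ht)
          (fun hj => absurd (Finset.mem_univ j) hj), hh' j t ht p,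
          Finset.sum_eq_zero fun i _ => hnp j i t p ht (by linarith),
          stepFun_eq_zero hw htm.le, sub_zero, zero_add])
    Θ hΘ (Sum.elim N N') (fun i => match i with
      | Sum.inl i => T i
      | Sum.inr j => T' j)
    (fun i => match i with
      | Sum.inl i => hT1 i
      | Sum.inr j => hT1' j)
  rw [Fintype.sum_sum_type] at key
  have e1 : ∀ i, ∑ x, (T i x).integral C.orientation = a i := fun i => by
    rw [hT2, stepFun_eq_one hw (by linarith), stepFun_eq_zero hw (by linarith)]; ring
  have e2 : ∀ j, ∑ x, (T' j x).integral C.orientation = -b j := fun j => by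
    rw [hT2', stepFun_eq_one hw (by linarith), stepFun_eq_zero hw (by linarith)]; ring
  have key' : (∑ i, ∑ x, (T i x).integral C.orientation) +
      ∑ j, ∑ x, (T' j x).integral C.orientation = 0 := key
  simp only [e1, e2, Finset.sum_neg_distrib] at key'
  linarith

end Cobordism

/-! ### Cohomology classes and characteristic numbers -/

section Classes

variable {X Y : Type*} {D : DiffeologicalSpace X} {D' : DiffeologicalSpace Y} {k : ℕ}

theorem HdR.mk_eq_mk_iff {α β : DForm D k} {hα : DForm.d α = 0} {hβ : DForm.d β = 0} :
    HdR.mk α hα = HdR.mk β hβ ↔ α - β ∈ exactForms D k := by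
  rw [HdR.mk, HdR.mk, Submodule.Quotient.eq]
  rfl

theorem HdR.exists_rep (x : HdR D k) : ∃ (α : DForm D k) (hα : DForm.d α = 0), x = HdR.mk α hα := by
  obtain ⟨⟨α, hα⟩, rfl⟩ := Submodule.Quotient.mk_surjective _ x
  exact ⟨α, LinearMap.mem_ker.1 hα, rfl⟩

theorem DForm.exact_wedge (f : DForm D 0) {β : DForm D k} (hβ : DForm.d β = 0) :
    (DForm.d f).wedge β = DForm.d (DForm.smulFun f.toFun f.contDiff_toFun β) := by
  rw [DForm.d_smulFun, hβ, ← f.eq_ofFun_toFun]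
  have : DForm.smulFun f.toFun f.contDiff_toFun (0 : DForm D (k + 1)) = 0 :=
    DForm.ext fun P hP u => smul_zero _
  rw [this, add_zero]

end Classes

section CharNumber

variable {k : ℕ} {L : Type*} [TopologicalSpace L]
  [ChartedSpace (EuclideanSpace ℝ (Fin (k + 1))) L] [IsManifold (𝓡 (k + 1)) ∞ L]
  [T2Space L] [CompactSpace L] (o : ManifoldOrientation (𝓡 (k + 1)) L (k + 1))

/-- The number `∫_L α ∧ β` depends only on the classes of `α` and `β`. -/
theorem integralForm_wedge_eq {α α' : DForm (manifoldDiffeology (𝓡 (k + 1)) L) 1}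
    {β β' : DForm (manifoldDiffeology (𝓡 (k + 1)) L) k}
    {hα : DForm.d α = 0} {hα' : DForm.d α' = 0} {hβ : DForm.d β = 0} {hβ' : DForm.d β' = 0}
    (h1 : HdR.mk α hα = HdR.mk α' hα') (h2 : HdR.mk β hβ = HdR.mk β' hβ') :
    integralForm o (α.wedge β) = integralForm o (α'.wedge β') := by
  have e1 : integralForm o (α.wedge β) = integralForm o (α'.wedge β) := by
    obtain ⟨f, hf⟩ := HdR.mk_eq_mk_iff.1 h1
    rw [eq_add_of_sub_eq' hf.symm, DForm.wedge_add_left, integralForm_add, DForm.exact_wedge f hβ,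
      integralForm_d, add_zero]
  rw [e1]
  have h3 := HdR.mk_eq_mk_iff.1 h2
  cases k with
  | zero =>
    have h0 : β - β' = 0 := by simpa [exactForms] using h3
    rw [sub_eq_zero.1 h0]
  | succ k =>
    obtain ⟨γ, hγ⟩ := h3
    have h4 : α'.wedge (DForm.d γ) = DForm.d (-(α'.wedge γ)) := by
      rw [map_neg, DForm.d_wedge_of_closed α' hα', neg_neg]
    rw [eq_add_of_sub_eq' hγ.symm, DForm.wedge_add_right, integralForm_add, h4, integralForm_d,
      add_zero]

end CharNumber

section Invariance

universe u v w

variable {E : Type*} [NormedAddCommGroup E] [NormedSpace ℝ E] [FiniteDimensional ℝ E]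
  {H : Type*} [TopologicalSpace H] {I : ModelWithCorners ℝ E H}
  {M : Type*} [TopologicalSpace M] [ChartedSpace H M] [IsManifold I ∞ M]
  {k : ℕ} {σ : SymplecticForm I M} {lam : DForm (lagGrDiffeology σ.toFun) 1}

namespace OrientedLagrangian

theorem isCharNumber_iff (f : OrientedLagrangian.{u} (k + 1) σ.toFun) (hlam : IsActionForm σ lam)
    (ξ : DForm (lagGrDiffeology σ.toFun) k) (hξ : DForm.d ξ = 0) (c : ℝ) :
    f.IsCharNumber hlam (HdR.mk ξ hξ) c ↔ c = integralForm f.orientation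
      ((DForm.pullback (gaussMap f.isLagrangianImmersion)
        (smooth_gaussMap f.isLagrangianImmersion) lam).wedge
        (DForm.pullback (gaussMap f.isLagrangianImmersion)
        (smooth_gaussMap f.isLagrangianImmersion) ξ)) := by
  constructor
  · rintro ⟨α, hα, β, hβ, h1, h2, rfl⟩
    exact integralForm_wedge_eq _ (hβ' := by rw [DForm.d_pullback, hξ, map_zero]) h1 h2
  · rintro rfl
    exact ⟨_, closed_pullback_gaussMap hlam f.isLagrangianImmersion,
      DForm.pullback (gaussMap f.isLagrangianImmersion)
        (smooth_gaussMap f.isLagrangianImmersion) ξ,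
      by rw [DForm.d_pullback, hξ, map_zero], rfl, rfl, rfl⟩

theorem existsUnique_isCharNumber (f : OrientedLagrangian.{u} (k + 1) σ.toFun)
    (hlam : IsActionForm σ lam) (x : HdR (lagGrDiffeology σ.toFun) k) :
    ∃! c : ℝ, f.IsCharNumber hlam x c := by
  obtain ⟨ξ, hξ, rfl⟩ := HdR.exists_rep x
  exact ⟨_, (f.isCharNumber_iff hlam ξ hξ _).2 rfl,
    fun c hc => (f.isCharNumber_iff hlam ξ hξ c).1 hc⟩

end OrientedLagrangian

/-- Characteristic numbers of the ends agree as soon as the action class and the second class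
extend over the cobordism. -/
theorem OrientedCobordism.sum_charNumber_eq {r s : ℕ}
    {α : Fin r → OrientedLagrangian.{u} (k + 1) σ.toFun}
    {β : Fin s → OrientedLagrangian.{v} (k + 1) σ.toFun} (C : OrientedCobordism.{u, v, w} α β)
    (hlam : IsActionForm σ lam) (ξ : DForm (lagGrDiffeology σ.toFun) k) (hξ : DForm.d ξ = 0)
    (A : DForm (manifoldDiffeology (𝓡∂ (k + 1 + 1)) C.V) 1) (hA : DForm.d A = 0)
    (B : DForm (manifoldDiffeology (𝓡∂ (k + 1 + 1)) C.V) k) (hB : DForm.d B = 0)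
    (hAp : ∀ i t (ht : t ∈ Ioc (1 - C.ε) 1),
      DForm.pullback _ ((C.isCollar_pos i).smooth_slice ht) A -
        DForm.pullback _ (smooth_gaussMap (α i).isLagrangianImmersion) lam ∈ exactForms _ 1)
    (hAn : ∀ j t (ht : t ∈ Ico 0 C.ε),
      DForm.pullback _ ((C.isCollar_neg j).smooth_slice ht) A -
        DForm.pullback _ (smooth_gaussMap (β j).isLagrangianImmersion) lam ∈ exactForms _ 1)
    (hBp : ∀ i t (ht : t ∈ Ioc (1 - C.ε) 1),
      DForm.pullback _ ((C.isCollar_pos i).smooth_slice ht) B -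
        DForm.pullback _ (smooth_gaussMap (α i).isLagrangianImmersion) ξ ∈ exactForms _ k)
    (hBn : ∀ j t (ht : t ∈ Ico 0 C.ε),
      DForm.pullback _ ((C.isCollar_neg j).smooth_slice ht) B -
        DForm.pullback _ (smooth_gaussMap (β j).isLagrangianImmersion) ξ ∈ exactForms _ k)
    (a : Fin r → ℝ) (b : Fin s → ℝ)
    (ha : ∀ i, (α i).IsCharNumber hlam (HdR.mk ξ hξ) (a i))
    (hb : ∀ j, (β j).IsCharNumber hlam (HdR.mk ξ hξ) (b j)) : ∑ i, a i = ∑ j, b j := by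
  refine C.sum_eq_sum (A.wedge B) (DForm.d_wedge_closed A hA B hB) a b (fun i t ht => ?_)
    (fun j t ht => ?_)
  · rw [((α i).isCharNumber_iff hlam ξ hξ (a i)).1 (ha i), DForm.pullback_wedge]
    exact integralForm_wedge_eq _ (hα := by rw [DForm.d_pullback, hA, map_zero])
      (hα' := closed_pullback_gaussMap hlam _) (hβ := by rw [DForm.d_pullback, hB, map_zero])
      (hβ' := by rw [DForm.d_pullback, hξ, map_zero])
      (HdR.mk_eq_mk_iff.2 (hAp i t ht)) (HdR.mk_eq_mk_iff.2 (hBp i t ht))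
  · rw [((β j).isCharNumber_iff hlam ξ hξ (b j)).1 (hb j), DForm.pullback_wedge]
    exact integralForm_wedge_eq _ (hα := by rw [DForm.d_pullback, hA, map_zero])
      (hα' := closed_pullback_gaussMap hlam _) (hβ := by rw [DForm.d_pullback, hB, map_zero])
      (hβ' := by rw [DForm.d_pullback, hξ, map_zero])
      (HdR.mk_eq_mk_iff.2 (hAn j t ht)) (HdR.mk_eq_mk_iff.2 (hBn j t ht))

end Invariance

/-! ### Smooth vector fields along maps -/

section FieldsAlong

/-- The vector field `X` along the map `p` is smooth on `s`. -/
def SmoothAlong {E : Type*} [NormedAddCommGroup E] [NormedSpace ℝ E]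
    {H : Type*} [TopologicalSpace H] (I : ModelWithCorners ℝ E H)
    {M : Type*} [TopologicalSpace M] [ChartedSpace H M] [IsManifold I ∞ M]
    {m : ℕ} {p : EuclideanSpace ℝ (Fin m) → M} (X : ∀ y, TangentSpace I (p y))
    (s : Set (EuclideanSpace ℝ (Fin m))) : Prop :=
  ContMDiffOn 𝓘(ℝ, EuclideanSpace ℝ (Fin m)) I.tangent ∞
    (fun y => (⟨p y, X y⟩ : TangentBundle I M)) s

variable {N m : ℕ} {M : Type*} [TopologicalSpace M] [ChartedSpace (EuclideanSpace ℝ (Fin N)) M]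
  [IsManifold (𝓡 N) ∞ M] {p : EuclideanSpace ℝ (Fin m) → M}
  {X Y : ∀ y, TangentSpace (𝓡 N) (p y)} {s u : Set (EuclideanSpace ℝ (Fin m))}
  {P : EuclideanSpace ℝ (Fin N) → M} {e : M → EuclideanSpace ℝ (Fin N)}

/-- The coordinates of a tangent vector in a chart. -/
def chartCoord (e : M → EuclideanSpace ℝ (Fin N)) (x : M) :
    TangentSpace (𝓡 N) x →L[ℝ] EuclideanSpace ℝ (Fin N) :=
  mfderiv (𝓡 N) 𝓘(ℝ, EuclideanSpace ℝ (Fin N)) e x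

theorem SmoothAlong.mono (hX : SmoothAlong (𝓡 N) X s) (h : u ⊆ s) : SmoothAlong (𝓡 N) X u :=
  ContMDiffOn.mono hX h

theorem SmoothAlong.contMDiffOn (hX : SmoothAlong (𝓡 N) X s) :
    ContMDiffOn 𝓘(ℝ, EuclideanSpace ℝ (Fin m)) (𝓡 N) ∞ p s :=
  (contMDiff_proj (TangentSpace (𝓡 N) : M → Type _)).comp_contMDiffOn hX

theorem SmoothAlong.of_locally
    (h : ∀ y ∈ s, ∃ u, IsOpen u ∧ y ∈ u ∧ SmoothAlong (𝓡 N) X (s ∩ u)) :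
    SmoothAlong (𝓡 N) X s :=
  contMDiffOn_of_locally_contMDiffOn h

namespace IsChartPlot

theorem mfderiv_chartCoord (hP : IsChartPlot (𝓡 N) P e) {x : M} (hx : x ∈ range P)
    (v : TangentSpace (𝓡 N) x) :
    (⟨P (e x), mfderiv 𝓘(ℝ, EuclideanSpace ℝ (Fin N)) (𝓡 N) P (e x) (chartCoord e x v)⟩ :
      TangentBundle (𝓡 N) M) = ⟨x, v⟩ := by
  obtain ⟨w, rfl⟩ := hx
  have h := hP.mfderiv_comp_inv w v
  have key : ∀ w', w' = w → (⟨P w', mfderiv 𝓘(ℝ, EuclideanSpace ℝ (Fin N)) (𝓡 N) P w'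
      (chartCoord e (P w) v)⟩ : TangentBundle (𝓡 N) M) = ⟨P w, v⟩ := by
    rintro _ rfl
    exact congrArg _ h
  exact key _ (hP.left_inv w)

theorem contDiffOn_chartCoord (hP : IsChartPlot (𝓡 N) P e) (hX : SmoothAlong (𝓡 N) X s)
    (hs : MapsTo p s (range P)) : ContDiffOn ℝ ∞ (fun y => chartCoord e (p y) (X y)) s := by
  have h2 : ContMDiffOn (𝓡 N).tangent 𝓘(ℝ, EuclideanSpace ℝ (Fin N)).tangent ∞
      (tangentMapWithin (𝓡 N) 𝓘(ℝ, EuclideanSpace ℝ (Fin N)) e (range P))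
        (TotalSpace.proj ⁻¹' range P) :=
    hP.contMDiffOn.contMDiffOn_tangentMapWithin (by simp) hP.isOpen_range.uniqueMDiffOn
  have h3 := (contMDiff_snd_tangentBundle_modelSpace (EuclideanSpace ℝ (Fin N))
    𝓘(ℝ, EuclideanSpace ℝ (Fin N)) (n := ∞)).comp_contMDiffOn (h2.comp hX hs)
  refine (h3.congr fun y hy => ?_).contDiffOn
  change _ = mfderivWithin (𝓡 N) 𝓘(ℝ, EuclideanSpace ℝ (Fin N)) e (range P) (p y) (X y)
  rw [mfderivWithin_of_isOpen hP.isOpen_range (hs hy)]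
  rfl

theorem smoothAlong (hP : IsChartPlot (𝓡 N) P e)
    (hp : ContMDiffOn 𝓘(ℝ, EuclideanSpace ℝ (Fin m)) (𝓡 N) ∞ p s) (hs : MapsTo p s (range P))
    (hX : ContDiffOn ℝ ∞ (fun y => chartCoord e (p y) (X y)) s) : SmoothAlong (𝓡 N) X s := by
  have h1 : ContMDiffOn 𝓘(ℝ, EuclideanSpace ℝ (Fin m)) 𝓘(ℝ, EuclideanSpace ℝ (Fin N)).tangent ∞
      (fun y => (⟨e (p y), chartCoord e (p y) (X y)⟩ :
        TangentBundle 𝓘(ℝ, EuclideanSpace ℝ (Fin N)) (EuclideanSpace ℝ (Fin N)))) s := by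
    intro y hy
    rw [contMDiffWithinAt_totalSpace]
    refine ⟨(hP.contMDiffOn.comp hp hs) y hy, ?_⟩
    simpa using hX.contMDiffOn y hy
  have h2 := (hP.contMDiff.contMDiff_tangentMap (m := ∞) (by simp)).comp_contMDiffOn h1
  exact h2.congr fun y hy => (hP.mfderiv_chartCoord (hs hy) (X y)).symm

end IsChartPlot

theorem SmoothAlong.of_chartCoord (hs : IsOpen s)
    (hp : ContMDiffOn 𝓘(ℝ, EuclideanSpace ℝ (Fin m)) (𝓡 N) ∞ p s)
    (h : ∀ (P : EuclideanSpace ℝ (Fin N) → M) (e : M → EuclideanSpace ℝ (Fin N)),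
      IsChartPlot (𝓡 N) P e →
        ContDiffOn ℝ ∞ (fun y => chartCoord e (p y) (X y)) (s ∩ p ⁻¹' range P)) :
    SmoothAlong (𝓡 N) X s := by
  refine SmoothAlong.of_locally fun y hy => ?_
  obtain ⟨e, he⟩ := exists_isChartPlot_ballPlot (n := N) (p y)
  refine ⟨s ∩ p ⁻¹' range (ballPlot (n := N) (p y)),
    hp.continuousOn.isOpen_inter_preimage hs he.isOpen_range,
    ⟨hy, mem_range_ballPlot (p y)⟩, ?_⟩
  rw [← inter_assoc, inter_self]
  exact he.smoothAlong (hp.mono inter_subset_left) (fun z hz => hz.2) (h _ e he)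

theorem SmoothAlong.contDiffOn_chartCoord (hX : SmoothAlong (𝓡 N) X s)
    (hP : IsChartPlot (𝓡 N) P e) :
    ContDiffOn ℝ ∞ (fun y => chartCoord e (p y) (X y)) (s ∩ p ⁻¹' range P) :=
  hP.contDiffOn_chartCoord (hX.mono inter_subset_left) fun _ hy => hy.2

theorem SmoothAlong.add (hs : IsOpen s) (hX : SmoothAlong (𝓡 N) X s)
    (hY : SmoothAlong (𝓡 N) Y s) : SmoothAlong (𝓡 N) (fun y => X y + Y y) s :=
  .of_chartCoord hs hX.contMDiffOn fun P e hP => by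
    simpa only [map_add] using (hX.contDiffOn_chartCoord hP).add (hY.contDiffOn_chartCoord hP)

theorem SmoothAlong.sub (hs : IsOpen s) (hX : SmoothAlong (𝓡 N) X s)
    (hY : SmoothAlong (𝓡 N) Y s) : SmoothAlong (𝓡 N) (fun y => X y - Y y) s :=
  .of_chartCoord hs hX.contMDiffOn fun P e hP => by
    simpa only [map_sub] using (hX.contDiffOn_chartCoord hP).sub (hY.contDiffOn_chartCoord hP)

theorem SmoothAlong.smul (hs : IsOpen s) {f : EuclideanSpace ℝ (Fin m) → ℝ}
    (hf : ContDiffOn ℝ ∞ f s) (hX : SmoothAlong (𝓡 N) X s) :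
    SmoothAlong (𝓡 N) (fun y => f y • X y) s :=
  .of_chartCoord hs hX.contMDiffOn fun P e hP => by
    simp only [map_smul]
    exact (hf.mono inter_subset_left).smul (hX.contDiffOn_chartCoord hP)

theorem SmoothAlong.comp (hX : SmoothAlong (𝓡 N) X s) {m' : ℕ}
    {g : EuclideanSpace ℝ (Fin m') → EuclideanSpace ℝ (Fin m)}
    {t : Set (EuclideanSpace ℝ (Fin m'))} (hg : ContDiffOn ℝ ∞ g t) (ht : MapsTo g t s) :
    SmoothAlong (𝓡 N) (p := p ∘ g) (fun y => X (g y)) t :=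
  ContMDiffOn.comp hX hg.contMDiffOn ht

/-- A tangent vector extends to a smooth field along a smooth map. -/
theorem exists_smoothAlong (hs : IsOpen s)
    (hp : ContMDiffOn 𝓘(ℝ, EuclideanSpace ℝ (Fin m)) (𝓡 N) ∞ p s)
    {y : EuclideanSpace ℝ (Fin m)} (hy : y ∈ s) (v : TangentSpace (𝓡 N) (p y)) :
    ∃ (u : Set (EuclideanSpace ℝ (Fin m))) (X : ∀ y, TangentSpace (𝓡 N) (p y)),
      IsOpen u ∧ y ∈ u ∧ u ⊆ s ∧ SmoothAlong (𝓡 N) X u ∧ X y = v := by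
  obtain ⟨e, he⟩ := exists_isChartPlot_ballPlot (n := N) (p y)
  set P : EuclideanSpace ℝ (Fin N) → M := ballPlot (p y)
  let X : ∀ z, TangentSpace (𝓡 N) (p z) := fun z =>
    (mfderiv 𝓘(ℝ, EuclideanSpace ℝ (Fin N)) (𝓡 N) P (e (p z)) (chartCoord e (p y) v) :
      EuclideanSpace ℝ (Fin N))
  have hX : ∀ z, p z ∈ range P → (⟨P (e (p z)), mfderiv 𝓘(ℝ, EuclideanSpace ℝ (Fin N)) (𝓡 N) P
      (e (p z)) (chartCoord e (p y) v)⟩ : TangentBundle (𝓡 N) M) = ⟨p z, X z⟩ := by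
    intro z hz
    have key : ∀ (q : M) (_ : q = p z) (w : EuclideanSpace ℝ (Fin N)),
        (⟨q, w⟩ : TangentBundle (𝓡 N) M) = ⟨p z, w⟩ := by rintro _ rfl w; rfl
    exact key _ (he.right_inv hz) _
  refine ⟨s ∩ p ⁻¹' range P, X, hp.continuousOn.isOpen_inter_preimage hs he.isOpen_range,
    ⟨hy, mem_range_ballPlot (p y)⟩, inter_subset_left,
    he.smoothAlong (hp.mono inter_subset_left) (fun z hz => hz.2) ?_, ?_⟩
  · refine (contDiffOn_const (c := chartCoord e (p y) v)).congr fun z hz => ?_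
    have h1 := he.mfderiv_chartCoord hz.2 (X z)
    rw [← hX z hz.2] at h1
    have h2 := totalSpace_mk_inj h1
    have h3 := congrArg (chartCoord e (P (e (p z)))) h2
    exact (he.mfderiv_inv_comp (e (p z)) _).symm.trans
      (h3.trans (he.mfderiv_inv_comp (e (p z)) _))
  · have h1 := he.mfderiv_chartCoord (mem_range_ballPlot (p y)) v
    exact totalSpace_mk_inj ((hX y (mem_range_ballPlot (p y))).symm.trans h1)

/-- The pairing of two smooth fields by a smooth `2`-form is smooth. -/
theorem SmoothForm.contDiffOn_pairing (η : SmoothForm (𝓡 N) M 2) (hs : IsOpen s)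
    (hX : SmoothAlong (𝓡 N) X s) (hY : SmoothAlong (𝓡 N) Y s) :
    ContDiffOn ℝ ∞ (fun y => η.toFun (p y) ![X y, Y y]) s := by
  intro y hy
  obtain ⟨e, he⟩ := exists_isChartPlot_ballPlot (n := N) (p y)
  set P : EuclideanSpace ℝ (Fin N) → M := ballPlot (p y)
  have ho : IsOpen (s ∩ p ⁻¹' range P) :=
    hX.contMDiffOn.continuousOn.isOpen_inter_preimage hs he.isOpen_range
  have hxy : y ∈ s ∩ p ⁻¹' range P := ⟨hy, mem_range_ballPlot (p y)⟩
  have h1 : ContDiffOn ℝ ∞ (fun z => η.toFun.pull P (e (p z))) (s ∩ p ⁻¹' range P) :=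
    (η.smooth P he.contMDiff).comp_contDiffOn
      ((he.contMDiffOn.comp (hX.contMDiffOn.mono inter_subset_left)
        (fun z hz => hz.2)).contDiffOn)
  have h3 : ContDiffOn ℝ ∞ (fun z => η.toFun.pull P (e (p z))
      ![chartCoord e (p z) (X z), chartCoord e (p z) (Y z)]) (s ∩ p ⁻¹' range P) := by
    have h4 : ContDiffOn ℝ ∞ (fun z => (η.toFun.pull P (e (p z))).toContinuousMultilinearMap)
        (s ∩ p ⁻¹' range P) :=
      (ContinuousAlternatingMap.toContinuousMultilinearMapLI (𝕜 := ℝ)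
        (E := EuclideanSpace ℝ (Fin N)) (F := ℝ) (ι := Fin 2)).contDiff.comp_contDiffOn h1
    have h5 := ((continuousMultilinearCurryLeftEquiv ℝ (fun _ : Fin 2 => EuclideanSpace ℝ (Fin N))
      ℝ).contDiff.comp_contDiffOn h4).clm_apply (hX.contDiffOn_chartCoord he)
    have h6 := ((continuousMultilinearCurryFin1 ℝ (EuclideanSpace ℝ (Fin N))
      ℝ).contDiff.comp_contDiffOn h5).clm_apply (hY.contDiffOn_chartCoord he)
    refine h6.congr fun z hz => ?_
    refine congrArg (η.toFun.pull P (e (p z))) ?_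
    ext i
    fin_cases i <;> rfl
  have h5 : ∀ z ∈ s ∩ p ⁻¹' range P, η.toFun (p z) ![X z, Y z] = η.toFun.pull P (e (p z))
      ![chartCoord e (p z) (X z), chartCoord e (p z) (Y z)] := by
    intro z hz
    have key : ∀ v w : TangentBundle (𝓡 N) M, v = w → ∀ v' w' : TangentBundle (𝓡 N) M, v' = w' →
        ∀ (h : v'.1 = v.1) (h' : w'.1 = w.1),
        η.toFun v.1 ![v.2, h ▸ v'.2] = η.toFun w.1 ![w.2, h' ▸ w'.2] := by
      rintro v _ rfl v' _ rfl h h'; rfl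
    have h6 := key _ _ (he.mfderiv_chartCoord hz.2 (X z)) _ _
      (he.mfderiv_chartCoord hz.2 (Y z)) rfl rfl
    refine h6.symm.trans ?_
    refine congrArg (η.toFun (P (e (p z)))) ?_
    ext i
    fin_cases i <;> rfl
  exact ((h3.congr h5).contDiffAt (ho.mem_nhds hxy)).contDiffWithinAt

end FieldsAlong

/-! ### Alternating forms of degree two -/

section AltBilin

variable {V : Type*} [AddCommGroup V] [Module ℝ V] [TopologicalSpace V]

/-- An alternating `2`-form as a bilinear map. -/
def altBilin (A : V [⋀^Fin 2]→L[ℝ] ℝ) : V →ₗ[ℝ] V →ₗ[ℝ] ℝ :=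
  LinearMap.mk₂ ℝ (fun u v => A ![u, v])
    (fun a b c => by simpa using A.vecCons_add ![c] a b)
    (fun r a c => by simpa using A.vecCons_smul ![c] r a)
    (fun a b c => by
      have h := A.map_update_add ![a, 0] 1 b c
      have hupd : ∀ x : V, Function.update ![a, 0] 1 x = ![a, x] := fun x => by
        ext i; fin_cases i <;> rfl
      simpa only [hupd] using h)
    (fun r a c => by
      have h := A.map_update_smul ![a, 0] 1 r c
      have hupd : ∀ x : V, Function.update ![a, 0] 1 x = ![a, x] := fun x => by
        ext i; fin_cases i <;> rfl
      simpa only [hupd] using h)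

theorem altBilin_apply (A : V [⋀^Fin 2]→L[ℝ] ℝ) (u v : V) : altBilin A u v = A ![u, v] := rfl

theorem altBilin_self (A : V [⋀^Fin 2]→L[ℝ] ℝ) (u : V) : altBilin A u u = 0 :=
  A.map_eq_zero_of_eq _ (i := 0) (j := 1) rfl (by decide)

theorem altBilin_swap (A : V [⋀^Fin 2]→L[ℝ] ℝ) (u v : V) : altBilin A u v = - altBilin A v u := by
  have h := altBilin_self A (u + v)
  simp only [map_add, LinearMap.add_apply, altBilin_self] at h
  linarith

theorem isLagrangianSubspace_iff {A : V [⋀^Fin 2]→L[ℝ] ℝ} {W : Submodule ℝ V} :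
    IsLagrangianSubspace A W ↔ ∀ u, u ∈ W ↔ ∀ w ∈ W, altBilin A u w = 0 := Iff.rfl

/-- The elements of a span on which a functional vanishes. -/
theorem mem_span_kernel {ι : Type*} [Fintype ι] (x : ι → V) (l : ι → ℝ) {i₀ : ι} (h : l i₀ ≠ 0)
    (w : V) : w ∈ Submodule.span ℝ (range fun q : ι × ι => l q.1 • x q.2 - l q.2 • x q.1) ↔
      ∃ c : ι → ℝ, ∑ i, c i • x i = w ∧ ∑ i, c i * l i = 0 := by
  classical
  constructor
  · intro hw
    induction hw using Submodule.span_induction with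
    | mem w hw =>
      obtain ⟨⟨i, j⟩, rfl⟩ := hw
      refine ⟨Pi.single j (l i) - Pi.single i (l j), ?_, ?_⟩
      · simp [sub_smul, Finset.sum_sub_distrib, Pi.single_apply, ite_smul]
      · simp [sub_mul, Finset.sum_sub_distrib, Pi.single_apply]
        ring
    | zero => exact ⟨0, by simp, by simp⟩
    | add a b _ _ ha hb =>
      obtain ⟨c, rfl, hc⟩ := ha
      obtain ⟨c', rfl, hc'⟩ := hb
      exact ⟨c + c', by simp [add_smul, Finset.sum_add_distrib],
        by simp [add_mul, Finset.sum_add_distrib, hc, hc']⟩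
    | smul r a _ ha =>
      obtain ⟨c, rfl, hc⟩ := ha
      exact ⟨r • c, by simp [Finset.smul_sum, mul_smul],
        by simp [mul_assoc, ← Finset.mul_sum, hc]⟩
  · rintro ⟨c, rfl, hc⟩
    have e : ∑ i, c i • x i = ∑ i, ((l i₀)⁻¹ * c i) • (l i₀ • x i - l i • x i₀) := by
      simp only [smul_sub, Finset.sum_sub_distrib, smul_smul]
      have h1 : ∑ i, ((l i₀)⁻¹ * c i * l i) • x i₀ = 0 := by
        rw [← Finset.sum_smul]
        simp only [mul_assoc]
        rw [← Finset.mul_sum, hc, mul_zero, zero_smul]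
      rw [h1, sub_zero]
      refine Finset.sum_congr rfl fun i _ => ?_
      congr 1
      field_simp
    rw [e]
    exact Submodule.sum_mem _ fun i _ => Submodule.smul_mem _ _ (Submodule.subset_span ⟨(i₀, i), rfl⟩)

theorem mem_span_range_iff_sum {ι : Type*} [Fintype ι] (x : ι → V) (w : V) :
    w ∈ Submodule.span ℝ (range x) ↔ ∃ c : ι → ℝ, ∑ i, c i • x i = w :=
  Submodule.mem_span_range_iff_exists_fun ℝ

end AltBilin

/-! ### Plots of the Lagrangian Grassmannian -/

namespace LagGr

section General

variable {E : Type*} [NormedAddCommGroup E] [NormedSpace ℝ E]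
  {H : Type*} [TopologicalSpace H] {I : ModelWithCorners ℝ E H}
  {M : Type*} [TopologicalSpace M] [ChartedSpace H M] [IsManifold I ∞ M]
  {σ : FormField I M 2} {m : ℕ} {P : EuclideanSpace ℝ (Fin m) → LagGr σ}
  {u : Set (EuclideanSpace ℝ (Fin m))}

theorem IsPlotOn.exists_fields (hP : IsPlotOn u P) {x : EuclideanSpace ℝ (Fin m)} (hx : x ∈ u) :
    ∃ v, IsOpen v ∧ x ∈ v ∧ v ⊆ u ∧ ∃ (N : ℕ) (X : Fin N → ∀ y, TangentSpace I (P y).pt),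
      (∀ i, SmoothAlong I (X i) v) ∧
      ∀ y ∈ v, (P y).plane = Submodule.span ℝ (range fun i => X i y) := by
  obtain ⟨v, hv, hxv, hvu, N, X, hX, hs⟩ := hP.2 x hx
  have hX' : ∀ i, ∀ y ∈ v, X i y = ⟨(P y).pt, (X i y).2⟩ := by
    intro i y hy
    have key : ∀ (a : TangentBundle I M) (q : M), a.proj = q → a = ⟨q, (a.2 : E)⟩ := by
      rintro a _ rfl; rfl
    exact key _ _ ((hs y hy).1 i)
  refine ⟨v, hv, hxv, hvu, N, fun i y => ((X i y).2 : E), fun i => ?_, fun y hy => ?_⟩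
  · exact (hX i).congr fun y hy => (hX' i y hy).symm
  · rw [(hs y hy).2]
    congr 1
    ext w
    constructor
    · rintro ⟨i, hi⟩
      refine ⟨i, ?_⟩
      rw [hX' i y hy] at hi
      exact totalSpace_mk_inj (F := E) (V := (TangentSpace I : M → Type _)) (b := (P y).pt) hi
    · rintro ⟨i, rfl⟩
      exact ⟨i, hX' i y hy⟩

theorem isPlotOn_of_fields
    (hp : ContMDiffOn 𝓘(ℝ, EuclideanSpace ℝ (Fin m)) I ∞ (fun y => (P y).pt) u)
    (h : ∀ x ∈ u, ∃ v, IsOpen v ∧ x ∈ v ∧ v ⊆ u ∧ ∃ (ι : Type) (_ : Fintype ι)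
      (X : ι → ∀ y, TangentSpace I (P y).pt), (∀ i, SmoothAlong I (X i) v) ∧
      ∀ y ∈ v, (P y).plane = Submodule.span ℝ (range fun i => X i y)) : IsPlotOn u P := by
  refine ⟨hp, fun x hx => ?_⟩
  obtain ⟨v, hv, hxv, hvu, ι, _, X, hX, hs⟩ := h x hx
  let e := Fintype.equivFin ι
  refine ⟨v, hv, hxv, hvu, Fintype.card ι, fun i y => ⟨(P y).pt, X (e.symm i) y⟩,
    fun i => hX _, fun y hy => ⟨fun i => rfl, ?_⟩⟩
  rw [hs y hy]
  congr 1
  ext w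
  constructor
  · rintro ⟨i, rfl⟩
    exact ⟨e i, by simp only [e.symm_apply_apply]⟩
  · rintro ⟨i, hi⟩
    exact ⟨e.symm i, totalSpace_mk_inj hi⟩

theorem IsPlotOn.mono {v : Set (EuclideanSpace ℝ (Fin m))} (hP : IsPlotOn u P) (hv : IsOpen v)
    (h : v ⊆ u) : IsPlotOn v P := by
  refine ⟨hP.1.mono h, fun x hx => ?_⟩
  obtain ⟨w, hw, hxw, hwu, N, X, hX, hs⟩ := hP.2 x (h hx)
  exact ⟨w ∩ v, hw.inter hv, ⟨hxw, hx⟩, inter_subset_right, N, X,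
    fun i => (hX i).mono inter_subset_left, fun y hy => hs y hy.1⟩

end General

variable {N m : ℕ} {M : Type*} [TopologicalSpace M] [ChartedSpace (EuclideanSpace ℝ (Fin N)) M]
  [IsManifold (𝓡 N) ∞ M] {σ : FormField (𝓡 N) M 2} {P : EuclideanSpace ℝ (Fin m) → LagGr σ}
  {u : Set (EuclideanSpace ℝ (Fin m))}

/-- Planes cut out of smoothly varying spans by a smooth nonvanishing functional form a plot. -/
theorem isPlotOn_of_kernel
    (hp : ContMDiffOn 𝓘(ℝ, EuclideanSpace ℝ (Fin m)) (𝓡 N) ∞ (fun y => (P y).pt) u)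
    (h : ∀ x ∈ u, ∃ v, IsOpen v ∧ x ∈ v ∧ v ⊆ u ∧ ∃ (ι : Type) (_ : Fintype ι)
      (X : ι → ∀ y, TangentSpace (𝓡 N) (P y).pt) (l : ι → EuclideanSpace ℝ (Fin m) → ℝ),
      (∀ i, SmoothAlong (𝓡 N) (X i) v) ∧ (∀ i, ContDiffOn ℝ ∞ (l i) v) ∧
      ∀ y ∈ v, (∃ i, l i y ≠ 0) ∧
        ∀ w, w ∈ (P y).plane ↔ ∃ c : ι → ℝ, ∑ i, c i • X i y = w ∧ ∑ i, c i * l i y = 0) :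
    IsPlotOn u P := by
  refine isPlotOn_of_fields hp fun x hx => ?_
  obtain ⟨v, hv, hxv, hvu, ι, _, X, l, hX, hl, hs⟩ := h x hx
  refine ⟨v, hv, hxv, hvu, ι × ι, inferInstance,
    fun q y => l q.1 y • X q.2 y - l q.2 y • X q.1 y, fun q => ?_, fun y hy => ?_⟩
  · exact ((hX q.2).smul hv (hl q.1)).sub hv ((hX q.1).smul hv (hl q.2))
  · obtain ⟨⟨i, hi⟩, hw⟩ := hs y hy
    ext w
    rw [hw w, mem_span_kernel (fun i => X i y) (fun i => l i y) hi]

end LagGr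

/-! ### Symplectic reduction along a line in `ℂ` -/

/-- The unit vector in direction `t`. -/
def dirC (t : ℝ) : ℂ := ⟨Real.cos t, Real.sin t⟩

theorem altBilin_dirC (t : ℝ) (z : ℂ) :
    altBilin omegaC (dirC t) z = Real.cos t * z.im - z.re * Real.sin t := by
  rw [altBilin_apply, omegaC_apply]; rfl

theorem eq_smul_dirC {t : ℝ} {z : ℂ} (h : altBilin omegaC (dirC t) z = 0) :
    ∃ a : ℝ, z = a • dirC t := by
  rw [altBilin_dirC] at h
  have hcs := Real.sin_sq_add_cos_sq t
  refine ⟨z.re * Real.cos t + z.im * Real.sin t, Complex.ext ?_ ?_⟩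
  · simp only [dirC, Complex.real_smul, Complex.mul_re, Complex.ofReal_re, Complex.ofReal_im]
    linear_combination (-Real.sin t) * h - z.re * hcs
  · simp only [dirC, Complex.real_smul, Complex.mul_im, Complex.ofReal_re, Complex.ofReal_im]
    linear_combination (Real.cos t) * h - z.im * hcs

namespace LagGr

section Reduction

variable {E : Type*} [NormedAddCommGroup E] [NormedSpace ℝ E]
  {H : Type*} [TopologicalSpace H] {I : ModelWithCorners ℝ E H}
  {M : Type*} [TopologicalSpace M] [ChartedSpace H M]
  {σ : FormField I M 2}

/-- The plane of a point of `ℒ(ℂ × M)`, as a subspace of `ℂ × T_pM`. -/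
def prodPlane (W : LagGr (prodForm σ)) : Submodule ℝ (ℂ × TangentSpace I W.pt.2) := W.plane

theorem mem_prodPlane_iff (W : LagGr (prodForm σ)) (u : ℂ × TangentSpace I W.pt.2) :
    u ∈ W.prodPlane ↔ ∀ w ∈ W.prodPlane,
      altBilin omegaC u.1 w.1 + altBilin (σ W.pt.2) u.2 w.2 = 0 := by
  refine (W.isLagrangian u).trans (forall₂_congr fun w _ => ?_)
  exact Eq.congr_left (prodForm_apply σ W.pt u w)

/-- The reduction of a Lagrangian plane of `ℂ × M` along the line in direction `t`. -/
def reduce (W : LagGr (prodForm σ)) (t : ℝ) : LagGr σ where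
  pt := W.pt.2
  plane := (W.prodPlane ⊓ LinearMap.ker (altBilin omegaC (dirC t) ∘ₗ LinearMap.fst ℝ ℂ _)).map
    (LinearMap.snd ℝ ℂ (TangentSpace I W.pt.2))
  isLagrangian := by
    rw [isLagrangianSubspace_iff]
    intro u
    constructor
    · rintro ⟨⟨z, u⟩, ⟨hu, hz⟩, rfl⟩ w ⟨⟨z', w⟩, ⟨hw, hz'⟩, rfl⟩
      obtain ⟨a, rfl⟩ := eq_smul_dirC hz
      have h := (W.mem_prodPlane_iff _).1 hu _ hw
      have hz'' : altBilin omegaC (dirC t) z' = 0 := hz'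
      simp only [map_smul, LinearMap.smul_apply, hz'', smul_zero, zero_add] at h
      exact h
    · intro hu
      have key : ∀ x ∈ W.prodPlane, altBilin omegaC (dirC t) x.1 = 0 →
          altBilin (σ W.pt.2) u x.2 = 0 := fun x hx h0 => hu _ ⟨x, ⟨hx, h0⟩, rfl⟩
      by_cases h : ∃ x ∈ W.prodPlane, altBilin omegaC (dirC t) x.1 ≠ 0
      · obtain ⟨x, hx, hx0⟩ := h
        set a := - altBilin (σ W.pt.2) u x.2 / altBilin omegaC (dirC t) x.1 with ha
        refine ⟨(a • dirC t, u), ⟨(W.mem_prodPlane_iff _).2 fun w hw => ?_, ?_⟩, rfl⟩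
        · have h1 := key (w - (altBilin omegaC (dirC t) w.1 / altBilin omegaC (dirC t) x.1) • x)
            (Submodule.sub_mem _ hw (Submodule.smul_mem _ _ hx)) (by
              simp only [Prod.fst_sub, Prod.smul_fst, map_sub, map_smul, smul_eq_mul]
              field_simp
              ring)
          simp only [Prod.snd_sub, Prod.smul_snd, map_sub, map_smul, smul_eq_mul] at h1
          simp only [map_smul, LinearMap.smul_apply, smul_eq_mul, ha]
          field_simp
          field_simp at h1
          linear_combination h1
        · change altBilin omegaC (dirC t) (a • dirC t) = 0
          rw [map_smul, altBilin_self, smul_zero]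
      · push Not at h
        refine ⟨(0, u), ⟨(W.mem_prodPlane_iff _).2 fun w hw => ?_, ?_⟩, rfl⟩
        · simpa using key w hw (h w hw)
        · change altBilin omegaC (dirC t) 0 = 0
          simp

theorem mem_reduce {W : LagGr (prodForm σ)} {t : ℝ} {w : TangentSpace I W.pt.2} :
    w ∈ (W.reduce t).plane ↔ ∃ z, (z, w) ∈ W.prodPlane ∧ altBilin omegaC (dirC t) z = 0 := by
  constructor
  · rintro ⟨⟨z, u⟩, ⟨hu, hz⟩, rfl⟩
    exact ⟨z, hu, hz⟩
  · rintro ⟨z, hu, hz⟩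
    exact ⟨(z, w), ⟨hu, hz⟩, rfl⟩

/-- The line in direction `t` is not contained in `W`. -/
def Avoids (W : LagGr (prodForm σ)) (t : ℝ) : Prop :=
  ((dirC t, 0) : ℂ × TangentSpace I W.pt.2) ∉ W.prodPlane

theorem avoids_iff {W : LagGr (prodForm σ)} {t : ℝ} :
    W.Avoids t ↔ ∃ x ∈ W.prodPlane, altBilin omegaC (dirC t) x.1 ≠ 0 := by
  rw [Avoids, mem_prodPlane_iff]
  push Not
  refine exists_congr fun x => and_congr_right fun _ => ?_
  simp

theorem avoids_or_avoids (W : LagGr (prodForm σ)) {s t : ℝ} (h : Real.sin (t - s) ≠ 0) :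
    W.Avoids s ∨ W.Avoids t := by
  by_contra hc
  push Not at hc
  obtain ⟨h1, h2⟩ := hc
  have h3 := (W.mem_prodPlane_iff _).1 (not_not.1 h1) _ (not_not.1 h2)
  rw [altBilin_dirC] at h3
  simp only [dirC, map_zero, add_zero] at h3
  rw [Real.sin_sub] at h
  apply h
  linear_combination h3

theorem dirC_add_pi (t : ℝ) : dirC (t + Real.pi) = - dirC t := by
  apply Complex.ext <;> simp [dirC]

theorem reduce_add_pi (W : LagGr (prodForm σ)) (t : ℝ) :
    W.reduce (t + Real.pi) = W.reduce t := by
  simp only [reduce]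
  congr 3
  ext x
  simp [dirC_add_pi]

theorem avoids_add_pi (W : LagGr (prodForm σ)) (t : ℝ) :
    W.Avoids (t + Real.pi) ↔ W.Avoids t := by
  simp only [avoids_iff, dirC_add_pi, map_neg, LinearMap.neg_apply, neg_ne_zero]

end Reduction

section ReductionPlots

variable {N m : ℕ} {M : Type*} [TopologicalSpace M] [ChartedSpace (EuclideanSpace ℝ (Fin N)) M]
  [IsManifold (𝓡 N) ∞ M] {σ : FormField (𝓡 N) M 2}
  {P : EuclideanSpace ℝ (Fin m) → LagGr (prodForm σ)}
  {u : Set (EuclideanSpace ℝ (Fin m))}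

theorem IsPlotOn.exists_prod_fields (hP : IsPlotOn u P) {x : EuclideanSpace ℝ (Fin m)}
    (hx : x ∈ u) :
    ∃ v, IsOpen v ∧ x ∈ v ∧ v ⊆ u ∧ ∃ (K : ℕ) (Z : Fin K → EuclideanSpace ℝ (Fin m) → ℂ)
      (X : Fin K → ∀ y, TangentSpace (𝓡 N) (P y).pt.2),
      (∀ i, ContDiffOn ℝ ∞ (Z i) v) ∧ (∀ i, SmoothAlong (𝓡 N) (X i) v) ∧
      ∀ y ∈ v, (P y).prodPlane = Submodule.span ℝ (range fun i => (Z i y, X i y)) := by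
  obtain ⟨v, hv, hxv, hvu, K, X, hX, hs⟩ := hP.exists_fields hx
  have hsm : ContMDiff (𝓘(ℝ, ℂ).prod (𝓡 N)).tangent (𝓘(ℝ, ℂ).tangent.prod (𝓡 N).tangent) ∞
      (equivTangentBundleProd 𝓘(ℝ, ℂ) ℂ (𝓡 N) M) := contMDiff_equivTangentBundleProd
  have h1 : ∀ i, ContMDiffOn 𝓘(ℝ, EuclideanSpace ℝ (Fin m)) (𝓘(ℝ, ℂ).tangent.prod (𝓡 N).tangent) ∞
      (fun y => equivTangentBundleProd 𝓘(ℝ, ℂ) ℂ (𝓡 N) M ⟨(P y).pt, X i y⟩) v := fun i =>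
    hsm.comp_contMDiffOn (hX i)
  refine ⟨v, hv, hxv, hvu, K, fun i y => (X i y : ℂ × EuclideanSpace ℝ (Fin N)).1,
    fun i y => (X i y : ℂ × EuclideanSpace ℝ (Fin N)).2, fun i => ?_, fun i => ?_,
    fun y hy => hs y hy⟩
  · exact ((contMDiff_snd_tangentBundle_modelSpace ℂ 𝓘(ℝ, ℂ) (n := ∞)).comp_contMDiffOn
      (contMDiff_fst.comp_contMDiffOn (h1 i))).contDiffOn
  · exact contMDiff_snd.comp_contMDiffOn (h1 i)

theorem contDiffOn_altBilin_dirC {t : EuclideanSpace ℝ (Fin m) → ℝ}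
    {Z : EuclideanSpace ℝ (Fin m) → ℂ} (ht : ContDiffOn ℝ ∞ t u) (hZ : ContDiffOn ℝ ∞ Z u) :
    ContDiffOn ℝ ∞ (fun y => altBilin omegaC (dirC (t y)) (Z y)) u := by
  simp only [altBilin_dirC]
  exact (ht.cos.mul (Complex.imCLM.contDiff.comp_contDiffOn hZ)).sub
    ((Complex.reCLM.contDiff.comp_contDiffOn hZ).mul ht.sin)

theorem avoids_iff_exists {W : LagGr (prodForm σ)} {ι : Type*} [Fintype ι]
    {x : ι → ℂ × TangentSpace (𝓡 N) W.pt.2}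
    (h : W.prodPlane = Submodule.span ℝ (range x)) (t : ℝ) :
    W.Avoids t ↔ ∃ i, altBilin omegaC (dirC t) (x i).1 ≠ 0 := by
  rw [avoids_iff]
  constructor
  · intro hx
    by_contra! hc
    obtain ⟨w, hw, hw0⟩ := hx
    rw [h, mem_span_range_iff_sum] at hw
    obtain ⟨c, rfl⟩ := hw
    apply hw0
    rw [Prod.fst_sum, map_sum]
    exact Finset.sum_eq_zero fun i _ => by rw [Prod.smul_fst, map_smul, hc i, smul_zero]
  · rintro ⟨i, hi⟩
    exact ⟨x i, h ▸ Submodule.subset_span ⟨i, rfl⟩, hi⟩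

/-- Reductions along smoothly varying transverse lines form a plot. -/
theorem IsPlotOn.reduce (hP : IsPlotOn u P) {t : EuclideanSpace ℝ (Fin m) → ℝ}
    (ht : ContDiffOn ℝ ∞ t u) (h : ∀ y ∈ u, (P y).Avoids (t y)) :
    IsPlotOn u (fun y => (P y).reduce (t y)) := by
  refine isPlotOn_of_kernel (contMDiff_snd.comp_contMDiffOn hP.1) fun x hx => ?_
  obtain ⟨v, hv, hxv, hvu, K, Z, X, hZ, hX, hs⟩ := hP.exists_prod_fields hx
  refine ⟨v, hv, hxv, hvu, Fin K, inferInstance, X,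
    fun i y => altBilin omegaC (dirC (t y)) (Z i y), hX,
    fun i => contDiffOn_altBilin_dirC (ht.mono hvu) (hZ i), fun y hy => ⟨?_, fun w => ?_⟩⟩
  · exact (avoids_iff_exists (hs y hy) _).1 (h y (hvu hy))
  · refine mem_reduce.trans ?_
    constructor
    · rintro ⟨z, hz, h0⟩
      rw [hs y hy, mem_span_range_iff_sum] at hz
      obtain ⟨c, hc⟩ := hz
      refine ⟨c, ?_, ?_⟩
      · exact Prod.snd_sum.symm.trans (congrArg Prod.snd hc)
      · have h1 : ∑ i, c i • Z i y = z := Prod.fst_sum.symm.trans (congrArg Prod.fst hc)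
        rw [← h1, map_sum] at h0
        simpa only [map_smul, smul_eq_mul] using h0
    · rintro ⟨c, hc, h0⟩
      refine ⟨∑ i, c i • Z i y, ?_, ?_⟩
      · rw [hs y hy, mem_span_range_iff_sum]
        refine ⟨c, ?_⟩
        exact Prod.ext Prod.fst_sum (Prod.snd_sum.trans hc)
      · rw [map_sum]
        simpa only [map_smul, smul_eq_mul] using h0

theorem IsPlotOn.eventually_avoids (hP : IsPlotOn u P) {x : EuclideanSpace ℝ (Fin m)}
    (hx : x ∈ u) {t : ℝ} (h : (P x).Avoids t) :
    ∀ᶠ q : EuclideanSpace ℝ (Fin m) × ℝ in 𝓝 (x, t), (P q.1).Avoids q.2 := by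
  obtain ⟨v, hv, hxv, hvu, K, Z, X, hZ, hX, hs⟩ := hP.exists_prod_fields hx
  obtain ⟨i, hi⟩ := (avoids_iff_exists (hs x hxv) t).1 h
  have hc : ContinuousAt (fun q : EuclideanSpace ℝ (Fin m) × ℝ =>
      altBilin omegaC (dirC q.2) (Z i q.1)) (x, t) := by
    simp only [altBilin_dirC]
    have hZc : ContinuousAt (fun q : EuclideanSpace ℝ (Fin m) × ℝ => Z i q.1) (x, t) :=
      ContinuousAt.comp (f := Prod.fst) (g := Z i)
        ((hZ i).continuousOn.continuousAt (hv.mem_nhds hxv)) continuousAt_fst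
    exact ((Real.continuous_cos.continuousAt.comp continuousAt_snd).mul
      (Complex.continuous_im.continuousAt.comp hZc)).sub
      ((Complex.continuous_re.continuousAt.comp hZc).mul
      (Real.continuous_sin.continuousAt.comp continuousAt_snd))
  filter_upwards [hc.eventually_ne hi, continuousAt_fst.eventually (hv.mem_nhds hxv)] with q h1 h2
  exact (avoids_iff_exists (hs q.1 h2) q.2).2 ⟨i, h1⟩

theorem IsPlotOn.eventually_forall_avoids (hP : IsPlotOn u P) {x : EuclideanSpace ℝ (Fin m)}
    (hx : x ∈ u) {K : Set ℝ} (hK : IsCompact K) (h : ∀ t ∈ K, (P x).Avoids t) :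
    ∀ᶠ y in 𝓝 x, ∀ t ∈ K, (P y).Avoids t :=
  hK.eventually_forall_of_forall_eventually fun t ht => hP.eventually_avoids hx (h t ht)

end ReductionPlots

end LagGr

/-! ### Line integrals and homotopies -/

section LineIntegral

variable {X : Type*} {D : DiffeologicalSpace X}

open scoped Classical in
/-- The integral of a `1`-form along a path. -/
def lineInt (α : DForm D 1) (γ : EuclideanSpace ℝ (Fin 1) → X) (a b : ℝ) : ℝ :=
  ∫ s in a..b, if h : γ ∈ D.plots 1 then
    α.val γ h (EuclideanSpace.single 0 s) (fun _ => EuclideanSpace.single 0 1) else 0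

/-- A covector as an alternating `1`-form. -/
abbrev covecForm {m : ℕ} (a : EuclideanSpace ℝ (Fin m) →L[ℝ] ℝ) :
    EuclideanSpace ℝ (Fin m) [⋀^Fin 1]→L[ℝ] ℝ :=
  ContinuousAlternatingMap.ofSubsingleton ℝ _ ℝ (0 : Fin 1) a

theorem covecForm_comp {m m' : ℕ} (a : EuclideanSpace ℝ (Fin m) →L[ℝ] ℝ)
    (B : EuclideanSpace ℝ (Fin m') →L[ℝ] EuclideanSpace ℝ (Fin m)) :
    (covecForm a).compContinuousLinearMap B = covecForm (a.comp B) := by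
  ext v; rfl

theorem single_eq_smul (s : ℝ) : EuclideanSpace.single (0 : Fin 1) s =
    s • EuclideanSpace.single (0 : Fin 1) (1 : ℝ) := by
  ext i; simp

theorem contDiff_euclideanSingle : ContDiff ℝ ∞ fun s : ℝ => EuclideanSpace.single (0 : Fin 1) s := by
  rw [funext single_eq_smul]
  exact contDiff_id.smul contDiff_const

theorem hasDerivAt_euclideanSingle (s : ℝ) : HasDerivAt (fun s : ℝ => EuclideanSpace.single (0 : Fin 1) s)
    (EuclideanSpace.single (0 : Fin 1) (1 : ℝ)) s := by
  rw [funext single_eq_smul]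
  simpa using (hasDerivAt_id s).smul_const (EuclideanSpace.single (0 : Fin 1) (1 : ℝ))

theorem lineInt_eq_sub {α : DForm D 1} {γ : EuclideanSpace ℝ (Fin 1) → X} (hγ : γ ∈ D.plots 1)
    {F : EuclideanSpace ℝ (Fin 1) → ℝ} (hF : ContDiff ℝ ∞ F)
    (h : ∀ u, α.val γ hγ u = covecForm (fderiv ℝ F u)) (a b : ℝ) :
    lineInt α γ a b = F (EuclideanSpace.single 0 b) - F (EuclideanSpace.single 0 a) := by
  have hd : ∀ s : ℝ, HasDerivAt (fun s => F (EuclideanSpace.single (0 : Fin 1) s))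
      (fderiv ℝ F (EuclideanSpace.single 0 s) (EuclideanSpace.single 0 1)) s := by
    intro s
    exact ((hF.differentiable (by simp) _).hasFDerivAt).comp_hasDerivAt s (hasDerivAt_euclideanSingle s)
  have hc : Continuous fun s : ℝ =>
      fderiv ℝ F (EuclideanSpace.single 0 s) (EuclideanSpace.single 0 1) :=
    ((hF.continuous_fderiv (by simp)).comp contDiff_euclideanSingle.continuous).clm_apply
      continuous_const
  rw [lineInt, ← intervalIntegral.integral_eq_sub_of_hasDerivAt (fun s _ => hd s)
    (hc.intervalIntegrable a b)]
  refine intervalIntegral.integral_congr fun s _ => ?_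
  simp only [dif_pos hγ, h]
  rfl

theorem exists_primitive_path (α : DForm D 1) {γ : EuclideanSpace ℝ (Fin 1) → X}
    (hγ : γ ∈ D.plots 1) : ∃ F : EuclideanSpace ℝ (Fin 1) → ℝ, ContDiff ℝ ∞ F ∧
      ∀ u, α.val γ hγ u = covecForm (fderiv ℝ F u) := by
  refine DForm.exists_primitive_of_closed (α.smooth γ hγ) (funext fun u => ?_)
  refine ContinuousAlternatingMap.toAlternatingMap_injective
    (Basis.ext_alternating (stdBasis 1) fun v hv => ?_)
  exact absurd (hv (Subsingleton.elim (v 0) (v 1))) (by decide)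

theorem lineInt_comp (α : DForm D 1) {γ : EuclideanSpace ℝ (Fin 1) → X} (hγ : γ ∈ D.plots 1)
    {g : ℝ → ℝ} (hg : ContDiff ℝ ∞ g) (a b : ℝ) :
    lineInt α (fun s => γ (EuclideanSpace.single 0 (g (s 0)))) a b = lineInt α γ (g a) (g b) := by
  obtain ⟨F, hF, hFα⟩ := exists_primitive_path α hγ
  have hG : ContDiff ℝ ∞ fun s : EuclideanSpace ℝ (Fin 1) =>
      EuclideanSpace.single (0 : Fin 1) (g (s 0)) := by
    have h1 : ContDiff ℝ ∞ fun s : EuclideanSpace ℝ (Fin 1) => s 0 :=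
      (EuclideanSpace.proj (𝕜 := ℝ) (0 : Fin 1)).contDiff
    exact contDiff_euclideanSingle.comp (hg.comp h1)
  have hγ' := D.plot_reparam hγ hG
  rw [lineInt_eq_sub hγ hF hFα]
  refine (lineInt_eq_sub hγ' (hF.comp hG) (fun u => ?_) a b).trans ?_
  · rw [α.natural γ hγ _ hG u, hFα, covecForm_comp,
      fderiv_comp u (hF.differentiable (by simp) _) (hG.differentiable (by simp) _)]
  · simp

theorem lineInt_add (α : DForm D 1) {γ : EuclideanSpace ℝ (Fin 1) → X} (hγ : γ ∈ D.plots 1)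
    (a b c : ℝ) : lineInt α γ a b + lineInt α γ b c = lineInt α γ a c := by
  obtain ⟨F, hF, hFα⟩ := exists_primitive_path α hγ
  simp only [lineInt_eq_sub hγ hF hFα]
  ring

variable {m : ℕ}

theorem contDiff_join_right (a : ℝ) :
    ContDiff ℝ ∞ fun y : EuclideanSpace ℝ (Fin m) => joinL m (a, y) :=
  (joinL m).contDiff.comp (contDiff_const.prodMk contDiff_id)

theorem hasFDerivAt_join_right (a : ℝ) (y : EuclideanSpace ℝ (Fin m)) :
    HasFDerivAt (fun y : EuclideanSpace ℝ (Fin m) => joinL m (a, y))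
      ((joinL m).comp (ContinuousLinearMap.inr ℝ ℝ _)) y :=
  (joinL m).hasFDerivAt.comp y (hasFDerivAt_prodMk_right a y)

/-- The primitive of a form along a homotopy whose parameter direction is annihilated by the
exterior derivative. -/
theorem exists_homotopy_primitive (α : DForm D 1) {S : EuclideanSpace ℝ (Fin (m + 1)) → X}
    (hS : S ∈ D.plots (m + 1)) (c : ℝ)
    (hd : ∀ u, (DForm.d α).val S hS u =
      ((DForm.d α).val _ (D.plot_reparam hS (contDiff_join_right c)) (tailL m u)).compContinuousLinearMap
        (tailL m)) :
    ∃ F : EuclideanSpace ℝ (Fin (m + 1)) → ℝ, ContDiff ℝ ∞ F ∧ ∀ u, α.val S hS u =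
      (α.val _ (D.plot_reparam hS (contDiff_join_right c)) (tailL m u)).compContinuousLinearMap
        (tailL m) + covecForm (fderiv ℝ F u) := by
  set Q := S ∘ fun y : EuclideanSpace ℝ (Fin m) => joinL m (c, y)
  have hQ : Q ∈ D.plots m := D.plot_reparam hS (contDiff_join_right c)
  have hA := α.smooth S hS
  have hB : ContDiff ℝ ∞ fun u => (α.val Q hQ (tailL m u)).compContinuousLinearMap (tailL m) := by
    have h := α.smooth (Q ∘ tailL m) (D.plot_reparam hQ (tailL m).contDiff)
    have e : α.val (Q ∘ tailL m) (D.plot_reparam hQ (tailL m).contDiff) = fun u =>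
        (α.val Q hQ (tailL m u)).compContinuousLinearMap (tailL m) := by
      funext u
      rw [α.natural Q hQ _ (tailL m).contDiff u, ContinuousLinearMap.fderiv]
    rwa [e] at h
  obtain ⟨F, hF, hFα⟩ := DForm.exists_primitive_of_closed (hA.sub hB) (funext fun u => by
    have hBn : extDeriv ((-1 : ℝ) • fun u =>
        (α.val Q hQ (tailL m u)).compContinuousLinearMap (tailL m)) u = (-1 : ℝ) • extDeriv
          (fun u => (α.val Q hQ (tailL m u)).compContinuousLinearMap (tailL m)) u :=
      extDeriv_smul (-1 : ℝ) _
    have hBd : DifferentiableAt ℝ ((-1 : ℝ) • fun u =>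
        (α.val Q hQ (tailL m u)).compContinuousLinearMap (tailL m)) u :=
      ((contDiff_const (c := (-1 : ℝ))).smul hB).differentiable (by simp) u
    rw [show (fun u => α.val S hS u - (α.val Q hQ (tailL m u)).compContinuousLinearMap (tailL m)) =
      (α.val S hS) + (-1 : ℝ) • fun u => (α.val Q hQ (tailL m u)).compContinuousLinearMap (tailL m)
        from funext fun u => by
          rw [Pi.add_apply, Pi.smul_apply]
          ext v
          simp [sub_eq_add_neg],
      extDeriv_add (hA.differentiable (by simp) u) hBd, hBn]
    have h1 : extDeriv (fun u => (α.val Q hQ (tailL m u)).compContinuousLinearMap (tailL m)) u =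
        (extDeriv (α.val Q hQ) (tailL m u)).compContinuousLinearMap (tailL m) := by
      have h := (DForm.d α).natural Q hQ _ (tailL m).contDiff u
      rw [DForm.d_val, DForm.d_val, ContinuousLinearMap.fderiv] at h
      rw [← h]
      congr 1
      funext u
      rw [α.natural Q hQ _ (tailL m).contDiff u, ContinuousLinearMap.fderiv]
    rw [h1, ← DForm.d_val, ← DForm.d_val, hd u]
    ext v
    simp [Q])
  refine ⟨F, hF, fun u => ?_⟩
  rw [show covecForm (fderiv ℝ F u) = _ from (hFα u).symm]
  exact (add_sub_cancel _ _).symm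

theorem lineInt_homotopy (α : DForm D 1) {S : EuclideanSpace ℝ (Fin (m + 1)) → X}
    (hS : S ∈ D.plots (m + 1)) (c : ℝ)
    (hd : ∀ u, (DForm.d α).val S hS u =
      ((DForm.d α).val _ (D.plot_reparam hS (contDiff_join_right c)) (tailL m u)).compContinuousLinearMap
        (tailL m)) (a b : ℝ) :
    ContDiff ℝ ∞ (fun y => lineInt α (fun s => S (joinL m (s 0, y))) a b) ∧
    ∀ y, covecForm (fderiv ℝ (fun y => lineInt α (fun s => S (joinL m (s 0, y))) a b) y) =
      α.val _ (D.plot_reparam hS (contDiff_join_right b)) y -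
        α.val _ (D.plot_reparam hS (contDiff_join_right a)) y := by
  obtain ⟨F, hF, hFα⟩ := exists_homotopy_primitive α hS c hd
  have hpath : ∀ y : EuclideanSpace ℝ (Fin m),
      lineInt α (fun s => S (joinL m (s 0, y))) a b = F (joinL m (b, y)) - F (joinL m (a, y)) := by
    intro y
    let g : EuclideanSpace ℝ (Fin 1) → EuclideanSpace ℝ (Fin (m + 1)) := fun s => joinL m (s 0, y)
    have hg : ∀ s, HasFDerivAt g ((joinL m).comp ((ContinuousLinearMap.inl ℝ ℝ _).comp
        (EuclideanSpace.proj (𝕜 := ℝ) (0 : Fin 1)))) s := fun s =>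
      (joinL m).hasFDerivAt.comp s ((hasFDerivAt_prodMk_left (s 0) y).comp s
        (EuclideanSpace.proj (𝕜 := ℝ) (0 : Fin 1)).hasFDerivAt)
    have hgc : ContDiff ℝ ∞ g := (joinL m).contDiff.comp
      (((EuclideanSpace.proj (𝕜 := ℝ) (0 : Fin 1)).contDiff).prodMk contDiff_const)
    refine (lineInt_eq_sub (D.plot_reparam hS hgc) (hF.comp hgc) (fun s => ?_) a b).trans ?_
    · rw [α.natural S hS g hgc s, hFα, fderiv_comp s (hF.differentiable (by simp) _)
        (hgc.differentiable (by simp) _), (hg s).fderiv]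
      ext v
      have h0 : ∀ z : EuclideanSpace ℝ (Fin 1), tailL m (joinL m (z 0, (0 : EuclideanSpace ℝ (Fin m)))) = 0 :=
        fun z => by simp
      simp only [ContinuousAlternatingMap.compContinuousLinearMap_apply,
        ContinuousAlternatingMap.add_apply]
      have h1 : (α.val _ (D.plot_reparam hS (contDiff_join_right c)) (tailL m (g s)))
          (⇑(tailL m) ∘ ⇑((joinL m).comp ((ContinuousLinearMap.inl ℝ ℝ _).comp
            (EuclideanSpace.proj (𝕜 := ℝ) (0 : Fin 1)))) ∘ v) = 0 :=
        ContinuousAlternatingMap.map_coord_zero _ (0 : Fin 1) (h0 (v 0))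
      rw [h1, zero_add]
      rfl
    · simp [g]
  have hslice : ∀ t (y : EuclideanSpace ℝ (Fin m)),
      α.val _ (D.plot_reparam hS (contDiff_join_right t)) y =
      α.val _ (D.plot_reparam hS (contDiff_join_right c)) y +
        covecForm (fderiv ℝ (fun y => F (joinL m (t, y))) y) := by
    intro t y
    rw [α.natural S hS _ (contDiff_join_right t) y, hFα]
    rw [show (fun y => F (joinL m (t, y))) = F ∘ fun y => joinL m (t, y) from rfl,
      fderiv_comp y (hF.differentiable (by simp) _) ((contDiff_join_right t).differentiable (by simp) _),
      (hasFDerivAt_join_right t y).fderiv]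
    ext v
    simp only [ContinuousAlternatingMap.compContinuousLinearMap_apply,
        ContinuousAlternatingMap.add_apply]
    have h1 : (⇑(tailL m) ∘ ⇑((joinL m).comp (ContinuousLinearMap.inr ℝ ℝ _)) ∘ v) = v :=
      funext fun i => tailL_joinL (0, v i)
    rw [h1, tailL_joinL]
    rfl
  have hFt : ∀ t, ContDiff ℝ ∞ fun y => F (joinL m (t, y)) := fun t =>
    hF.comp (contDiff_join_right t)
  simp only [hpath]
  refine ⟨(hFt b).sub (hFt a), fun y => ?_⟩
  rw [hslice b, hslice a, fderiv_fun_sub ((hFt b).differentiable (by simp) _)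
    ((hFt a).differentiable (by simp) _)]
  ext v
  simp

end LineIntegral

/-- The homotopy condition holds for action forms. -/
theorem IsActionForm.d_val_homotopy {E : Type*} [NormedAddCommGroup E] [NormedSpace ℝ E]
    [FiniteDimensional ℝ E] {H : Type*} [TopologicalSpace H] {I : ModelWithCorners ℝ E H}
    {M : Type*} [TopologicalSpace M] [ChartedSpace H M] [IsManifold I ∞ M]
    {σ : SymplecticForm I M} {lam : DForm (lagGrDiffeology σ.toFun) 1} (hlam : IsActionForm σ lam)
    {m : ℕ} {S : EuclideanSpace ℝ (Fin (m + 1)) → LagGr σ.toFun}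
    (hS : S ∈ (lagGrDiffeology σ.toFun).plots (m + 1)) (c : ℝ)
    (hpt : ∀ u, (S u).pt = (S (joinL m (c, tailL m u))).pt) (u : EuclideanSpace ℝ (Fin (m + 1))) :
    (DForm.d lam).val S hS u = ((DForm.d lam).val _
      ((lagGrDiffeology σ.toFun).plot_reparam hS (contDiff_join_right c))
        (tailL m u)).compContinuousLinearMap (tailL m) := by
  rw [hlam]
  have hQ := (lagGrDiffeology σ.toFun).plot_reparam hS (contDiff_join_right c)
  have h1 := σ.toSmoothForm.toDForm.natural _ (LagGr.smooth_pt σ.toFun _ _ hQ) (tailL m)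
    (tailL m).contDiff u
  rw [ContinuousLinearMap.fderiv] at h1
  refine Eq.trans ?_ h1
  exact σ.toSmoothForm.toDForm.val_of_eq (LagGr.smooth_pt σ.toFun _ _ hS) _ (funext hpt) u

/-! ### Rotations of Lagrangian planes -/

namespace LagGr

section Rotation

variable {E : Type*} [NormedAddCommGroup E] [NormedSpace ℝ E]
  {H : Type*} [TopologicalSpace H] {I : ModelWithCorners ℝ E H}
  {M : Type*} [TopologicalSpace M] [ChartedSpace H M]
  {σ : FormField I M 2}

/-- Planes over the same point agree if they have the same elements. -/
theorem ext_mem {p : M} {A B : Submodule ℝ (TangentSpace I p)} {hA : IsLagrangianSubspace (σ p) A}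
    {hB : IsLagrangianSubspace (σ p) B} (h : ∀ w, w ∈ A ↔ w ∈ B) :
    (⟨p, A, hA⟩ : LagGr σ) = ⟨p, B, hB⟩ := by
  obtain rfl : A = B := SetLike.ext h
  rfl

theorem altBilin_eq_zero (U : LagGr σ) {u w : TangentSpace I U.pt} (hu : u ∈ U.plane)
    (hw : w ∈ U.plane) : altBilin (σ U.pt) u w = 0 :=
  (U.isLagrangian u).1 hu w hw

theorem exists_altBilin_ne_zero (U : LagGr σ) {f : TangentSpace I U.pt} (hf : f ∉ U.plane) :
    ∃ u ∈ U.plane, altBilin (σ U.pt) u f ≠ 0 := by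
  by_contra! h
  exact hf ((U.isLagrangian f).2 fun w hw => by
    rw [← altBilin_apply, altBilin_swap, h w hw, neg_zero])

/-- The loop of Lagrangian planes obtained by rotating `U` in the direction of `f`. -/
def rotate (U : LagGr σ) (f : TangentSpace I U.pt) (s : ℝ) : LagGr σ where
  pt := U.pt
  plane :=
    { carrier := {w | ∃ u ∈ U.plane, ∃ a : ℝ,
        a * Real.cos s + altBilin (σ U.pt) u f * Real.sin s = 0 ∧ u + a • f = w}
      zero_mem' := ⟨0, U.plane.zero_mem, 0, by simp, by simp⟩
      add_mem' := by
        rintro _ _ ⟨u, hu, a, h, rfl⟩ ⟨u', hu', a', h', rfl⟩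
        refine ⟨u + u', add_mem hu hu', a + a', ?_, ?_⟩
        · simp only [map_add, LinearMap.add_apply]
          linear_combination h + h'
        · rw [add_smul]; abel
      smul_mem' := by
        rintro c _ ⟨u, hu, a, h, rfl⟩
        refine ⟨c • u, Submodule.smul_mem _ _ hu, c * a, ?_, ?_⟩
        · simp only [map_smul, LinearMap.smul_apply, smul_eq_mul]
          linear_combination c * h
        · rw [smul_add, mul_smul] }
  isLagrangian := by
    rw [isLagrangianSubspace_iff]
    set B := altBilin (σ U.pt) with hB
    intro x
    constructor
    · rintro ⟨u, hu, a, h, rfl⟩ _ ⟨u', hu', a', h', rfl⟩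
      have hsw : B f u' = - B u' f := altBilin_swap _ _ _
      have h0 : B u u' = 0 := U.altBilin_eq_zero hu hu'
      have hff : B f f = 0 := altBilin_self _ _
      simp only [map_add, map_smul, LinearMap.add_apply, LinearMap.smul_apply, smul_eq_mul,
        h0, hff, hsw]
      linear_combination Real.cos s * (B u f * h' - B u' f * h) + Real.sin s * (a' * h - a * h') -
        (a' * B u f - a * B u' f) * Real.sin_sq_add_cos_sq s
    · intro hx
      have hQ : ∀ w ∈ U.plane, B w f = 0 → B x w = 0 := fun w hw h0 =>
        hx w ⟨w, hw, 0, by rw [h0]; simp, by simp⟩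
      by_cases hf : f ∈ U.plane
      · have hxU : x ∈ U.plane := (U.isLagrangian x).2 fun w hw =>
          hQ w hw (U.altBilin_eq_zero hw hf)
        exact ⟨x, hxU, 0, by
          rw [show B x f = 0 from U.altBilin_eq_zero hxU hf, zero_mul, zero_mul, add_zero],
          by simp⟩
      · obtain ⟨u₀, hu₀, hr⟩ := U.exists_altBilin_ne_zero hf
        rw [← hB] at hr
        set c := - (B x u₀ / B u₀ f) with hc
        have hU : x - c • f ∈ U.plane := (U.isLagrangian _).2 fun w hw => by
          have h1 := hQ (w - (B w f / B u₀ f) • u₀)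
            (sub_mem hw (Submodule.smul_mem _ _ hu₀)) (by
              simp only [map_sub, map_smul, LinearMap.sub_apply, LinearMap.smul_apply, smul_eq_mul]
              field_simp
              ring)
          rw [← altBilin_apply, ← hB]
          have hsw : B f w = - B w f := altBilin_swap _ _ _
          simp only [map_sub, map_smul, LinearMap.sub_apply, LinearMap.smul_apply,
            smul_eq_mul] at h1 ⊢
          rw [hsw, hc]
          linear_combination h1
        refine ⟨x - c • f, hU, c, ?_, by abel⟩
        have h2 := hx _ ⟨(Real.cos s / B u₀ f) • u₀, Submodule.smul_mem _ _ hu₀, - Real.sin s, by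
          simp only [map_smul, LinearMap.smul_apply, smul_eq_mul]
          field_simp
          ring, rfl⟩
        have hff : B f f = 0 := altBilin_self _ _
        simp only [map_add, map_sub, map_smul, LinearMap.sub_apply, LinearMap.smul_apply,
          smul_eq_mul, hff] at h2 ⊢
        rw [hc]
        linear_combination - h2

theorem mem_rotate {U : LagGr σ} {f : TangentSpace I U.pt} {s : ℝ} {w : TangentSpace I U.pt} :
    w ∈ (U.rotate f s).plane ↔ ∃ u ∈ U.plane, ∃ a : ℝ,
      a * Real.cos s + altBilin (σ U.pt) u f * Real.sin s = 0 ∧ u + a • f = w := Iff.rfl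

theorem rotate_zero (U : LagGr σ) (f : TangentSpace I U.pt) : U.rotate f 0 = U := by
  refine ext_mem fun w => ⟨?_, fun hw => ⟨w, hw, 0, by simp, by simp⟩⟩
  rintro ⟨u, hu, a, h, rfl⟩
  obtain rfl : a = 0 := by simpa using h
  simpa using hu

theorem rotate_neg_pi (U : LagGr σ) (f : TangentSpace I U.pt) : U.rotate f (-Real.pi) = U := by
  refine ext_mem fun w => ⟨?_, fun hw => ⟨w, hw, 0, by simp, by simp⟩⟩
  rintro ⟨u, hu, a, h, rfl⟩
  obtain rfl : a = 0 := by simpa using h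
  simpa using hu

theorem rotate_neg (U : LagGr σ) (f : TangentSpace I U.pt) (s : ℝ) :
    U.rotate (-f) s = U.rotate f s := by
  refine ext_mem fun w => ⟨?_, ?_⟩
  · rintro ⟨u, hu, a, h, rfl⟩
    refine ⟨u, hu, -a, ?_, by simp⟩
    rw [map_neg] at h
    linear_combination - h
  · rintro ⟨u, hu, a, h, rfl⟩
    refine ⟨u, hu, -a, ?_, by simp⟩
    rw [map_neg]
    linear_combination - h

theorem dirC_add (s t : ℝ) :
    dirC (t + s) = Real.cos s • dirC t + Real.sin s • dirC (t + Real.pi / 2) := by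
  apply Complex.ext
  · simp only [dirC, Complex.add_re, Complex.real_smul, Complex.mul_re, Complex.ofReal_re,
      Complex.ofReal_im, Real.cos_add_pi_div_two]
    rw [Real.cos_add]
    ring
  · simp only [dirC, Complex.add_im, Complex.real_smul, Complex.mul_im, Complex.ofReal_re,
      Complex.ofReal_im, Real.sin_add_pi_div_two]
    rw [Real.sin_add]
    ring

theorem altBilin_dirC_add_pi_div_two (t : ℝ) :
    altBilin omegaC (dirC t) (dirC (t + Real.pi / 2)) = 1 := by
  rw [altBilin_dirC]
  simp only [dirC, Real.sin_add_pi_div_two, Real.cos_add_pi_div_two]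
  linear_combination Real.sin_sq_add_cos_sq t

/-- The reductions of a plane transverse to `ℂ` form a rotation loop. -/
theorem reduce_eq_rotate (W : LagGr (prodForm σ)) (t s : ℝ) {f : TangentSpace I W.pt.2}
    (hf : (dirC (t + Real.pi / 2), f) ∈ W.prodPlane) :
    W.reduce (t + s) = (W.reduce t).rotate f s := by
  refine ext_mem fun w => mem_reduce.trans ?_
  have hpair : ∀ (c : ℝ) (u : TangentSpace I W.pt.2), (c • dirC t, u) ∈ W.prodPlane →
      c + altBilin (σ W.pt.2) u f = 0 := fun c u hu => by
    have h := (W.mem_prodPlane_iff _).1 hu _ hf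
    simpa only [map_smul, LinearMap.smul_apply, altBilin_dirC_add_pi_div_two, smul_eq_mul,
      mul_one] using h
  constructor
  · rintro ⟨z, hz, h0⟩
    obtain ⟨a, rfl⟩ := eq_smul_dirC h0
    have h1 : ((a * Real.cos s) • dirC t, w - (a * Real.sin s) • f) ∈ W.prodPlane := by
      have h2 := sub_mem hz (Submodule.smul_mem _ (a * Real.sin s) hf)
      have e : ((a • dirC (t + s), w) - (a * Real.sin s) • (dirC (t + Real.pi / 2), f) :
          ℂ × TangentSpace I W.pt.2) = ((a * Real.cos s) • dirC t, w - (a * Real.sin s) • f) := by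
        refine Prod.ext ?_ rfl
        change a • dirC (t + s) - (a * Real.sin s) • dirC (t + Real.pi / 2) = _
        rw [dirC_add, smul_add, smul_smul, smul_smul, add_sub_cancel_right]
      rwa [e] at h2
    refine ⟨w - (a * Real.sin s) • f, mem_reduce.2 ⟨_, h1, ?_⟩, a * Real.sin s, ?_,
      sub_add_cancel w _⟩
    · rw [map_smul, altBilin_self, smul_zero]
    · have h3 := hpair _ _ h1
      change _ + altBilin (σ W.pt.2) _ f * _ = 0
      linear_combination Real.sin s * h3
  · rintro ⟨u, hu, b, h, rfl⟩
    obtain ⟨z, hz, h0⟩ := mem_reduce.1 hu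
    obtain ⟨c, rfl⟩ := eq_smul_dirC h0
    refine ⟨c • dirC t + b • dirC (t + Real.pi / 2), add_mem hz (Submodule.smul_mem _ b hf), ?_⟩
    have h3 := hpair _ _ hz
    have h' : b * Real.cos s + altBilin (σ W.pt.2) u f * Real.sin s = 0 := h
    rw [dirC_add]
    have h4 : altBilin omegaC (dirC (t + Real.pi / 2)) (dirC t) = -1 := by
      rw [altBilin_swap, altBilin_dirC_add_pi_div_two]
    simp only [map_add, map_smul, LinearMap.add_apply, LinearMap.smul_apply, smul_eq_mul,
      altBilin_self, altBilin_dirC_add_pi_div_two, h4]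
    linear_combination h' - Real.sin s * h3

theorem exists_altBilin_omegaC_ne_zero {W : LagGr (prodForm σ)} (hW : ∀ t, W.Avoids t) {z : ℂ}
    (hz : z ≠ 0) : ∃ x ∈ W.prodPlane, altBilin omegaC z x.1 ≠ 0 := by
  obtain ⟨x, hx, hx0⟩ := avoids_iff.1 (hW z.arg)
  refine ⟨x, hx, ?_⟩
  have e : z = ‖z‖ • dirC z.arg := by
    apply Complex.ext
    · simp [dirC, Complex.norm_mul_cos_arg]
    · simp [dirC, Complex.norm_mul_sin_arg]
  rw [e, map_smul, LinearMap.smul_apply, smul_eq_mul]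
  exact mul_ne_zero (norm_ne_zero_iff.2 hz) hx0

theorem exists_mem_prodPlane {W : LagGr (prodForm σ)} (hW : ∀ t, W.Avoids t) (z : ℂ) :
    ∃ f, (z, f) ∈ W.prodPlane := by
  obtain ⟨x, hx, hx0⟩ := exists_altBilin_omegaC_ne_zero hW one_ne_zero
  have hx1 : x.1 ≠ 0 := by
    intro h
    rw [h, map_zero] at hx0
    exact hx0 rfl
  obtain ⟨y, hy, hy0⟩ := exists_altBilin_omegaC_ne_zero hW hx1
  set d := altBilin omegaC x.1 y.1
  have h := add_mem (Submodule.smul_mem _ (altBilin omegaC z y.1 / d) hx)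
    (Submodule.smul_mem _ (altBilin omegaC x.1 z / d) hy)
  refine ⟨(altBilin omegaC z y.1 / d) • x.2 + (altBilin omegaC x.1 z / d) • y.2, ?_⟩
  have e : z = (altBilin omegaC z y.1 / d) • x.1 + (altBilin omegaC x.1 z / d) • y.1 := by
    have hd : d = x.1.re * y.1.im - y.1.re * x.1.im := omegaC_apply _ _
    simp only [altBilin_apply, omegaC_apply]
    apply Complex.ext
    · simp only [Complex.add_re, Complex.real_smul, Complex.mul_re, Complex.ofReal_re,
        Complex.ofReal_im]
      field_simp
      rw [hd]; ring
    · simp only [Complex.add_im, Complex.real_smul, Complex.mul_im, Complex.ofReal_re,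
        Complex.ofReal_im]
      field_simp
      rw [hd]; ring
  have e2 : ((z, (altBilin omegaC z y.1 / d) • x.2 + (altBilin omegaC x.1 z / d) • y.2) :
      ℂ × TangentSpace I W.pt.2) =
      (altBilin omegaC z y.1 / d) • x + (altBilin omegaC x.1 z / d) • y := Prod.ext e rfl
  rw [e2]
  exact h

theorem notMem_reduce {W : LagGr (prodForm σ)} {t : ℝ} (hW : W.Avoids (t + Real.pi / 2))
    {f : TangentSpace I W.pt.2} (hf : (dirC (t + Real.pi / 2), f) ∈ W.prodPlane) :
    f ∉ (W.reduce t).plane := by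
  intro h
  obtain ⟨z, hz, h0⟩ := mem_reduce.1 h
  obtain ⟨c, rfl⟩ := eq_smul_dirC h0
  have h1 := (W.mem_prodPlane_iff _).1 hz _ hf
  simp only [map_smul, LinearMap.smul_apply, altBilin_dirC_add_pi_div_two, altBilin_self,
    smul_eq_mul, mul_one, add_zero] at h1
  subst h1
  apply hW
  have h2 := sub_mem hf hz
  have e : ((dirC (t + Real.pi / 2), f) - ((0 : ℝ) • dirC t, f) : ℂ × TangentSpace I W.pt.2) =
      (dirC (t + Real.pi / 2), 0) := by simp
  rwa [e] at h2

end Rotation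

section RotationPlots

variable {N m : ℕ} {M : Type*} [TopologicalSpace M] [ChartedSpace (EuclideanSpace ℝ (Fin N)) M]
  [IsManifold (𝓡 N) ∞ M] {η : SmoothForm (𝓡 N) M 2} {P : EuclideanSpace ℝ (Fin m) → LagGr η.toFun}
  {u : Set (EuclideanSpace ℝ (Fin m))} {f : ∀ y, TangentSpace (𝓡 N) (P y).pt}

theorem IsPlotOn.rotate (hP : IsPlotOn u P) (hf : SmoothAlong (𝓡 N) f u)
    (h : ∀ y ∈ u, f y ∉ (P y).plane) {s : EuclideanSpace ℝ (Fin m) → ℝ}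
    (hs : ContDiffOn ℝ ∞ s u) : IsPlotOn u (fun y => (P y).rotate (f y) (s y)) := by
  refine isPlotOn_of_kernel hP.1 fun x hx => ?_
  obtain ⟨v, hv, hxv, hvu, K, X, hX, hspan⟩ := hP.exists_fields hx
  let Y : Option (Fin K) → ∀ y, TangentSpace (𝓡 N) (P y).pt := fun o y =>
    o.elim (f y) fun i => X i y
  let l : Option (Fin K) → EuclideanSpace ℝ (Fin m) → ℝ := fun o y =>
    o.elim (Real.cos (s y)) fun i => altBilin (η.toFun (P y).pt) (X i y) (f y) * Real.sin (s y)
  refine ⟨v, hv, hxv, hvu, Option (Fin K), inferInstance, Y, l, ?_, ?_, fun y hy => ⟨?_, fun w => ?_⟩⟩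
  · rintro (_ | i)
    · exact hf.mono hvu
    · exact hX i
  · rintro (_ | i)
    · exact (hs.mono hvu).cos
    · exact (η.contDiffOn_pairing hv (hX i) (hf.mono hvu)).mul (hs.mono hvu).sin
  · by_cases hc : Real.cos (s y) = 0
    · have hsin : Real.sin (s y) ≠ 0 := fun h0 => by
        have := Real.sin_sq_add_cos_sq (s y)
        rw [hc, h0] at this
        norm_num at this
      obtain ⟨w, hw, hw0⟩ := (P y).exists_altBilin_ne_zero (h y (hvu hy))
      by_contra! hl
      rw [hspan y hy, mem_span_range_iff_sum] at hw
      obtain ⟨c, rfl⟩ := hw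
      apply hw0
      rw [map_sum, LinearMap.sum_apply]
      refine Finset.sum_eq_zero fun i _ => ?_
      have h1 : altBilin (η.toFun (P y).pt) (X i y) (f y) * Real.sin (s y) = 0 := hl (some i)
      rw [map_smul, LinearMap.smul_apply, (mul_eq_zero.1 h1).resolve_right hsin, smul_zero]
    · exact ⟨none, hc⟩
  · refine mem_rotate.trans ?_
    simp only [Fintype.sum_option, Y, l, Option.elim_none, Option.elim_some]
    constructor
    · rintro ⟨x, hx, a, h1, rfl⟩
      rw [hspan y hy, mem_span_range_iff_sum] at hx
      obtain ⟨c, rfl⟩ := hx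
      refine ⟨fun o => o.elim a c, add_comm _ _, ?_⟩
      rw [map_sum, LinearMap.sum_apply, Finset.sum_mul] at h1
      simp only [map_smul, LinearMap.smul_apply, smul_eq_mul, mul_assoc] at h1
      exact h1
    · rintro ⟨c, rfl, h1⟩
      refine ⟨∑ i, c (some i) • X i y, ?_, c none, ?_, add_comm _ _⟩
      · rw [hspan y hy, mem_span_range_iff_sum]
        exact ⟨fun i => c (some i), rfl⟩
      · rw [map_sum, LinearMap.sum_apply, Finset.sum_mul]
        simpa only [map_smul, LinearMap.smul_apply, smul_eq_mul, mul_assoc] using h1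

theorem IsPlotOn.eventually_notMem (hP : IsPlotOn u P) (hf : SmoothAlong (𝓡 N) f u)
    {x : EuclideanSpace ℝ (Fin m)} (hx : x ∈ u) (h : f x ∉ (P x).plane) :
    ∀ᶠ y in 𝓝 x, f y ∉ (P y).plane := by
  obtain ⟨v, hv, hxv, hvu, K, X, hX, hspan⟩ := hP.exists_fields hx
  obtain ⟨w, hw, hw0⟩ := (P x).exists_altBilin_ne_zero h
  obtain ⟨i, hi⟩ : ∃ i, altBilin (η.toFun (P x).pt) (X i x) (f x) ≠ 0 := by
    by_contra! hl
    rw [hspan x hxv, mem_span_range_iff_sum] at hw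
    obtain ⟨c, rfl⟩ := hw
    apply hw0
    rw [map_sum, LinearMap.sum_apply]
    exact Finset.sum_eq_zero fun i _ => by
      rw [map_smul, LinearMap.smul_apply, hl i, smul_zero]
  have hc : ContinuousAt (fun y => altBilin (η.toFun (P y).pt) (X i y) (f y)) x :=
    (η.contDiffOn_pairing hv (hX i) (hf.mono hvu)).continuousOn.continuousAt (hv.mem_nhds hxv)
  filter_upwards [hc.eventually_ne hi, hv.mem_nhds hxv] with y hy hyv hmem
  refine hy ((P y).altBilin_eq_zero ?_ hmem)
  rw [hspan y hyv]
  exact Submodule.subset_span ⟨i, rfl⟩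

end RotationPlots

end LagGr

/-! ### The period of an action form along rotation loops -/

namespace LagGr

section Period

variable {N m : ℕ} {M : Type*} [TopologicalSpace M] [ChartedSpace (EuclideanSpace ℝ (Fin N)) M]
  [IsManifold (𝓡 N) ∞ M] {σ : SymplecticForm (𝓡 N) M}
  {lam : DForm (lagGrDiffeology σ.toFun) 1}

/-- The integral of a form over the rotation loop of a plane in a direction. -/
def rotationPeriod (lam : DForm (lagGrDiffeology σ.toFun) 1) (U : LagGr σ.toFun)
    (f : TangentSpace (𝓡 N) U.pt) : ℝ :=
  lineInt lam (fun s => U.rotate f (s 0)) (-Real.pi) 0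

theorem covecForm_eq_zero {a : EuclideanSpace ℝ (Fin m) →L[ℝ] ℝ} (h : covecForm a = 0) : a = 0 := by
  ext v
  exact congrArg (fun A => A fun _ => v) h

theorem rotationPeriod_congr (hlam : IsActionForm σ lam) {P : EuclideanSpace ℝ (Fin m) → LagGr σ.toFun}
    (hP : IsPlotOn univ P) {f : ∀ y, TangentSpace (𝓡 N) (P y).pt} (hf : SmoothAlong (𝓡 N) f univ)
    (h : ∀ y, f y ∉ (P y).plane) (y y' : EuclideanSpace ℝ (Fin m)) :
    rotationPeriod lam (P y) (f y) = rotationPeriod lam (P y') (f y') := by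
  let S : EuclideanSpace ℝ (Fin (m + 1)) → LagGr σ.toFun := fun u =>
    (P (tailL m u)).rotate (f (tailL m u)) (u 0)
  have hPt : IsPlotOn univ (P ∘ tailL m) :=
    (lagGrDiffeology σ.toFun).plot_reparam (p := P) hP (tailL m).contDiff
  have hS : S ∈ (lagGrDiffeology σ.toFun).plots (m + 1) :=
    IsPlotOn.rotate (η := σ.toSmoothForm) hPt (hf.comp (tailL m).contDiff.contDiffOn (mapsTo_univ _ _))
      (fun u _ => h _) (EuclideanSpace.proj (𝕜 := ℝ) (0 : Fin (m + 1))).contDiff.contDiffOn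
  obtain ⟨h1, h2⟩ := lineInt_homotopy lam hS 0
    (hlam.d_val_homotopy hS 0 fun u => by simp only [S, tailL_joinL]; rfl) (-Real.pi) 0
  have e : (fun y => lineInt lam (fun s => S (joinL m (s 0, y))) (-Real.pi) 0) =
      fun y => rotationPeriod lam (P y) (f y) := by
    funext y
    simp only [S, tailL_joinL, joinL_zero]
    rfl
  rw [e] at h1 h2
  refine is_const_of_fderiv_eq_zero (𝕜 := ℝ) (h1.differentiable (by simp)) (fun z => ?_) y y'
  refine covecForm_eq_zero ((h2 z).trans (sub_eq_zero.2 (lam.val_of_eq _ _ ?_ z)))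
  funext z
  simp only [S, Function.comp_apply, tailL_joinL, joinL_zero, rotate_zero, rotate_neg_pi]

theorem smoothAlong_const {p : M} (f : TangentSpace (𝓡 N) p) {u : Set (EuclideanSpace ℝ (Fin m))} :
    SmoothAlong (𝓡 N) (p := fun _ : EuclideanSpace ℝ (Fin m) => p) (fun _ => f) u :=
  contMDiffOn_const

theorem rotationPeriod_eq_of_segment (hlam : IsActionForm σ lam) (U : LagGr σ.toFun)
    {f f' : TangentSpace (𝓡 N) U.pt} (h : ∀ a ∈ Icc (0 : ℝ) 1, (1 - a) • f + a • f' ∉ U.plane) :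
    rotationPeriod lam U f = rotationPeriod lam U f' := by
  have hτ : ContDiff ℝ ∞ fun y : EuclideanSpace ℝ (Fin 1) => Real.smoothTransition (y 0) :=
    Real.smoothTransition.contDiff.comp (EuclideanSpace.proj (𝕜 := ℝ) (0 : Fin 1)).contDiff
  have h1 := rotationPeriod_congr hlam (P := fun _ : EuclideanSpace ℝ (Fin 1) => U)
    ((lagGrDiffeology σ.toFun).constant_plots (n := 1) U)
    (f := fun y => (1 - Real.smoothTransition (y 0)) • f + Real.smoothTransition (y 0) • f')
    (((smoothAlong_const f).smul isOpen_univ (contDiff_const.sub hτ).contDiffOn).add isOpen_univ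
      ((smoothAlong_const f').smul isOpen_univ hτ.contDiffOn))
    (fun y => h _ ⟨Real.smoothTransition.nonneg _, Real.smoothTransition.le_one _⟩)
    (EuclideanSpace.single 0 0) (EuclideanSpace.single 0 1)
  simpa using h1

theorem rotationPeriod_neg (U : LagGr σ.toFun) (f : TangentSpace (𝓡 N) U.pt) :
    rotationPeriod lam U (-f) = rotationPeriod lam U f := by
  simp only [rotationPeriod, rotate_neg]

theorem rotationPeriod_eq (hlam : IsActionForm σ lam) (U : LagGr σ.toFun)
    {f f' : TangentSpace (𝓡 N) U.pt} (hf : f ∉ U.plane) (hf' : f' ∉ U.plane) :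
    rotationPeriod lam U f = rotationPeriod lam U f' := by
  by_cases h : ∀ a ∈ Icc (0 : ℝ) 1, (1 - a) • f + a • f' ∉ U.plane
  · exact rotationPeriod_eq_of_segment hlam U h
  · push Not at h
    obtain ⟨a, ha, hmem⟩ := h
    have ha0 : a ≠ 0 := by rintro rfl; apply hf; simpa using hmem
    have ha1 : a ≠ 1 := by rintro rfl; apply hf'; simpa using hmem
    have ha0' : 0 < a := lt_of_le_of_ne ha.1 ha0.symm
    have ha1' : a < 1 := lt_of_le_of_ne ha.2 ha1
    rw [← rotationPeriod_neg U f']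
    refine rotationPeriod_eq_of_segment hlam U fun b hb hb' => hf ?_
    have h1 := add_mem (Submodule.smul_mem _ b hmem) (Submodule.smul_mem _ a hb')
    have e : b • ((1 - a) • f + a • f') + a • ((1 - b) • f + b • -f') =
        (b * (1 - a) + a * (1 - b)) • f := by
      module
    rw [e] at h1
    have hpos : b * (1 - a) + a * (1 - b) ≠ 0 := by
      have h2 : 0 ≤ b * (1 - a) := mul_nonneg hb.1 (by linarith)
      have h3 : 0 ≤ a * (1 - b) := mul_nonneg ha.1 (by linarith [hb.2])
      intro h0
      have h4 : b * (1 - a) = 0 := by linarith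
      have h5 : a * (1 - b) = 0 := by linarith
      rcases mul_eq_zero.1 h4 with h | h
      · rw [h] at h5
        apply ha0; linarith
      · linarith
    exact (Submodule.smul_mem_iff _ hpos).1 h1

theorem exists_notMem (hN : 0 < N) (U : LagGr σ.toFun) : ∃ f, f ∉ U.plane := by
  by_contra! h
  let v : TangentSpace (𝓡 N) U.pt := (EuclideanSpace.single ⟨0, hN⟩ (1 : ℝ) : EuclideanSpace ℝ (Fin N))
  have h1 : v = 0 := σ.nondegenerate U.pt v fun w => U.altBilin_eq_zero (h v) (h w)
  have h2 : (EuclideanSpace.single (⟨0, hN⟩ : Fin N) (1 : ℝ) : EuclideanSpace ℝ (Fin N)) = 0 := h1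
  simpa using congrArg (fun x : EuclideanSpace ℝ (Fin N) => x ⟨0, hN⟩) h2

/-- The period of a form along the rotation loops based at a plane. -/
def fiberPeriod (lam : DForm (lagGrDiffeology σ.toFun) 1) (hN : 0 < N) (U : LagGr σ.toFun) : ℝ :=
  rotationPeriod lam U (exists_notMem hN U).choose

theorem fiberPeriod_eq (hlam : IsActionForm σ lam) (hN : 0 < N) (U : LagGr σ.toFun)
    {f : TangentSpace (𝓡 N) U.pt} (hf : f ∉ U.plane) :
    fiberPeriod lam hN U = rotationPeriod lam U f :=
  rotationPeriod_eq hlam U (exists_notMem hN U).choose_spec hf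

theorem eventually_fiberPeriod_eq (hlam : IsActionForm σ lam) (hN : 0 < N)
    {P : EuclideanSpace ℝ (Fin m) → LagGr σ.toFun} (hP : IsPlotOn univ P)
    (y : EuclideanSpace ℝ (Fin m)) :
    ∀ᶠ z in 𝓝 y, fiberPeriod lam hN (P z) = fiberPeriod lam hN (P y) := by
  obtain ⟨f₀, hf₀⟩ := exists_notMem hN (P y)
  obtain ⟨u, f, hu, hyu, -, hf, rfl⟩ := exists_smoothAlong isOpen_univ hP.1 (mem_univ y) f₀
  have hPu := hP.mono hu (subset_univ _)
  have h1 := IsPlotOn.eventually_notMem (η := σ.toSmoothForm) hPu hf hyu hf₀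
  obtain ⟨g, hg, hgU, hgy⟩ := exists_squash y (inter_mem h1 (hu.mem_nhds hyu))
  have hPg : IsPlotOn univ (P ∘ g) := (lagGrDiffeology σ.toFun).plot_reparam (p := P) hP hg
  have h2 := rotationPeriod_congr hlam hPg (f := fun z => f (g z))
    (hf.comp hg.contDiffOn fun z _ => (hgU z).2) (fun z => (hgU z).1)
  filter_upwards [hgy] with z hz
  have h3 := h2 z y
  have hy : g y = y := hgy.eq_of_nhds
  rw [fiberPeriod_eq hlam hN (P y) hf₀]
  have hz' : g z = z := hz
  have hfz : f z ∉ (P z).plane := hz' ▸ (hgU z).1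
  rw [fiberPeriod_eq hlam hN (P z) hfz]
  have key : ∀ w, w = z → rotationPeriod lam (P w) (f w) = rotationPeriod lam (P z) (f z) := by
    rintro _ rfl; rfl
  have key' : ∀ w, w = y → rotationPeriod lam (P w) (f w) = rotationPeriod lam (P y) (f y) := by
    rintro _ rfl; rfl
  exact (key _ hz').symm.trans (h3.trans (key' _ hy))

/-! ### The comparison of two reductions -/

/-- The integral of a form along the reductions with direction running from `a` to `b`. -/
def arcInt (lam : DForm (lagGrDiffeology σ.toFun) 1) (W : LagGr (prodForm σ.toFun)) (a b : ℝ) : ℝ :=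
  lineInt lam (fun s => W.reduce (a + (b - a) * Real.smoothTransition (s 0))) 0 1

theorem arc_mem (a b s : ℝ) : a + (b - a) * Real.smoothTransition s ∈ uIcc a b := by
  have h0 := Real.smoothTransition.nonneg s
  have h1 := Real.smoothTransition.le_one s
  have := (convex_uIcc a b) left_mem_uIcc right_mem_uIcc (sub_nonneg.2 h1) h0 (by ring)
  convert this using 1
  simp only [smul_eq_mul]
  ring

theorem contDiff_arc (a b : ℝ) : ContDiff ℝ ∞ fun s => a + (b - a) * Real.smoothTransition s :=
  contDiff_const.add (contDiff_const.mul Real.smoothTransition.contDiff)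

theorem arcInt_spec (hlam : IsActionForm σ lam)
    {P : EuclideanSpace ℝ (Fin m) → LagGr (prodForm σ.toFun)} (hP : IsPlotOn univ P) {a b : ℝ}
    (h : ∀ y, ∀ t ∈ uIcc a b, (P y).Avoids t) :
    ContDiff ℝ ∞ (fun y => arcInt lam (P y) a b) ∧
    ∀ (ha : (fun y => (P y).reduce a) ∈ (lagGrDiffeology σ.toFun).plots m)
      (hb : (fun y => (P y).reduce b) ∈ (lagGrDiffeology σ.toFun).plots m) y,
      covecForm (fderiv ℝ (fun y => arcInt lam (P y) a b) y) = lam.val _ hb y - lam.val _ ha y := by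
  let S : EuclideanSpace ℝ (Fin (m + 1)) → LagGr σ.toFun := fun u =>
    (P (tailL m u)).reduce (a + (b - a) * Real.smoothTransition (u 0))
  have hPt : IsPlotOn univ (P ∘ tailL m) :=
    (lagGrDiffeology (prodForm σ.toFun)).plot_reparam (p := P) hP (tailL m).contDiff
  have hS : S ∈ (lagGrDiffeology σ.toFun).plots (m + 1) :=
    hPt.reduce ((contDiff_arc a b).comp
      (EuclideanSpace.proj (𝕜 := ℝ) (0 : Fin (m + 1))).contDiff).contDiffOn
      (fun u _ => h _ _ (arc_mem a b _))
  obtain ⟨h1, h2⟩ := lineInt_homotopy lam hS 0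
    (hlam.d_val_homotopy hS 0 fun u => by simp only [S, tailL_joinL]; rfl) 0 1
  have e : (fun y => lineInt lam (fun s => S (joinL m (s 0, y))) 0 1) =
      fun y => arcInt lam (P y) a b := by
    funext y
    simp only [S, tailL_joinL, joinL_zero]
    rfl
  rw [e] at h1 h2
  refine ⟨h1, fun ha hb y => (h2 y).trans ?_⟩
  congr 1
  · refine lam.val_of_eq _ _ (funext fun z => ?_) y
    simp [S]
  · refine lam.val_of_eq _ _ (funext fun z => ?_) y
    simp [S]

theorem reducePath_mem_plots {W : LagGr (prodForm σ.toFun)} (hW : ∀ t, W.Avoids t) :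
    (fun s : EuclideanSpace ℝ (Fin 1) => W.reduce (s 0)) ∈ (lagGrDiffeology σ.toFun).plots 1 :=
  IsPlotOn.reduce (P := fun _ : EuclideanSpace ℝ (Fin 1) => W)
    ((lagGrDiffeology (prodForm σ.toFun)).constant_plots (n := 1) W)
    (EuclideanSpace.proj (𝕜 := ℝ) (0 : Fin 1)).contDiff.contDiffOn fun _ _ => hW _

theorem arcInt_eq {W : LagGr (prodForm σ.toFun)} (hW : ∀ t, W.Avoids t) (a b : ℝ) :
    arcInt lam W a b = lineInt lam (fun s => W.reduce (s 0)) a b := by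
  have h := lineInt_comp lam (reducePath_mem_plots hW) (contDiff_arc a b) 0 1
  simpa [arcInt] using h

/-- On planes transverse to `ℂ`, the two arcs differ by the period. -/
theorem arcInt_eq_add (hlam : IsActionForm σ lam) (hN : 0 < N) {W : LagGr (prodForm σ.toFun)}
    (hW : ∀ t, W.Avoids t) (a b : ℝ) :
    arcInt lam W a b = arcInt lam W a (b - Real.pi) + fiberPeriod lam hN (W.reduce b) := by
  obtain ⟨f, hf⟩ := exists_mem_prodPlane hW (dirC (b + Real.pi / 2))
  have h1 : rotationPeriod lam (W.reduce b) f = lineInt lam (fun s => W.reduce (s 0)) (b - Real.pi) b := by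
    have h := lineInt_comp lam (reducePath_mem_plots hW) (g := fun s => b + s)
      (contDiff_const.add contDiff_id) (-Real.pi) 0
    rw [add_zero, ← sub_eq_add_neg] at h
    rw [← h]
    simp only [rotationPeriod, PiLp.single_apply, ↓reduceIte]
    congr 1
    funext s
    exact (reduce_eq_rotate W b (s 0) hf).symm
  rw [fiberPeriod_eq hlam hN (W.reduce b) (notMem_reduce (hW _) hf), h1, arcInt_eq hW, arcInt_eq hW,
    lineInt_add lam (reducePath_mem_plots hW)]

open scoped Classical in
/-- A primitive of the difference of the reductions in the directions `a` and `b`. -/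
def transition (lam : DForm (lagGrDiffeology σ.toFun) 1) (hN : 0 < N) (a b : ℝ)
    (W : LagGr (prodForm σ.toFun)) : ℝ :=
  if ∀ t ∈ uIcc a b, W.Avoids t then arcInt lam W a b
  else arcInt lam W a (b - Real.pi) + fiberPeriod lam hN (W.reduce b)

theorem avoids_of_avoids_arcs {W : LagGr (prodForm σ.toFun)} {a b : ℝ} (hab : a ≤ b)
    (hba : b - Real.pi ≤ a)
    (h1 : ∀ t ∈ uIcc a b, W.Avoids t) (h2 : ∀ t ∈ uIcc a (b - Real.pi), W.Avoids t) (t : ℝ) :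
    W.Avoids t := by
  have hper : Function.Periodic (fun t => W.Avoids t) Real.pi := fun t =>
    propext (avoids_add_pi W t)
  obtain ⟨s, hs, hst⟩ := hper.exists_mem_Ico Real.pi_pos t (b - Real.pi)
  rw [show W.Avoids t = W.Avoids s from hst]
  by_cases hsa : s ≤ a
  · exact h2 s (by rw [uIcc_of_ge hba]; exact ⟨hs.1, hsa⟩)
  · exact h1 s (by rw [uIcc_of_le hab]; exact ⟨(not_le.1 hsa).le, by linarith [hs.2]⟩)

theorem transition_eq (hlam : IsActionForm σ lam) (hN : 0 < N) {a b : ℝ} (hab : a ≤ b)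
    (hba : b - Real.pi ≤ a) {W : LagGr (prodForm σ.toFun)}
    (h : ∀ t ∈ uIcc a (b - Real.pi), W.Avoids t) :
    transition lam hN a b W = arcInt lam W a (b - Real.pi) + fiberPeriod lam hN (W.reduce b) := by
  rw [transition]
  split_ifs with h1
  · exact arcInt_eq_add hlam hN (avoids_of_avoids_arcs hab hba h1 h) a b
  · rfl

theorem avoids_arc_or {W : LagGr (prodForm σ.toFun)} {a b : ℝ} (hab : a ≤ b)
    (hba : b - Real.pi ≤ a) (ha : W.Avoids a) (hb : W.Avoids b) :
    (∀ t ∈ uIcc a b, W.Avoids t) ∨ ∀ t ∈ uIcc a (b - Real.pi), W.Avoids t := by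
  by_contra! h
  obtain ⟨⟨t, ht, hta⟩, s, hs, hsa⟩ := h
  rw [uIcc_of_le hab] at ht
  rw [uIcc_of_ge hba] at hs
  have hsin : Real.sin (t - s) = 0 := by
    by_contra h0
    rcases W.avoids_or_avoids h0 with h | h
    · exact hsa h
    · exact hta h
  rcases eq_or_lt_of_le (show s ≤ t by linarith [hs.2, ht.1]) with h | h
  · obtain rfl : t = a := le_antisymm (h ▸ hs.2) ht.1
    exact hta ha
  · rcases eq_or_lt_of_le (show t - s ≤ Real.pi by linarith [hs.1, ht.2]) with h' | h'
    · obtain rfl : t = b := le_antisymm ht.2 (by linarith [hs.1])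
      exact hta hb
    · exact (Real.sin_pos_of_pos_of_lt_pi (by linarith) h').ne' hsin

theorem transition_spec (hlam : IsActionForm σ lam) (hN : 0 < N) {a b : ℝ} (hab : a ≤ b)
    (hba : b - Real.pi ≤ a)
    {P : EuclideanSpace ℝ (Fin m) → LagGr (prodForm σ.toFun)} (hP : IsPlotOn univ P)
    (hPa : ∀ y, (P y).Avoids a) (hPb : ∀ y, (P y).Avoids b) :
    ContDiff ℝ ∞ (fun y => transition lam hN a b (P y)) ∧
    ∀ (ha : (fun y => (P y).reduce a) ∈ (lagGrDiffeology σ.toFun).plots m)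
      (hb : (fun y => (P y).reduce b) ∈ (lagGrDiffeology σ.toFun).plots m) y,
      covecForm (fderiv ℝ (fun y => transition lam hN a b (P y)) y) =
        lam.val _ hb y - lam.val _ ha y := by
  have ha : (fun y => (P y).reduce a) ∈ (lagGrDiffeology σ.toFun).plots m :=
    hP.reduce (t := fun _ => a) contDiffOn_const fun y _ => hPa y
  have hb : (fun y => (P y).reduce b) ∈ (lagGrDiffeology σ.toFun).plots m :=
    hP.reduce (t := fun _ => b) contDiffOn_const fun y _ => hPb y
  have key : ∀ y, ContDiffAt ℝ ∞ (fun y => transition lam hN a b (P y)) y ∧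
      covecForm (fderiv ℝ (fun y => transition lam hN a b (P y)) y) =
        lam.val _ hb y - lam.val _ ha y := by
    intro y
    have hloc : ∀ c, (∀ t ∈ uIcc a c, (P y).Avoids t) →
        ∃ g : EuclideanSpace ℝ (Fin m) → EuclideanSpace ℝ (Fin m), ContDiff ℝ ∞ g ∧
          (∀ z, ∀ t ∈ uIcc a c, (P (g z)).Avoids t) ∧ g =ᶠ[𝓝 y] id := fun c hc =>
      exists_squash y (hP.eventually_forall_avoids (mem_univ y) isCompact_uIcc hc)
    have hfin : ∀ (g : EuclideanSpace ℝ (Fin m) → EuclideanSpace ℝ (Fin m)) (hg : ContDiff ℝ ∞ g),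
        g =ᶠ[𝓝 y] id → ∀ c (hc' : (fun y => (P y).reduce c) = fun y => (P y).reduce b),
        (∀ z, ∀ t ∈ uIcc a c, (P (g z)).Avoids t) → ∀ C : ℝ,
        (fun y => transition lam hN a b (P y)) =ᶠ[𝓝 y] (fun z => arcInt lam (P (g z)) a c + C) →
        ContDiffAt ℝ ∞ (fun y => transition lam hN a b (P y)) y ∧
          covecForm (fderiv ℝ (fun y => transition lam hN a b (P y)) y) =
          lam.val _ hb y - lam.val _ ha y := by
      intro g hg hgy c hc' hc C hC
      have hPg : IsPlotOn univ (P ∘ g) :=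
        (lagGrDiffeology (prodForm σ.toFun)).plot_reparam (p := P) hP hg
      obtain ⟨h1, h2⟩ := arcInt_spec hlam hPg hc
      refine ⟨(h1.contDiffAt.add contDiffAt_const).congr_of_eventuallyEq hC, ?_⟩
      rw [hC.fderiv_eq, fderiv_add_const]
      have hag : (fun z => (P (g z)).reduce a) ∈ (lagGrDiffeology σ.toFun).plots m :=
        (lagGrDiffeology σ.toFun).plot_reparam ha hg
      have hcg : (fun z => (P (g z)).reduce c) ∈ (lagGrDiffeology σ.toFun).plots m := by
        have h3 := (lagGrDiffeology σ.toFun).plot_reparam hb hg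
        rw [← hc'] at h3
        exact h3
      refine (h2 hag hcg y).trans ?_
      congr 1
      · refine lam.val_congr hcg hb ?_
        filter_upwards [hgy] with z hz
        rw [show g z = z from hz]
        exact congrFun hc' z
      · refine lam.val_congr hag ha ?_
        filter_upwards [hgy] with z hz
        rw [show g z = z from hz]
    rcases avoids_arc_or hab hba (hPa y) (hPb y) with h | h
    · obtain ⟨g, hg, hgc, hgy⟩ := hloc b h
      refine hfin g hg hgy b rfl hgc 0 ?_
      filter_upwards [hgy] with z hz
      have hz' : g z = z := hz
      rw [transition, if_pos (hz' ▸ hgc z), hz', add_zero]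
    · obtain ⟨g, hg, hgc, hgy⟩ := hloc (b - Real.pi) h
      refine hfin g hg hgy (b - Real.pi) ?_ hgc (fiberPeriod lam hN ((P y).reduce b)) ?_
      · funext z
        have := reduce_add_pi (P z) (b - Real.pi)
        rw [sub_add_cancel] at this
        exact this.symm
      · filter_upwards [hgy, eventually_fiberPeriod_eq hlam hN hb y] with z hz hz2
        have hz' : g z = z := hz
        rw [transition_eq hlam hN hab hba (hz' ▸ hgc z), hz', hz2]
  exact ⟨contDiff_iff_contDiffAt.2 fun y => (key y).1, fun _ _ y => (key y).2⟩

end Period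

end LagGr

/-! ### Extension of action forms along stable Lagrangian planes -/

theorem extDeriv_covecForm_fderiv {m : ℕ} {f : EuclideanSpace ℝ (Fin m) → ℝ}
    (hf : ContDiff ℝ ∞ f) : extDeriv (fun u => covecForm (fderiv ℝ f u)) = 0 := by
  have e : (fun u => covecForm (fderiv ℝ f u)) =
      extDeriv fun u => ContinuousAlternatingMap.constOfIsEmpty ℝ (EuclideanSpace ℝ (Fin m))
        (Fin 0) (f u) := funext fun u => (extDeriv_constOfIsEmpty f u).symm
  rw [e]
  exact extDeriv_extDeriv ((ContinuousAlternatingMap.constOfIsEmptyLIE ℝ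
    (EuclideanSpace ℝ (Fin m)) ℝ (Fin 0)).contDiff.comp hf)
    (by simp; exact WithTop.coe_le_coe.2 le_top)

theorem contDiff_covecForm_fderiv {m : ℕ} {f : EuclideanSpace ℝ (Fin m) → ℝ}
    (hf : ContDiff ℝ ∞ f) : ContDiff ℝ ∞ (fun u => covecForm (fderiv ℝ f u)) :=
  (ContinuousAlternatingMap.ofSubsingletonLIE (𝕜 := ℝ) (E := EuclideanSpace ℝ (Fin m))
    (F := ℝ) (0 : Fin 1)).contDiff.comp (hf.fderiv_right (m := ∞) (by simp))

namespace LagGr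

section Extension

variable {N : ℕ} {M : Type*} [TopologicalSpace M] [ChartedSpace (EuclideanSpace ℝ (Fin N)) M]
  [IsManifold (𝓡 N) ∞ M] {σ : SymplecticForm (𝓡 N) M}
  {lam : DForm (lagGrDiffeology σ.toFun) 1}
  {X : Type*} {D : DiffeologicalSpace X} {G : X → LagGr (prodForm σ.toFun)}
  {ρ : Bool → X → ℝ} {c : Bool → ℝ}

/-- The two functions correcting the reductions on the two domains. -/
def correction (lam : DForm (lagGrDiffeology σ.toFun) 1) (hN : 0 < N)
    (G : X → LagGr (prodForm σ.toFun)) (ρ : Bool → X → ℝ) (c : Bool → ℝ) (i : Bool) (x : X) : ℝ :=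
  (bif i then 1 else -1) * (ρ (!i) x * transition lam hN (c true) (c false) (G x))

theorem reduce_comp_mem_plots
    (hG : @Diffeology.DSmooth X _ D (lagGrDiffeology (prodForm σ.toFun)) G) {m : ℕ}
    {R : EuclideanSpace ℝ (Fin m) → X} (hR : R ∈ D.plots m) {t : ℝ}
    (h : ∀ y, (G (R y)).Avoids t) :
    (fun y => (G (R y)).reduce t) ∈ (lagGrDiffeology σ.toFun).plots m :=
  IsPlotOn.reduce (P := fun y => G (R y)) (hG m R hR) (t := fun _ => t) contDiffOn_const
    fun y _ => h y

theorem contDiff_correction (hlam : IsActionForm σ lam) (hN : 0 < N)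
    (hc : c true ≤ c false) (hc' : c false - Real.pi ≤ c true)
    (hG : @Diffeology.DSmooth X _ D (lagGrDiffeology (prodForm σ.toFun)) G)
    (hρ : ∀ i, ∀ {m : ℕ} (P : EuclideanSpace ℝ (Fin m) → X), P ∈ D.plots m → ContDiff ℝ ∞ (ρ i ∘ P))
    (hsupp : ∀ i, ∀ {m : ℕ} (P : EuclideanSpace ℝ (Fin m) → X), P ∈ D.plots m → ∀ u,
      (G (P u)).Avoids (c i) ∨ ∀ᶠ y in 𝓝 u, ρ i (P y) = 0)
    (i : Bool) {m : ℕ} {R : EuclideanSpace ℝ (Fin m) → X} (hR : R ∈ D.plots m)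
    (h : ∀ y, (G (R y)).Avoids (c i)) : ContDiff ℝ ∞ (correction lam hN G ρ c i ∘ R) := by
  refine contDiff_iff_contDiffAt.2 fun u => contDiffAt_const.mul ?_
  rcases hsupp (!i) R hR u with h1 | h1
  · have hP : IsPlotOn univ (fun y => G (R y)) := hG m R hR
    have h2 : ∀ᶠ y in 𝓝 u, (G (R y)).Avoids (c !i) := by
      have h3 := hP.eventually_forall_avoids (mem_univ u) (K := {c !i}) isCompact_singleton
        (fun t ht => by rw [mem_singleton_iff.1 ht]; exact h1)
      filter_upwards [h3] with y hy using hy _ rfl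
    obtain ⟨g, hg, hgU, hgu⟩ := exists_squash u h2
    have hall : ∀ j y, (G (R (g y))).Avoids (c j) := by
      intro j y
      by_cases hj : j = i
      · exact hj ▸ h (g y)
      · have : j = !i := by cases i <;> cases j <;> simp_all
        exact this ▸ hgU y
    have h4 := (transition_spec hlam hN hc hc' (hG m _ (D.plot_reparam hR hg)) (hall true)
      (hall false)).1
    refine (hρ (!i) R hR).contDiffAt.mul (h4.contDiffAt.congr_of_eventuallyEq ?_)
    filter_upwards [hgu] with y hy
    simp only [Function.comp_apply, show g y = y from hy]
  · refine (contDiffAt_const (c := (0 : ℝ))).congr_of_eventuallyEq ?_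
    filter_upwards [h1] with y hy
    rw [hy, zero_mul]

/-- The local expression of the extended form. -/
def localForm (lam : DForm (lagGrDiffeology σ.toFun) 1) (hN : 0 < N)
    (G : X → LagGr (prodForm σ.toFun)) (ρ : Bool → X → ℝ) (c : Bool → ℝ) (i : Bool) {m : ℕ}
    (R : EuclideanSpace ℝ (Fin m) → X)
    (h : (fun y => (G (R y)).reduce (c i)) ∈ (lagGrDiffeology σ.toFun).plots m)
    (u : EuclideanSpace ℝ (Fin m)) : EuclideanSpace ℝ (Fin m) [⋀^Fin 1]→L[ℝ] ℝ :=
  lam.val _ h u + covecForm (fderiv ℝ (correction lam hN G ρ c i ∘ R) u)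

theorem localForm_congr (hN : 0 < N) (i : Bool) {m : ℕ} {R R' : EuclideanSpace ℝ (Fin m) → X}
    (h : (fun y => (G (R y)).reduce (c i)) ∈ (lagGrDiffeology σ.toFun).plots m)
    (h' : (fun y => (G (R' y)).reduce (c i)) ∈ (lagGrDiffeology σ.toFun).plots m)
    {u : EuclideanSpace ℝ (Fin m)} (e : R =ᶠ[𝓝 u] R') :
    localForm lam hN G ρ c i R h u = localForm lam hN G ρ c i R' h' u := by
  rw [localForm, localForm, lam.val_congr h h' (e.fun_comp fun x => (G x).reduce (c i)),
    (e.fun_comp (correction lam hN G ρ c i)).fderiv_eq]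

theorem localForm_eq (hlam : IsActionForm σ lam) (hN : 0 < N)
    (hc : c true ≤ c false) (hc' : c false - Real.pi ≤ c true)
    (hG : @Diffeology.DSmooth X _ D (lagGrDiffeology (prodForm σ.toFun)) G)
    (hρ : ∀ i, ∀ {m : ℕ} (P : EuclideanSpace ℝ (Fin m) → X), P ∈ D.plots m → ContDiff ℝ ∞ (ρ i ∘ P))
    (hsum : ∀ x, ρ true x + ρ false x = 1)
    {m : ℕ} {R : EuclideanSpace ℝ (Fin m) → X} (hR : R ∈ D.plots m)
    (hall : ∀ i y, (G (R y)).Avoids (c i)) (u : EuclideanSpace ℝ (Fin m)) :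
    localForm lam hN G ρ c true R (reduce_comp_mem_plots hG hR (hall true)) u =
      localForm lam hN G ρ c false R (reduce_comp_mem_plots hG hR (hall false)) u := by
  obtain ⟨h1, h2⟩ := transition_spec hlam hN hc hc' (hG m R hR) (hall true) (hall false)
  set k : EuclideanSpace ℝ (Fin m) → ℝ := fun y =>
    transition lam hN (c true) (c false) ((G ∘ R) y) with hk
  have e1 : correction lam hN G ρ c true ∘ R = fun y => ρ false (R y) * k y := by
    funext y; simp [correction, hk]
  have e2 : correction lam hN G ρ c false ∘ R = fun y => ρ false (R y) * k y - k y := by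
    funext y
    simp only [correction, hk, Function.comp_apply, cond_false, Bool.not_false]
    linear_combination (-transition lam hN (c true) (c false) (G (R y))) * hsum (R y)
  have hd : ContDiff ℝ ∞ fun y => ρ false (R y) * k y := (hρ false R hR).mul h1
  rw [localForm, localForm, e1, e2, fderiv_fun_sub (hd.differentiable (by simp) u)
    (h1.differentiable (by simp) u)]
  have h3 : covecForm (fderiv ℝ k u) =
      lam.val (fun y => (G (R y)).reduce (c false)) (reduce_comp_mem_plots hG hR (hall false)) u -
      lam.val (fun y => (G (R y)).reduce (c true)) (reduce_comp_mem_plots hG hR (hall true)) u :=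
    h2 (reduce_comp_mem_plots hG hR (hall true)) (reduce_comp_mem_plots hG hR (hall false)) u
  ext v
  have h4 := congrArg (fun A => A v) h3
  simp only [ContinuousAlternatingMap.add_apply, ContinuousAlternatingMap.sub_apply,
    ContinuousAlternatingMap.ofSubsingleton_apply_apply, _root_.sub_apply] at h4 ⊢
  linarith

/-- The pullbacks of an action form under two different reductions fit together, up to exact
forms, to a form with the expected differential. -/
theorem exists_extension (hlam : IsActionForm σ lam) (hN : 0 < N)
    (hc : c true < c false) (hc' : c false - Real.pi < c true)
    (hG : @Diffeology.DSmooth X _ D (lagGrDiffeology (prodForm σ.toFun)) G)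
    (hρ : ∀ i, ∀ {m : ℕ} (P : EuclideanSpace ℝ (Fin m) → X), P ∈ D.plots m → ContDiff ℝ ∞ (ρ i ∘ P))
    (hsupp : ∀ i, ∀ {m : ℕ} (P : EuclideanSpace ℝ (Fin m) → X), P ∈ D.plots m → ∀ u,
      (G (P u)).Avoids (c i) ∨ ∀ᶠ y in 𝓝 u, ρ i (P y) = 0)
    (hsum : ∀ x, ρ true x + ρ false x = 1) :
    ∃ A : DForm D 1,
      (∀ {m : ℕ} (P : EuclideanSpace ℝ (Fin m) → X) (hP : P ∈ D.plots m) u,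
        (DForm.d A).val P hP u = σ.toFun.pull (fun y => (G (P y)).pt.2) u) ∧
      ∀ {m : ℕ} (R : EuclideanSpace ℝ (Fin m) → X) (hR : R ∈ D.plots m)
        (h : ∀ y, (G (R y)).Avoids (c true)) u,
        A.val R hR u = localForm lam hN G ρ c true R (reduce_comp_mem_plots hG hR h) u := by
  have hor : ∀ W : LagGr (prodForm σ.toFun), ∃ i, W.Avoids (c i) := fun W => by
    have hs : Real.sin (c false - c true) ≠ 0 :=
      (Real.sin_pos_of_pos_of_lt_pi (by linarith) (by linarith)).ne'
    rcases W.avoids_or_avoids hs with h | h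
    · exact ⟨true, h⟩
    · exact ⟨false, h⟩
  have hopen : ∀ {m : ℕ} (P : EuclideanSpace ℝ (Fin m) → X), P ∈ D.plots m → ∀ u t,
      (G (P u)).Avoids t → ∀ᶠ y in 𝓝 u, (G (P y)).Avoids t := fun {m} P hP u t h1 => by
    have hP' : IsPlotOn univ (fun y => G (P y)) := hG m P hP
    have h3 := hP'.eventually_forall_avoids (mem_univ u) (K := {t}) isCompact_singleton
        (fun t' ht => by rw [mem_singleton_iff.1 ht]; exact h1)
    filter_upwards [h3] with y hy using hy _ rfl
  obtain ⟨A, hA⟩ := DForm.exists_ofLocal D 1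
    (fun {m} P u W => ∃ (i : Bool) (R : EuclideanSpace ℝ (Fin m) → X) (hR : R ∈ D.plots m)
      (h : ∀ y, (G (R y)).Avoids (c i)), P =ᶠ[𝓝 u] R ∧
        W = localForm lam hN G ρ c i R (reduce_comp_mem_plots hG hR h))
    (fun {m} P hP u => by
      obtain ⟨i, hi⟩ := hor (G (P u))
      obtain ⟨g, hg, hgU, hgu⟩ := exists_squash u (hopen P hP u _ hi)
      exact ⟨_, i, P ∘ g, D.plot_reparam hP hg, hgU, (hgu.fun_comp P).symm, rfl⟩)
    (fun {m} P hP u W => by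
      rintro ⟨i, R, hR, h, -, rfl⟩
      exact ((lam.smooth _ _).add (contDiff_covecForm_fderiv
        (contDiff_correction hlam hN hc.le hc'.le hG hρ hsupp i hR h))).contDiffAt)
    (fun {m} P hP u W => by
      rintro ⟨i, R, hR, h, e, rfl⟩
      filter_upwards [eventually_eventually_nhds.2 e] with y hy
      exact ⟨i, R, hR, h, hy, rfl⟩)
    (fun {m} P hP u W W' => by
      rintro ⟨i, R, hR, h, e, rfl⟩ ⟨i', R', hR', h', e', rfl⟩
      have key : ∀ (R R' : EuclideanSpace ℝ (Fin m) → X) (hR : R ∈ D.plots m) (hR' : R' ∈ D.plots m)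
          (h : ∀ y, (G (R y)).Avoids (c true)) (h' : ∀ y, (G (R' y)).Avoids (c false)),
          P =ᶠ[𝓝 u] R → P =ᶠ[𝓝 u] R' →
          localForm lam hN G ρ c true R (reduce_comp_mem_plots hG hR h) u =
            localForm lam hN G ρ c false R' (reduce_comp_mem_plots hG hR' h') u := by
        intro R R' hR hR' h h' e e'
        have e2 : R =ᶠ[𝓝 u] R' := e.symm.trans e'
        obtain ⟨g, hg, hgU, hgu⟩ := exists_squash u e2
        have hall : ∀ i y, (G ((R ∘ g) y)).Avoids (c i) := by
          rintro (_ | _) y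
          · rw [Function.comp_apply, show R (g y) = R' (g y) from hgU y]
            exact h' _
          · exact h _
        have e3 : R =ᶠ[𝓝 u] R ∘ g := (hgu.fun_comp R).symm
        rw [localForm_congr hN true _ (reduce_comp_mem_plots hG (D.plot_reparam hR hg) (hall true)) e3,
          localForm_congr hN false _ (reduce_comp_mem_plots hG (D.plot_reparam hR hg) (hall false))
            (e2.symm.trans e3)]
        exact localForm_eq hlam hN hc.le hc'.le hG hρ hsum (D.plot_reparam hR hg) hall u
      cases i <;> cases i'
      · exact localForm_congr hN _ _ _ (e.symm.trans e')
      · exact (key _ _ hR' hR h' h e' e).symm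
      · exact key _ _ hR hR' h h' e e'
      · exact localForm_congr hN _ _ _ (e.symm.trans e'))
    (fun {m m'} P hP g hg u W => by
      rintro ⟨i, R, hR, h, e, rfl⟩
      refine ⟨_, ⟨i, R ∘ g, D.plot_reparam hR hg, fun y => h (g y),
        hg.continuous.continuousAt.eventually e, rfl⟩, ?_⟩
      have hk := contDiff_correction hlam hN hc.le hc'.le hG hρ hsupp i hR h
      have h1 := lam.natural _ (reduce_comp_mem_plots hG hR h) g hg u
      have h2 : fderiv ℝ ((correction lam hN G ρ c i ∘ R) ∘ g) u = _ :=
        fderiv_comp u (hk.differentiable (by simp) (g u)) (hg.differentiable (by simp) u)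
      rw [localForm, localForm, ← Function.comp_assoc, h2, ← covecForm_comp]
      exact (congrArg (· + _) h1).trans rfl)
  refine ⟨A, fun {m} P hP u => ?_, fun {m} R hR h u => ?_⟩
  · obtain ⟨i, hi⟩ := hor (G (P u))
    obtain ⟨g, hg, hgU, hgu⟩ := exists_squash u (hopen P hP u _ hi)
    have hR := D.plot_reparam hP hg
    have h1 := hA P hP u _ ⟨i, P ∘ g, hR, hgU, (hgu.fun_comp P).symm, rfl⟩
    have hk := contDiff_correction hlam hN hc.le hc'.le hG hρ hsupp i hR hgU
    rw [DForm.d_val, h1.extDeriv_eq]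
    have h2 : extDeriv (localForm lam hN G ρ c i (P ∘ g) (reduce_comp_mem_plots hG hR hgU)) u =
        (DForm.d lam).val _ (reduce_comp_mem_plots hG hR hgU) u +
          extDeriv (fun u => covecForm (fderiv ℝ (correction lam hN G ρ c i ∘ P ∘ g) u)) u :=
      extDeriv_fun_add ((lam.smooth _ _).differentiable (by simp) u)
        ((contDiff_covecForm_fderiv hk).differentiable (by simp) u)
    rw [h2, extDeriv_covecForm_fderiv hk, hlam, Pi.zero_apply, add_zero]
    have hpl : (fun y => (G (P y)).pt.2) ∈ (manifoldDiffeology (𝓡 N) M).plots m :=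
      contMDiff_snd.comp (contMDiffOn_univ.1 (hG m P hP).1)
    refine σ.toSmoothForm.toDForm.val_congr (LagGr.smooth_pt σ.toFun _ _
      (reduce_comp_mem_plots hG hR hgU)) hpl ?_
    filter_upwards [hgu] with y hy
    exact congrArg (fun y => (G (P y)).pt.2) hy
  · exact (hA R hR u _ ⟨true, R, hR, h, EventuallyEq.rfl, rfl⟩).eq_of_nhds

end Extension

end LagGr

/-! ### Stable planes -/

namespace LagGr

section Stable

variable {E : Type*} [NormedAddCommGroup E] [NormedSpace ℝ E]
  {H : Type*} [TopologicalSpace H] {I : ModelWithCorners ℝ E H}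
  {M : Type*} [TopologicalSpace M] [ChartedSpace H M]
  {σ : FormField I M 2}

/-- `W` is the direct sum of the real line in `ℂ` and the plane `U`. -/
structure IsStableOver (W : LagGr (prodForm σ)) (U : LagGr σ) : Prop where
  pt_eq : W.pt.2 = U.pt
  one_mem : ((1, 0) : ℂ × TangentSpace I W.pt.2) ∈ W.prodPlane
  mem : ∀ w : E, (w : TangentSpace I U.pt) ∈ U.plane →
    ((0, w) : ℂ × TangentSpace I W.pt.2) ∈ W.prodPlane

variable {W : LagGr (prodForm σ)} {U : LagGr σ}

theorem IsStableOver.mem_iff (h : W.IsStableOver U) (z : ℂ) (w : E) :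
    ((z, w) : ℂ × TangentSpace I W.pt.2) ∈ W.prodPlane ↔
      z.im = 0 ∧ (w : TangentSpace I U.pt) ∈ U.plane := by
  obtain ⟨h0, h1, h2⟩ := h
  rcases U with ⟨p, A, hA⟩
  change W.pt.2 = p at h0
  subst h0
  change TangentSpace I W.pt.2 at w
  constructor
  · intro hz
    have h3 := (W.mem_prodPlane_iff _).1 hz _ h1
    rw [altBilin_apply, omegaC_apply, map_zero, add_zero] at h3
    refine ⟨by simpa using h3, (hA w).2 fun w' hw' => ?_⟩
    have h4 := (W.mem_prodPlane_iff _).1 hz _ (h2 w' hw')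
    rwa [map_zero, zero_add] at h4
  · rintro ⟨hz, hw⟩
    have h3 := add_mem (Submodule.smul_mem _ z.re h1) (h2 w hw)
    have e : z.re • ((1, 0) : ℂ × TangentSpace I W.pt.2) + (0, w) = (z, w) := by
      refine Prod.ext (Complex.ext ?_ ?_) ?_
      · simp
      · simp [hz]
      · simp
    rwa [e] at h3

theorem IsStableOver.avoids (h : W.IsStableOver U) {t : ℝ} (ht : Real.sin t ≠ 0) : W.Avoids t :=
  fun h1 => ht ((h.mem_iff (dirC t) 0).1 h1).1

theorem IsStableOver.reduce_eq (h : W.IsStableOver U) (t : ℝ) :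
    W.reduce t = U := by
  have h1 := h.mem_iff
  obtain ⟨h0, -, -⟩ := h
  rcases U with ⟨p, A, hA⟩
  change W.pt.2 = p at h0
  subst h0
  refine ext_mem fun w => mem_reduce.trans ?_
  constructor
  · rintro ⟨z, hz, -⟩
    exact ((h1 z w).1 hz).2
  · intro hw
    exact ⟨0, (h1 0 w).2 ⟨rfl, hw⟩, map_zero _⟩

/-- Translation of the base point in the direction of `ℂ` to `0`. -/
def recenter (W : LagGr (prodForm σ)) : LagGr (prodForm σ) where
  pt := (0, W.pt.2)
  plane := W.prodPlane
  isLagrangian := W.isLagrangian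

theorem IsStableOver.recenter_eq (h : W.IsStableOver U) : W.recenter = stabilize U := by
  have h1 := h.mem_iff
  obtain ⟨h0, -, -⟩ := h
  rcases U with ⟨p, A, hA⟩
  change W.pt.2 = p at h0
  subst h0
  refine ext_mem fun w => ?_
  change (ℂ × TangentSpace I W.pt.2) at w
  refine (h1 w.1 w.2).trans ?_
  change _ ↔ w.1 ∈ Submodule.span ℝ {(1 : ℂ)} ∧ w.2 ∈ A
  refine and_congr_left fun _ => ?_
  rw [Submodule.mem_span_singleton]
  constructor
  · intro h; exact ⟨w.1.re, by apply Complex.ext <;> simp [h]⟩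
  · rintro ⟨a, ha⟩; rw [← ha]; simp

variable [IsManifold I ∞ M] [FiniteDimensional ℝ E]

theorem smooth_recenter (σ : FormField I M 2) :
    @Diffeology.DSmooth (LagGr (prodForm σ)) (LagGr (prodForm σ)) (lagGrDiffeology (prodForm σ))
      (lagGrDiffeology (prodForm σ)) recenter := by
  intro m P hP
  refine isPlotOn_of_fields (contMDiffOn_const.prodMk (contMDiff_snd.comp_contMDiffOn hP.1))
    fun x hx => ?_
  obtain ⟨v, hv, hxv, hvu, K, X, hX, hs⟩ := IsPlotOn.exists_fields hP hx
  refine ⟨v, hv, hxv, hvu, Fin K, inferInstance, fun i y => X i y, fun i => ?_, fun y hy => hs y hy⟩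
  have hsm : ContMDiff (𝓘(ℝ, ℂ).prod I).tangent (𝓘(ℝ, ℂ).tangent.prod I.tangent) ∞
      (equivTangentBundleProd 𝓘(ℝ, ℂ) ℂ I M) := contMDiff_equivTangentBundleProd
  have hsm' : ContMDiff (𝓘(ℝ, ℂ).tangent.prod I.tangent) (𝓘(ℝ, ℂ).prod I).tangent ∞
      (equivTangentBundleProd 𝓘(ℝ, ℂ) ℂ I M).symm := contMDiff_equivTangentBundleProd_symm
  have h1 := hsm.comp_contMDiffOn (hX i)
  have h2 : ContMDiffOn 𝓘(ℝ, EuclideanSpace ℝ (Fin m)) 𝓘(ℝ, ℂ) ∞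
      (fun y => (X i y : ℂ × E).1) v :=
    (contMDiff_snd_tangentBundle_modelSpace ℂ 𝓘(ℝ, ℂ) (n := ∞)).comp_contMDiffOn
      (contMDiff_fst.comp_contMDiffOn h1)
  have h3 : ContMDiffOn 𝓘(ℝ, EuclideanSpace ℝ (Fin m)) 𝓘(ℝ, ℂ).tangent ∞
      (fun y => (⟨0, (X i y : ℂ × E).1⟩ : TangentBundle 𝓘(ℝ, ℂ) ℂ)) v := by
    intro y hy
    rw [contMDiffWithinAt_totalSpace]
    refine ⟨contMDiffWithinAt_const, ?_⟩
    simpa using h2 y hy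
  exact hsm'.comp_contMDiffOn (h3.prodMk (contMDiff_snd.comp_contMDiffOn h1))

end Stable

end LagGr

/-! ### Lagrangian immersions into `ℂ × M` -/

section ProductImmersion

variable {E : Type*} [NormedAddCommGroup E] [NormedSpace ℝ E]
  {H : Type*} [TopologicalSpace H] {I : ModelWithCorners ℝ E H}
  {M : Type*} [TopologicalSpace M] [ChartedSpace H M] [IsManifold I ∞ M]
  {σ : FormField I M 2}
  {E' : Type*} [NormedAddCommGroup E'] [NormedSpace ℝ E'] [FiniteDimensional ℝ E']
  {H' : Type*} [TopologicalSpace H'] {I' : ModelWithCorners ℝ E' H'}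
  {V : Type*} [TopologicalSpace V] [ChartedSpace H' V] [IsManifold I' ∞ V] {F : V → ℂ × M}

theorem isOpen_avoids (hF : IsLagrangianImmersion I' (prodForm σ) F) (t : ℝ) :
    IsOpen {x | (gaussMap hF x).Avoids t} := by
  rw [isOpen_iff_mem_nhds]
  intro x hx
  obtain ⟨w, ⟨ξ, rfl⟩, hw⟩ := LagGr.avoids_iff.1 hx
  let e := trivializationAt E' (TangentSpace I' : V → Type _) x
  let b := Module.finBasis ℝ E'
  have hx0 : x ∈ e.baseSet :=
    FiberBundle.mem_baseSet_trivializationAt E' (TangentSpace I' : V → Type _) x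
  let dF : ∀ q, TangentSpace I' q → ℂ × TangentSpace I (F q).2 := fun q v =>
    mfderiv I' (𝓘(ℝ, ℂ).prod I) F q v
  let Z : Fin (Module.finrank ℝ E') → V → ℂ := fun i q => (dF q (e.localFrame b i q)).1
  have hZ : ∀ i, ContinuousOn (Z i) e.baseSet := by
    intro i
    have h1 : ContMDiffOn I' I'.tangent ∞
        (fun q : V => (⟨q, e.localFrame b i q⟩ : TangentBundle I' V)) e.baseSet :=
      e.contMDiffOn_localFrame_baseSet ∞ b i
    have h2 : ContMDiff I'.tangent (𝓘(ℝ, ℂ).prod I).tangent ∞ (tangentMap I' (𝓘(ℝ, ℂ).prod I) F) :=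
      hF.contMDiff.contMDiff_tangentMap (m := ∞) (by simp)
    have hsm : ContMDiff (𝓘(ℝ, ℂ).prod I).tangent (𝓘(ℝ, ℂ).tangent.prod I.tangent) ∞
      (equivTangentBundleProd 𝓘(ℝ, ℂ) ℂ I M) := contMDiff_equivTangentBundleProd
    exact ((contMDiff_snd_tangentBundle_modelSpace ℂ 𝓘(ℝ, ℂ) (n := ∞)).comp_contMDiffOn
      (contMDiff_fst.comp_contMDiffOn (hsm.comp_contMDiffOn (h2.comp_contMDiffOn h1)))).continuousOn
  obtain ⟨i, hi⟩ : ∃ i, altBilin omegaC (dirC t) (Z i x) ≠ 0 := by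
    by_contra! hc
    have hb : ξ ∈ Submodule.span ℝ (range fun i => e.localFrame b i x) := by
      rw [top_le_iff.1 ((e.isLocalFrameOn_localFrame_baseSet I' ∞ b).generating hx0)]
      trivial
    rw [mem_span_range_iff_sum] at hb
    obtain ⟨c, rfl⟩ := hb
    apply hw
    let A : TangentSpace I' x →ₗ[ℝ] ℝ := altBilin omegaC (dirC t) ∘ₗ LinearMap.fst ℝ ℂ
      (TangentSpace I (F x).2) ∘ₗ (mfderiv I' (𝓘(ℝ, ℂ).prod I) F x).toLinearMap
    change A (∑ i, c i • e.localFrame b i x) = 0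
    rw [map_sum]
    refine Finset.sum_eq_zero fun i _ => ?_
    rw [map_smul]
    change c i • altBilin omegaC (dirC t) (Z i x) = 0
    rw [hc i, smul_zero]
  have hcont : ContinuousAt (fun q => altBilin omegaC (dirC t) (Z i q)) x := by
    simp only [altBilin_dirC]
    have hZc := (hZ i).continuousAt (e.open_baseSet.mem_nhds hx0)
    exact (continuousAt_const.mul (Complex.continuous_im.continuousAt.comp hZc)).sub
      ((Complex.continuous_re.continuousAt.comp hZc).mul continuousAt_const)
  filter_upwards [hcont.eventually_ne hi] with q hq
  exact LagGr.avoids_iff.2 ⟨dF q (e.localFrame b i q), ⟨_, rfl⟩, hq⟩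

end ProductImmersion

section CollarPlanes

variable {n : ℕ} {E : Type*} [NormedAddCommGroup E] [NormedSpace ℝ E]
  {H : Type*} [TopologicalSpace H] {I : ModelWithCorners ℝ E H}
  {M : Type*} [TopologicalSpace M] [ChartedSpace H M]
  {σ : FormField I M 2}
  {L : Type*} [TopologicalSpace L] [ChartedSpace (EuclideanSpace ℝ (Fin n)) L]
  [IsManifold (𝓡 n) ∞ L]
  {V : Type*} [TopologicalSpace V] [ChartedSpace (EuclideanHalfSpace (n + 1)) V]
  [IsManifold (𝓡∂ (n + 1)) ∞ V]
  {oL : ManifoldOrientation (𝓡 n) L n} {oV : ManifoldOrientation (𝓡∂ (n + 1)) V (n + 1)}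
  {S : Set ℝ} {c : ℝ × L → V} {F : V → ℂ × M} {f : L → M}

/-- The planes of a cylindrical Lagrangian are stable. -/
theorem IsOrientedCollar.isStableOver (hc : IsOrientedCollar oL oV S c) (hS : UniqueDiffOn ℝ S)
    (hF : IsLagrangianImmersion (𝓡∂ (n + 1)) (prodForm σ) F) (hf : IsLagrangianImmersion (𝓡 n) σ f)
    {h : ℝ} (hcyl : ∀ t ∈ S, ∀ p, F (c (t, p)) = (⟨t, h⟩, f p)) {t : ℝ} (ht : t ∈ S) (p : L) :
    (gaussMap hF (c (t, p))).IsStableOver (gaussMap hf p) := by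
  let J : ℝ × L → ℂ × M := fun q => (⟨q.1, h⟩, f q.2)
  have hq : (t, p) ∈ S ×ˢ (univ : Set L) := ⟨ht, trivial⟩
  have hu : UniqueMDiffWithinAt (𝓘(ℝ, ℝ).prod (𝓡 n)) (S ×ˢ (univ : Set L)) (t, p) :=
    ((hS.uniqueMDiffOn).prod uniqueMDiffOn_univ) _ hq
  have h1 := mfderiv_comp_mfderivWithin (t, p)
    (hF.contMDiff.mdifferentiableAt (x := c (t, p)) (by simp))
    ((hc.smooth _ hq).mdifferentiableWithinAt (by simp)) hu
  have hz : HasDerivAt (fun s : ℝ => (⟨s, h⟩ : ℂ)) 1 t := by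
    have h2 : HasDerivAt (fun s : ℝ => (s : ℂ) + (⟨0, h⟩ : ℂ)) 1 t :=
      (Complex.ofRealCLM.hasDerivAt (x := t)).add_const _
    have e : (fun s : ℝ => (⟨s, h⟩ : ℂ)) = fun s : ℝ => (s : ℂ) + (⟨0, h⟩ : ℂ) := by
      funext s; apply Complex.ext <;> simp
    rwa [e]
  have hJ : HasMFDerivAt (𝓘(ℝ, ℝ).prod (𝓡 n)) (𝓘(ℝ, ℂ).prod I) J (t, p)
      (((ContinuousLinearMap.toSpanSingleton ℝ (1 : ℂ)).comp (ContinuousLinearMap.fst ℝ ℝ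
        (TangentSpace (𝓡 n) p))).prod ((mfderiv (𝓡 n) I f p).comp (ContinuousLinearMap.snd ℝ ℝ
        (TangentSpace (𝓡 n) p)))) := by
    refine HasMFDerivAt.prodMk ?_ ?_
    · exact HasMFDerivAt.comp (g := fun s : ℝ => (⟨s, h⟩ : ℂ)) (t, p)
        hz.hasFDerivAt.hasMFDerivAt (hasMFDerivAt_fst (t, p))
    · exact HasMFDerivAt.comp (g := f) (t, p)
        (hf.contMDiff.mdifferentiableAt (x := p) (by simp)).hasMFDerivAt (hasMFDerivAt_snd (t, p))
  have h2 : mfderivWithin (𝓘(ℝ, ℝ).prod (𝓡 n)) (𝓘(ℝ, ℂ).prod I) (F ∘ c) (S ×ˢ (univ : Set L)) (t, p) =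
      mfderivWithin (𝓘(ℝ, ℝ).prod (𝓡 n)) (𝓘(ℝ, ℂ).prod I) J (S ×ˢ (univ : Set L)) (t, p) :=
    mfderivWithin_congr (fun q hq => hcyl q.1 hq.1 q.2) (hcyl t ht p)
  rw [hJ.hasMFDerivWithinAt.mfderivWithin hu] at h2
  have h3 := h1.symm.trans h2
  have hmem : ∀ (a : ℝ) (v : TangentSpace (𝓡 n) p),
      ((a • (1 : ℂ), mfderiv (𝓡 n) I f p v) : ℂ × TangentSpace I (F (c (t, p))).2) ∈
        (gaussMap hF (c (t, p))).prodPlane := fun a v =>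
    ⟨mfderivWithin (𝓘(ℝ, ℝ).prod (𝓡 n)) (𝓡∂ (n + 1)) c (S ×ˢ univ) (t, p) (a, v),
      congrArg (fun A => A (a, v)) h3⟩
  refine ⟨congrArg Prod.snd (hcyl t ht p), ?_, ?_⟩
  · have h4 := hmem 1 0
    rw [one_smul, map_zero] at h4
    exact h4
  · rintro w ⟨v, hv⟩
    have h4 := hmem 0 v
    rw [zero_smul] at h4
    have hv' : mfderiv (𝓡 n) I f p v = w := hv
    rw [hv'] at h4
    exact h4

end CollarPlanes

/-! ### Cobordism invariance of stable characteristic numbers -/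

section StableInvariance

universe u v w

variable {N k : ℕ} {M : Type*} [TopologicalSpace M] [ChartedSpace (EuclideanSpace ℝ (Fin N)) M]
  [IsManifold (𝓡 N) ∞ M] {σ : SymplecticForm (𝓡 N) M} {lam : DForm (lagGrDiffeology σ.toFun) 1}

/-- The Lagrangian condition kills the pullback of the product form. -/
theorem pull_prodForm_eq_zero {V : Type*} [TopologicalSpace V]
    [ChartedSpace (EuclideanHalfSpace (k + 1)) V] [IsManifold (𝓡∂ (k + 1)) ∞ V] {F : V → ℂ × M}
    (hF : IsLagrangianImmersion (𝓡∂ (k + 1)) (prodForm σ.toFun) F) {m : ℕ}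
    {P : EuclideanSpace ℝ (Fin m) → V} (hP : ContMDiff 𝓘(ℝ, EuclideanSpace ℝ (Fin m)) (𝓡∂ (k + 1)) ∞ P)
    (u : EuclideanSpace ℝ (Fin m)) (v : Fin 2 → EuclideanSpace ℝ (Fin m)) :
    omegaC ![fderiv ℝ (fun y => (F (P y)).1) u (v 0), fderiv ℝ (fun y => (F (P y)).1) u (v 1)] +
      σ.toFun.pull (fun y => (F (P y)).2) u v = 0 := by
  have h0 := mfderiv_comp u (hF.contMDiff.mdifferentiableAt (x := P u) (by simp))
    (hP.mdifferentiableAt (by simp))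
  have hFP : ContMDiff 𝓘(ℝ, EuclideanSpace ℝ (Fin m)) (𝓘(ℝ, ℂ).prod (𝓡 N)) ∞ (F ∘ P) :=
    hF.contMDiff.comp hP
  have h1 : ContMDiff 𝓘(ℝ, EuclideanSpace ℝ (Fin m)) 𝓘(ℝ, ℂ) ∞ (fun y => (F (P y)).1) :=
    contMDiff_fst.comp hFP
  have h2 : ContMDiff 𝓘(ℝ, EuclideanSpace ℝ (Fin m)) (𝓡 N) ∞ (fun y => (F (P y)).2) :=
    contMDiff_snd.comp hFP
  have h3 := ((h1.mdifferentiableAt (x := u) (by simp)).hasMFDerivAt.prodMk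
    (h2.mdifferentiableAt (x := u) (by simp)).hasMFDerivAt).mfderiv
  have h4 : ∀ x, ((fderiv ℝ (fun y => (F (P y)).1) u x,
      mfderiv 𝓘(ℝ, EuclideanSpace ℝ (Fin m)) (𝓡 N) (fun y => (F (P y)).2) u x) :
        ℂ × TangentSpace (𝓡 N) (F (P u)).2) ∈ (gaussMap hF (P u)).prodPlane := fun x => by
    refine ⟨mfderiv 𝓘(ℝ, EuclideanSpace ℝ (Fin m)) (𝓡∂ (k + 1)) P u x, ?_⟩
    rw [mfderiv_eq_fderiv] at h3
    exact (congrArg (fun A => A x) h0).symm.trans (congrArg (fun A => A x) h3)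
  have h5 := ((gaussMap hF (P u)).mem_prodPlane_iff _).1 (h4 (v 0)) _ (h4 (v 1))
  refine Eq.trans ?_ h5
  rw [altBilin_apply, altBilin_apply]
  congr 1
  change (σ.toFun (F (P u)).2) _ = (σ.toFun (F (P u)).2) _
  congr 1
  ext i
  fin_cases i <;> rfl

variable {r s : ℕ} {α : Fin r → OrientedLagrangian.{u} (k + 1) σ.toFun}
  {β : Fin s → OrientedLagrangian.{v} (k + 1) σ.toFun}

theorem OrientedCobordism.exists_action_extension (C : OrientedCobordism.{u, v, w} α β)
    (hlam : IsActionForm σ lam) (hN : 0 < N) :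
    ∃ A : DForm (manifoldDiffeology (𝓡∂ (k + 1 + 1)) C.V) 1, DForm.d A = 0 ∧ ∃ K : C.V → ℝ,
      ∀ {m : ℕ} (R : EuclideanSpace ℝ (Fin m) → C.V)
        (hR : R ∈ (manifoldDiffeology (𝓡∂ (k + 1 + 1)) C.V).plots m)
        (hav : ∀ y, (gaussMap C.isLagrangianImmersion (R y)).Avoids (Real.pi / 4)) (h : ℝ),
        (∀ y, (C.toFun (R y)).1.im = h) →
        ContDiff ℝ ∞ (K ∘ R) ∧ ∀ u, A.val R hR u =
          lam.val _ (LagGr.reduce_comp_mem_plots (smooth_gaussMap C.isLagrangianImmersion) hR hav) u +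
            covecForm (fderiv ℝ (K ∘ R) u) := by
  set hF := C.isLagrangianImmersion
  let G : C.V → LagGr (prodForm σ.toFun) := gaussMap hF
  have hG : @Diffeology.DSmooth _ _ (manifoldDiffeology (𝓡∂ (k + 1 + 1)) C.V)
      (lagGrDiffeology (prodForm σ.toFun)) G := smooth_gaussMap hF
  let c : Bool → ℝ := fun i => bif i then Real.pi / 4 else Real.pi / 2
  have hpi := Real.pi_pos
  have hor : ∀ W : LagGr (prodForm σ.toFun), ∃ i, W.Avoids (c i) := fun W => by
    have hs : Real.sin (c false - c true) ≠ 0 :=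
      (Real.sin_pos_of_pos_of_lt_pi (by simp only [c, cond_false, cond_true]; linarith)
        (by simp only [c, cond_false, cond_true]; linarith)).ne'
    rcases W.avoids_or_avoids hs with h | h
    · exact ⟨true, h⟩
    · exact ⟨false, h⟩
  obtain ⟨ρ, hρ⟩ := SmoothPartitionOfUnity.exists_isSubordinate (𝓡∂ (k + 1 + 1))
    (isClosed_univ (X := C.V)) (fun i : Bool => {x | (G x).Avoids (c i)})
    (fun i => isOpen_avoids hF _) (fun x _ => mem_iUnion.2 (hor (G x)))
  have hsupp : ∀ i, ∀ {m : ℕ} (P : EuclideanSpace ℝ (Fin m) → C.V),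
      P ∈ (manifoldDiffeology (𝓡∂ (k + 1 + 1)) C.V).plots m → ∀ u,
      (G (P u)).Avoids (c i) ∨ ∀ᶠ y in 𝓝 u, ρ i (P y) = 0 := fun i {m} P hP u => by
    by_cases h : (G (P u)).Avoids (c i)
    · exact Or.inl h
    · exact Or.inr (((continuous_of_mem_plots P hP).continuousAt).eventually
        (notMem_tsupport_iff_eventuallyEq.1 fun h2 => h (hρ i h2)))
  obtain ⟨A₀, hA₀, hA₁⟩ := LagGr.exists_extension (lam := lam) (D := manifoldDiffeology _ C.V)
    (ρ := fun i x => ρ i x) (c := c) hlam hN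
    (by simp only [c, cond_false, cond_true]; linarith)
    (by simp only [c, cond_false, cond_true]; linarith) hG
    (fun i {m} P hP => ((ρ i).contMDiff.comp ((mem_manifoldDiffeology_plots _ _ P).1 hP)).contDiff)
    hsupp
    (fun x => by
      have h := ρ.sum_eq_one (mem_univ x)
      rw [finsum_eq_sum_of_fintype] at h
      simpa using h)
  have hFs := hF.contMDiff
  have hF1 : ContMDiff (𝓡∂ (k + 1 + 1)) 𝓘(ℝ, ℂ) ∞ fun x => (C.toFun x).1 := contMDiff_fst.comp hFs
  let X : C^∞⟮𝓡∂ (k + 1 + 1), C.V; 𝓘(ℝ, ℝ), ℝ⟯ :=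
    ⟨fun x => (C.toFun x).1.re, Complex.reCLM.contDiff.contMDiff.comp hF1⟩
  let Y : C^∞⟮𝓡∂ (k + 1 + 1), C.V; 𝓘(ℝ, ℝ), ℝ⟯ :=
    ⟨fun x => (C.toFun x).1.im, Complex.imCLM.contDiff.contMDiff.comp hF1⟩
  have hsm : ∀ {m : ℕ} (P : EuclideanSpace ℝ (Fin m) → C.V),
      P ∈ (manifoldDiffeology (𝓡∂ (k + 1 + 1)) C.V).plots m →
      ∀ u, DifferentiableAt ℝ (fun y => (C.toFun (P y)).1) u := fun {m} P hP u =>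
    ((hF1.comp ((mem_manifoldDiffeology_plots _ _ P).1 hP)).contDiff).differentiable (by simp) u
  refine ⟨A₀ + DForm.smulSmooth X (DForm.dSmooth Y), ?_, LagGr.correction lam hN G (fun i x => ρ i x) c true,
    fun {m} R hR hav h hh => ⟨?_, fun u => ?_⟩⟩
  · have hdY : DForm.d (DForm.dSmooth Y) = 0 := DForm.d_d _
    rw [map_add, DForm.d_smulSmooth, hdY]
    refine DForm.ext fun {m} P hP u => ?_
    have hz : (DForm.smulSmooth X (0 : DForm (manifoldDiffeology (𝓡∂ (k + 1 + 1)) C.V) 2)).val P hP u = 0 :=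
      smul_zero _
    rw [DForm.add_val, DForm.add_val, hz, add_zero, hA₀]
    ext v
    rw [ContinuousAlternatingMap.add_apply, DForm.wedge_val, Fin.sum_univ_two]
    simp only [DForm.dSmooth_val]
    have hre : fderiv ℝ (X ∘ P) u = Complex.reCLM.comp (fderiv ℝ (fun y => (C.toFun (P y)).1) u) :=
      (Complex.reCLM.hasFDerivAt.comp u (hsm P hP u).hasFDerivAt).fderiv
    have him : fderiv ℝ (Y ∘ P) u = Complex.imCLM.comp (fderiv ℝ (fun y => (C.toFun (P y)).1) u) :=
      (Complex.imCLM.hasFDerivAt.comp u (hsm P hP u).hasFDerivAt).fderiv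
    have h1 := pull_prodForm_eq_zero hF ((mem_manifoldDiffeology_plots _ _ P).1 hP) u v
    rw [omegaC_apply] at h1
    rw [hre, him]
    refine Eq.trans ?_ h1
    have e : σ.toFun.pull (fun y => (G (P y)).pt.2) u v =
      σ.toFun.pull (fun y => (C.toFun (P y)).2) u v := rfl
    rw [e]
    simp [Fin.removeNth]
    ring
  · exact LagGr.contDiff_correction (D := manifoldDiffeology _ C.V) hlam hN
      (by simp only [c, cond_false, cond_true]; linarith)
      (by simp only [c, cond_false, cond_true]; linarith) hG
      (fun i {m} P hP =>
        ((ρ i).contMDiff.comp ((mem_manifoldDiffeology_plots _ _ P).1 hP)).contDiff)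
      hsupp true hR hav
  · have h2 : (A₀ + DForm.smulSmooth X (DForm.dSmooth Y)).val R hR u =
        A₀.val R hR u + X (R u) • (DForm.dSmooth Y).val R hR u := rfl
    have h3 : (DForm.dSmooth Y).val R hR u = 0 := by
      ext v
      have e : ⇑Y ∘ R = fun _ => h := funext hh
      rw [DForm.dSmooth_val, e]
      simp
    rw [h2, h3, smul_zero, add_zero]
    exact hA₁ R hR hav u

/-- Along the ends, an extension of the action form restricts to the action class. -/
theorem OrientedCobordism.pullback_sub_mem_exactForms (C : OrientedCobordism.{u, v, w} α β)
    {A : DForm (manifoldDiffeology (𝓡∂ (k + 1 + 1)) C.V) 1} {K : C.V → ℝ}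
    (hA : ∀ {m : ℕ} (R : EuclideanSpace ℝ (Fin m) → C.V)
        (hR : R ∈ (manifoldDiffeology (𝓡∂ (k + 1 + 1)) C.V).plots m)
        (hav : ∀ y, (gaussMap C.isLagrangianImmersion (R y)).Avoids (Real.pi / 4)) (h : ℝ),
        (∀ y, (C.toFun (R y)).1.im = h) →
        ContDiff ℝ ∞ (K ∘ R) ∧ ∀ u, A.val R hR u =
          lam.val _ (LagGr.reduce_comp_mem_plots (smooth_gaussMap C.isLagrangianImmersion) hR hav) u +
            covecForm (fderiv ℝ (K ∘ R) u))
    (f : OrientedLagrangian (k + 1) σ.toFun) (c : f.carrier → C.V)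
    (hc : @Diffeology.DSmooth _ _ (manifoldDiffeology (𝓡 (k + 1)) f.carrier)
      (manifoldDiffeology (𝓡∂ (k + 1 + 1)) C.V) c) (h : ℝ)
    (hh : ∀ p, (C.toFun (c p)).1.im = h)
    (hst : ∀ p, (gaussMap C.isLagrangianImmersion (c p)).IsStableOver
      (gaussMap f.isLagrangianImmersion p)) :
    DForm.pullback c hc A -
      DForm.pullback _ (smooth_gaussMap f.isLagrangianImmersion) lam ∈ exactForms _ 1 := by
  have hpi := Real.pi_pos
  have hav : ∀ p, (gaussMap C.isLagrangianImmersion (c p)).Avoids (Real.pi / 4) := fun p =>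
    (hst p).avoids (Real.sin_pos_of_pos_of_lt_pi (by linarith) (by linarith)).ne'
  refine ⟨DForm.ofFun (K ∘ c) fun {m} P hP =>
    (hA (c ∘ P) (hc m P hP) (fun y => hav _) h fun y => hh _).1, ?_⟩
  refine DForm.ext fun {m} P hP u => ?_
  rw [DForm.d_ofFun_val, sub_eq_add_neg, DForm.add_val]
  have h1 := (hA (c ∘ P) (hc m P hP) (fun y => hav _) h fun y => hh _).2 u
  have h4 : lam.val (fun y => (gaussMap C.isLagrangianImmersion ((c ∘ P) y)).reduce (Real.pi / 4))
      (LagGr.reduce_comp_mem_plots (smooth_gaussMap C.isLagrangianImmersion) (hc m P hP)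
        fun y => hav _) u =
      (DForm.pullback _ (smooth_gaussMap f.isLagrangianImmersion) lam).val P hP u :=
    lam.val_of_eq _ (smooth_gaussMap f.isLagrangianImmersion m P hP)
      (funext fun y => (hst (P y)).reduce_eq _) u
  have h2 : (DForm.pullback c hc A).val P hP u = A.val (c ∘ P) (hc m P hP) u := rfl
  rw [h2, h1, h4]
  ext v
  simp [Function.comp_assoc]

theorem OrientedCobordism.pullback_recenter_sub_mem_exactForms (C : OrientedCobordism.{u, v, w} α β)
    (Y : DForm (lagGrDiffeology (prodForm σ.toFun)) k)
    (f : OrientedLagrangian (k + 1) σ.toFun) (c : f.carrier → C.V)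
    (hc : @Diffeology.DSmooth _ _ (manifoldDiffeology (𝓡 (k + 1)) f.carrier)
      (manifoldDiffeology (𝓡∂ (k + 1 + 1)) C.V) c)
    (hst : ∀ p, (gaussMap C.isLagrangianImmersion (c p)).IsStableOver
      (gaussMap f.isLagrangianImmersion p)) :
    DForm.pullback c hc (DForm.pullback (gaussMap C.isLagrangianImmersion)
        (smooth_gaussMap C.isLagrangianImmersion)
        (DForm.pullback _ (LagGr.smooth_recenter σ.toFun) Y)) -
      DForm.pullback _ (smooth_gaussMap f.isLagrangianImmersion)
        (DForm.pullback stabilize (smooth_stabilize σ.toFun) Y) ∈ exactForms _ k := by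
  rw [sub_eq_zero.2 (DForm.ext fun {m} P hP u =>
    Y.val_of_eq _ _ (funext fun y => (hst (P y)).recenter_eq) u)]
  exact Submodule.zero_mem _

/-- Stable characteristic numbers are invariant under oriented Lagrangian cobordism. -/
theorem OrientedCobordism.sum_eq_of_isStableClass (C : OrientedCobordism.{u, v, w} α β)
    (hlam : IsActionForm σ lam) (hN : 0 < N) {x : HdR (lagGrDiffeology σ.toFun) k}
    (hx : IsStableClass x) (a : Fin r → ℝ) (b : Fin s → ℝ)
    (ha : ∀ i, (α i).IsCharNumber hlam x (a i)) (hb : ∀ j, (β j).IsCharNumber hlam x (b j)) :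
    ∑ i, a i = ∑ j, b j := by
  obtain ⟨y, rfl⟩ := hx
  obtain ⟨Y, hY, rfl⟩ := HdR.exists_rep y
  obtain ⟨A, hA, K, hAs⟩ := C.exists_action_extension hlam hN
  let G : C.V → LagGr (prodForm σ.toFun) := gaussMap C.isLagrangianImmersion
  have hG : @Diffeology.DSmooth _ _ (manifoldDiffeology (𝓡∂ (k + 1 + 1)) C.V)
      (lagGrDiffeology (prodForm σ.toFun)) G := smooth_gaussMap C.isLagrangianImmersion
  let B := DForm.pullback G hG (DForm.pullback _ (LagGr.smooth_recenter σ.toFun) Y)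
  have hB : DForm.d B = 0 := by rw [DForm.d_pullback, DForm.d_pullback, hY, map_zero, map_zero]
  have hp : ∀ i t, t ∈ Ioc (1 - C.ε) 1 → ∀ p, (gaussMap C.isLagrangianImmersion
      (C.posCollar i (t, p))).IsStableOver (gaussMap (α i).isLagrangianImmersion p) := fun i t ht p =>
    (C.isCollar_pos i).isStableOver (uniqueDiffOn_Ioc _ _) _ _ (C.cylindrical_pos i) ht p
  have hn : ∀ j t, t ∈ Ico 0 C.ε → ∀ p, (gaussMap C.isLagrangianImmersion
      (C.negCollar j (t, p))).IsStableOver (gaussMap (β j).isLagrangianImmersion p) := fun j t ht p =>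
    (C.isCollar_neg j).isStableOver (uniqueDiffOn_Ico _ _) _ _ (C.cylindrical_neg j) ht p
  refine C.sum_charNumber_eq hlam (DForm.pullback stabilize (smooth_stabilize σ.toFun) Y)
    (by rw [DForm.d_pullback, hY, map_zero]) A hA B hB ?_ ?_ ?_ ?_ a b ha hb
  · intro i t ht
    exact C.pullback_sub_mem_exactForms hAs (α i) _ ((C.isCollar_pos i).smooth_slice ht) _
      (fun p => congrArg (fun q => q.1.im) (C.cylindrical_pos i t ht p)) (hp i t ht)
  · intro j t ht
    exact C.pullback_sub_mem_exactForms hAs (β j) _ ((C.isCollar_neg j).smooth_slice ht) _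
      (fun p => congrArg (fun q => q.1.im) (C.cylindrical_neg j t ht p)) (hn j t ht)
  · intro i t ht
    exact C.pullback_recenter_sub_mem_exactForms Y (α i) _ ((C.isCollar_pos i).smooth_slice ht) (hp i t ht)
  · intro j t ht
    exact C.pullback_recenter_sub_mem_exactForms Y (β j) _ ((C.isCollar_neg j).smooth_slice ht) (hn j t ht)

end StableInvariance

/-! ### Trace identities for a complex structure and an anticommuting involution -/

section TraceIdentities

variable {A : Type*} [Ring A] [Algebra ℝ A] {tr : A →ₗ[ℝ] ℝ} {J S : A}

/-- The value of `½ tr (J ∇S S)`, where `∇S = S' + [g, S]`. -/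
def reflectionTrace (tr : A →ₗ[ℝ] ℝ) (J S S' g : A) : ℝ := 1 / 2 * tr (J * S' * S) + tr (J * g)

/-- `reflectionTrace` does not depend on the frame. -/
theorem reflectionTrace_conj (htr : ∀ a b, tr (a * b) = tr (b * a)) {J' S' T T' g g' H K H' : A}
    (hHK : H * K = 1) (hJS : J' * S' = -(S' * J')) (hS' : S' * S' = 1)
    (h1 : S' * H = H * S) (h2 : J' * H = H * J) (h3 : T' * H + S' * H' = H' * S + H * T)
    (h4 : g' * H = H * g - H') (hKH : K * H = 1) :
    reflectionTrace tr J' S' T' g' = reflectionTrace tr J S T g := by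
  have e1 : J' * T' * S' = J' * H' * K + H * (J * T * S) * K - J' * S' * (H' * K) * S' := by
    have h5 : T' = (H' * S + H * T - S' * H') * K := by
      rw [← h3, add_sub_cancel_right, mul_assoc, hHK, mul_one]
    have h6 : K * S' = S * K := by
      calc K * S' = K * S' * (H * K) := by rw [hHK, mul_one]
        _ = K * (S' * H) * K := by noncomm_ring
        _ = K * H * S * K := by rw [h1]; noncomm_ring
        _ = S * K := by rw [hKH, one_mul]
    have h7 : S * K * S' = K := by rw [← h6, mul_assoc, hS', mul_one]
    calc J' * T' * S' = J' * H' * (S * K * S') + J' * H * T * (K * S') - J' * S' * (H' * K) * S' := by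
          rw [h5]; noncomm_ring
      _ = _ := by rw [h7, h6, h2]; noncomm_ring
  have e2 : J' * g' = H * (J * g) * K - J' * H' * K := by
    have h5 : g' = (H * g - H') * K := by rw [← h4, mul_assoc, hHK, mul_one]
    calc J' * g' = J' * H * g * K - J' * H' * K := by rw [h5]; noncomm_ring
      _ = _ := by rw [h2]; noncomm_ring
  have e3 : ∀ x, tr (H * x * K) = tr x := fun x => by rw [htr, ← mul_assoc, hKH, one_mul]
  have e4 : tr (J' * S' * (H' * K) * S') = -tr (J' * H' * K) := by
    rw [htr, ← mul_assoc, ← mul_assoc, hJS, mul_neg, neg_mul, ← mul_assoc, hS', one_mul, neg_mul,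
      map_neg, mul_assoc]
  rw [reflectionTrace, reflectionTrace, e1, e2]
  simp only [map_add, map_sub, e3, e4]
  ring

/-- The curvature identity behind `d (reflectionTrace) = tr (J R)`. -/
theorem reflectionTrace_curvature (htr : ∀ a b, tr (a * b) = tr (b * a))
    {Ju Jv Su Sv gu gv : A} (hJS : J * S = -(S * J)) (hS : S * S = 1)
    (hu : Ju = J * gu - gu * J) (hv : Jv = J * gv - gv * J)
    (hu1 : Ju * S + J * Su = -(Su * J + S * Ju)) (hv1 : Jv * S + J * Sv = -(Sv * J + S * Jv))
    (hu2 : Su * S + S * Su = 0) (hv2 : Sv * S + S * Sv = 0) :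
    1 / 2 * (tr (Ju * Sv * S) + tr (J * Sv * Su) - tr (Jv * Su * S) - tr (J * Su * Sv)) +
      tr (Ju * gv) - tr (Jv * gu) = tr (J * (gu * gv - gv * gu)) := by
  have hodd : ∀ x, S * x = x * S → tr (J * x) = 0 := fun x hx => by
    have h : tr (J * x) = -tr (J * x) := by
      calc tr (J * x) = tr (J * x * S * S) := by rw [mul_assoc _ S S, hS, mul_one]
        _ = tr (S * J * (x * S)) := by rw [htr]; congr 1; noncomm_ring
        _ = -tr (J * (S * S) * x) := by
          rw [← hx, show S * J = -(J * S) by rw [hJS, neg_neg], ← map_neg]; congr 1; noncomm_ring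
        _ = -tr (J * x) := by rw [hS, mul_one]
    linarith
  have h3 : S * J = -(J * S) := by rw [hJS, neg_neg]
  have key : ∀ {Ju Su gu : A}, Ju = J * gu - gu * J → Ju * S + J * Su = -(Su * J + S * Ju) →
      J * (Su * S + gu - S * gu * S) = (Su * S + gu - S * gu * S) * J := by
    intro Ju Su gu h h1
    have h2 : J * Su * S + Su * J * S = -(S * Ju * S) - Ju := by
      calc J * Su * S + Su * J * S = (Ju * S + J * Su) * S + Su * J * S - Ju * (S * S) := by
            noncomm_ring
        _ = -(S * Ju * S) - Ju := by rw [h1, hS]; noncomm_ring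
    have h4 : J * (S * gu * S) = -(S * (J * gu) * S) := by
      rw [← mul_assoc, ← mul_assoc, hJS]; noncomm_ring
    have h5 : Su * S * J = -(Su * J * S) := by rw [mul_assoc, h3]; noncomm_ring
    have h6 : S * gu * S * J = -(S * (gu * J) * S) := by rw [mul_assoc _ S, h3]; noncomm_ring
    calc J * (Su * S + gu - S * gu * S)
        = (J * Su * S + Su * J * S) - Su * J * S + J * gu - J * (S * gu * S) := by noncomm_ring
      _ = (Su * S + gu - S * gu * S) * J := by
        rw [h2, h4, sub_mul, add_mul, h5, h6, h]; noncomm_ring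
  have hSc : ∀ x, S * (S * x * S) = x * S := fun x => by
    rw [← mul_assoc, ← mul_assoc, hS, one_mul]
  have hSc' : ∀ x, S * x * S * S = S * x := fun x => by rw [mul_assoc, hS, mul_one]
  have hodd2 : ∀ {x y}, S * x = -(x * S) → S * y = -(y * S) → tr (J * (x * y)) = 0 :=
    fun {x y} hx hy => hodd _ <| by
      rw [← mul_assoc, hx, neg_mul, mul_assoc, hy, mul_neg, neg_neg, mul_assoc]
  have heven2 : ∀ {x y}, S * x = x * S → S * y = y * S → tr (J * (x * y)) = 0 :=
    fun {x y} hx hy => hodd _ <| by rw [← mul_assoc, hx, mul_assoc, hy, mul_assoc]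
  have ha : ∀ {Su : A}, Su * S + S * Su = 0 → S * (Su * S) = -(Su * S * S) := fun {Su} h => by
    rw [← mul_assoc, eq_neg_of_add_eq_zero_right h, neg_mul]
  have hd : ∀ {Su : A} (gu : A), Su * S + S * Su = 0 →
      S * (Su * S + gu - S * gu * S) = -((Su * S + gu - S * gu * S) * S) := fun {Su} gu h => by
    rw [mul_sub, mul_add, ha h, hSc, sub_mul, add_mul, hSc']; abel
  have hp : ∀ gu, S * (gu + S * gu * S) = (gu + S * gu * S) * S := fun gu => by
    rw [mul_add, hSc, add_mul, hSc']; abel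
  have hcomm : ∀ {d} (p : A), J * d = d * J → tr (J * (p * d)) = tr (J * (d * p)) :=
    fun {d} p h => by rw [← mul_assoc, htr, ← mul_assoc, ← h, mul_assoc]
  have kJ : ∀ {Ju gu : A} (x : A), Ju = J * gu - gu * J →
      tr (Ju * x) = tr (J * (gu * x)) - tr (J * (x * gu)) := fun {Ju gu} x h => by
    rw [h, sub_mul, map_sub, mul_assoc, mul_assoc, htr gu, mul_assoc]
  have kS : ∀ {Su Sv : A}, Su * S + S * Su = 0 → tr (J * Sv * Su) = -tr (J * (Sv * S * (Su * S))) :=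
    fun {Su Sv} h => by
      rw [mul_assoc Sv, ha h, mul_assoc Su, hS, mul_one, mul_neg, mul_neg, map_neg, neg_neg,
        mul_assoc]
  have e1 := hodd2 (ha hu2) (ha hv2)
  have e2 := hodd2 (ha hv2) (ha hu2)
  have e3 := hodd2 (hd gu hu2) (hd gv hv2)
  have e4 := hodd2 (hd gv hv2) (hd gu hu2)
  have e5 := heven2 (hp gu) (hp gv)
  have e6 := heven2 (hp gv) (hp gu)
  have e7 := hcomm (gu + S * gu * S) (key hv hv1)
  have e8 := hcomm (gv + S * gv * S) (key hu hu1)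
  have e9 : tr (J * ((gu + gu + Su * S) * (gv + gv + Sv * S))) =
      tr (J * ((gv + gv + Sv * S) * (gu + gu + Su * S))) := by
    have h7 : ∀ g T : A, g + g + T = (g + S * g * S) + (T + g - S * g * S) := fun g T => by abel
    have h8 : ∀ p q d d' : A, tr (J * ((p + d) * (q + d'))) =
        tr (J * (p * q)) + tr (J * (p * d')) + tr (J * (d * q)) + tr (J * (d * d')) :=
      fun p q d d' => by simp only [← map_add]; congr 1; noncomm_ring
    rw [h7 gu, h7 gv, h8 (gu + S * gu * S), h8 (gv + S * gv * S), e3, e4, e5, e6, e7, e8]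
    ring
  rw [mul_assoc Ju, mul_assoc Jv, kJ _ hu, kJ _ hv, kJ _ hu, kJ _ hv, kS hu2, kS hv2, e1, e2]
  simp only [mul_add, add_mul, map_add, mul_sub, map_sub] at e9 ⊢
  simp only [e1, e2] at e9
  linarith

end TraceIdentities

/-! ### Connections in a chart -/

section ChartConnection

variable {N : ℕ} {M : Type*} [TopologicalSpace M] [ChartedSpace (EuclideanSpace ℝ (Fin N)) M]
  [IsManifold (𝓡 N) ∞ M] {P : EuclideanSpace ℝ (Fin N) → M} {e : M → EuclideanSpace ℝ (Fin N)}

theorem _root_.ContinuousLinearMap.apply_eq_sum_single {F : Type*} [NormedAddCommGroup F]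
    [NormedSpace ℝ F] {k : ℕ} (A : EuclideanSpace ℝ (Fin k) →L[ℝ] F) (a : EuclideanSpace ℝ (Fin k)) :
    A a = ∑ i, a i • A (EuclideanSpace.single i 1) := by
  simp_rw [← map_smul, ← map_sum]
  congr 1
  ext j
  simp [Pi.single_apply]

/-- The vector field with given components in a chart. -/
def chartField (P : EuclideanSpace ℝ (Fin N) → M) (e : M → EuclideanSpace ℝ (Fin N))
    (Y : EuclideanSpace ℝ (Fin N) → EuclideanSpace ℝ (Fin N)) (x : M) : TangentSpace (𝓡 N) x :=
  (mfderiv 𝓘(ℝ, EuclideanSpace ℝ (Fin N)) (𝓡 N) P (e x) (Y (e x)) : EuclideanSpace ℝ (Fin N))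

theorem IsChartPlot.chartField_apply (hP : IsChartPlot (𝓡 N) P e)
    (Y : EuclideanSpace ℝ (Fin N) → EuclideanSpace ℝ (Fin N)) (u : EuclideanSpace ℝ (Fin N)) :
    chartField P e Y (P u) = mfderiv 𝓘(ℝ, EuclideanSpace ℝ (Fin N)) (𝓡 N) P u (Y u) := by
  have key : ∀ w, w = u → (mfderiv 𝓘(ℝ, EuclideanSpace ℝ (Fin N)) (𝓡 N) P w (Y w) :
      EuclideanSpace ℝ (Fin N)) =
        mfderiv 𝓘(ℝ, EuclideanSpace ℝ (Fin N)) (𝓡 N) P u (Y u) := by rintro _ rfl; rfl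
  exact key _ (hP.left_inv u)

theorem IsChartPlot.chartCoord_chartField (hP : IsChartPlot (𝓡 N) P e)
    (Y : EuclideanSpace ℝ (Fin N) → EuclideanSpace ℝ (Fin N)) (u : EuclideanSpace ℝ (Fin N)) :
    chartCoord e (P u) (chartField P e Y (P u)) = Y u := by
  rw [hP.chartField_apply]
  exact hP.mfderiv_inv_comp u _

theorem IsChartPlot.contMDiffOn_chartField (hP : IsChartPlot (𝓡 N) P e)
    {Y : EuclideanSpace ℝ (Fin N) → EuclideanSpace ℝ (Fin N)} {U : Set (EuclideanSpace ℝ (Fin N))}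
    (hY : ContDiffOn ℝ ∞ Y U) :
    ContMDiffOn (𝓡 N) (𝓡 N).tangent ∞
      (fun x => (⟨x, chartField P e Y x⟩ : TangentBundle (𝓡 N) M)) (range P ∩ e ⁻¹' U) := by
  have h1 : ContMDiffOn (𝓡 N) 𝓘(ℝ, EuclideanSpace ℝ (Fin N)).tangent ∞
      (fun x => (⟨e x, Y (e x)⟩ :
        TangentBundle 𝓘(ℝ, EuclideanSpace ℝ (Fin N)) (EuclideanSpace ℝ (Fin N))))
      (range P ∩ e ⁻¹' U) := by
    have h2 := hP.contMDiffOn.mono (inter_subset_left (t := e ⁻¹' U))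
    have h3 := hY.contMDiffOn.comp h2 inter_subset_right
    intro y hy
    rw [contMDiffWithinAt_totalSpace]
    refine ⟨h2 y hy, ?_⟩
    exact (by simpa [Function.comp_def] using h3 y hy)
  refine ((hP.contMDiff.contMDiff_tangentMap (m := ∞) (by simp)).comp_contMDiffOn h1).congr
    fun x hx => ?_
  have key : ∀ (q : M) (_ : q = x) (v : EuclideanSpace ℝ (Fin N)),
      (⟨x, v⟩ : TangentBundle (𝓡 N) M) = ⟨q, v⟩ := by rintro q rfl v; rfl
  exact key _ (hP.right_inv hx.1) _

theorem IsChartPlot.mdifferentiableAt_chartField (hP : IsChartPlot (𝓡 N) P e)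
    {Y : EuclideanSpace ℝ (Fin N) → EuclideanSpace ℝ (Fin N)} (hY : ContDiff ℝ ∞ Y)
    (u : EuclideanSpace ℝ (Fin N)) :
    MDifferentiableAt (𝓡 N) (𝓡 N).tangent
      (fun x => (⟨x, chartField P e Y x⟩ : TangentBundle (𝓡 N) M)) (P u) :=
  (((hP.contMDiffOn_chartField hY.contDiffOn (U := univ)).mono (by simp)).contMDiffAt
    (hP.isOpen_range.mem_nhds ⟨u, rfl⟩)).mdifferentiableAt (by simp)

/-- A vector field given in a chart extends, near a point, to a global smooth field. -/
theorem IsChartPlot.exists_isSmoothField [T2Space M] (hP : IsChartPlot (𝓡 N) P e)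
    {Y : EuclideanSpace ℝ (Fin N) → EuclideanSpace ℝ (Fin N)} (hY : ContDiff ℝ ∞ Y)
    (u : EuclideanSpace ℝ (Fin N)) :
    ∃ Z : ∀ x : M, TangentSpace (𝓡 N) x, IsSmoothField Z ∧
      ∀ᶠ x in 𝓝 (P u), Z x = chartField P e Y x := by
  obtain ⟨f, -, hf⟩ := (SmoothBumpFunction.nhds_basis_tsupport (I := 𝓡 N) (P u)).mem_iff.1
    (hP.isOpen_range.mem_nhds ⟨u, rfl⟩)
  refine ⟨fun x => f x • chartField P e Y x,
    ContMDiffOn.smul_section_of_tsupport f.contMDiff.contMDiffOn hP.isOpen_range hf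
    ((hP.contMDiffOn_chartField hY.contDiffOn (U := univ)).mono (by simp)), ?_⟩
  filter_upwards [f.eventuallyEq_one] with x hx
  rw [hx, Pi.one_apply, one_smul]

variable (cov : CovariantDerivative (𝓡 N) (EuclideanSpace ℝ (Fin N)) (TangentSpace (𝓡 N) : M → Type _))

/-- The covariant derivative of a coordinate field, in coordinates. -/
def chartCov (P : EuclideanSpace ℝ (Fin N) → M) (e : M → EuclideanSpace ℝ (Fin N))
    (Z : ∀ x : M, TangentSpace (𝓡 N) x) (u : EuclideanSpace ℝ (Fin N)) :
    EuclideanSpace ℝ (Fin N) →L[ℝ] EuclideanSpace ℝ (Fin N) :=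
  (chartCoord e (P u)).comp ((cov Z (P u)).comp
    (mfderiv 𝓘(ℝ, EuclideanSpace ℝ (Fin N)) (𝓡 N) P u))

/-- The connection form of a connection in a chart. -/
def chartGamma (P : EuclideanSpace ℝ (Fin N) → M) (e : M → EuclideanSpace ℝ (Fin N))
    (u : EuclideanSpace ℝ (Fin N)) : EuclideanSpace ℝ (Fin N) →L[ℝ]
      (EuclideanSpace ℝ (Fin N) →L[ℝ] EuclideanSpace ℝ (Fin N)) :=
  ∑ i, (ContinuousLinearMap.smulRightL ℝ (EuclideanSpace ℝ (Fin N)) (EuclideanSpace ℝ (Fin N))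
    (EuclideanSpace.proj (𝕜 := ℝ) i)).comp
      (chartCov cov P e (chartField P e fun _ => EuclideanSpace.single i 1) u)

theorem chartGamma_apply (u w a : EuclideanSpace ℝ (Fin N)) :
    chartGamma cov P e u w a =
      ∑ i, a i • chartCov cov P e (chartField P e fun _ => EuclideanSpace.single i 1) u w := by
  simp [chartGamma]

variable {cov}

theorem smoothAlong_mfderiv (hP : IsChartPlot (𝓡 N) P e)
    {Y : EuclideanSpace ℝ (Fin N) → EuclideanSpace ℝ (Fin N)} (hY : ContDiff ℝ ∞ Y) :
    SmoothAlong (𝓡 N) (p := P)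
      (fun u => mfderiv 𝓘(ℝ, EuclideanSpace ℝ (Fin N)) (𝓡 N) P u (Y u)) univ := by
  refine hP.smoothAlong hP.contMDiff.contMDiffOn (fun y _ => ⟨y, rfl⟩) ?_
  exact hY.contDiffOn.congr fun y _ => hP.mfderiv_inv_comp y _

theorem IsChartPlot.contDiff_chartCov (hP : IsChartPlot (𝓡 N) P e)
    (hcov : CovariantDerivative.ContMDiffCovariantDerivative cov ∞)
    {Z : ∀ x : M, TangentSpace (𝓡 N) x} (hZ : IsSmoothField Z) :
    ContDiff ℝ ∞ (chartCov cov P e Z) := by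
  refine contDiff_clm_apply_iff.2 fun w => ?_
  have h1 : ContMDiff (𝓡 N) ((𝓡 N).prod 𝓘(ℝ, EuclideanSpace ℝ (Fin N) →L[ℝ] EuclideanSpace ℝ (Fin N))) ∞
      (fun x => TotalSpace.mk' (EuclideanSpace ℝ (Fin N) →L[ℝ] EuclideanSpace ℝ (Fin N))
        (E := fun x : M => TangentSpace (𝓡 N) x →L[ℝ] TangentSpace (𝓡 N) x) x (cov Z x)) :=
    contMDiffOn_univ.1 (hcov.contMDiff.contMDiff (σ := Z) hZ.contMDiffOn)
  have h2 := smoothAlong_mfderiv hP (contDiff_const (c := w))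
  have h3 : SmoothAlong (𝓡 N) (p := P) (fun u => cov Z (P u)
      (mfderiv 𝓘(ℝ, EuclideanSpace ℝ (Fin N)) (𝓡 N) P u w)) univ :=
    ((h1.comp hP.contMDiff).contMDiffOn).clm_bundle_apply h2
  exact contDiffOn_univ.1 (hP.contDiffOn_chartCoord h3 fun y _ => ⟨y, rfl⟩)

theorem IsChartPlot.contDiff_chartGamma [T2Space M] (hP : IsChartPlot (𝓡 N) P e)
    (hcov : CovariantDerivative.ContMDiffCovariantDerivative cov ∞) :
    ContDiff ℝ ∞ (chartGamma cov P e) := by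
  refine ContDiff.sum fun i _ => contDiff_const.clm_comp ?_
  refine contDiff_iff_contDiffAt.2 fun u => ?_
  obtain ⟨Z, hZ, hZe⟩ := hP.exists_isSmoothField
    (contDiff_const (c := EuclideanSpace.single i (1 : ℝ))) u
  refine (hP.contDiff_chartCov hcov hZ).contDiffAt.congr_of_eventuallyEq ?_
  filter_upwards [hP.contMDiff.continuous.continuousAt.eventually hZe.eventually_nhds] with y hy
  rw [chartCov, chartCov]
  congr 2
  have h1 := hP.mdifferentiableAt_chartField
    (contDiff_const (c := EuclideanSpace.single i (1 : ℝ))) y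
  exact (cov.isCovariantDerivativeOn (s := univ)).congr_of_eventuallyEq h1
    ((hZ (P y)).mdifferentiableAt (by simp)) univ_mem (hy.mono fun x hx => hx.symm)

/-- The formula for the covariant derivative in a chart. -/
theorem IsChartPlot.chartCov_eq (hP : IsChartPlot (𝓡 N) P e)
    {Z : ∀ x : M, TangentSpace (𝓡 N) x} (hZs : IsSmoothField Z)
    {Y : EuclideanSpace ℝ (Fin N) → EuclideanSpace ℝ (Fin N)} {u : EuclideanSpace ℝ (Fin N)}
    (hY : DifferentiableAt ℝ Y u) (hZ : ∀ᶠ x in 𝓝 (P u), Z x = chartField P e Y x)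
    (w : EuclideanSpace ℝ (Fin N)) :
    chartCov cov P e Z u w = fderiv ℝ Y u w + chartGamma cov P e u w (Y u) := by
  have hc := cov.isCovariantDerivativeOn (s := univ)
  let s : Fin N → ∀ x : M, TangentSpace (𝓡 N) x := fun i =>
    chartField P e fun _ => EuclideanSpace.single i 1
  let f : Fin N → M → ℝ := fun i x => Y (e x) i
  have hs : ∀ i, MDifferentiableAt (𝓡 N) (𝓡 N).tangent
      (fun x => (⟨x, s i x⟩ : TangentBundle (𝓡 N) M)) (P u) := fun i =>
    hP.mdifferentiableAt_chartField contDiff_const u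
  have hYi : ∀ i, DifferentiableAt ℝ (fun v => Y v i) u := fun i =>
    (EuclideanSpace.proj (𝕜 := ℝ) i).differentiableAt.comp u hY
  have hei := (hP.contMDiffAt_inv u).mdifferentiableAt (by simp)
  have hf : ∀ i, MDifferentiableAt (𝓡 N) 𝓘(ℝ, ℝ) (f i) (P u) := fun i => by
    have h1 : MDifferentiableAt 𝓘(ℝ, EuclideanSpace ℝ (Fin N)) 𝓘(ℝ, ℝ) (fun v => Y v i) (e (P u)) := by
      rw [hP.left_inv]; exact (hYi i).mdifferentiableAt
    exact h1.comp (P u) hei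
  have hsum : ∀ t : Finset (Fin N), MDifferentiableAt (𝓡 N) (𝓡 N).tangent
      (fun x => (⟨x, (∑ i ∈ t, f i • s i) x⟩ : TangentBundle (𝓡 N) M)) (P u) ∧
      cov (∑ i ∈ t, f i • s i) (P u) =
        ∑ i ∈ t, (f i (P u) • cov (s i) (P u) +
          (mvfderiv (𝓡 N) (f i) (P u)).smulRight (s i (P u))) := by
    intro t
    classical
    induction t using Finset.induction_on with
    | empty =>
      simp only [Finset.sum_empty]
      exact ⟨mdifferentiableAt_zeroSection .., hc.zero⟩
    | insert a t ha ih =>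
      have h1 : MDifferentiableAt (𝓡 N) (𝓡 N).tangent
          (fun x => (⟨x, (f a • s a) x⟩ : TangentBundle (𝓡 N) M)) (P u) :=
        (hf a).smul_section (hs a)
      rw [Finset.sum_insert ha, Finset.sum_insert ha]
      refine ⟨mdifferentiableAt_add_section h1 ih.1, ?_⟩
      rw [hc.add h1 ih.1, ih.2, hc.leibniz (hs a) (hf a)]
  obtain ⟨h1, h2⟩ := hsum Finset.univ
  have h3 : ∀ᶠ x in 𝓝 (P u), Z x = (∑ i, f i • s i) x := by
    filter_upwards [hZ] with x hx
    rw [hx, Finset.sum_apply]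
    exact ContinuousLinearMap.apply_eq_sum_single (F := EuclideanSpace ℝ (Fin N))
      (show EuclideanSpace ℝ (Fin N) →L[ℝ] EuclideanSpace ℝ (Fin N) from
        mfderiv 𝓘(ℝ, EuclideanSpace ℝ (Fin N)) (𝓡 N) P (e x)) (Y (e x))
  have h4 : cov Z (P u) = _ :=
    (hc.congr_of_eventuallyEq ((hZs (P u)).mdifferentiableAt (by simp)) h1 univ_mem h3).trans h2
  have h5 : ∀ i, mvfderiv (𝓡 N) (f i) (P u)
      (mfderiv 𝓘(ℝ, EuclideanSpace ℝ (Fin N)) (𝓡 N) P u w) = fderiv ℝ Y u w i := fun i => by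
    have h6 := mfderiv_comp u (hf i) (hP.contMDiff.mdifferentiableAt (by simp))
    have h7 : f i ∘ P = fun v => EuclideanSpace.proj (𝕜 := ℝ) i (Y v) := by
      funext v; simp [f, hP.left_inv]
    have h8 : fderiv ℝ (fun v => EuclideanSpace.proj (𝕜 := ℝ) i (Y v)) u =
        (EuclideanSpace.proj (𝕜 := ℝ) i).comp (fderiv ℝ Y u) :=
      ((EuclideanSpace.proj (𝕜 := ℝ) i).hasFDerivAt.comp u hY.hasFDerivAt).fderiv
    rw [h7, mfderiv_eq_fderiv] at h6
    exact (congrArg (fun A => A w) h6).symm.trans (congrArg (fun A => A w) h8)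
  have h6 := (ContinuousLinearMap.id ℝ (EuclideanSpace ℝ (Fin N))).apply_eq_sum_single
    (fderiv ℝ Y u w)
  simp only [ContinuousLinearMap.id_apply] at h6
  rw [chartGamma_apply, h6, ← Finset.sum_add_distrib, chartCov, h4]
  change chartCoord e (P u) ((∑ i, (f i (P u) • cov (s i) (P u) +
    (mvfderiv (𝓡 N) (f i) (P u)).smulRight (s i (P u))))
      (mfderiv 𝓘(ℝ, EuclideanSpace ℝ (Fin N)) (𝓡 N) P u w)) = _
  rw [sum_apply, map_sum]
  refine Finset.sum_congr rfl fun i _ => ?_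
  rw [add_apply, ContinuousLinearMap.smulRight_apply, h5, map_add, map_smul,
    add_comm, hP.chartCoord_chartField, smul_apply, map_smul]
  have h7 : f i (P u) = Y u i := by simp only [f, hP.left_inv]
  rw [h7]
  rfl

end ChartConnection

/-! ### The complex structure and the curvature in a chart -/

section ChartCurvature

variable {N : ℕ} {M : Type*} [TopologicalSpace M] [ChartedSpace (EuclideanSpace ℝ (Fin N)) M]
  [IsManifold (𝓡 N) ∞ M]
  {P Q : EuclideanSpace ℝ (Fin N) → M} {e e' : M → EuclideanSpace ℝ (Fin N)}

/-- The tangent vector with given coordinates. -/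
def chartInv (P : EuclideanSpace ℝ (Fin N) → M) (e : M → EuclideanSpace ℝ (Fin N)) (x : M) :
    EuclideanSpace ℝ (Fin N) →L[ℝ] TangentSpace (𝓡 N) x :=
  (mfderiv 𝓘(ℝ, EuclideanSpace ℝ (Fin N)) (𝓡 N) P (e x) :
    EuclideanSpace ℝ (Fin N) →L[ℝ] TangentSpace (𝓡 N) (P (e x)))

theorem IsChartPlot.chartInv_apply (hP : IsChartPlot (𝓡 N) P e) (u a : EuclideanSpace ℝ (Fin N)) :
    chartInv P e (P u) a = mfderiv 𝓘(ℝ, EuclideanSpace ℝ (Fin N)) (𝓡 N) P u a :=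
  hP.chartField_apply (fun _ => a) u

theorem IsChartPlot.chartCoord_chartInv (hP : IsChartPlot (𝓡 N) P e) {x : M} (hx : x ∈ range P)
    (a : EuclideanSpace ℝ (Fin N)) : chartCoord e x (chartInv P e x a) = a := by
  obtain ⟨u, rfl⟩ := hx
  exact hP.chartCoord_chartField (fun _ => a) u

theorem IsChartPlot.chartInv_chartCoord (hP : IsChartPlot (𝓡 N) P e) {x : M} (hx : x ∈ range P)
    (v : TangentSpace (𝓡 N) x) : chartInv P e x (chartCoord e x v) = v := by
  obtain ⟨u, rfl⟩ := hx
  rw [hP.chartInv_apply]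
  exact hP.mfderiv_comp_inv u v

/-- The chart identifies a tangent space with the model space. -/
def IsChartPlot.coordEquiv (hP : IsChartPlot (𝓡 N) P e) {x : M} (hx : x ∈ range P) :
    TangentSpace (𝓡 N) x ≃ₗ[ℝ] EuclideanSpace ℝ (Fin N) where
  toFun := chartCoord e x
  map_add' := map_add _
  map_smul' := map_smul _
  invFun := chartInv P e x
  left_inv := hP.chartInv_chartCoord hx
  right_inv := hP.chartCoord_chartInv hx

/-- An endomorphism of a tangent space in coordinates. -/
def chartConj (P : EuclideanSpace ℝ (Fin N) → M) (e : M → EuclideanSpace ℝ (Fin N)) (x : M)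
    (T : TangentSpace (𝓡 N) x →L[ℝ] TangentSpace (𝓡 N) x) :
    EuclideanSpace ℝ (Fin N) →L[ℝ] EuclideanSpace ℝ (Fin N) :=
  (chartCoord e x).comp (T.comp (chartInv P e x))

theorem chartConj_apply (x : M) (T : TangentSpace (𝓡 N) x →L[ℝ] TangentSpace (𝓡 N) x)
    (a : EuclideanSpace ℝ (Fin N)) :
    chartConj P e x T a = chartCoord e x (T (chartInv P e x a)) := rfl

theorem IsChartPlot.chartConj_chartCoord (hP : IsChartPlot (𝓡 N) P e) {x : M} (hx : x ∈ range P)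
    (T : TangentSpace (𝓡 N) x →L[ℝ] TangentSpace (𝓡 N) x) (v : TangentSpace (𝓡 N) x) :
    chartConj P e x T (chartCoord e x v) = chartCoord e x (T v) := by
  rw [chartConj_apply, hP.chartInv_chartCoord hx]

theorem IsChartPlot.chartConj_mul (hP : IsChartPlot (𝓡 N) P e) {x : M} (hx : x ∈ range P)
    (T T' : TangentSpace (𝓡 N) x →L[ℝ] TangentSpace (𝓡 N) x) :
    chartConj P e x T * chartConj P e x T' = chartConj P e x (T.comp T') := by
  ext1 a
  exact hP.chartConj_chartCoord hx T _

theorem IsChartPlot.chartConj_id (hP : IsChartPlot (𝓡 N) P e) {x : M} (hx : x ∈ range P) :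
    chartConj P e x (ContinuousLinearMap.id ℝ _) = 1 := by
  ext1 a
  exact hP.chartCoord_chartInv hx a

theorem chartConj_neg (x : M) (T : TangentSpace (𝓡 N) x →L[ℝ] TangentSpace (𝓡 N) x) :
    chartConj P e x (-T) = -chartConj P e x T := by
  ext1 a
  exact map_neg (chartCoord e x) _

section Transition

theorem IsChartPlot.chartCoord_eq_transition (hP : IsChartPlot (𝓡 N) P e)
    (hQ : IsChartPlot (𝓡 N) Q e') {u : EuclideanSpace ℝ (Fin N)} (hu : P u ∈ range Q)
    (v : TangentSpace (𝓡 N) (P u)) :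
    chartCoord e' (P u) v = fderiv ℝ (e' ∘ P) u (chartCoord e (P u) v) := by
  have h1 := mfderiv_comp u ((hQ.contMDiffOn.contMDiffAt
    (hQ.isOpen_range.mem_nhds hu)).mdifferentiableAt (by simp))
    (hP.contMDiff.mdifferentiableAt (by simp))
  rw [mfderiv_eq_fderiv] at h1
  have h2 := congrArg (fun A => A (chartCoord e (P u) v)) h1
  refine Eq.trans ?_ h2.symm
  exact congrArg (chartCoord e' (P u)) (hP.mfderiv_comp_inv u v).symm

theorem IsChartPlot.chartConj_transition (hP : IsChartPlot (𝓡 N) P e)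
    (hQ : IsChartPlot (𝓡 N) Q e') {u : EuclideanSpace ℝ (Fin N)} (hu : P u ∈ range Q)
    (T : TangentSpace (𝓡 N) (P u) →L[ℝ] TangentSpace (𝓡 N) (P u)) :
    chartConj Q e' (P u) T * fderiv ℝ (e' ∘ P) u = fderiv ℝ (e' ∘ P) u * chartConj P e (P u) T := by
  ext1 a
  obtain ⟨v, rfl⟩ : ∃ v, chartCoord e (P u) v = a := ⟨_, hP.chartCoord_chartInv ⟨u, rfl⟩ a⟩
  change chartConj Q e' (P u) T (fderiv ℝ (e' ∘ P) u (chartCoord e (P u) v)) =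
    fderiv ℝ (e' ∘ P) u (chartConj P e (P u) T (chartCoord e (P u) v))
  rw [← hP.chartCoord_eq_transition hQ hu, hQ.chartConj_chartCoord hu,
    hP.chartConj_chartCoord ⟨u, rfl⟩, ← hP.chartCoord_eq_transition hQ hu]

theorem IsChartPlot.fderiv_transition_mul (hP : IsChartPlot (𝓡 N) P e)
    (hQ : IsChartPlot (𝓡 N) Q e') {u : EuclideanSpace ℝ (Fin N)} (hu : P u ∈ range Q) :
    fderiv ℝ (e' ∘ P) u * fderiv ℝ (e ∘ Q) (e' (P u)) = 1 := by
  have h : ∀ w, Q w = P u → fderiv ℝ (e' ∘ P) u * fderiv ℝ (e ∘ Q) w = 1 := fun w hw => by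
    ext1 a
    obtain ⟨v, rfl⟩ : ∃ v, chartCoord e' (Q w) v = a := ⟨_, hQ.chartCoord_chartInv ⟨w, rfl⟩ a⟩
    have h1 := hQ.chartCoord_eq_transition hP (u := w) ⟨u, hw.symm⟩ v
    change fderiv ℝ (e' ∘ P) u (fderiv ℝ (e ∘ Q) w (chartCoord e' (Q w) v)) = chartCoord e' (Q w) v
    rw [← h1]
    have key : ∀ (x : M) (_ : x = P u) (v : TangentSpace (𝓡 N) x),
        fderiv ℝ (e' ∘ P) u (chartCoord e x v) = chartCoord e' x v := by
      rintro _ rfl v; exact (hP.chartCoord_eq_transition hQ hu v).symm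
    exact key _ hw v
  exact h _ (hQ.right_inv hu)

end Transition

variable
  {cov : CovariantDerivative (𝓡 N) (EuclideanSpace ℝ (Fin N)) (TangentSpace (𝓡 N) : M → Type _)}
  {J : ∀ x : M, TangentSpace (𝓡 N) x →L[ℝ] TangentSpace (𝓡 N) x}

theorem IsChartPlot.chartCov_eq_chartConj (hP : IsChartPlot (𝓡 N) P e)
    (Z : ∀ x : M, TangentSpace (𝓡 N) x) (u : EuclideanSpace ℝ (Fin N)) :
    chartCov cov P e Z u = chartConj P e (P u) (cov Z (P u)) := by
  ext1 a
  rw [chartConj_apply, hP.chartInv_apply]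
  rfl

/-- A smooth field of endomorphisms is smooth in coordinates. -/
theorem IsChartPlot.contDiff_chartConj (hP : IsChartPlot (𝓡 N) P e)
    (hJ : ContMDiff (𝓡 N) ((𝓡 N).prod 𝓘(ℝ, EuclideanSpace ℝ (Fin N) →L[ℝ] EuclideanSpace ℝ (Fin N))) ∞
      (fun x => TotalSpace.mk' (EuclideanSpace ℝ (Fin N) →L[ℝ] EuclideanSpace ℝ (Fin N))
        (E := fun x : M => TangentSpace (𝓡 N) x →L[ℝ] TangentSpace (𝓡 N) x) x (J x))) :
    ContDiff ℝ ∞ fun u => chartConj P e (P u) (J (P u)) := by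
  refine contDiff_clm_apply_iff.2 fun w => ?_
  have h2 := smoothAlong_mfderiv hP (contDiff_const (c := w))
  have h3 : SmoothAlong (𝓡 N) (p := P) (fun u => J (P u)
      (mfderiv 𝓘(ℝ, EuclideanSpace ℝ (Fin N)) (𝓡 N) P u w)) univ :=
    ((hJ.comp hP.contMDiff).contMDiffOn).clm_bundle_apply h2
  have h4 : (fun u => chartConj P e (P u) (J (P u)) w) = fun u => chartCoord e (P u) (J (P u)
      (mfderiv 𝓘(ℝ, EuclideanSpace ℝ (Fin N)) (𝓡 N) P u w)) := funext fun u => by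
    rw [chartConj_apply, hP.chartInv_apply]
  rw [h4]
  exact contDiffOn_univ.1 (hP.contDiffOn_chartCoord h3 fun y _ => ⟨y, rfl⟩)

theorem chartField_eq_chartInv (Y : EuclideanSpace ℝ (Fin N) → EuclideanSpace ℝ (Fin N)) (x : M) :
    chartField P e Y x = chartInv P e x (Y (e x)) := rfl

/-- The derivative of a parallel complex structure in a chart. -/
theorem IsChartPlot.fderiv_chartConj [T2Space M] (hP : IsChartPlot (𝓡 N) P e)
    (hJ : ContMDiff (𝓡 N) ((𝓡 N).prod 𝓘(ℝ, EuclideanSpace ℝ (Fin N) →L[ℝ] EuclideanSpace ℝ (Fin N))) ∞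
      (fun x => TotalSpace.mk' (EuclideanSpace ℝ (Fin N) →L[ℝ] EuclideanSpace ℝ (Fin N))
        (E := fun x : M => TangentSpace (𝓡 N) x →L[ℝ] TangentSpace (𝓡 N) x) x (J x)))
    (hcJ : ∀ Z : (∀ x : M, TangentSpace (𝓡 N) x), IsSmoothField Z →
      ∀ x v, cov (fun y => J y (Z y)) x v = J x (cov Z x v)) (u w : EuclideanSpace ℝ (Fin N)) :
    fderiv ℝ (fun u => chartConj P e (P u) (J (P u))) u w =
      chartConj P e (P u) (J (P u)) * chartGamma cov P e u w -
        chartGamma cov P e u w * chartConj P e (P u) (J (P u)) := by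
  have hs := hP.contDiff_chartConj hJ
  ext1 a
  obtain ⟨Z, hZ, hZe⟩ := hP.exists_isSmoothField (contDiff_const (c := a)) u
  have hJZ : IsSmoothField fun y => J y (Z y) := ContMDiff.clm_bundle_apply hJ hZ
  have h1 := hP.chartCov_eq (cov := cov) hZ (differentiableAt_const a) hZe w
  have h2 := hP.chartCov_eq (cov := cov) (u := u) (Y := fun u => chartConj P e (P u) (J (P u)) a) hJZ
    ((contDiff_clm_apply_iff.1 hs a).differentiable (by simp) u) (by
      filter_upwards [hZe, hP.isOpen_range.mem_nhds ⟨u, rfl⟩] with x hx hx'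
      rw [hx]
      obtain ⟨v, rfl⟩ := hx'
      rw [chartField_eq_chartInv, chartField_eq_chartInv, hP.left_inv, chartConj_apply,
        hP.chartInv_chartCoord ⟨v, rfl⟩]) w
  have h3 : chartCov cov P e (fun y => J y (Z y)) u w =
      chartConj P e (P u) (J (P u)) (chartCov cov P e Z u w) := by
    rw [hP.chartCov_eq_chartConj, hP.chartCov_eq_chartConj, chartConj_apply, chartConj_apply _ (cov Z _),
      hP.chartConj_chartCoord ⟨u, rfl⟩, hcJ Z hZ]
  have h4 : fderiv ℝ (fun u => chartConj P e (P u) (J (P u)) a) u w =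
      fderiv ℝ (fun u => chartConj P e (P u) (J (P u))) u w a := by
    rw [fderiv_clm_apply (hs.differentiable (by simp) u) (differentiableAt_const a)]
    simp
  rw [h3, h1, h4] at h2
  rw [eq_sub_of_add_eq h2.symm]
  simp

/-- The connection form under a change of charts. -/
theorem IsChartPlot.chartGamma_transition [T2Space M] (hP : IsChartPlot (𝓡 N) P e)
    (hQ : IsChartPlot (𝓡 N) Q e') {u : EuclideanSpace ℝ (Fin N)} (hu : P u ∈ range Q)
    (w : EuclideanSpace ℝ (Fin N)) :
    chartGamma cov Q e' (e' (P u)) (fderiv ℝ (e' ∘ P) u w) * fderiv ℝ (e' ∘ P) u =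
      fderiv ℝ (e' ∘ P) u * chartGamma cov P e u w - fderiv ℝ (fderiv ℝ (e' ∘ P)) u w := by
  have hφ : ContDiffAt ℝ ∞ (e' ∘ P) u := (hQ.contDiffOn_inv_comp hP.contMDiff).contDiffAt
    ((hQ.isOpen_range.preimage hP.contMDiff.continuous).mem_nhds hu)
  have hψ : ContDiffAt ℝ ∞ (e ∘ Q) (e' (P u)) := (hP.contDiffOn_inv_comp hQ.contMDiff).contDiffAt
    ((hP.isOpen_range.preimage hQ.contMDiff.continuous).mem_nhds
      ⟨u, (hQ.right_inv hu).symm⟩)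
  have hψu : (e ∘ Q) (e' (P u)) = u := by
    rw [Function.comp_apply, hQ.right_inv hu, hP.left_inv]
  have hH : DifferentiableAt ℝ (fderiv ℝ (e' ∘ P)) u :=
    (hφ.fderiv_right (m := ∞) le_rfl).differentiableAt (by simp)
  ext1 a
  obtain ⟨Z, hZ, hZe⟩ := hP.exists_isSmoothField (contDiff_const (c := a)) u
  let Y : EuclideanSpace ℝ (Fin N) → EuclideanSpace ℝ (Fin N) := fun v =>
    fderiv ℝ (e' ∘ P) ((e ∘ Q) v) a
  have hY : DifferentiableAt ℝ Y (e' (P u)) := by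
    have h1 : DifferentiableAt ℝ (fun u => fderiv ℝ (e' ∘ P) u a) ((e ∘ Q) (e' (P u))) := by
      rw [hψu]; exact hH.clm_apply (differentiableAt_const a)
    exact h1.comp (e' (P u)) (hψ.differentiableAt (by simp))
  have h1 := hP.chartCov_eq (cov := cov) hZ (differentiableAt_const a) hZe w
  have h2 := hQ.chartCov_eq (cov := cov) hZ hY (by
      rw [hQ.right_inv hu]
      filter_upwards [hZe, hP.isOpen_range.mem_nhds ⟨u, rfl⟩, hQ.isOpen_range.mem_nhds hu]
        with x hx hx' hxQ
      rw [hx]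
      obtain ⟨v, rfl⟩ := hx'
      have h3 : Y (e' (P v)) = chartCoord e' (P v) (chartInv P e (P v) a) := by
        rw [hP.chartCoord_eq_transition hQ hxQ, hP.chartCoord_chartInv ⟨v, rfl⟩]
        simp only [Y, Function.comp_apply, hQ.right_inv hxQ, hP.left_inv]
      rw [chartField_eq_chartInv, chartField_eq_chartInv, h3, hQ.chartInv_chartCoord hxQ])
    (fderiv ℝ (e' ∘ P) u w)
  have h3 : chartCov cov Q e' Z (e' (P u)) (fderiv ℝ (e' ∘ P) u w) =
      fderiv ℝ (e' ∘ P) u (chartCov cov P e Z u w) := by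
    rw [hQ.chartCov_eq_chartConj, hP.chartCov_eq_chartConj,
      congrArg (fun x => chartConj Q e' x (cov Z x)) (hQ.right_inv hu)]
    exact congrArg (fun A => A w) (hP.chartConj_transition hQ hu (cov Z (P u)))
  have h4 : fderiv ℝ Y (e' (P u)) (fderiv ℝ (e' ∘ P) u w) = fderiv ℝ (fderiv ℝ (e' ∘ P)) u w a := by
    have h5 := fderiv_comp u (g := Y) (f := e' ∘ P) hY (hφ.differentiableAt (by simp))
    have h6 : Y ∘ (e' ∘ P) =ᶠ[𝓝 u] fun u => fderiv ℝ (e' ∘ P) u a := by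
      filter_upwards [(hQ.isOpen_range.preimage hP.contMDiff.continuous).mem_nhds hu] with v hv
      simp only [Y, Function.comp_apply, hQ.right_inv hv, hP.left_inv]
    rw [h6.fderiv_eq, fderiv_clm_apply hH (differentiableAt_const a)] at h5
    have h7 := congrArg (fun A => A w) h5
    simp at h7
    exact h7.symm
  have h5 : Y (e' (P u)) = fderiv ℝ (e' ∘ P) u a := by simp only [Y, hψu]
  rw [h3, h1, h4, h5] at h2
  simp only [fderiv_fun_const, Pi.zero_apply, zero_apply, zero_add] at h2
  change chartGamma cov Q e' (e' (P u)) (fderiv ℝ (e' ∘ P) u w) (fderiv ℝ (e' ∘ P) u a) =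
    fderiv ℝ (e' ∘ P) u (chartGamma cov P e u w a) - fderiv ℝ (fderiv ℝ (e' ∘ P)) u w a
  rw [h2]
  abel

theorem IsChartPlot.mlieBracket_eq_zero (hP : IsChartPlot (𝓡 N) P e)
    {X Y : ∀ x : M, TangentSpace (𝓡 N) x} {u v w : EuclideanSpace ℝ (Fin N)}
    (hXs : IsSmoothField X) (hYs : IsSmoothField Y)
    (hX : ∀ᶠ x in 𝓝 (P u), X x = chartField P e (fun _ => v) x)
    (hY : ∀ᶠ x in 𝓝 (P u), Y x = chartField P e (fun _ => w) x) :
    VectorField.mlieBracket (𝓡 N) X Y (P u) = 0 := by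
  have hinv : ∀ u, (mfderiv 𝓘(ℝ, EuclideanSpace ℝ (Fin N)) (𝓡 N) P u).IsInvertible := fun u =>
    ⟨ContinuousLinearEquiv.equivOfInverse (mfderiv 𝓘(ℝ, EuclideanSpace ℝ (Fin N)) (𝓡 N) P u)
      (mfderiv (𝓡 N) 𝓘(ℝ, EuclideanSpace ℝ (Fin N)) e (P u)) (hP.mfderiv_inv_comp u)
      (hP.mfderiv_comp_inv u), rfl⟩
  have : IsManifold (𝓡 N) (minSmoothness ℝ 2) M := IsManifold.of_le (n := ∞) (by simp; exact ENat.LEInfty.out)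
  have h1 := VectorField.mpullback_mlieBracket (n := ∞) (I := 𝓘(ℝ, EuclideanSpace ℝ (Fin N)))
    (I' := 𝓡 N) (f := P) (V := X) (W := Y) (x₀ := u)
    ((hXs (P u)).mdifferentiableAt (by simp)) ((hYs (P u)).mdifferentiableAt (by simp))
    (hP.contMDiff u) (by simp; exact ENat.LEInfty.out)
  have h2 : ∀ (X : ∀ x : M, TangentSpace (𝓡 N) x) (v : EuclideanSpace ℝ (Fin N)),
      (∀ᶠ x in 𝓝 (P u), X x = chartField P e (fun _ => v) x) →
      VectorField.mpullback 𝓘(ℝ, EuclideanSpace ℝ (Fin N)) (𝓡 N) P X =ᶠ[𝓝 u] fun _ => v := by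
    intro X v hX
    filter_upwards [hP.contMDiff.continuous.continuousAt.eventually hX] with y hy
    rw [VectorField.mpullback_apply, hy, hP.chartField_apply]
    exact (hinv y).inverse_apply_eq.2 rfl
  rw [(h2 X v hX).mlieBracket_vectorField_eq (h2 Y w hY), VectorField.mpullback_apply,
    (hinv u).inverse_apply_eq] at h1
  have hb : ∀ V W : (∀ y : EuclideanSpace ℝ (Fin N), TangentSpace 𝓘(ℝ, EuclideanSpace ℝ (Fin N)) y),
      VectorField.mlieBracket 𝓘(ℝ, EuclideanSpace ℝ (Fin N)) V W u =
        VectorField.lieBracket ℝ (E := EuclideanSpace ℝ (Fin N)) V W u := fun V W => by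
    rw [← VectorField.mlieBracketWithin_univ, VectorField.mlieBracketWithin_eq_lieBracketWithin]
    exact congrFun (VectorField.lieBracketWithin_univ (𝕜 := ℝ) (E := EuclideanSpace ℝ (Fin N))) u
  have hc : VectorField.lieBracket ℝ (fun _ : EuclideanSpace ℝ (Fin N) => v) (fun _ => w) u = 0 := by
    simp [VectorField.lieBracket]
  rw [h1]
  exact (congrArg _ ((hb _ _).trans hc)).trans (map_zero _)

/-- The first Chern form in a chart. -/
theorem IsChernForm.pull_eq [T2Space M] {κ : SmoothForm (𝓡 N) M 2} (hκ : IsChernForm J cov κ)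
    (hcov : CovariantDerivative.ContMDiffCovariantDerivative cov ∞)
    (hP : IsChartPlot (𝓡 N) P e) (u v w : EuclideanSpace ℝ (Fin N)) :
    κ.toFun (P u) ![chartInv P e (P u) v, chartInv P e (P u) w] = 1 / (4 * Real.pi) *
      LinearMap.trace ℝ (EuclideanSpace ℝ (Fin N)) (chartConj P e (P u) (J (P u)) *
        (fderiv ℝ (chartGamma cov P e) u v w - fderiv ℝ (chartGamma cov P e) u w v +
          (chartGamma cov P e u v * chartGamma cov P e u w -
            chartGamma cov P e u w * chartGamma cov P e u v)) : _ →L[ℝ] _) := by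
  obtain ⟨R, hR, hκR⟩ := hκ
  have hG := hP.contDiff_chartGamma hcov
  have hfield : ∀ (v w a : EuclideanSpace ℝ (Fin N)) (Y Z : ∀ x : M, TangentSpace (𝓡 N) x),
      IsSmoothField Y → IsSmoothField Z → (∀ᶠ x in 𝓝 (P u), Y x = chartField P e (fun _ => w) x) →
      (∀ᶠ x in 𝓝 (P u), Z x = chartField P e (fun _ => a) x) →
      chartCoord e (P u) (cov (fun y => cov Z y (Y y)) (P u) (chartInv P e (P u) v)) =
        fderiv ℝ (chartGamma cov P e) u v w a +
          chartGamma cov P e u v (chartGamma cov P e u w a) := by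
    intro v w a Y Z hYs hZs hY hZ
    have h1 : IsSmoothField fun y => cov Z y (Y y) :=
      ContMDiff.clm_bundle_apply (contMDiffOn_univ.1 (hcov.contMDiff.contMDiff (σ := Z) hZs.contMDiffOn))
        hYs
    have h2 := hP.chartCov_eq (cov := cov) (u := u) (Y := fun u => chartGamma cov P e u w a) h1
      (((hG.differentiable (by simp) u).clm_apply (differentiableAt_const w)).clm_apply
        (differentiableAt_const a)) (by
        filter_upwards [hY, hZ.eventually_nhds, hP.isOpen_range.mem_nhds ⟨u, rfl⟩] with x hx hx' hxP
        obtain ⟨y, rfl⟩ := hxP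
        have h3 := hP.chartCov_eq (cov := cov) hZs (differentiableAt_const a) hx' w
        rw [hP.chartCov_eq_chartConj, chartConj_apply] at h3
        simp only [fderiv_fun_const, Pi.zero_apply, zero_apply, zero_add] at h3
        rw [hx, chartField_eq_chartInv, chartField_eq_chartInv, hP.left_inv, ← h3,
          hP.chartInv_chartCoord ⟨y, rfl⟩]) v
    rw [hP.chartCov_eq_chartConj, chartConj_apply] at h2
    rw [h2, fderiv_clm_apply ((hG.differentiable (by simp) u).clm_apply (differentiableAt_const w))
      (differentiableAt_const a), fderiv_clm_apply (hG.differentiable (by simp) u)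
      (differentiableAt_const w)]
    simp
  have hRa : ∀ a, chartCoord e (P u) (R (P u) (chartInv P e (P u) v) (chartInv P e (P u) w)
      (chartInv P e (P u) a)) = (fderiv ℝ (chartGamma cov P e) u v w -
        fderiv ℝ (chartGamma cov P e) u w v + (chartGamma cov P e u v * chartGamma cov P e u w -
            chartGamma cov P e u w * chartGamma cov P e u v)) a := fun a => by
    obtain ⟨X, hXs, hX⟩ := hP.exists_isSmoothField (contDiff_const (c := v)) u
    obtain ⟨Y, hYs, hY⟩ := hP.exists_isSmoothField (contDiff_const (c := w)) u
    obtain ⟨Z, hZs, hZ⟩ := hP.exists_isSmoothField (contDiff_const (c := a)) u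
    have h1 := hR X Y Z hXs hYs hZs (P u)
    rw [hP.mlieBracket_eq_zero hXs hYs hX hY, map_zero, sub_zero] at h1
    have h2 := hfield v w a Y Z hYs hZs hY hZ
    have h3 := hfield w v a X Z hXs hZs hX hZ
    rw [hX.self_of_nhds, hY.self_of_nhds, hZ.self_of_nhds] at h1
    simp only [chartField_eq_chartInv] at h1
    rw [h1, map_sub, h2, h3]
    change _ = fderiv ℝ (chartGamma cov P e) u v w a - fderiv ℝ (chartGamma cov P e) u w v a +
      (chartGamma cov P e u v (chartGamma cov P e u w a) -
        chartGamma cov P e u w (chartGamma cov P e u v a))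
    abel
  rw [hκR, ← LinearMap.trace_conj' _ (hP.coordEquiv ⟨u, rfl⟩)]
  congr 2
  ext1 a
  change chartCoord e (P u) (J (P u) (R (P u) (chartInv P e (P u) v) (chartInv P e (P u) w)
      (chartInv P e (P u) a))) = chartConj P e (P u) (J (P u)) _
  exact (hP.chartConj_chartCoord ⟨u, rfl⟩ _ _).symm.trans (congrArg _ (hRa a))

end ChartCurvature

/-! ### The reflection in a Lagrangian plane -/

namespace LagGr

variable {N : ℕ} {M : Type*} [TopologicalSpace M] [ChartedSpace (EuclideanSpace ℝ (Fin N)) M]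
  [IsManifold (𝓡 N) ∞ M] {σ : SymplecticForm (𝓡 N) M}
  {J : ∀ x : M, TangentSpace (𝓡 N) x →L[ℝ] TangentSpace (𝓡 N) x}

theorem exists_add_J (hJ : IsCompatibleJ σ J) (W : LagGr σ.toFun) (v : TangentSpace (𝓡 N) W.pt) :
    ∃ x ∈ W.plane, ∃ y ∈ W.plane, v = x + J W.pt y := by
  have : FiniteDimensional ℝ (TangentSpace (𝓡 N) W.pt) :=
    inferInstanceAs (FiniteDimensional ℝ (EuclideanSpace ℝ (Fin N)))
  let A := altBilin (σ.toFun W.pt)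
  let B : LinearMap.BilinForm ℝ (TangentSpace (𝓡 N) W.pt) :=
    A.compl₂ (J W.pt : TangentSpace (𝓡 N) W.pt →ₗ[ℝ] TangentSpace (𝓡 N) W.pt)
  have hB : ∀ x y, B x y = A x (J W.pt y) := fun x y => rfl
  have hs : ∀ x y, B x y = B y x := fun x y => by
    have h1 : A (J W.pt y) (J W.pt (J W.pt x)) = A y (J W.pt x) := hJ.invariant W.pt y (J W.pt x)
    rw [hJ.sq, map_neg, ← altBilin_swap] at h1
    rw [hB, hB, ← h1]
  have hc : IsCompl W.plane (B.orthogonal W.plane) := by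
    refine LinearMap.BilinForm.isCompl_orthogonal_of_restrict_nondegenerate
      (fun x y h => (hs y x).trans h) ?_
    have hp : ∀ x : W.plane, (∀ y : W.plane, B x y = 0) → x = 0 := fun x h => by
      by_contra h0
      have h1 := hJ.pos W.pt x.1 fun h => h0 (Subtype.ext h)
      exact h1.ne' (h x)
    exact ⟨hp, fun x h => hp x fun y => (hs x y).trans (h y)⟩
  obtain ⟨x, hx, z, hz, rfl⟩ := Submodule.mem_sup.1 (hc.sup_eq_top ▸ Submodule.mem_top : v ∈ _)
  refine ⟨x, hx, -J W.pt z, Submodule.neg_mem _ ((W.isLagrangian _).2 fun w hw => ?_), by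
    rw [map_neg, hJ.sq, neg_neg]⟩
  have h1 : A w (J W.pt z) = 0 := hz w hw
  have h2 : A (J W.pt z) w = 0 := by rw [altBilin_swap, h1, neg_zero]
  exact h2

theorem eq_zero_of_add_J (hJ : IsCompatibleJ σ J) (W : LagGr σ.toFun)
    {x y : TangentSpace (𝓡 N) W.pt} (hx : x ∈ W.plane) (hy : y ∈ W.plane) (h : x + J W.pt y = 0) :
    x = 0 ∧ y = 0 := by
  have hy0 : y = 0 := by
    by_contra h0
    have h1 := hJ.pos W.pt y h0
    have h2 : J W.pt y = -x := (eq_neg_of_add_eq_zero_right h)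
    have h3 : altBilin (σ.toFun W.pt) y x = 0 := (W.isLagrangian y).1 hy x hx
    have h4 : altBilin (σ.toFun W.pt) y (J W.pt y) = 0 := by rw [h2, map_neg, h3, neg_zero]
    exact h1.ne' h4
  refine ⟨?_, hy0⟩
  rw [hy0, map_zero, add_zero] at h
  exact h

theorem exists_reflection (hJ : IsCompatibleJ σ J) (W : LagGr σ.toFun) :
    ∃ S : TangentSpace (𝓡 N) W.pt →L[ℝ] TangentSpace (𝓡 N) W.pt,
      ∀ x ∈ W.plane, S x = x ∧ S (J W.pt x) = -J W.pt x := by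
  have : FiniteDimensional ℝ (TangentSpace (𝓡 N) W.pt) :=
    inferInstanceAs (FiniteDimensional ℝ (EuclideanSpace ℝ (Fin N)))
  have hc : IsCompl W.plane (W.plane.map (J W.pt : TangentSpace (𝓡 N) W.pt →ₗ[ℝ]
      TangentSpace (𝓡 N) W.pt)) := by
    constructor
    · rw [Submodule.disjoint_def]
      rintro x hx ⟨y, hy, rfl⟩
      exact (eq_zero_of_add_J hJ W hx (Submodule.neg_mem _ hy) (by
        rw [map_neg]; exact add_neg_cancel _)).1
    · rw [codisjoint_iff, eq_top_iff]
      rintro v -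
      obtain ⟨x, hx, y, hy, rfl⟩ := exists_add_J hJ W v
      exact Submodule.add_mem_sup hx ⟨y, hy, rfl⟩
  let S : TangentSpace (𝓡 N) W.pt →ₗ[ℝ] TangentSpace (𝓡 N) W.pt :=
    (2 : ℝ) • Submodule.projection _ _ hc - LinearMap.id
  have : T2Space (TangentSpace (𝓡 N) W.pt) :=
    inferInstanceAs (T2Space (EuclideanSpace ℝ (Fin N)))
  refine ⟨LinearMap.toContinuousLinearMap (E := TangentSpace (𝓡 N) W.pt)
    (F' := TangentSpace (𝓡 N) W.pt) S, fun x hx => ⟨?_, ?_⟩⟩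
  · change (2 : ℝ) • Submodule.projection _ _ hc x - x = x
    rw [Submodule.projection_apply_of_mem_left hc hx]
    module
  · change (2 : ℝ) • Submodule.projection _ _ hc (J W.pt x) - J W.pt x = _
    rw [show Submodule.projection _ _ hc (J W.pt x) = 0 from
      Submodule.projection_apply_of_mem_right hc ⟨x, hx, rfl⟩]
    module

/-- The reflection in a Lagrangian plane `U` along `J U`. -/
def reflection (hJ : IsCompatibleJ σ J) (W : LagGr σ.toFun) :
    TangentSpace (𝓡 N) W.pt →L[ℝ] TangentSpace (𝓡 N) W.pt :=
  (exists_reflection hJ W).choose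

theorem reflection_of_mem (hJ : IsCompatibleJ σ J) (W : LagGr σ.toFun)
    {x : TangentSpace (𝓡 N) W.pt} (hx : x ∈ W.plane) : reflection hJ W x = x :=
  ((exists_reflection hJ W).choose_spec x hx).1

theorem reflection_J_of_mem (hJ : IsCompatibleJ σ J) (W : LagGr σ.toFun)
    {x : TangentSpace (𝓡 N) W.pt} (hx : x ∈ W.plane) :
    reflection hJ W (J W.pt x) = -J W.pt x :=
  ((exists_reflection hJ W).choose_spec x hx).2

theorem reflection_comp_self (hJ : IsCompatibleJ σ J) (W : LagGr σ.toFun) :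
    (reflection hJ W).comp (reflection hJ W) = ContinuousLinearMap.id ℝ _ := by
  ext1 v
  obtain ⟨x, hx, y, hy, rfl⟩ := exists_add_J hJ W v
  simp only [ContinuousLinearMap.comp_apply, map_add, reflection_of_mem hJ W hx,
    reflection_J_of_mem hJ W hy, map_neg, neg_neg, ContinuousLinearMap.id_apply]

theorem J_comp_reflection (hJ : IsCompatibleJ σ J) (W : LagGr σ.toFun) :
    (J W.pt).comp (reflection hJ W) = -(reflection hJ W).comp (J W.pt) := by
  ext1 v
  obtain ⟨x, hx, y, hy, rfl⟩ := exists_add_J hJ W v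
  simp only [ContinuousLinearMap.comp_apply, map_add, reflection_of_mem hJ W hx,
    reflection_J_of_mem hJ W hy, map_neg, neg_apply, hJ.sq, reflection_J_of_mem hJ W hx,
    reflection_of_mem hJ W hy, neg_neg]

theorem add_reflection_mem (hJ : IsCompatibleJ σ J) (W : LagGr σ.toFun)
    (v : TangentSpace (𝓡 N) W.pt) : v + reflection hJ W v ∈ W.plane := by
  obtain ⟨x, hx, y, hy, rfl⟩ := exists_add_J hJ W v
  rw [map_add, reflection_of_mem hJ W hx, reflection_J_of_mem hJ W hy,
    show x + J W.pt y + (x + -J W.pt y) = x + x by abel]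
  exact Submodule.add_mem _ hx hx

theorem J_sub_reflection_mem (hJ : IsCompatibleJ σ J) (W : LagGr σ.toFun)
    (v : TangentSpace (𝓡 N) W.pt) : J W.pt (reflection hJ W v - v) ∈ W.plane := by
  obtain ⟨x, hx, y, hy, rfl⟩ := exists_add_J hJ W v
  rw [map_add, reflection_of_mem hJ W hx, reflection_J_of_mem hJ W hy,
    show x + -J W.pt y - (x + J W.pt y) = -J W.pt (y + y) by rw [map_add]; abel, map_neg, hJ.sq,
    neg_neg]
  exact Submodule.add_mem _ hy hy

variable {m : ℕ} {R : EuclideanSpace ℝ (Fin m) → LagGr σ.toFun}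
  {P : EuclideanSpace ℝ (Fin N) → M} {e : M → EuclideanSpace ℝ (Fin N)}

/-- The reflection is smooth along plots. -/
theorem contDiff_chartConj_reflection (hJ : IsCompatibleJ σ J) (hP : IsChartPlot (𝓡 N) P e)
    (hR : IsPlotOn univ R) (hRP : ∀ y, (R y).pt ∈ range P) :
    ContDiff ℝ ∞ fun y => chartConj P e (R y).pt (reflection hJ (R y)) := by
  refine contDiff_iff_contDiffAt.2 fun u => ?_
  obtain ⟨U, hU, huU, -, K, X, hX, hs⟩ := hR.exists_fields (mem_univ u)
  have hpt : ContMDiff 𝓘(ℝ, EuclideanSpace ℝ (Fin m)) (𝓡 N) ∞ fun y => (R y).pt :=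
    contMDiffOn_univ.1 hR.1
  have hUn := hU.mem_nhds huU
  have hXm : ∀ i, ∀ y ∈ U, X i y ∈ (R y).plane := fun i y hy => by
    rw [hs y hy]; exact Submodule.subset_span ⟨i, rfl⟩
  have hx : ∀ i, ContDiffAt ℝ ∞ (fun y => chartCoord e (R y).pt (X i y)) u := fun i =>
    (hP.contDiffOn_chartCoord (hX i) fun y _ => hRP y).contDiffAt hUn
  have hq : ContDiffAt ℝ ∞ (fun y => e (R y).pt) u :=
    ((hP.contDiffOn_inv_comp hpt).contDiffAt (by
      rw [show (fun y => (R y).pt) ⁻¹' range P = univ from eq_univ_of_forall hRP]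
      exact univ_mem))
  have hj : ContDiffAt ℝ ∞ (fun y => chartConj P e (R y).pt (J (R y).pt)) u := by
    have h1 := (hP.contDiff_chartConj hJ.smooth).contDiffAt.comp u hq
    refine h1.congr_of_eventuallyEq (Eventually.of_forall fun y => ?_)
    exact congrArg (fun x => chartConj P e x (J x)) (hP.right_inv (hRP y)).symm
  set T := TangentSpace (𝓡 N) (R u).pt
  let L : (Fin K → ℝ) →ₗ[ℝ] T := Fintype.linearCombination ℝ (fun i => X i u)
  have hL : ∀ c, L c = ∑ i, c i • X i u := fun c => Fintype.linearCombination_apply ℝ _ c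
  have hLr : LinearMap.range L = (R u).plane := by
    rw [hs u huU]; exact Fintype.range_linearCombination ℝ _
  obtain ⟨g, hg⟩ := L.rangeRestrict.exists_rightInverse_of_surjective L.range_rangeRestrict
  obtain ⟨c, hc⟩ := LinearMap.exists_extend g
  have hLc : ∀ v ∈ (R u).plane, ∑ i, c v i • X i u = v := fun v hv => by
    rw [← hLr] at hv
    have h1 := congrArg (fun A => A ⟨v, hv⟩) hg
    have h2 := congrArg (fun A => A ⟨v, hv⟩) hc
    have h3 : c v = g ⟨v, hv⟩ := h2
    rw [← hL, h3]
    exact congrArg Subtype.val h1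
  let S₀ := chartConj P e (R u).pt (reflection hJ (R u))
  let φ : Fin K → EuclideanSpace ℝ (Fin N) →L[ℝ] ℝ := fun i =>
    LinearMap.toContinuousLinearMap ((1 / 2 : ℝ) • (LinearMap.proj i ∘ₗ c ∘ₗ
      ((ContinuousLinearMap.id ℝ _ + reflection hJ (R u)).comp (chartInv P e (R u).pt) :
        EuclideanSpace ℝ (Fin N) →L[ℝ] T)))
  let ψ : Fin K → EuclideanSpace ℝ (Fin N) →L[ℝ] ℝ := fun i =>
    LinearMap.toContinuousLinearMap ((1 / 2 : ℝ) • (LinearMap.proj i ∘ₗ c ∘ₗ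
      (((J (R u).pt).comp (reflection hJ (R u) - ContinuousLinearMap.id ℝ _)).comp
        (chartInv P e (R u).pt) : EuclideanSpace ℝ (Fin N) →L[ℝ] T)))
  let F : EuclideanSpace ℝ (Fin m) → EuclideanSpace ℝ (Fin N) →L[ℝ] EuclideanSpace ℝ (Fin N) :=
    fun y => ∑ i, ((φ i).smulRight (chartCoord e (R y).pt (X i y)) +
      (ψ i).smulRight (chartConj P e (R y).pt (J (R y).pt) (chartCoord e (R y).pt (X i y))))
  have hF : ContDiffAt ℝ ∞ F u := by
    refine ContDiffAt.sum fun i _ => ContDiffAt.add ?_ ?_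
    · exact contDiffAt_const.smulRight (hx i)
    · exact contDiffAt_const.smulRight (hj.clm_apply (hx i))
  have hFv : ∀ y v, F y v = ∑ i, (φ i v • chartCoord e (R y).pt (X i y) +
      ψ i v • chartConj P e (R y).pt (J (R y).pt) (chartCoord e (R y).pt (X i y))) := fun y v => by
    simp only [F, sum_apply]
    rfl
  have hφ : ∀ i v, φ i v = (1 / 2 : ℝ) * c (chartInv P e (R u).pt v +
      reflection hJ (R u) (chartInv P e (R u).pt v)) i := fun i v => rfl
  have hψ : ∀ i v, ψ i v = (1 / 2 : ℝ) * c (J (R u).pt (reflection hJ (R u)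
      (chartInv P e (R u).pt v) - chartInv P e (R u).pt v)) i := fun i v => rfl
  have hS₀ : ∀ v, chartInv P e (R u).pt (S₀ v) = reflection hJ (R u) (chartInv P e (R u).pt v) :=
    fun v => by
      rw [← hP.chartCoord_chartInv (hRP u) v, hP.chartConj_chartCoord (hRP u),
        hP.chartInv_chartCoord (hRP u), hP.chartInv_chartCoord (hRP u)]
  have hrr : ∀ w, reflection hJ (R u) (reflection hJ (R u) w) = w := fun w =>
    congrArg (fun A => A w) (reflection_comp_self hJ (R u))
  have hF1 : F u = 1 := by
    ext1 v
    obtain ⟨w, rfl⟩ : ∃ w, chartCoord e (R u).pt w = v :=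
      ⟨chartInv P e (R u).pt v, hP.chartCoord_chartInv (hRP u) v⟩
    have h1 := hLc _ (add_reflection_mem hJ (R u) w)
    have h2 := hLc _ (J_sub_reflection_mem hJ (R u) w)
    have h3 : w = (1 / 2 : ℝ) • ∑ i, c (w + reflection hJ (R u) w) i • X i u +
        (1 / 2 : ℝ) • J (R u).pt (∑ i, c (J (R u).pt (reflection hJ (R u) w - w)) i • X i u) := by
      rw [h1, h2, hJ.sq]
      module
    rw [hFv]
    simp only [hφ, hψ, hP.chartInv_chartCoord (hRP u), hP.chartConj_chartCoord (hRP u)]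
    conv_rhs => rw [h3]
    simp only [map_add, map_smul, map_sum, Finset.smul_sum, Finset.sum_add_distrib, mul_smul]
    rfl
  have hFS : ∀ y ∈ U, chartConj P e (R y).pt (reflection hJ (R y)) * F y = F y * S₀ := by
    intro y hy
    ext1 v
    change chartConj P e (R y).pt (reflection hJ (R y)) (F y v) = F y (S₀ v)
    rw [hFv, hFv, map_sum]
    refine Finset.sum_congr rfl fun i _ => ?_
    rw [map_add, map_smul, map_smul, hφ, hφ, hψ, hψ, hS₀, hrr, hP.chartConj_chartCoord (hRP y),
      hP.chartConj_chartCoord (hRP y), hP.chartConj_chartCoord (hRP y),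
      reflection_of_mem hJ _ (hXm i y hy), reflection_J_of_mem hJ _ (hXm i y hy)]
    rw [add_comm (chartInv P e (R u).pt v), ← neg_sub (reflection hJ (R u) _), map_neg (J (R u).pt),
      map_neg c, map_neg (chartCoord e (R y).pt), Pi.neg_apply]
    module
  have hinv : ContDiffAt ℝ ∞ (fun y => Ring.inverse (F y)) u := by
    have h := contDiffAt_ringInverse (n := ∞) ℝ
      (1 : (EuclideanSpace ℝ (Fin N) →L[ℝ] EuclideanSpace ℝ (Fin N))ˣ)
    rw [Units.val_one, ← hF1] at h
    exact h.comp u hF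
  have hunit : ∀ᶠ y in 𝓝 u, IsUnit (F y) :=
    hF.continuousAt.eventually (by rw [hF1]; exact Units.isOpen.mem_nhds isUnit_one)
  refine ((hF.clm_comp (contDiffAt_const (c := S₀))).clm_comp hinv).congr_of_eventuallyEq ?_
  filter_upwards [hunit, hUn] with y hy hyU
  change _ = F y * S₀ * Ring.inverse (F y)
  rw [← hFS y hyU, mul_assoc, Ring.mul_inverse_cancel _ hy, mul_one]

end LagGr

/-! ### The connection form on the Lagrangian Grassmannian -/

section ReflectionCovec

variable {E E' A : Type*} [NormedAddCommGroup E] [NormedSpace ℝ E] [NormedAddCommGroup E']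
  [NormedSpace ℝ E'] [NormedRing A] [NormedAlgebra ℝ A]

/-- The covector `v ↦ reflectionTrace tr J S (S' v) (g v)`. -/
def reflectionCovec (tr : A →L[ℝ] ℝ) (J S : A) (S' g : E →L[ℝ] A) : E →L[ℝ] ℝ :=
  (1 / 2 : ℝ) • tr.comp (((ContinuousLinearMap.mul ℝ A).flip S).comp
      ((ContinuousLinearMap.mul ℝ A J).comp S')) +
    tr.comp ((ContinuousLinearMap.mul ℝ A J).comp g)

theorem reflectionCovec_apply (tr : A →L[ℝ] ℝ) (J S : A) (S' g : E →L[ℝ] A) (v : E) :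
    reflectionCovec tr J S S' g v = reflectionTrace (tr : A →ₗ[ℝ] ℝ) J S (S' v) (g v) := rfl

theorem reflectionCovec_comp (tr : A →L[ℝ] ℝ) (J S : A) {S' g : E →L[ℝ] A} {S₁ g₁ : E' →L[ℝ] A}
    {B : E' →L[ℝ] E} (hS : S₁ = S'.comp B) (hg : g₁ = g.comp B) :
    reflectionCovec tr J S S₁ g₁ = (reflectionCovec tr J S S' g).comp B := by
  subst hS hg; rfl

theorem ContDiff.reflectionCovec {tr : A →L[ℝ] ℝ} {j s : E' → A} {s' g : E' → E →L[ℝ] A}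
    (hj : ContDiff ℝ ∞ j) (hs : ContDiff ℝ ∞ s) (hs' : ContDiff ℝ ∞ s') (hg : ContDiff ℝ ∞ g) :
    ContDiff ℝ ∞ fun u => reflectionCovec tr (j u) (s u) (s' u) (g u) := by
  have h1 : ContDiff ℝ ∞ fun u => ContinuousLinearMap.mul ℝ A (j u) :=
    (ContinuousLinearMap.mul ℝ A).contDiff.comp hj
  have h2 : ContDiff ℝ ∞ fun u => (ContinuousLinearMap.mul ℝ A).flip (s u) :=
    (ContinuousLinearMap.mul ℝ A).flip.contDiff.comp hs
  exact ContDiff.add (ContDiff.const_smul (1 / 2 : ℝ) (ContDiff.clm_comp contDiff_const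
    (ContDiff.clm_comp h2 (ContDiff.clm_comp h1 hs'))))
    (contDiff_const.clm_comp (ContDiff.clm_comp h1 hg))

theorem reflectionCovec_transition {tr : A →L[ℝ] ℝ} (htr : ∀ a b, tr (a * b) = tr (b * a))
    {j j' K : A} {s s' H : E → A} {g g' : E →L[ℝ] A} {u : E} (hs : DifferentiableAt ℝ s u)
    (hs' : DifferentiableAt ℝ s' u) (hH : DifferentiableAt ℝ H u) (hHK : H u * K = 1)
    (hKH : K * H u = 1) (hjs : j' * s' u = -(s' u * j')) (hss : s' u * s' u = 1)
    (h1 : ∀ y, s' y * H y = H y * s y) (h2 : j' * H u = H u * j)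
    (h3 : ∀ v, g' v * H u = H u * g v - fderiv ℝ H u v) :
    reflectionCovec tr j' (s' u) (fderiv ℝ s' u) g' = reflectionCovec tr j (s u) (fderiv ℝ s u) g := by
  ext v
  rw [reflectionCovec_apply, reflectionCovec_apply]
  refine reflectionTrace_conj htr (H := H u) (K := K) (H' := fderiv ℝ H u v) hHK hjs hss (h1 u) h2
    ?_ (h3 v) hKH
  have h4 : fderiv ℝ (fun y => s' y * H y) u = fderiv ℝ (fun y => H y * s y) u := by
    rw [funext h1]
  have h5 := congrArg (fun B => B v) h4
  simp only [fderiv_fun_mul' hs' hH, fderiv_fun_mul' hH hs] at h5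
  rw [add_comm]
  refine h5.trans ?_
  rw [add_comm]
  rfl

theorem fderiv_reflectionCovec_sub {tr : A →L[ℝ] ℝ} (htr : ∀ a b, tr (a * b) = tr (b * a))
    {j s : E → A} {g : E → E →L[ℝ] A} (hj : ContDiff ℝ ∞ j) (hs : ContDiff ℝ ∞ s)
    (hg : ContDiff ℝ ∞ g) (hjs : ∀ u, j u * s u = -(s u * j u)) (hss : ∀ u, s u * s u = 1)
    (hjd : ∀ u w, fderiv ℝ j u w = j u * g u w - g u w * j u) (u v w : E) :
    fderiv ℝ (fun u => reflectionCovec tr (j u) (s u) (fderiv ℝ s u) (g u)) u v w -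
      fderiv ℝ (fun u => reflectionCovec tr (j u) (s u) (fderiv ℝ s u) (g u)) u w v =
    tr (j u * (fderiv ℝ g u v w - fderiv ℝ g u w v + (g u v * g u w - g u w * g u v))) := by
  have hs' : ContDiff ℝ ∞ (fderiv ℝ s) := hs.fderiv_right (m := ∞) (by simp)
  have dj := (hj.differentiable (by simp)) u
  have ds := (hs.differentiable (by simp)) u
  have ds' := (hs'.differentiable (by simp)) u
  have dg := (hg.differentiable (by simp)) u
  have dL := ((hj.reflectionCovec (tr := tr) hs hs' hg).differentiable (by simp)) u
  have hL : ∀ v w, fderiv ℝ (fun u => reflectionCovec tr (j u) (s u) (fderiv ℝ s u) (g u)) u v w =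
      1 / 2 * (tr (fderiv ℝ j u v * fderiv ℝ s u w * s u) +
        tr (j u * fderiv ℝ (fderiv ℝ s) u v w * s u) + tr (j u * fderiv ℝ s u w * fderiv ℝ s u v)) +
      tr (fderiv ℝ j u v * g u w) + tr (j u * fderiv ℝ g u v w) := by
    intro v w
    have e1 : HasFDerivAt (fun y => fderiv ℝ s y w) _ u :=
      ds'.hasFDerivAt.clm_apply (hasFDerivAt_const w u)
    have e2 : HasFDerivAt (fun y => g y w) _ u := dg.hasFDerivAt.clm_apply (hasFDerivAt_const w u)
    have e3 := (tr.hasFDerivAt.comp u ((dj.hasFDerivAt.mul' e1).mul' ds.hasFDerivAt)).const_mul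
      (1 / 2 : ℝ)
    have e4 := e3.add (tr.hasFDerivAt.comp u (dj.hasFDerivAt.mul' e2))
    have e5 : HasFDerivAt (fun y => reflectionCovec tr (j y) (s y) (fderiv ℝ s y) (g y) w) _ u :=
      dL.hasFDerivAt.clm_apply (hasFDerivAt_const w u)
    have e6 := congrArg (fun B => B v) (e5.unique e4)
    simp at e6
    rw [e6]
    simp only [mul_add, mul_assoc]
    ring
  have hdj : ∀ v, fderiv ℝ j u v * s u + j u * fderiv ℝ s u v =
      -(fderiv ℝ s u v * j u + s u * fderiv ℝ j u v) := fun v => by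
    have h := (dj.hasFDerivAt.mul' ds.hasFDerivAt).unique
      (((ds.hasFDerivAt.mul' dj.hasFDerivAt).neg).congr_of_eventuallyEq
        (Eventually.of_forall hjs))
    have h' := congrArg (fun B => B v) h
    simp at h'
    rw [add_comm, h']
    abel
  have hds : ∀ v, fderiv ℝ s u v * s u + s u * fderiv ℝ s u v = 0 := fun v => by
    have h := (ds.hasFDerivAt.mul' ds.hasFDerivAt).unique
      ((hasFDerivAt_const (1 : A) u).congr_of_eventuallyEq (Eventually.of_forall hss))
    have h' := congrArg (fun B => B v) h
    simp at h'
    rw [add_comm, h']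
  have hsymm : fderiv ℝ (fderiv ℝ s) u v w = fderiv ℝ (fderiv ℝ s) u w v :=
    (hs.contDiffAt.isSymmSndFDerivAt (by simp; exact WithTop.coe_le_coe.2 le_top)).eq v w
  have key := reflectionTrace_curvature (tr := (tr : A →ₗ[ℝ] ℝ)) htr (hjs u) (hss u) (hjd u v)
    (hjd u w) (hdj v) (hdj w) (hds v) (hds w)
  simp only [ContinuousLinearMap.coe_coe] at key
  rw [hL, hL, hsymm, mul_add (j u), map_add, ← key, mul_sub (j u), map_sub]
  ring

end ReflectionCovec

/-! ### The pullback of the first Chern form to the Lagrangian Grassmannian is exact -/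

section

variable {N : ℕ} {M : Type*} [TopologicalSpace M] [ChartedSpace (EuclideanSpace ℝ (Fin N)) M]
  [IsManifold (𝓡 N) ∞ M] {σ : SymplecticForm (𝓡 N) M}
  {J : ∀ x : M, TangentSpace (𝓡 N) x →L[ℝ] TangentSpace (𝓡 N) x}
  {cov : CovariantDerivative (𝓡 N) (EuclideanSpace ℝ (Fin N)) (TangentSpace (𝓡 N) : M → Type _)}

/-- The trace of continuous endomorphisms. -/
def clmTrace (N : ℕ) : (EuclideanSpace ℝ (Fin N) →L[ℝ] EuclideanSpace ℝ (Fin N)) →L[ℝ] ℝ :=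
  LinearMap.toContinuousLinearMap
    (LinearMap.trace ℝ (EuclideanSpace ℝ (Fin N)) ∘ₗ ContinuousLinearMap.coeLM ℝ)

theorem clmTrace_apply (T : EuclideanSpace ℝ (Fin N) →L[ℝ] EuclideanSpace ℝ (Fin N)) :
    clmTrace N T = LinearMap.trace ℝ (EuclideanSpace ℝ (Fin N)) T := rfl

theorem clmTrace_mul_comm (S T : EuclideanSpace ℝ (Fin N) →L[ℝ] EuclideanSpace ℝ (Fin N)) :
    clmTrace N (S * T) = clmTrace N (T * S) :=
  LinearMap.trace_mul_comm ℝ (S : EuclideanSpace ℝ (Fin N) →ₗ[ℝ] EuclideanSpace ℝ (Fin N)) T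

namespace LagGr

variable {m : ℕ} {R : EuclideanSpace ℝ (Fin m) → LagGr σ.toFun}
  {P Q : EuclideanSpace ℝ (Fin N) → M} {e e' : M → EuclideanSpace ℝ (Fin N)}

/-- In a chart, the connection form of the determinant line of the complexification of the
tautological bundle. -/
def chernCovec (hJ : IsCompatibleJ σ J)
    (cov : CovariantDerivative (𝓡 N) (EuclideanSpace ℝ (Fin N)) (TangentSpace (𝓡 N) : M → Type _))
    (P : EuclideanSpace ℝ (Fin N) → M) (e : M → EuclideanSpace ℝ (Fin N))
    (R : EuclideanSpace ℝ (Fin m) → LagGr σ.toFun) (u : EuclideanSpace ℝ (Fin m)) :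
    EuclideanSpace ℝ (Fin m) →L[ℝ] ℝ :=
  reflectionCovec (clmTrace N) (chartConj P e (R u).pt (J (R u).pt))
    (chartConj P e (R u).pt (reflection hJ (R u)))
    (fderiv ℝ (fun y => chartConj P e (R y).pt (reflection hJ (R y))) u)
    ((chartGamma cov P e (e (R u).pt)).comp (fderiv ℝ (fun y => e (R y).pt) u))

theorem contDiff_coord (hP : IsChartPlot (𝓡 N) P e) (hR : IsPlotOn univ R)
    (hRP : ∀ y, (R y).pt ∈ range P) : ContDiff ℝ ∞ fun y => e (R y).pt := by
  have hpt : ContMDiff 𝓘(ℝ, EuclideanSpace ℝ (Fin m)) (𝓡 N) ∞ fun y => (R y).pt :=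
    contMDiffOn_univ.1 hR.1
  have h := hP.contDiffOn_inv_comp hpt
  rw [show (fun y => (R y).pt) ⁻¹' range P = univ from eq_univ_of_forall hRP] at h
  exact contDiffOn_univ.1 h

theorem contDiff_chartConj_J (hJ : IsCompatibleJ σ J) (hP : IsChartPlot (𝓡 N) P e)
    (hR : IsPlotOn univ R) (hRP : ∀ y, (R y).pt ∈ range P) :
    ContDiff ℝ ∞ fun y => chartConj P e (R y).pt (J (R y).pt) := by
  have h1 := (hP.contDiff_chartConj hJ.smooth).comp (contDiff_coord hP hR hRP)
  have he : (fun y => chartConj P e (R y).pt (J (R y).pt)) =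
      (fun u => chartConj P e (P u) (J (P u))) ∘ fun y => e (R y).pt := funext fun y =>
    congrArg (fun x => chartConj P e x (J x)) (hP.right_inv (hRP y)).symm
  rw [he]
  exact h1

theorem contDiff_chartGamma_comp [T2Space M]
    (hcov : CovariantDerivative.ContMDiffCovariantDerivative cov ∞) (hP : IsChartPlot (𝓡 N) P e)
    (hR : IsPlotOn univ R) (hRP : ∀ y, (R y).pt ∈ range P) :
    ContDiff ℝ ∞ fun u => (chartGamma cov P e (e (R u).pt)).comp
      (fderiv ℝ (fun y => e (R y).pt) u) :=
  ((hP.contDiff_chartGamma hcov).comp (contDiff_coord hP hR hRP)).clm_comp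
    ((contDiff_coord hP hR hRP).fderiv_right (m := ∞) (by simp))

theorem contDiff_chernCovec [T2Space M] (hJ : IsCompatibleJ σ J)
    (hcov : CovariantDerivative.ContMDiffCovariantDerivative cov ∞) (hP : IsChartPlot (𝓡 N) P e)
    (hR : IsPlotOn univ R) (hRP : ∀ y, (R y).pt ∈ range P) :
    ContDiff ℝ ∞ (chernCovec hJ cov P e R) :=
  ContDiff.reflectionCovec (contDiff_chartConj_J hJ hP hR hRP)
    (contDiff_chartConj_reflection hJ hP hR hRP)
    ((contDiff_chartConj_reflection hJ hP hR hRP).fderiv_right (m := ∞) (by simp))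
    (contDiff_chartGamma_comp hcov hP hR hRP)

theorem chernCovec_congr (hJ : IsCompatibleJ σ J) {R' : EuclideanSpace ℝ (Fin m) → LagGr σ.toFun}
    {u : EuclideanSpace ℝ (Fin m)} (h : R =ᶠ[𝓝 u] R') :
    chernCovec hJ cov P e R u = chernCovec hJ cov P e R' u := by
  have h1 : fderiv ℝ (fun y => chartConj P e (R y).pt (reflection hJ (R y))) u =
      fderiv ℝ (fun y => chartConj P e (R' y).pt (reflection hJ (R' y))) u :=
    (h.fun_comp fun W => chartConj P e W.pt (reflection hJ W)).fderiv_eq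
  have h2 : fderiv ℝ (fun y => e (R y).pt) u = fderiv ℝ (fun y => e (R' y).pt) u :=
    (h.fun_comp fun W => e W.pt).fderiv_eq
  rw [chernCovec, chernCovec, h1, h2, h.eq_of_nhds]

theorem chernCovec_comp (hJ : IsCompatibleJ σ J) (hP : IsChartPlot (𝓡 N) P e)
    (hR : IsPlotOn univ R) (hRP : ∀ y, (R y).pt ∈ range P) {m' : ℕ}
    {g : EuclideanSpace ℝ (Fin m') → EuclideanSpace ℝ (Fin m)} (hg : ContDiff ℝ ∞ g)
    (u : EuclideanSpace ℝ (Fin m')) :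
    chernCovec hJ cov P e (R ∘ g) u = (chernCovec hJ cov P e R (g u)).comp (fderiv ℝ g u) := by
  have dg := (hg.differentiable (by simp)) u
  have h1 : fderiv ℝ (fun y => chartConj P e (R (g y)).pt (reflection hJ (R (g y)))) u =
      (fderiv ℝ (fun y => chartConj P e (R y).pt (reflection hJ (R y))) (g u)).comp
        (fderiv ℝ g u) :=
    fderiv_comp u (((contDiff_chartConj_reflection hJ hP hR hRP).differentiable (by simp)) (g u)) dg
  have h2 : fderiv ℝ (fun y => e (R (g y)).pt) u =
      (fderiv ℝ (fun y => e (R y).pt) (g u)).comp (fderiv ℝ g u) :=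
    fderiv_comp u (((contDiff_coord hP hR hRP).differentiable (by simp)) (g u)) dg
  refine reflectionCovec_comp _ _ _ h1 ?_
  rw [ContinuousLinearMap.comp_assoc, ← h2]
  rfl

theorem chartConj_reflection_mul_self (hJ : IsCompatibleJ σ J) (hP : IsChartPlot (𝓡 N) P e)
    {W : LagGr σ.toFun} (hW : W.pt ∈ range P) :
    chartConj P e W.pt (reflection hJ W) * chartConj P e W.pt (reflection hJ W) = 1 := by
  rw [hP.chartConj_mul hW, reflection_comp_self, hP.chartConj_id hW]

theorem chartConj_J_mul_reflection (hJ : IsCompatibleJ σ J) (hP : IsChartPlot (𝓡 N) P e)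
    {W : LagGr σ.toFun} (hW : W.pt ∈ range P) :
    chartConj P e W.pt (J W.pt) * chartConj P e W.pt (reflection hJ W) =
      -(chartConj P e W.pt (reflection hJ W) * chartConj P e W.pt (J W.pt)) := by
  rw [hP.chartConj_mul hW, hP.chartConj_mul hW, J_comp_reflection, chartConj_neg]

theorem chernCovec_transition [T2Space M] (hJ : IsCompatibleJ σ J) (hP : IsChartPlot (𝓡 N) P e)
    (hQ : IsChartPlot (𝓡 N) Q e') (hR : IsPlotOn univ R) (hRP : ∀ y, (R y).pt ∈ range P)
    (hRQ : ∀ y, (R y).pt ∈ range Q) (u : EuclideanSpace ℝ (Fin m)) :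
    chernCovec hJ cov Q e' R u = chernCovec hJ cov P e R u := by
  have hPe : ∀ y, P (e (R y).pt) = (R y).pt := fun y => hP.right_inv (hRP y)
  have hPQ : ∀ y, P (e (R y).pt) ∈ range Q := fun y => by rw [hPe]; exact hRQ y
  have hφ : ContDiffAt ℝ ∞ (e' ∘ P) (e (R u).pt) :=
    (hQ.contDiffOn_inv_comp hP.contMDiff).contDiffAt
      ((hQ.isOpen_range.preimage hP.contMDiff.continuous).mem_nhds (hPQ u))
  have hφ' : DifferentiableAt ℝ (fderiv ℝ (e' ∘ P)) (e (R u).pt) :=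
    (hφ.fderiv_right (m := ∞) (by simp)).differentiableAt (by simp)
  have hq := ((contDiff_coord hP hR hRP).differentiable (by simp)) u
  have hconj : ∀ (x : M) (T : TangentSpace (𝓡 N) x →L[ℝ] TangentSpace (𝓡 N) x), x ∈ range P →
      x ∈ range Q → chartConj Q e' x T * fderiv ℝ (e' ∘ P) (e x) =
        fderiv ℝ (e' ∘ P) (e x) * chartConj P e x T := by
    rintro _ T ⟨y, rfl⟩ hy
    rw [hP.left_inv]
    exact hP.chartConj_transition hQ hy T
  have hinv : ∀ x : M, x ∈ range P → x ∈ range Q →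
      fderiv ℝ (e' ∘ P) (e x) * fderiv ℝ (e ∘ Q) (e' x) = 1 := by
    rintro _ ⟨y, rfl⟩ hy
    rw [hP.left_inv]
    exact hP.fderiv_transition_mul hQ hy
  have hinv' : ∀ x : M, x ∈ range P → x ∈ range Q →
      fderiv ℝ (e ∘ Q) (e' x) * fderiv ℝ (e' ∘ P) (e x) = 1 := by
    rintro _ hy ⟨y, rfl⟩
    rw [hQ.left_inv]
    exact hQ.fderiv_transition_mul hP hy
  have hH : fderiv ℝ (fun y => fderiv ℝ (e' ∘ P) (e (R y).pt)) u =
      (fderiv ℝ (fderiv ℝ (e' ∘ P)) (e (R u).pt)).comp (fderiv ℝ (fun y => e (R y).pt) u) :=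
    fderiv_comp u hφ' hq
  have hq' : fderiv ℝ (fun y => e' (R y).pt) u =
      (fderiv ℝ (e' ∘ P) (e (R u).pt)).comp (fderiv ℝ (fun y => e (R y).pt) u) := by
    rw [← fderiv_comp u (hφ.differentiableAt (by simp)) hq]
    congr 1
    funext y
    exact congrArg e' (hPe y).symm
  refine reflectionCovec_transition clmTrace_mul_comm (H := fun y => fderiv ℝ (e' ∘ P) (e (R y).pt))
    (K := fderiv ℝ (e ∘ Q) (e' (R u).pt))
    (((contDiff_chartConj_reflection hJ hP hR hRP).differentiable (by simp)) u)
    (((contDiff_chartConj_reflection hJ hQ hR hRQ).differentiable (by simp)) u)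
    (DifferentiableAt.comp u hφ' hq) (hinv _ (hRP u) (hRQ u)) (hinv' _ (hRP u) (hRQ u))
    (chartConj_J_mul_reflection hJ hQ (hRQ u)) (chartConj_reflection_mul_self hJ hQ (hRQ u))
    (fun y => hconj _ _ (hRP y) (hRQ y)) (hconj _ _ (hRP u) (hRQ u)) fun v => ?_
  rw [hH, hq']
  have h := hP.chartGamma_transition (cov := cov) hQ (hPQ u) (fderiv ℝ (fun y => e (R y).pt) u v)
  rw [hPe] at h
  exact h

end LagGr
end

section

theorem fderiv_comp_fderiv_apply {E V A : Type*} [NormedAddCommGroup E] [NormedSpace ℝ E]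
    [NormedAddCommGroup V] [NormedSpace ℝ V] [NormedAddCommGroup A] [NormedSpace ℝ A]
    {G : V → V →L[ℝ] A} {q : E → V} (hG : ContDiff ℝ ∞ G) (hq : ContDiff ℝ ∞ q) (u a b : E) :
    fderiv ℝ (fun u => (G (q u)).comp (fderiv ℝ q u)) u a b =
      fderiv ℝ G (q u) (fderiv ℝ q u a) (fderiv ℝ q u b) +
        G (q u) (fderiv ℝ (fderiv ℝ q) u a b) := by
  have hq' : ContDiff ℝ ∞ (fderiv ℝ q) := hq.fderiv_right (m := ∞) (by simp)
  have e1 : HasFDerivAt (fun u => G (q u)) _ u :=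
    ((hG.differentiable (by simp) _).hasFDerivAt).comp u (hq.differentiable (by simp) u).hasFDerivAt
  rw [(e1.clm_comp (hq'.differentiable (by simp) u).hasFDerivAt).fderiv]
  simp [add_comm]

theorem extDeriv_covecForm_apply {m : ℕ}
    {L : EuclideanSpace ℝ (Fin m) → EuclideanSpace ℝ (Fin m) →L[ℝ] ℝ}
    (u : EuclideanSpace ℝ (Fin m)) (v : Fin 2 → EuclideanSpace ℝ (Fin m)) :
    extDeriv (fun u => covecForm (L u)) u v = fderiv ℝ L u (v 0) (v 1) - fderiv ℝ L u (v 1) (v 0) := by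
  have h := LinearIsometryEquiv.comp_fderiv (ContinuousAlternatingMap.ofSubsingletonLIE (𝕜 := ℝ)
    (E := EuclideanSpace ℝ (Fin m)) (F := ℝ) (0 : Fin 1)) (f := L) (x := u)
  rw [extDeriv, show fderiv ℝ (fun u => covecForm (L u)) u = _ from h, ContinuousAlternatingMap.alternatizeUncurryFin_apply, Fin.sum_univ_two]
  simp only [Fin.val_zero, pow_zero, one_smul, Fin.val_one, pow_one, neg_smul]
  rw [← sub_eq_add_neg]
  rfl

variable {N : ℕ} {M : Type*} [TopologicalSpace M] [ChartedSpace (EuclideanSpace ℝ (Fin N)) M]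
  [IsManifold (𝓡 N) ∞ M] {σ : SymplecticForm (𝓡 N) M}
  {J : ∀ x : M, TangentSpace (𝓡 N) x →L[ℝ] TangentSpace (𝓡 N) x}
  {cov : CovariantDerivative (𝓡 N) (EuclideanSpace ℝ (Fin N)) (TangentSpace (𝓡 N) : M → Type _)}

namespace LagGr

variable {m : ℕ} {R : EuclideanSpace ℝ (Fin m) → LagGr σ.toFun}
  {P Q : EuclideanSpace ℝ (Fin N) → M} {e e' : M → EuclideanSpace ℝ (Fin N)}

theorem extDeriv_chernCovec [T2Space M] (hJ : IsCompatibleJ σ J)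
    (hcov : CovariantDerivative.ContMDiffCovariantDerivative cov ∞)
    (hcJ : ∀ Z : (∀ x : M, TangentSpace (𝓡 N) x), IsSmoothField Z →
      ∀ x v, cov (fun y => J y (Z y)) x v = J x (cov Z x v))
    {κ : SmoothForm (𝓡 N) M 2} (hκ : IsChernForm J cov κ) (hP : IsChartPlot (𝓡 N) P e)
    (hR : IsPlotOn univ R) (hRP : ∀ y, (R y).pt ∈ range P) (u : EuclideanSpace ℝ (Fin m)) :
    extDeriv (fun u => covecForm (chernCovec hJ cov P e R u)) u =
      (4 * Real.pi) • κ.toFun.pull (fun y => (R y).pt) u := by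
  have hPe : ∀ y, P (e (R y).pt) = (R y).pt := fun y => hP.right_inv (hRP y)
  have hq := contDiff_coord hP hR hRP
  have hq' : ContDiff ℝ ∞ (fderiv ℝ fun y => e (R y).pt) := hq.fderiv_right (m := ∞) (by simp)
  have hΓ := hP.contDiff_chartGamma hcov
  have hj := hP.contDiff_chartConj hJ.smooth
  ext v
  rw [extDeriv_covecForm_apply]
  have hjR : (fun y => chartConj P e (R y).pt (J (R y).pt)) =
      (fun u => chartConj P e (P u) (J (P u))) ∘ fun y => e (R y).pt := funext fun y =>
    congrArg (fun x => chartConj P e x (J x)) (hPe y).symm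
  have h1 := fderiv_reflectionCovec_sub (tr := clmTrace N) clmTrace_mul_comm
    (contDiff_chartConj_J hJ hP hR hRP) (contDiff_chartConj_reflection hJ hP hR hRP)
    (contDiff_chartGamma_comp hcov hP hR hRP) (fun y => chartConj_J_mul_reflection hJ hP (hRP y))
    (fun y => chartConj_reflection_mul_self hJ hP (hRP y)) (fun u w => by
      rw [hjR, fderiv_comp u (hj.differentiable (by simp) _) (hq.differentiable (by simp) u)]
      rw [show chartConj P e (R u).pt (J (R u).pt) = _ from congrFun hjR u]
      exact hP.fderiv_chartConj hJ.smooth hcJ _ _) u (v 0) (v 1)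
  refine h1.trans ?_
  have h2 : ∀ a b, fderiv ℝ (fun u => (chartGamma cov P e (e (R u).pt)).comp
      (fderiv ℝ (fun y => e (R y).pt) u)) u a b =
      fderiv ℝ (chartGamma cov P e) (e (R u).pt) (fderiv ℝ (fun y => e (R y).pt) u a)
        (fderiv ℝ (fun y => e (R y).pt) u b) + chartGamma cov P e (e (R u).pt)
          (fderiv ℝ (fderiv ℝ fun y => e (R y).pt) u a b) :=
    fderiv_comp_fderiv_apply hΓ hq u
  have hsymm : fderiv ℝ (fderiv ℝ fun y => e (R y).pt) u (v 0) (v 1) =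
      fderiv ℝ (fderiv ℝ fun y => e (R y).pt) u (v 1) (v 0) :=
    (hq.contDiffAt.isSymmSndFDerivAt (by simp; exact WithTop.coe_le_coe.2 le_top)).eq _ _
  have h3 := hκ.pull_eq hcov hP (e (R u).pt) (fderiv ℝ (fun y => e (R y).pt) u (v 0))
    (fderiv ℝ (fun y => e (R y).pt) u (v 1))
  have h4 : ∀ a, chartInv P e (P (e (R u).pt)) (fderiv ℝ (fun y => e (R y).pt) u a) =
      mfderiv 𝓘(ℝ, EuclideanSpace ℝ (Fin m)) (𝓡 N) (fun y => (R y).pt) u a := fun a => by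
    rw [hP.chartInv_apply]
    have h5 := mfderiv_comp u (hP.contMDiff.mdifferentiableAt (by simp))
      (hq.contMDiff.mdifferentiableAt (x := u) (by simp))
    rw [mfderiv_eq_fderiv, show P ∘ (fun y => e (R y).pt) = fun y => (R y).pt from funext hPe] at h5
    rw [h5]
    rfl
  have h6 : κ.toFun.pull (fun y => (R y).pt) u v = κ.toFun (P (e (R u).pt))
      ![chartInv P e (P (e (R u).pt)) (fderiv ℝ (fun y => e (R y).pt) u (v 0)),
        chartInv P e (P (e (R u).pt)) (fderiv ℝ (fun y => e (R y).pt) u (v 1))] := by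
    rw [h4, h4]
    have h7 : ∀ (x : M) (hx : x = (R u).pt) (a b : EuclideanSpace ℝ (Fin N)),
        κ.toFun x ![(a : TangentSpace (𝓡 N) x), b] =
          κ.toFun (R u).pt ![(a : TangentSpace (𝓡 N) (R u).pt), b] := by
      rintro _ rfl a b; rfl
    refine Eq.trans ?_ (h7 _ (hPe u) _ _).symm
    refine congrArg (κ.toFun (R u).pt) ?_
    ext i
    fin_cases i <;> rfl
  rw [ContinuousAlternatingMap.smul_apply, h6, h3, h2, h2, hsymm, ← clmTrace_apply, smul_eq_mul,
    ← mul_assoc, mul_one_div_cancel (by positivity), one_mul, add_sub_add_right_eq_sub]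
  congr 2
  exact congrArg (fun x => chartConj P e x (J x)) (hPe u).symm

/-- The pullback of the first Chern form to the bundle of Lagrangian planes is exact. -/
theorem exists_chern_primitive [T2Space M] (hJ : IsCompatibleJ σ J)
    (hcov : CovariantDerivative.ContMDiffCovariantDerivative cov ∞)
    (hcJ : ∀ Z : (∀ x : M, TangentSpace (𝓡 N) x), IsSmoothField Z →
      ∀ x v, cov (fun y => J y (Z y)) x v = J x (cov Z x v))
    {κ : SmoothForm (𝓡 N) M 2} (hκ : IsChernForm J cov κ) :
    ∃ μ : DForm (lagGrDiffeology σ.toFun) 1,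
      DForm.d μ = (4 * Real.pi) • DForm.pullback LagGr.pt (LagGr.smooth_pt σ.toFun) κ.toDForm := by
  obtain ⟨μ, hμ⟩ := DForm.exists_ofLocal (lagGrDiffeology σ.toFun) 1
    (fun {m} P' u W => ∃ (P : EuclideanSpace ℝ (Fin N) → M) (e : M → EuclideanSpace ℝ (Fin N))
      (R : EuclideanSpace ℝ (Fin m) → LagGr σ.toFun), IsChartPlot (𝓡 N) P e ∧ IsPlotOn univ R ∧
        (∀ y, (R y).pt ∈ range P) ∧ P' =ᶠ[𝓝 u] R ∧
        W = fun u => covecForm (chernCovec hJ cov P e R u))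
    (fun {m} P' hP' u => by
      obtain ⟨e, he⟩ := exists_isChartPlot_ballPlot (n := N) (P' u).pt
      have hpt : ContMDiff 𝓘(ℝ, EuclideanSpace ℝ (Fin m)) (𝓡 N) ∞ fun y => (P' y).pt :=
        contMDiffOn_univ.1 (show IsPlotOn univ P' from hP').1
      obtain ⟨g, hg, hgU, hgu⟩ := exists_squash u
        (hpt.continuous.continuousAt.eventually (he.isOpen_range.mem_nhds (mem_range_ballPlot _)))
      exact ⟨_, _, e, P' ∘ g, he, (lagGrDiffeology σ.toFun).plot_reparam hP' hg, hgU,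
        (hgu.fun_comp P').symm, rfl⟩)
    (fun {m} P' hP' u W => by
      rintro ⟨P, e, R, hP, hR, hRP, -, rfl⟩
      exact ((ContinuousAlternatingMap.ofSubsingletonLIE (𝕜 := ℝ) (E := EuclideanSpace ℝ (Fin m))
        (F := ℝ) (0 : Fin 1)).contDiff.comp (contDiff_chernCovec hJ hcov hP hR hRP)).contDiffAt)
    (fun {m} P' hP' u W => by
      rintro ⟨P, e, R, hP, hR, hRP, h, rfl⟩
      filter_upwards [eventually_eventually_nhds.2 h] with y hy
      exact ⟨P, e, R, hP, hR, hRP, hy, rfl⟩)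
    (fun {m} P' hP' u W W' => by
      rintro ⟨P, e, R, hP, hR, hRP, h, rfl⟩ ⟨Q, e', R', hQ, hR', hRQ, h', rfl⟩
      obtain ⟨g, hg, hgU, hgu⟩ := exists_squash u (h.symm.trans h')
      have h1 : R =ᶠ[𝓝 u] R ∘ g := (hgu.fun_comp R).symm
      have h2 : R' =ᶠ[𝓝 u] R ∘ g := (h'.symm.trans h).trans h1
      have hRg : IsPlotOn univ (R ∘ g) :=
        (lagGrDiffeology σ.toFun).plot_reparam (show R ∈ (lagGrDiffeology σ.toFun).plots m from hR) hg
      change covecForm _ = covecForm _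
      rw [chernCovec_congr hJ h1, chernCovec_congr hJ h2,
        chernCovec_transition hJ hP hQ hRg (fun y => hRP (g y)) fun y => by
          rw [Function.comp_apply, show R (g y) = R' (g y) from hgU y]
          exact hRQ _])
    (fun {m m'} P' hP' g hg u W => by
      rintro ⟨P, e, R, hP, hR, hRP, h, rfl⟩
      refine ⟨_, ⟨P, e, R ∘ g, hP, (lagGrDiffeology σ.toFun).plot_reparam
        (show R ∈ (lagGrDiffeology σ.toFun).plots m from hR) hg, fun y => hRP (g y),
        hg.continuous.continuousAt.eventually h, rfl⟩, ?_⟩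
      change covecForm _ = (covecForm _).compContinuousLinearMap _
      rw [covecForm_comp, chernCovec_comp hJ hP hR hRP hg])
  refine ⟨μ, DForm.ext fun {m} P' hP' u => ?_⟩
  obtain ⟨e, he⟩ := exists_isChartPlot_ballPlot (n := N) (P' u).pt
  have hpt : ContMDiff 𝓘(ℝ, EuclideanSpace ℝ (Fin m)) (𝓡 N) ∞ fun y => (P' y).pt :=
    contMDiffOn_univ.1 (show IsPlotOn univ P' from hP').1
  obtain ⟨g, hg, hgU, hgu⟩ := exists_squash u
    (hpt.continuous.continuousAt.eventually (he.isOpen_range.mem_nhds (mem_range_ballPlot _)))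
  have hR : P' ∘ g ∈ (lagGrDiffeology σ.toFun).plots m :=
    (lagGrDiffeology σ.toFun).plot_reparam hP' hg
  have h1 : P' =ᶠ[𝓝 u] P' ∘ g := (hgu.fun_comp P').symm
  rw [DForm.val_congr _ hP' hR h1, DForm.val_congr _ hP' hR h1, DForm.d_val]
  have h2 := hμ (P' ∘ g) hR u _ ⟨_, e, P' ∘ g, he, hR, hgU, EventuallyEq.rfl, rfl⟩
  rw [h2.extDeriv_eq, extDeriv_chernCovec hJ hcov hcJ hκ he hR hgU]
  rfl

/-- On a monotone symplectic manifold, the symplectic form becomes exact on the bundle of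
Lagrangian planes. -/
theorem exists_isActionForm [T2Space M] (hσ : IsMonotone σ) :
    ∃ lam : DForm (lagGrDiffeology σ.toFun) 1, IsActionForm σ lam := by
  obtain ⟨τ, c, ⟨J, cov, κ, hκ, hJ, hcov, hcJ, hκJ, rfl⟩, hc⟩ := hσ
  obtain ⟨μ, hμ⟩ := exists_chern_primitive hJ hcov hcJ hκJ
  have hd : DForm.d (τ • κ.toDForm) = 0 := by rw [map_smul, hκ, smul_zero]
  have hc' : HdR.mk σ.toSmoothForm.toDForm σ.closed = HdR.mk (τ • κ.toDForm) hd := hc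
  obtain ⟨η, hη⟩ := HdR.mk_eq_mk_iff.1 hc'
  refine ⟨(τ / (4 * Real.pi)) • μ + DForm.pullback LagGr.pt (LagGr.smooth_pt σ.toFun) η, ?_⟩
  rw [IsActionForm, map_add, map_smul, hμ, smul_smul, div_mul_cancel₀ _ (by positivity),
    DForm.d_pullback, hη, map_sub, map_smul]
  abel

end LagGr
end

/-! ### The unit tangent bundle of a symplectic surface -/

namespace UnitTangent

section Fields

variable {N m : ℕ} {M : Type*} [TopologicalSpace M] [ChartedSpace (EuclideanSpace ℝ (Fin N)) M]
  [IsManifold (𝓡 N) ∞ M] {u : Set (EuclideanSpace ℝ (Fin m))}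
  {P : EuclideanSpace ℝ (Fin m) → UnitTangent (𝓡 N) M}

theorem IsPlotOn.exists_field (hP : IsPlotOn u P) {x : EuclideanSpace ℝ (Fin m)} (hx : x ∈ u) :
    ∃ v, IsOpen v ∧ x ∈ v ∧ v ⊆ u ∧ ∃ X : ∀ y, TangentSpace (𝓡 N) (P y).pt,
      SmoothAlong (𝓡 N) X v ∧ ∀ y ∈ v, ∃ h : X y ≠ 0, (P y).ray = rayOfNeZero ℝ (X y) h := by
  obtain ⟨v, hv, hxv, hvu, X, hX, hs⟩ := hP.2 x hx
  have key : ∀ (a : TangentBundle (𝓡 N) M) (q : M) (w : TangentSpace (𝓡 N) q), a = ⟨q, w⟩ →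
      (a.2 : EuclideanSpace ℝ (Fin N)) = w := by
    rintro _ q w rfl; rfl
  refine ⟨v, hv, hxv, hvu, fun y => ((X y).2 : EuclideanSpace ℝ (Fin N)), ?_, fun y hy => ?_⟩
  · refine hX.congr fun y hy => ?_
    obtain ⟨w, -, hw, -⟩ := hs y hy
    have h1 : ((X y).2 : EuclideanSpace ℝ (Fin N)) = w := key _ _ _ hw
    rw [hw]
    exact congrArg (fun a : TangentSpace (𝓡 N) (P y).pt =>
      (⟨(P y).pt, a⟩ : TangentBundle (𝓡 N) M)) h1
  · obtain ⟨w, hw0, hw, hr⟩ := hs y hy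
    have h1 : ((X y).2 : EuclideanSpace ℝ (Fin N)) = w := key _ _ _ hw
    have h2 : ∀ (a : TangentSpace (𝓡 N) (P y).pt), a = w →
        ∃ h : a ≠ 0, (P y).ray = rayOfNeZero ℝ a h := by rintro _ rfl; exact ⟨hw0, hr⟩
    exact h2 _ h1

theorem isPlotOn_of_field (hp : ContMDiffOn 𝓘(ℝ, EuclideanSpace ℝ (Fin m)) (𝓡 N) ∞
      (fun y => (P y).pt) u)
    (h : ∀ x ∈ u, ∃ v, IsOpen v ∧ x ∈ v ∧ v ⊆ u ∧ ∃ X : ∀ y, TangentSpace (𝓡 N) (P y).pt,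
      SmoothAlong (𝓡 N) X v ∧ ∀ y ∈ v, ∃ h : X y ≠ 0, (P y).ray = rayOfNeZero ℝ (X y) h) :
    IsPlotOn u P := by
  refine ⟨hp, fun x hx => ?_⟩
  obtain ⟨v, hv, hxv, hvu, X, hX, hs⟩ := h x hx
  exact ⟨v, hv, hxv, hvu, fun y => ⟨(P y).pt, X y⟩, hX, fun y hy =>
    ⟨X y, (hs y hy).1, rfl, (hs y hy).2⟩⟩

/-- The antipodal map of the unit tangent bundle. -/
def antipode (r : UnitTangent (𝓡 N) M) : UnitTangent (𝓡 N) M := ⟨r.pt, -r.ray⟩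

theorem smooth_antipode : @Diffeology.DSmooth (UnitTangent (𝓡 N) M) (UnitTangent (𝓡 N) M)
    (unitTangentDiffeology (𝓡 N) M) (unitTangentDiffeology (𝓡 N) M) antipode := by
  intro m P hP
  have hP' : IsPlotOn univ P := hP
  refine isPlotOn_of_field (P := antipode ∘ P) hP'.1 fun x hx => ?_
  obtain ⟨v, hv, hxv, hvu, X, hX, hs⟩ := hP'.exists_field hx
  refine ⟨v, hv, hxv, hvu, fun y => (-1 : ℝ) • X y, hX.smul hv contDiffOn_const, fun y hy => ?_⟩
  obtain ⟨h, hr⟩ := hs y hy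
  have h1 : ∀ w : TangentSpace (𝓡 N) (P y).pt, w = -X y →
      ∃ h : w ≠ 0, -(P y).ray = rayOfNeZero ℝ w h := by
    rintro _ rfl
    exact ⟨neg_ne_zero.2 h, by rw [hr, neg_rayOfNeZero]⟩
  exact h1 _ (neg_one_smul ℝ _)

end Fields

variable {S : Type*} [TopologicalSpace S] [ChartedSpace (EuclideanSpace ℝ (Fin 2)) S]

theorem _root_.SymplecticForm.isLagrangianSubspace_span_singleton (σ : SymplecticForm (𝓡 2) S) {x : S}
    {v : TangentSpace (𝓡 2) x} (hv : v ≠ 0) :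
    IsLagrangianSubspace (σ.toFun x) (Submodule.span ℝ {v}) := by
  let A := altBilin (σ.toFun x)
  have : FiniteDimensional ℝ (TangentSpace (𝓡 2) x) :=
    inferInstanceAs (FiniteDimensional ℝ (EuclideanSpace ℝ (Fin 2)))
  have hf : Module.finrank ℝ (TangentSpace (𝓡 2) x) = 2 := finrank_euclideanSpace_fin
  have hself : A v v = 0 := altBilin_self _ _
  intro u
  constructor
  · intro hu w hw
    obtain ⟨a, rfl⟩ := Submodule.mem_span_singleton.1 hu
    obtain ⟨b, rfl⟩ := Submodule.mem_span_singleton.1 hw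
    change A (a • v) (b • v) = 0
    simp [hself]
  · intro h
    by_contra hu
    have h0 : A u v = 0 := h v (Submodule.mem_span_singleton_self v)
    have hli : LinearIndependent ℝ ![v, u] := by
      rw [LinearIndependent.pair_iff' hv]
      intro a ha
      exact hu (Submodule.mem_span_singleton.2 ⟨a, ha⟩)
    have hspan := hli.span_eq_top_of_card_eq_finrank' (by simp [hf])
    refine hv (σ.nondegenerate _ v fun w => ?_)
    have hw : w ∈ Submodule.span ℝ (range ![v, u]) := by rw [hspan]; trivial
    rw [Matrix.range_cons, Matrix.range_cons, Matrix.range_empty, union_empty,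
      singleton_union, Submodule.mem_span_pair] at hw
    obtain ⟨a, b, rfl⟩ := hw
    change A v (a • v + b • u) = 0
    have h1 : A v u = 0 := by rw [altBilin_swap]; exact neg_eq_zero.2 h0
    simp [hself, h1]

theorem _root_.LagGr.plane_eq_span_singleton {σ : SymplecticForm (𝓡 2) S} (W : LagGr σ.toFun)
    {v : TangentSpace (𝓡 2) W.pt} (hv : v ≠ 0) (hvW : v ∈ W.plane) :
    W.plane = Submodule.span ℝ {v} := by
  have h : Submodule.span ℝ {v} ≤ W.plane := (Submodule.span_singleton_le_iff_mem _ _).2 hvW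
  refine le_antisymm (fun w hw => ?_) h
  exact (σ.isLagrangianSubspace_span_singleton hv w).2 fun z hz => (W.isLagrangian w).1 hw z (h hz)

theorem _root_.LagGr.exists_ne_zero_mem_plane {σ : SymplecticForm (𝓡 2) S} (W : LagGr σ.toFun) :
    ∃ v ∈ W.plane, v ≠ 0 := by
  by_contra! h
  have h1 : ∀ v : TangentSpace (𝓡 2) W.pt, v = 0 := fun v => h v ((W.isLagrangian v).2 fun w hw => by
    rw [h w hw]
    exact map_zero (altBilin (σ.toFun W.pt) v))
  have h2 := h1 (EuclideanSpace.single (0 : Fin 2) (1 : ℝ) : EuclideanSpace ℝ (Fin 2))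
  have h3 : (EuclideanSpace.single (0 : Fin 2) (1 : ℝ) : EuclideanSpace ℝ (Fin 2)) = 0 := h2
  simp at h3

variable (σ : SymplecticForm (𝓡 2) S)

/-- The Lagrangian line spanned by a ray. -/
@[reducible] def toLagGr (r : UnitTangent (𝓡 2) S) : LagGr σ.toFun where
  pt := r.pt
  plane := Submodule.span ℝ {r.ray.someVector}
  isLagrangian := σ.isLagrangianSubspace_span_singleton r.ray.someVector_ne_zero

theorem toLagGr_plane (r : UnitTangent (𝓡 2) S) {w : TangentSpace (𝓡 2) r.pt} (hw : w ≠ 0)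
    (h : r.ray = rayOfNeZero ℝ w hw) : (r.toLagGr σ).plane = Submodule.span ℝ {w} := by
  have h1 : SameRay ℝ r.ray.someVector w := by
    rw [← ray_eq_iff r.ray.someVector_ne_zero hw, r.ray.someVector_ray, h]
  obtain ⟨c, -, hc⟩ := h1.exists_nonneg_left r.ray.someVector_ne_zero
  exact (r.toLagGr σ).plane_eq_span_singleton (v := w) hw (Submodule.mem_span_singleton.2 ⟨c, hc⟩)

theorem smooth_toLagGr [IsManifold (𝓡 2) ∞ S] :
    @Diffeology.DSmooth (UnitTangent (𝓡 2) S) (LagGr σ.toFun)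
      (unitTangentDiffeology (𝓡 2) S) (lagGrDiffeology σ.toFun) (toLagGr σ) := by
  intro m P hP
  have hP' : IsPlotOn univ P := hP
  refine LagGr.isPlotOn_of_fields (P := toLagGr σ ∘ P) hP'.1 fun x hx => ?_
  obtain ⟨v, hv, hxv, hvu, X, hX, hs⟩ := hP'.exists_field hx
  refine ⟨v, hv, hxv, hvu, Unit, inferInstance, fun _ => X, fun _ => hX, fun y hy => ?_⟩
  obtain ⟨h, hr⟩ := hs y hy
  have h1 : (range fun _ : Unit => X y) = {X y} := range_const
  exact (toLagGr_plane σ (P y) h hr).trans (congrArg _ h1.symm)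

end UnitTangent

/-- On a monotone symplectic surface, the symplectic form becomes exact on the unit tangent
bundle. -/
theorem UnitTangent.exists_primitive {S : Type*} [TopologicalSpace S] [T2Space S]
    [ChartedSpace (EuclideanSpace ℝ (Fin 2)) S] [IsManifold (𝓡 2) ∞ S] {σ : SymplecticForm (𝓡 2) S}
    (hσ : IsMonotone σ) : ∃ lam : DForm (unitTangentDiffeology (𝓡 2) S) 1,
      DForm.d lam =
        DForm.pullback UnitTangent.pt UnitTangent.smooth_pt σ.toSmoothForm.toDForm := by
  obtain ⟨lam, hlam⟩ := LagGr.exists_isActionForm hσ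
  refine ⟨DForm.pullback _ (UnitTangent.smooth_toLagGr σ) lam, ?_⟩
  rw [DForm.d_pullback, hlam]
  rfl

/-! ### Descent from the unit tangent bundle to the Lagrangian Grassmannian -/

section

variable {N m : ℕ} {M : Type*} [TopologicalSpace M] [ChartedSpace (EuclideanSpace ℝ (Fin N)) M]
  [IsManifold (𝓡 N) ∞ M] {p : EuclideanSpace ℝ (Fin m) → M} {X : ∀ y, TangentSpace (𝓡 N) (p y)}
  {s : Set (EuclideanSpace ℝ (Fin m))} {P : EuclideanSpace ℝ (Fin N) → M}
  {e : M → EuclideanSpace ℝ (Fin N)}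

theorem IsChartPlot.chartCoord_ne_zero (hP : IsChartPlot (𝓡 N) P e) {x : M} (hx : x ∈ range P)
    {v : TangentSpace (𝓡 N) x} (hv : v ≠ 0) : chartCoord e x v ≠ 0 := fun h =>
  hv (by rw [← hP.chartInv_chartCoord hx v, h, map_zero])

theorem SmoothAlong.continuousAt_chartCoord (hX : SmoothAlong (𝓡 N) X s)
    (hP : IsChartPlot (𝓡 N) P e) {u : EuclideanSpace ℝ (Fin m)} (hs : s ∈ 𝓝 u)
    (hu : p u ∈ range P) : ContinuousAt (fun y => chartCoord e (p y) (X y)) u :=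
  (hX.contDiffOn_chartCoord hP).continuousOn.continuousAt (inter_mem hs
    ((hX.contMDiffOn.continuousOn.continuousAt hs).eventually (hP.isOpen_range.mem_nhds hu)))

theorem SmoothAlong.eventually_ne_zero (hX : SmoothAlong (𝓡 N) X s) {u : EuclideanSpace ℝ (Fin m)}
    (hs : s ∈ 𝓝 u) (hu : X u ≠ 0) : ∀ᶠ y in 𝓝 u, X y ≠ 0 := by
  obtain ⟨e, he⟩ := exists_isChartPlot_ballPlot (n := N) (p u)
  have hr := mem_range_ballPlot (n := N) (p u)
  filter_upwards [(hX.continuousAt_chartCoord he hs hr).eventually_ne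
    (he.chartCoord_ne_zero hr hu)] with y hy h
  rw [h, map_zero] at hy
  exact hy rfl

end

namespace UnitTangent

variable {S : Type*} [TopologicalSpace S] [ChartedSpace (EuclideanSpace ℝ (Fin 2)) S]
  [IsManifold (𝓡 2) ∞ S] (σ : SymplecticForm (𝓡 2) S)

theorem exists_lift {m : ℕ} {R : EuclideanSpace ℝ (Fin m) → LagGr σ.toFun}
    (hR : R ∈ (lagGrDiffeology σ.toFun).plots m) (u : EuclideanSpace ℝ (Fin m)) :
    ∃ Q ∈ (unitTangentDiffeology (𝓡 2) S).plots m, R =ᶠ[𝓝 u] toLagGr σ ∘ Q := by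
  have hR' : LagGr.IsPlotOn univ R := hR
  obtain ⟨v, hv, huv, -, K, X, hX, hs⟩ := hR'.exists_fields (mem_univ u)
  obtain ⟨i, hi⟩ : ∃ i, X i u ≠ 0 := by
    by_contra! h
    obtain ⟨w, hw, hw0⟩ := (R u).exists_ne_zero_mem_plane
    rw [hs u huv] at hw
    refine hw0 ((Submodule.mem_bot ℝ).1 (Submodule.span_le.2 ?_ hw))
    rintro _ ⟨i, rfl⟩
    exact h i
  obtain ⟨g, hg, hgU, hgu⟩ := exists_squash u
    (((hX i).eventually_ne_zero (hv.mem_nhds huv) hi).and (hv.mem_nhds huv))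
  refine ⟨fun y => ⟨(R (g y)).pt, rayOfNeZero ℝ (X i (g y)) (hgU y).1⟩, ?_, ?_⟩
  · have hX' : SmoothAlong (𝓡 2) (p := fun y => (R (g y)).pt) (fun y => X i (g y)) univ :=
      (hX i).comp hg.contDiffOn fun y _ => (hgU y).2
    exact isPlotOn_of_field hX'.contMDiffOn fun x _ => ⟨univ, isOpen_univ, mem_univ _,
      Subset.rfl, fun y => X i (g y), hX', fun y _ => ⟨(hgU y).1, rfl⟩⟩
  · have h1 : ∀ y, toLagGr σ ⟨(R (g y)).pt, rayOfNeZero ℝ (X i (g y)) (hgU y).1⟩ = R (g y) :=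
      fun y => by
        refine LagGr.ext rfl ?_
        refine (toLagGr_plane σ ⟨(R (g y)).pt, rayOfNeZero ℝ (X i (g y)) (hgU y).1⟩
          (hgU y).1 rfl).trans ((R (g y)).plane_eq_span_singleton (hgU y).1 ?_).symm
        rw [hs _ (hgU y).2]
        exact Submodule.subset_span ⟨i, rfl⟩
    refine (hgu.fun_comp R).symm.trans (Eventually.of_forall fun y => (h1 y).symm)

theorem pullback_toLagGr_injective {k : ℕ} {α β : DForm (lagGrDiffeology σ.toFun) k}
    (h : DForm.pullback _ (smooth_toLagGr σ) α = DForm.pullback _ (smooth_toLagGr σ) β) : α = β := by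
  refine DForm.ext fun {m} R hR u => ?_
  obtain ⟨Q, hQ, hRQ⟩ := exists_lift σ hR u
  rw [α.val_congr hR (smooth_toLagGr σ m Q hQ) hRQ, β.val_congr hR (smooth_toLagGr σ m Q hQ) hRQ]
  exact congrArg (fun γ => DForm.val γ Q hQ u) h

theorem eq_or_eq_antipode {P : EuclideanSpace ℝ (Fin 2) → S} {e : S → EuclideanSpace ℝ (Fin 2)}
    (hP : IsChartPlot (𝓡 2) P e) {q q' : UnitTangent (𝓡 2) S} (h : toLagGr σ q = toLagGr σ q')
    {w : TangentSpace (𝓡 2) q.pt} {w' : TangentSpace (𝓡 2) q'.pt} (hw : w ≠ 0) (hw' : w' ≠ 0)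
    (hq : q.ray = rayOfNeZero ℝ w hw) (hq' : q'.ray = rayOfNeZero ℝ w' hw') (hx : q.pt ∈ range P) :
    inner ℝ (chartCoord e q.pt w) (chartCoord e q'.pt w') ≠ 0 ∧
    (0 < inner ℝ (chartCoord e q.pt w) (chartCoord e q'.pt w') → q = q') ∧
    (inner ℝ (chartCoord e q.pt w) (chartCoord e q'.pt w') < 0 → q = antipode q') := by
  have h1 := toLagGr_plane σ q hw hq
  have h2 := toLagGr_plane σ q' hw' hq'
  obtain ⟨x, r⟩ := q
  obtain ⟨x', r'⟩ := q'
  obtain rfl : x = x' := congrArg LagGr.pt h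
  have h3 : (toLagGr σ ⟨x, r⟩).plane = (toLagGr σ ⟨x, r'⟩).plane := (LagGr.ext_iff.1 h).2
  rw [h1, h2] at h3
  have h4 : w' ∈ Submodule.span ℝ {w} := h3 ▸ Submodule.mem_span_singleton_self w'
  obtain ⟨c, rfl⟩ := Submodule.mem_span_singleton.1 h4
  have hc : c ≠ 0 := fun h0 => hw' (by rw [h0, zero_smul])
  have ha : 0 < inner ℝ (chartCoord e x w) (chartCoord e x w) :=
    real_inner_self_pos.2 (hP.chartCoord_ne_zero hx hw)
  have hin : inner ℝ (chartCoord e x w) (chartCoord e x (c • w)) =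
      c * inner ℝ (chartCoord e x w) (chartCoord e x w) := by
    rw [map_smul, real_inner_smul_right]
  simp only [hin]
  refine ⟨mul_ne_zero hc ha.ne', fun hpos => ?_, fun hneg => ?_⟩
  · have hc0 : 0 < c := pos_of_mul_pos_left hpos ha.le
    congr 1
    rw [show r = _ from hq, show r' = _ from hq', ray_eq_iff]
    exact SameRay.sameRay_pos_smul_right _ hc0
  · have hc0 : c < 0 := by
      by_contra! hc1
      exact absurd hneg (not_lt.2 (mul_nonneg hc1 ha.le))
    rw [antipode]
    congr 1
    rw [show r = _ from hq, show r' = _ from hq', neg_rayOfNeZero, ray_eq_iff, ← neg_smul]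
    exact SameRay.sameRay_pos_smul_right _ (neg_pos.2 hc0)

theorem eventuallyEq_or_eventuallyEq_antipode {m : ℕ}
    {Q Q' : EuclideanSpace ℝ (Fin m) → UnitTangent (𝓡 2) S}
    (hQ : Q ∈ (unitTangentDiffeology (𝓡 2) S).plots m)
    (hQ' : Q' ∈ (unitTangentDiffeology (𝓡 2) S).plots m) {u : EuclideanSpace ℝ (Fin m)}
    (h : toLagGr σ ∘ Q =ᶠ[𝓝 u] toLagGr σ ∘ Q') :
    Q =ᶠ[𝓝 u] Q' ∨ Q =ᶠ[𝓝 u] antipode ∘ Q' := by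
  obtain ⟨v, hv, huv, -, X, hX, hs⟩ := IsPlotOn.exists_field (u := univ) hQ (mem_univ u)
  obtain ⟨v', hv', huv', -, X', hX', hs'⟩ := IsPlotOn.exists_field (u := univ) hQ' (mem_univ u)
  obtain ⟨e, he⟩ := exists_isChartPlot_ballPlot (n := 2) (Q u).pt
  have hr := mem_range_ballPlot (n := 2) (Q u).pt
  have hpt : (Q u).pt = (Q' u).pt := congrArg LagGr.pt h.eq_of_nhds
  have hr' : (Q' u).pt ∈ range (ballPlot (n := 2) (Q u).pt) := hpt ▸ hr
  have hc := (hX.continuousAt_chartCoord he (hv.mem_nhds huv) hr).inner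
    (hX'.continuousAt_chartCoord he (hv'.mem_nhds huv') hr') (𝕜 := ℝ)
  have hev : ∀ᶠ y in 𝓝 u, (Q y).pt ∈ range (ballPlot (n := 2) (Q u).pt) :=
    (hX.contMDiffOn.continuousOn.continuousAt (hv.mem_nhds huv)).eventually
      (he.isOpen_range.mem_nhds hr)
  have key : ∀ y ∈ v, y ∈ v' → toLagGr σ (Q y) = toLagGr σ (Q' y) →
      (Q y).pt ∈ range (ballPlot (n := 2) (Q u).pt) → _ := fun y hy hy' hyQ hyr =>
    eq_or_eq_antipode σ he hyQ (hs y hy).1 (hs' y hy').1 (hs y hy).2 (hs' y hy').2 hyr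
  rcases lt_or_gt_of_ne (key u huv huv' h.eq_of_nhds hr).1 with hneg | hpos
  · right
    filter_upwards [hc.eventually (gt_mem_nhds hneg), hv.mem_nhds huv, hv'.mem_nhds huv', h, hev]
      with y hy1 hy2 hy3 hy4 hy5
    exact (key y hy2 hy3 hy4 hy5).2.2 hy1
  · left
    filter_upwards [hc.eventually (lt_mem_nhds hpos), hv.mem_nhds huv, hv'.mem_nhds huv', h, hev]
      with y hy1 hy2 hy3 hy4 hy5
    exact (key y hy2 hy3 hy4 hy5).2.1 hy1

/-- An antipodally invariant form on the unit tangent bundle descends to the bundle of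
Lagrangian lines. -/
theorem exists_pullback_toLagGr_eq {k : ℕ} {lam : DForm (unitTangentDiffeology (𝓡 2) S) k}
    (h : DForm.pullback _ smooth_antipode lam = lam) :
    ∃ μ : DForm (lagGrDiffeology σ.toFun) k, DForm.pullback _ (smooth_toLagGr σ) μ = lam := by
  obtain ⟨μ, hμ⟩ := DForm.exists_ofLocal (lagGrDiffeology σ.toFun) k
    (fun {m} R u W => ∃ (Q : EuclideanSpace ℝ (Fin m) → UnitTangent (𝓡 2) S)
      (hQ : Q ∈ (unitTangentDiffeology (𝓡 2) S).plots m), R =ᶠ[𝓝 u] toLagGr σ ∘ Q ∧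
        W = lam.val Q hQ)
    (fun {m} R hR u => by
      obtain ⟨Q, hQ, hRQ⟩ := exists_lift σ hR u
      exact ⟨_, Q, hQ, hRQ, rfl⟩)
    (fun {m} R hR u W => by
      rintro ⟨Q, hQ, -, rfl⟩
      exact (lam.smooth Q hQ).contDiffAt)
    (fun {m} R hR u W => by
      rintro ⟨Q, hQ, hRQ, rfl⟩
      filter_upwards [eventually_eventually_nhds.2 hRQ] with y hy
      exact ⟨Q, hQ, hy, rfl⟩)
    (fun {m} R hR u W W' => by
      rintro ⟨Q, hQ, hRQ, rfl⟩ ⟨Q', hQ', hRQ', rfl⟩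
      rcases eventuallyEq_or_eventuallyEq_antipode σ hQ hQ' (hRQ.symm.trans hRQ') with h1 | h1
      · exact lam.val_congr hQ hQ' h1
      · rw [lam.val_congr hQ (smooth_antipode m Q' hQ') h1]
        exact congrArg (fun γ => DForm.val γ Q' hQ' u) h)
    (fun {m m'} R hR g hg u W => by
      rintro ⟨Q, hQ, hRQ, rfl⟩
      exact ⟨_, ⟨Q ∘ g, (unitTangentDiffeology (𝓡 2) S).plot_reparam hQ hg,
        hg.continuous.continuousAt.eventually hRQ, rfl⟩, lam.natural Q hQ g hg u⟩)
  refine ⟨μ, DForm.ext fun {m} Q hQ u => ?_⟩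
  exact (hμ _ (smooth_toLagGr σ m Q hQ) u _ ⟨Q, hQ, EventuallyEq.rfl, rfl⟩).eq_of_nhds

/-- Averaging a primitive on the unit tangent bundle over the antipodal map gives an action
form. -/
theorem exists_isActionForm {lam : DForm (unitTangentDiffeology (𝓡 2) S) 1}
    (hlam : DForm.d lam =
      DForm.pullback UnitTangent.pt UnitTangent.smooth_pt σ.toSmoothForm.toDForm) :
    ∃ μ : DForm (lagGrDiffeology σ.toFun) 1, IsActionForm σ μ ∧
      DForm.pullback _ (smooth_toLagGr σ) μ =
        (1 / 2 : ℝ) • (lam + DForm.pullback _ smooth_antipode lam) := by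
  have hinv : DForm.pullback antipode smooth_antipode
      (DForm.pullback antipode smooth_antipode lam) = lam := by
    refine DForm.ext fun {m} Q hQ u => lam.val_of_eq _ _ (funext fun y => ?_) u
    change (⟨(Q y).pt, - -(Q y).ray⟩ : UnitTangent (𝓡 2) S) = Q y
    rw [neg_neg]
  obtain ⟨μ, hμ⟩ := exists_pullback_toLagGr_eq σ
    (lam := (1 / 2 : ℝ) • (lam + DForm.pullback _ smooth_antipode lam))
    (by rw [map_smul, map_add, hinv, add_comm])
  refine ⟨μ, pullback_toLagGr_injective σ ?_, hμ⟩
  rw [← DForm.d_pullback, hμ, map_smul, map_add, DForm.d_pullback, hlam]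
  change (1 / 2 : ℝ) • (DForm.pullback UnitTangent.pt UnitTangent.smooth_pt
    σ.toSmoothForm.toDForm + DForm.pullback UnitTangent.pt UnitTangent.smooth_pt
    σ.toSmoothForm.toDForm) = DForm.pullback UnitTangent.pt UnitTangent.smooth_pt
    σ.toSmoothForm.toDForm
  module

end UnitTangent

/-! ### Holonomy and the antipodal map -/

theorem UnitTangent.d_val_homotopy {N m : ℕ} {M : Type*} [TopologicalSpace M]
    [ChartedSpace (EuclideanSpace ℝ (Fin N)) M] [IsManifold (𝓡 N) ∞ M]
    {η : SmoothForm (𝓡 N) M 2} {lam : DForm (unitTangentDiffeology (𝓡 N) M) 1}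
    (hlam : DForm.d lam = DForm.pullback UnitTangent.pt UnitTangent.smooth_pt η.toDForm)
    {S : EuclideanSpace ℝ (Fin (m + 1)) → UnitTangent (𝓡 N) M}
    (hS : S ∈ (unitTangentDiffeology (𝓡 N) M).plots (m + 1)) (c : ℝ)
    (hpt : ∀ u, (S u).pt = (S (joinL m (c, tailL m u))).pt) (u : EuclideanSpace ℝ (Fin (m + 1))) :
    (DForm.d lam).val S hS u = ((DForm.d lam).val _
      ((unitTangentDiffeology (𝓡 N) M).plot_reparam hS (contDiff_join_right c))
        (tailL m u)).compContinuousLinearMap (tailL m) := by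
  rw [hlam]
  have hQ := (unitTangentDiffeology (𝓡 N) M).plot_reparam hS (contDiff_join_right c)
  have h1 := η.toDForm.natural _ (UnitTangent.smooth_pt _ _ hQ) (tailL m) (tailL m).contDiff u
  rw [ContinuousLinearMap.fderiv] at h1
  refine Eq.trans ?_ h1
  exact η.toDForm.val_of_eq (UnitTangent.smooth_pt _ _ hS) _ (funext hpt) u

/-- Over a compact set, finitely many vector fields detect nonzero vectors. -/
theorem SymplecticForm.exists_fields_pairing_ne_zero {N : ℕ} {M : Type*} [TopologicalSpace M]
    [T2Space M] [ChartedSpace (EuclideanSpace ℝ (Fin N)) M] [IsManifold (𝓡 N) ∞ M]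
    (σ : SymplecticForm (𝓡 N) M) {K : Set M} (hK : IsCompact K) :
    ∃ (ι : Type) (_ : Fintype ι) (Z : ι → ∀ x : M, TangentSpace (𝓡 N) x),
      (∀ i, IsSmoothField (Z i)) ∧
      ∀ x ∈ K, ∀ v : TangentSpace (𝓡 N) x, v ≠ 0 → ∃ i, altBilin (σ.toFun x) v (Z i x) ≠ 0 := by
  refine hK.induction_on (p := fun K => ∃ (ι : Type) (_ : Fintype ι)
    (Z : ι → ∀ x : M, TangentSpace (𝓡 N) x), (∀ i, IsSmoothField (Z i)) ∧
      ∀ x ∈ K, ∀ v : TangentSpace (𝓡 N) x, v ≠ 0 → ∃ i, altBilin (σ.toFun x) v (Z i x) ≠ 0)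
    ?_ ?_ ?_ ?_
  · exact ⟨Empty, inferInstance, fun i => i.elim, fun i => i.elim, fun x hx => hx.elim⟩
  · rintro s t hst ⟨ι, _, Z, hZ, h⟩
    exact ⟨ι, inferInstance, Z, hZ, fun x hx => h x (hst hx)⟩
  · rintro s t ⟨ι, _, Z, hZ, h⟩ ⟨ι', _, Z', hZ', h'⟩
    refine ⟨ι ⊕ ι', inferInstance, Sum.elim Z Z', ?_, ?_⟩
    · rintro (i | i)
      · exact hZ i
      · exact hZ' i
    · rintro x (hx | hx) v hv
      · obtain ⟨i, hi⟩ := h x hx v hv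
        exact ⟨Sum.inl i, hi⟩
      · obtain ⟨i, hi⟩ := h' x hx v hv
        exact ⟨Sum.inr i, hi⟩
  · intro x hx
    obtain ⟨e, he⟩ := exists_isChartPlot_ballPlot (n := N) x
    obtain ⟨u, hu⟩ := mem_range_ballPlot (n := N) x
    choose Z hZ hZe using fun i : Fin N =>
      he.exists_isSmoothField (Y := fun _ => EuclideanSpace.single i 1) contDiff_const u
    rw [hu] at hZe
    refine ⟨_, mem_nhdsWithin_of_mem_nhds ((eventually_all.2 hZe).and
      (he.isOpen_range.mem_nhds (mem_range_ballPlot (n := N) x))), Fin N, inferInstance, Z, hZ,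
      fun y hy v hv => ?_⟩
    by_contra! h0
    refine hv (σ.nondegenerate y v fun w => ?_)
    change altBilin (σ.toFun y) v w = 0
    have ha : ∀ a : EuclideanSpace ℝ (Fin N), a = ∑ i, a i • EuclideanSpace.single i (1 : ℝ) :=
      fun a => (ContinuousLinearMap.id ℝ (EuclideanSpace ℝ (Fin N))).apply_eq_sum_single a
    rw [← he.chartInv_chartCoord hy.2 w, ha (chartCoord e y w), map_sum, map_sum]
    refine Finset.sum_eq_zero fun i _ => ?_
    rw [map_smul, map_smul]
    have h1 : Z i y = chartInv (ballPlot x) e y (EuclideanSpace.single i 1) := hy.1 i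
    rw [← h1, h0 i, smul_zero]

namespace ImmersedCurve

variable {S : Type*} [TopologicalSpace S] [ChartedSpace (EuclideanSpace ℝ (Fin 2)) S]
  [IsManifold (𝓡 2) ∞ S] {σ : SymplecticForm (𝓡 2) S} (γ : ImmersedCurve S)

theorem smoothAlong_velocity {m : ℕ} {P : EuclideanSpace ℝ (Fin m) → Circle}
    (hP : ContMDiff 𝓘(ℝ, EuclideanSpace ℝ (Fin m)) (𝓡 1) ∞ P) :
    SmoothAlong (𝓡 2) (p := γ.toFun ∘ P) (fun y => γ.velocity (P y)) univ :=
  ((γ.contMDiff.contMDiff_tangentMap (m := ∞) (by simp)).comp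
    (contMDiff_circleField.comp hP)).contMDiffOn

/-- There is a vector field along an immersed curve that is transverse to it. -/
theorem exists_transverse [T2Space S] (σ : SymplecticForm (𝓡 2) S) :
    ∃ W : ∀ p : Circle, TangentSpace (𝓡 2) (γ.toFun p),
      (∀ p, altBilin (σ.toFun (γ.toFun p)) (γ.velocity p) (W p) ≠ 0) ∧
      ∀ {m : ℕ} (P : EuclideanSpace ℝ (Fin m) → Circle),
        ContMDiff 𝓘(ℝ, EuclideanSpace ℝ (Fin m)) (𝓡 1) ∞ P →
          SmoothAlong (𝓡 2) (p := γ.toFun ∘ P) (fun y => W (P y)) univ := by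
  obtain ⟨ι, _, Z, hZ, h⟩ := σ.exists_fields_pairing_ne_zero
    (isCompact_range γ.contMDiff.continuous)
  let c : ι → Circle → ℝ := fun i p =>
    altBilin (σ.toFun (γ.toFun p)) (γ.velocity p) (Z i (γ.toFun p))
  refine ⟨fun p => ∑ i, c i p • Z i (γ.toFun p), fun p => ?_, fun {m} P hP => ?_⟩
  · rw [map_sum]
    obtain ⟨i, hi⟩ := h _ ⟨p, rfl⟩ _ (γ.velocity_ne_zero p)
    refine (Finset.sum_pos' (fun j _ => ?_) ⟨i, Finset.mem_univ i, ?_⟩).ne'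
    · rw [map_smul]
      exact mul_self_nonneg _
    · rw [map_smul]
      exact mul_self_pos.2 hi
  · have hZP : ∀ i, SmoothAlong (𝓡 2) (p := γ.toFun ∘ P) (fun y => Z i (γ.toFun (P y))) univ :=
      fun i => ((hZ i).comp (γ.contMDiff.comp hP)).contMDiffOn
    have hc : ∀ i, ContDiffOn ℝ ∞ (fun y => c i (P y)) univ := fun i =>
      σ.toSmoothForm.contDiffOn_pairing isOpen_univ (γ.smoothAlong_velocity hP) (hZP i)
    refine .of_chartCoord isOpen_univ (γ.contMDiff.comp hP).contMDiffOn fun Q e hQ => ?_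
    simp only [map_sum, map_smul]
    exact ContDiffOn.sum fun i _ => ((hc i).mono inter_subset_left).smul
      ((hZP i).contDiffOn_chartCoord hQ)

theorem holonomy_eq_lineInt (lam : DForm (unitTangentDiffeology (𝓡 2) S) 1) :
    γ.holonomy lam = lineInt lam (γ.lift ∘ anglePlot) 0 (2 * Real.pi) := by
  rw [holonomy, lineInt]
  congr 1
  funext s
  have h : γ.lift ∘ anglePlot ∈ (unitTangentDiffeology (𝓡 2) S).plots 1 :=
    γ.smooth_lift 1 _ contMDiff_anglePlot
  rw [dif_pos h]
  rfl

omit [IsManifold (𝓡 2) ∞ S] in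
theorem cos_smul_add_sin_smul_ne_zero {p : Circle} {w : TangentSpace (𝓡 2) (γ.toFun p)}
    (hw : altBilin (σ.toFun (γ.toFun p)) (γ.velocity p) w ≠ 0) (t : ℝ) :
    Real.cos t • γ.velocity p + Real.sin t • w ≠ 0 := by
  intro h
  have h1 := congrArg (altBilin (σ.toFun (γ.toFun p)) (γ.velocity p)) h
  rw [map_add, map_smul, map_smul, altBilin_self, smul_zero, zero_add, map_zero, smul_eq_mul,
    mul_eq_zero, or_iff_left hw] at h1
  rw [h1, zero_smul, add_zero, smul_eq_zero, or_iff_left (γ.velocity_ne_zero p)] at h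
  have := Real.sin_sq_add_cos_sq t
  rw [h, h1] at this
  norm_num at this

/-- Averaging over the antipodal map does not change the holonomy. -/
theorem holonomy_average [T2Space S] (σ : SymplecticForm (𝓡 2) S)
    {lam : DForm (unitTangentDiffeology (𝓡 2) S) 1}
    (hlam : DForm.d lam =
      DForm.pullback UnitTangent.pt UnitTangent.smooth_pt σ.toSmoothForm.toDForm) :
    γ.holonomy ((1 / 2 : ℝ) • (lam + DForm.pullback _ UnitTangent.smooth_antipode lam)) =
      γ.holonomy lam := by
  obtain ⟨W, hW, hWs⟩ := γ.exists_transverse σ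
  let rot : ℝ → Circle → UnitTangent (𝓡 2) S := fun t p =>
    ⟨γ.toFun p, rayOfNeZero ℝ _ (γ.cos_smul_add_sin_smul_ne_zero (hW p) t)⟩
  let T : EuclideanSpace ℝ (Fin (1 + 1)) → UnitTangent (𝓡 2) S := fun z =>
    rot (z 0) (anglePlot (tailL 1 z))
  have hP : ContMDiff 𝓘(ℝ, EuclideanSpace ℝ (Fin (1 + 1))) (𝓡 1) ∞
      fun z => anglePlot (tailL 1 z) := contMDiff_anglePlot.comp (tailL 1).contDiff.contMDiff
  have hz : ContDiff ℝ ∞ fun z : EuclideanSpace ℝ (Fin (1 + 1)) => z 0 :=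
    (EuclideanSpace.proj (𝕜 := ℝ) (0 : Fin (1 + 1))).contDiff
  have hT : T ∈ (unitTangentDiffeology (𝓡 2) S).plots (1 + 1) := by
    refine UnitTangent.isPlotOn_of_field (γ.contMDiff.comp hP).contMDiffOn fun x _ =>
      ⟨univ, isOpen_univ, mem_univ _, Subset.rfl, fun z => Real.cos (z 0) •
        γ.velocity (anglePlot (tailL 1 z)) + Real.sin (z 0) • W (anglePlot (tailL 1 z)), ?_,
        fun y _ => ⟨_, rfl⟩⟩
    exact ((γ.smoothAlong_velocity hP).smul isOpen_univ
      (Real.contDiff_cos.comp hz).contDiffOn).add isOpen_univ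
      ((hWs _ hP).smul isOpen_univ (Real.contDiff_sin.comp hz).contDiffOn)
  have hTj : ∀ s y, T (joinL 1 (s, y)) = rot s (anglePlot y) := fun s y => by
    simp only [T, tailL_joinL, joinL_zero]
  obtain ⟨hK, hKd⟩ := lineInt_homotopy lam hT 0
    (UnitTangent.d_val_homotopy hlam hT 0 fun u => by rw [hTj]) 0 Real.pi
  simp only [hTj] at hK hKd
  set K : EuclideanSpace ℝ (Fin 1) → ℝ := fun y =>
    lineInt lam (fun s => rot (s 0) (anglePlot y)) 0 Real.pi
  have hγ : γ.lift ∘ anglePlot ∈ (unitTangentDiffeology (𝓡 2) S).plots 1 :=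
    γ.smooth_lift 1 _ contMDiff_anglePlot
  have hray : ∀ p (w : TangentSpace (𝓡 2) (γ.toFun p)), w = γ.velocity p → ∀ h : w ≠ 0,
      (⟨γ.toFun p, rayOfNeZero ℝ w h⟩ : UnitTangent (𝓡 2) S) = γ.lift p := by
    rintro p _ rfl h; rfl
  have hray' : ∀ p (w : TangentSpace (𝓡 2) (γ.toFun p)), w = -γ.velocity p → ∀ h : w ≠ 0,
      (⟨γ.toFun p, rayOfNeZero ℝ w h⟩ : UnitTangent (𝓡 2) S) = (γ.lift p).antipode := by
    rintro p _ rfl h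
    rw [UnitTangent.antipode, lift, neg_rayOfNeZero]
  have h0 : ∀ p, rot 0 p = γ.lift p := fun p => hray p _ (by simp) _
  have hpi : ∀ p, rot Real.pi p = (γ.lift p).antipode := fun p => hray' p _ (by simp) _
  obtain ⟨F, hF, hFl⟩ := exists_primitive_path lam hγ
  have hanti : ∀ u, (DForm.pullback _ UnitTangent.smooth_antipode lam).val _ hγ u =
      covecForm (fderiv ℝ F u) + covecForm (fderiv ℝ K u) := fun u => by
    have e1 : lam.val (T ∘ fun y => joinL 1 (0, y)) ((unitTangentDiffeology (𝓡 2) S).plot_reparam hT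
        (contDiff_join_right 0)) u = lam.val _ hγ u :=
      lam.val_of_eq _ hγ (funext fun y => (hTj 0 y).trans (h0 _)) u
    have e2 : lam.val (T ∘ fun y => joinL 1 (Real.pi, y)) ((unitTangentDiffeology (𝓡 2) S).plot_reparam
        hT (contDiff_join_right Real.pi)) u = lam.val _ (UnitTangent.smooth_antipode 1 _ hγ) u :=
      lam.val_of_eq _ _ (funext fun y => (hTj Real.pi y).trans (hpi _)) u
    rw [hKd u, ← hFl u, e1, e2, add_sub_cancel]
    rfl
  have hper : K (EuclideanSpace.single 0 (2 * Real.pi)) = K (EuclideanSpace.single 0 0) := by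
    simp only [K, anglePlot]
    simp
  rw [holonomy_eq_lineInt, holonomy_eq_lineInt, lineInt_eq_sub hγ hF hFl,
    lineInt_eq_sub hγ (F := fun u => F u + 1 / 2 * K u) (hF.add (contDiff_const.mul hK)) fun u => ?_]
  · simp only [hper]
    ring
  · rw [DForm.smul_val, DForm.add_val, hanti, hFl]
    rw [fderiv_fun_add (hF.differentiable (by simp) u)
      ((contDiff_const.mul hK).differentiable (by simp) u),
      fderiv_const_mul (hK.differentiable (by simp) u)]
    ext v
    simp
    ring

end ImmersedCurve

/-! ### Integration over the circle -/

namespace Circle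

/-- The coordinate `2 arctan` around the point `exp c`. -/
def angleCoord (c : ℝ) (u : EuclideanSpace ℝ (Fin 1)) : EuclideanSpace ℝ (Fin 1) :=
  EuclideanSpace.single 0 (c + 2 * Real.arctan (u 0))

/-- A chart of the circle around `exp c`, covering all but one point. -/
def angleChart (c : ℝ) : EuclideanSpace ℝ (Fin 1) → Circle := anglePlot ∘ angleCoord c

/-- The inverse of `angleChart`. -/
def angleInv (c : ℝ) (z : Circle) : EuclideanSpace ℝ (Fin 1) :=
  EuclideanSpace.single 0
    (((z * exp (-c) : Circle) : ℂ).im / (1 + ((z * exp (-c) : Circle) : ℂ).re))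

theorem contDiff_angleCoord (c : ℝ) : ContDiff ℝ ∞ (angleCoord c) :=
  contDiff_euclideanSingle.comp (contDiff_const.add (contDiff_const.mul
    (Real.contDiff_arctan.comp (EuclideanSpace.proj (𝕜 := ℝ) (0 : Fin 1)).contDiff)))

theorem coe_exp_re (t : ℝ) : ((exp t : Circle) : ℂ).re = Real.cos t := by
  rw [coe_exp, Complex.exp_ofReal_mul_I_re]

theorem coe_exp_im (t : ℝ) : ((exp t : Circle) : ℂ).im = Real.sin t := by
  rw [coe_exp, Complex.exp_ofReal_mul_I_im]

theorem angleChart_mul_exp_neg (c : ℝ) (u : EuclideanSpace ℝ (Fin 1)) :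
    angleChart c u * exp (-c) = exp (2 * Real.arctan (u 0)) := by
  simp only [angleChart, anglePlot, angleCoord, Function.comp_apply, ← exp_add]
  simp

theorem range_angleChart (c : ℝ) :
    range (angleChart c) = {z | ((z * exp (-c) : Circle) : ℂ).re ≠ -1} := by
  ext z
  constructor
  · rintro ⟨u, rfl⟩
    change ((angleChart c u * exp (-c) : Circle) : ℂ).re ≠ -1
    rw [angleChart_mul_exp_neg, coe_exp_re, Real.cos_two_mul]
    have := Real.cos_arctan_pos (u 0)
    nlinarith
  · intro hz
    set w : Circle := z * exp (-c) with hw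
    have h1 : exp (Complex.arg w) = w := exp_arg w
    have h2 : Complex.arg w ≠ Real.pi := fun h => by
      have h3 : ((exp (Complex.arg w) : Circle) : ℂ).re = -1 := by
        rw [h, coe_exp_re, Real.cos_pi]
      rw [h1] at h3
      exact hz h3
    have h3 := Complex.neg_pi_lt_arg (w : ℂ)
    have h4 := lt_of_le_of_ne (Complex.arg_le_pi (w : ℂ)) h2
    refine ⟨EuclideanSpace.single 0 (Real.tan (Complex.arg w / 2)), ?_⟩
    have h5 := angleChart_mul_exp_neg c (EuclideanSpace.single 0 (Real.tan (Complex.arg w / 2)))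
    rw [PiLp.single_apply, if_pos rfl, Real.arctan_tan (by linarith) (by linarith),
      mul_div_cancel₀ _ two_ne_zero, h1, hw] at h5
    exact mul_right_cancel h5

theorem contMDiff_coe : ContMDiff (𝓡 1) 𝓘(ℝ, ℂ) ∞ (fun z : Circle => (z : ℂ)) :=
  have := finrank_real_complex_fact'
  contMDiff_coe_sphere (E := ℂ) (n := 1)

theorem isChartPlot_angleChart (c : ℝ) : IsChartPlot (𝓡 1) (angleChart c) (angleInv c) where
  contMDiff := contMDiff_anglePlot.comp (contDiff_angleCoord c).contMDiff
  isOpen_range := by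
    rw [range_angleChart]
    have h : Continuous fun z : Circle => ((z * exp (-c) : Circle) : ℂ).re :=
      Complex.continuous_re.comp (continuous_subtype_val.comp (continuous_id.mul continuous_const))
    exact isOpen_ne.preimage h
  left_inv u := by
    rw [angleInv, angleChart_mul_exp_neg, coe_exp_re, coe_exp_im, Real.sin_two_mul,
      Real.cos_two_mul, add_sub_cancel]
    have h := (Real.cos_arctan_pos (u 0)).ne'
    rw [show 2 * Real.sin (Real.arctan (u 0)) * Real.cos (Real.arctan (u 0)) /
      (2 * Real.cos (Real.arctan (u 0)) ^ 2) = Real.tan (Real.arctan (u 0)) by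
        rw [Real.tan_eq_sin_div_cos]; field_simp, Real.tan_arctan]
    ext i
    fin_cases i
    simp
  contMDiffOn := by
    have h : ContMDiff (𝓡 1) 𝓘(ℝ, ℂ) ∞ fun z : Circle => ((z * exp (-c) : Circle) : ℂ) :=
      contMDiff_coe.comp (contMDiff_id.mul contMDiff_const)
    have h2 : ContDiffOn ℝ ∞ (fun w : ℂ => EuclideanSpace.single (0 : Fin 1) (w.im / (1 + w.re)))
        {w | 1 + w.re ≠ 0} := contDiff_euclideanSingle.comp_contDiffOn
      (Complex.imCLM.contDiff.contDiffOn.div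
        (contDiff_const.add Complex.reCLM.contDiff).contDiffOn fun w hw => hw)
    refine h2.contMDiffOn.comp h.contMDiffOn fun z hz => ?_
    rw [range_angleChart] at hz
    exact fun h0 => hz (eq_neg_of_add_eq_zero_right h0)

/-- The density of a `1`-form on the circle with respect to the angle. -/
def density (A : DForm (manifoldDiffeology (𝓡 1) Circle) 1) (t : ℝ) : ℝ :=
  A.val anglePlot contMDiff_anglePlot (EuclideanSpace.single 0 t) fun _ => EuclideanSpace.single 0 1

theorem continuous_density (A : DForm (manifoldDiffeology (𝓡 1) Circle) 1) :
    Continuous (density A) := by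
  have h1 := (A.smooth anglePlot contMDiff_anglePlot).continuous.comp contDiff_euclideanSingle.continuous
  exact (ContinuousAlternatingMap.apply ℝ (EuclideanSpace ℝ (Fin 1)) ℝ
    (fun _ : Fin 1 => EuclideanSpace.single (0 : Fin 1) (1 : ℝ))).continuous.comp h1

theorem density_periodic (A : DForm (manifoldDiffeology (𝓡 1) Circle) 1) :
    Function.Periodic (density A) (2 * Real.pi) := fun t => by
  have hg : ContDiff ℝ ∞ fun u : EuclideanSpace ℝ (Fin 1) =>
    u + EuclideanSpace.single (0 : Fin 1) (2 * Real.pi) := contDiff_id.add contDiff_const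
  have h1 := A.natural anglePlot contMDiff_anglePlot _ hg (EuclideanSpace.single 0 t)
  have h2 : anglePlot ∘ (fun u : EuclideanSpace ℝ (Fin 1) =>
      u + EuclideanSpace.single (0 : Fin 1) (2 * Real.pi)) = anglePlot := by
    funext u
    simp [anglePlot]
  rw [A.val_of_eq _ contMDiff_anglePlot h2] at h1
  rw [density, density, h1]
  simp only [fderiv_add_const, fderiv_fun_id]
  have h3 : EuclideanSpace.single (0 : Fin 1) (t + 2 * Real.pi) =
      EuclideanSpace.single 0 t + EuclideanSpace.single (0 : Fin 1) (2 * Real.pi) := by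
    ext i; fin_cases i; simp
  rw [h3]
  rfl

theorem integral_val_angleChart (c : ℝ) (A : DForm (manifoldDiffeology (𝓡 1) Circle) 1) :
    ∫ u, A.val (angleChart c) (isChartPlot_angleChart c).contMDiff u
      (fun i => EuclideanSpace.single i (1 : ℝ)) = ∫ t in (0 : ℝ)..(2 * Real.pi), density A t := by
  have hval : ∀ u, A.val (angleChart c) (isChartPlot_angleChart c).contMDiff u
      (fun i => EuclideanSpace.single i (1 : ℝ)) =
        (2 * (1 / (1 + u 0 ^ 2))) * density A (c + 2 * Real.arctan (u 0)) := fun u => by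
    rw [show A.val (angleChart c) (isChartPlot_angleChart c).contMDiff u = _ from
      A.natural anglePlot contMDiff_anglePlot _ (contDiff_angleCoord c) u]
    have h0 : HasFDerivAt (fun v : EuclideanSpace ℝ (Fin 1) => c + 2 * Real.arctan (v 0)) _ u :=
      HasDerivAt.comp_hasFDerivAt (h₂ := fun t : ℝ => c + 2 * Real.arctan t) u
        (((Real.hasDerivAt_arctan (u 0)).const_mul 2).const_add c)
        (EuclideanSpace.proj (𝕜 := ℝ) (0 : Fin 1)).hasFDerivAt
    have h1 : HasFDerivAt (angleCoord c) _ u :=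
      HasFDerivAt.comp u (g := fun t : ℝ => EuclideanSpace.single (0 : Fin 1) t)
        (hasDerivAt_euclideanSingle (c + 2 * Real.arctan (u 0))).hasFDerivAt h0
    rw [h1.fderiv, ContinuousAlternatingMap.compContinuousLinearMap_apply]
    have h2 : (A.val anglePlot contMDiff_anglePlot (angleCoord c u)) (fun _ : Fin 1 =>
        (2 * (1 / (1 + u 0 ^ 2))) • EuclideanSpace.single (0 : Fin 1) (1 : ℝ)) =
        (2 * (1 / (1 + u 0 ^ 2))) * density A (c + 2 * Real.arctan (u 0)) := by
      have h := (A.val anglePlot contMDiff_anglePlot (angleCoord c u)).map_smul_univ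
        (fun _ : Fin 1 => 2 * (1 / (1 + u 0 ^ 2))) (fun _ => EuclideanSpace.single (0 : Fin 1) (1 : ℝ))
      rw [h, Fin.prod_univ_one]
      rfl
    rw [← h2]
    congr 1
    funext i
    fin_cases i
    simp
  simp only [hval]
  have h1 : ∫ u : EuclideanSpace ℝ (Fin 1), (2 * (1 / (1 + u 0 ^ 2))) *
      density A (c + 2 * Real.arctan (u 0)) =
      ∫ t : ℝ, (2 * (1 / (1 + t ^ 2))) * density A (c + 2 * Real.arctan t) := by
    have hmp := (MeasureTheory.volume_preserving_funUnique (Fin 1) ℝ).comp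
      (PiLp.volume_preserving_ofLp (Fin 1))
    exact hmp.integral_comp (MeasurableEquiv.measurableEmbedding
      ((MeasurableEquiv.toLp 2 (Fin 1 → ℝ)).symm.trans (MeasurableEquiv.funUnique (Fin 1) ℝ)))
      (fun t : ℝ => (2 * (1 / (1 + t ^ 2))) * density A (c + 2 * Real.arctan t))
  have hd : ∀ t ∈ (univ : Set ℝ), HasDerivWithinAt (fun t => c + 2 * Real.arctan t)
      (2 * (1 / (1 + t ^ 2))) univ t := fun t _ =>
    (((Real.hasDerivAt_arctan t).const_mul 2).const_add c).hasDerivWithinAt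
  have hinj : InjOn (fun t => c + 2 * Real.arctan t) univ := fun a _ b _ h => by
    have h' : c + 2 * Real.arctan a = c + 2 * Real.arctan b := h
    exact Real.arctan_injective (by linarith)
  have h2 := MeasureTheory.integral_image_eq_integral_abs_deriv_smul MeasurableSet.univ hd hinj
    (density A)
  have himg : (fun t => c + 2 * Real.arctan t) '' univ = Ioo (c - Real.pi) (c + Real.pi) := by
    ext s
    simp only [image_univ, mem_range, mem_Ioo]
    constructor
    · rintro ⟨t, rfl⟩
      have h3 := Real.neg_pi_div_two_lt_arctan t
      have h4 := Real.arctan_lt_pi_div_two t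
      constructor <;> linarith
    · rintro ⟨h3, h4⟩
      refine ⟨Real.tan ((s - c) / 2), ?_⟩
      rw [Real.arctan_tan (by linarith) (by linarith)]
      ring
  rw [himg, MeasureTheory.setIntegral_univ] at h2
  rw [h1]
  have h3 : ∫ t : ℝ, (2 * (1 / (1 + t ^ 2))) * density A (c + 2 * Real.arctan t) =
      ∫ t in Ioo (c - Real.pi) (c + Real.pi), density A t := by
    rw [h2]
    congr 1
    funext t
    rw [abs_of_nonneg (by positivity), smul_eq_mul]
  rw [h3, ← MeasureTheory.integral_Ioc_eq_integral_Ioo,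
    ← intervalIntegral.integral_of_le (by linarith [Real.pi_pos])]
  have h4 := (density_periodic A).intervalIntegral_add_eq (c - Real.pi) 0
  rw [zero_add, show c - Real.pi + 2 * Real.pi = c + Real.pi by ring] at h4
  exact h4

theorem mfderiv_anglePlot (u : EuclideanSpace ℝ (Fin 1)) :
    mfderiv 𝓘(ℝ, EuclideanSpace ℝ (Fin 1)) (𝓡 1) anglePlot u (EuclideanSpace.single 0 (1 : ℝ)) =
      circleField (anglePlot u) := by
  have hG : (fun t : ℝ => anglePlot u * exp t) =
      anglePlot ∘ fun t : ℝ => u + EuclideanSpace.single (0 : Fin 1) t := by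
    funext t
    simp [anglePlot, exp_add]
  have key : ∀ v : EuclideanSpace ℝ (Fin 1), v = u → ∀ w : EuclideanSpace ℝ (Fin 1),
      (mfderiv 𝓘(ℝ, EuclideanSpace ℝ (Fin 1)) (𝓡 1) anglePlot v w : EuclideanSpace ℝ (Fin 1)) =
        mfderiv 𝓘(ℝ, EuclideanSpace ℝ (Fin 1)) (𝓡 1) anglePlot u w := by
    rintro v rfl w; rfl
  have hs : HasDerivAt (fun t : ℝ => u + EuclideanSpace.single (0 : Fin 1) t)
      (EuclideanSpace.single (0 : Fin 1) (1 : ℝ)) 0 := (hasDerivAt_euclideanSingle 0).const_add u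
  have hc := mfderiv_comp (I := 𝓘(ℝ, ℝ)) (I' := 𝓘(ℝ, EuclideanSpace ℝ (Fin 1))) (I'' := 𝓡 1)
    (0 : ℝ) (f := fun t : ℝ => u + EuclideanSpace.single (0 : Fin 1) t)
    (contMDiff_anglePlot.mdifferentiableAt (by simp)) hs.differentiableAt.mdifferentiableAt
  rw [circleField]
  have h1 : (mfderiv 𝓘(ℝ, ℝ) (𝓡 1) (fun t : ℝ => anglePlot u * exp t) 0 (1 : ℝ) :
      EuclideanSpace ℝ (Fin 1)) = mfderiv 𝓘(ℝ, EuclideanSpace ℝ (Fin 1)) (𝓡 1) anglePlot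
        (u + EuclideanSpace.single (0 : Fin 1) (0 : ℝ)) (EuclideanSpace.single (0 : Fin 1) (1 : ℝ)) := by
    rw [hG, hc, mfderiv_eq_fderiv, hs.hasFDerivAt.fderiv]
    change mfderiv 𝓘(ℝ, EuclideanSpace ℝ (Fin 1)) (𝓡 1) anglePlot
      (u + EuclideanSpace.single (0 : Fin 1) (0 : ℝ)) ((1 : ℝ) • EuclideanSpace.single (0 : Fin 1) (1 : ℝ)) = _
    rw [one_smul]
  exact (h1.trans (key _ (by simp) _)).symm

theorem chartSign_angleChart (c : ℝ) : chartSign circleOrientation (angleChart c) 0 = 1 := by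
  apply frameSign_of_pos
  set p : Circle := anglePlot (angleCoord c 0) with hp
  have hd : HasFDerivAt (angleCoord c) _ 0 :=
    HasFDerivAt.comp (0 : EuclideanSpace ℝ (Fin 1))
      (g := fun t : ℝ => EuclideanSpace.single (0 : Fin 1) t)
      (hasDerivAt_euclideanSingle _).hasFDerivAt
      (HasDerivAt.comp_hasFDerivAt (h₂ := fun t : ℝ => c + 2 * Real.arctan t)
        (0 : EuclideanSpace ℝ (Fin 1))
        (((Real.hasDerivAt_arctan 0).const_mul 2).const_add c)
        (EuclideanSpace.proj (𝕜 := ℝ) (0 : Fin 1)).hasFDerivAt)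
  have hfr : plotFrame (𝓡 1) (angleChart c) 0 = fun _ => (2 : ℝ) • circleField p := by
    funext i
    rw [Subsingleton.elim i 0, plotFrame, angleChart,
      mfderiv_comp 0 (contMDiff_anglePlot.mdifferentiableAt (by simp))
        hd.differentiableAt.mdifferentiableAt, mfderiv_eq_fderiv, hd.fderiv, hp,
      ← mfderiv_anglePlot]
    have h2 : (ContinuousLinearMap.toSpanSingleton ℝ (EuclideanSpace.single (0 : Fin 1) (1 : ℝ)) ∘SL
        ((2 * (1 / (1 + (0 : ℝ) ^ 2))) • EuclideanSpace.proj (𝕜 := ℝ) (0 : Fin 1)))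
        (EuclideanSpace.single (0 : Fin 1) (1 : ℝ)) =
          (2 : ℝ) • EuclideanSpace.single (0 : Fin 1) (1 : ℝ) := by simp
    exact (congrArg (mfderiv 𝓘(ℝ, EuclideanSpace ℝ (Fin 1)) (𝓡 1) anglePlot (angleCoord c 0)) h2).trans
      (map_smul (mfderiv 𝓘(ℝ, EuclideanSpace ℝ (Fin 1)) (𝓡 1) anglePlot (angleCoord c 0)) _ _)
  rw [hfr]
  change IsPosFrame (circleOrientation.o p) fun _ => (2 : ℝ) • circleField p
  let b := FiniteDimensional.basisSingleton (Fin 1)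
    (show Module.finrank ℝ (TangentSpace (𝓡 1) p) = 1 from finrank_euclideanSpace_fin)
    (circleField p) (circleField_ne_zero p)
  let b' := FiniteDimensional.basisSingleton (Fin 1)
    (show Module.finrank ℝ (TangentSpace (𝓡 1) p) = 1 from finrank_euclideanSpace_fin)
    ((2 : ℝ) • circleField p) (smul_ne_zero two_ne_zero (circleField_ne_zero p))
  have hb' : ⇑b' = fun i => (2 : ℝ) • b i := by
    funext i
    simp [b, b']
  refine ⟨b', by funext i; simp [b'], ?_⟩
  refine ((Basis.orientation_eq_iff_det_pos b b').2 ?_).symm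
  rw [hb']
  have := b.det.map_smul_univ (fun _ => (2 : ℝ)) b
  rw [this, Basis.det_self]
  norm_num

theorem chartIntegral_angleChart (c : ℝ) (A : DForm (manifoldDiffeology (𝓡 1) Circle) 1) :
    chartIntegral circleOrientation (angleChart c) (isChartPlot_angleChart c).contMDiff A =
      ∫ t in (0 : ℝ)..(2 * Real.pi), density A t := by
  rw [(isChartPlot_angleChart c).chartIntegral_eq_sign_mul, chartSign_angleChart, one_mul,
    integral_val_angleChart]

/-- A cutoff function on the circle: zero where `re ≤ -1/2`, one where `re ≥ 1/2`. -/
def cutoff : C^∞⟮𝓡 1, Circle; 𝓘(ℝ, ℝ), ℝ⟯ :=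
  ⟨fun z => Real.smoothTransition ((z : ℂ).re + 1 / 2),
    (Real.smoothTransition.contDiff.comp
      (Complex.reCLM.contDiff.add contDiff_const)).contMDiff.comp contMDiff_coe⟩

/-- A form supported in the range of a chart of the circle, from a function supported there. -/
def chartForm (c : ℝ) (f : C^∞⟮𝓡 1, Circle; 𝓘(ℝ, ℝ), ℝ⟯)
    (A : DForm (manifoldDiffeology (𝓡 1) Circle) 1) (K : Set Circle) (hK : IsClosed K)
    (hKc : K ⊆ range (angleChart c)) (hf : Function.support f ⊆ K) : ChartForm (𝓡 1) Circle where
  plot := angleChart c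
  inv := angleInv c
  isChartPlot := isChartPlot_angleChart c
  form := DForm.smulSmooth f A
  supp := K
  isCompact_supp := hK.isCompact
  supp_subset := hKc
  vanishesOff := by
    have h := DForm.VanishesOff.smulSmooth (β := A) (S := univ)
      (fun _ R hR u hu => absurd (mem_univ _) hu) f hf
    rwa [univ_inter] at h

theorem continuous_re : Continuous fun z : Circle => (z : ℂ).re :=
  Complex.continuous_re.comp continuous_subtype_val

/-- The integral over the circle is the integral over the angle. -/
theorem integralForm_eq (A : DForm (manifoldDiffeology (𝓡 1) Circle) 1) :
    integralForm circleOrientation A = ∫ t in (0 : ℝ)..(2 * Real.pi), density A t := by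
  let S₁ := chartForm 0 cutoff A {z | -1 / 2 ≤ (z : ℂ).re}
    (isClosed_le continuous_const continuous_re)
    (fun z hz => by
      rw [range_angleChart]
      intro h
      rw [neg_zero, exp_zero, mul_one] at h
      have hz' : -1 / 2 ≤ (z : ℂ).re := hz
      linarith)
    (fun z hz => by
      by_contra h
      have h' : ¬ -1 / 2 ≤ (z : ℂ).re := h
      exact hz (Real.smoothTransition.zero_of_nonpos (by linarith)))
  let S₂ := chartForm Real.pi (1 - cutoff) A {z | (z : ℂ).re ≤ 1 / 2}
    (isClosed_le continuous_re continuous_const)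
    (fun z hz => by
      rw [range_angleChart]
      intro h
      rw [coe_mul, coe_exp] at h
      have hz' : (z : ℂ).re ≤ 1 / 2 := hz
      rw [Complex.ofReal_neg, neg_mul, Complex.exp_neg, Complex.exp_pi_mul_I] at h
      simp at h
      linarith)
    (fun z hz => by
      by_contra h
      have h' : ¬ (z : ℂ).re ≤ 1 / 2 := h
      refine hz ?_
      change 1 - Real.smoothTransition ((z : ℂ).re + 1 / 2) = 0
      rw [Real.smoothTransition.one_of_one_le (by linarith), sub_self])
  have hsum : ∑ i, (![S₁, S₂] i).form = A := by
    rw [Fin.sum_univ_two]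
    refine DForm.ext fun P hP u => ?_
    change cutoff (P u) • A.val P hP u + (1 - cutoff (P u)) • A.val P hP u = A.val P hP u
    rw [← add_smul, add_sub_cancel, one_smul]
  rw [integralForm_eq_sum_chartForm circleOrientation ![S₁, S₂] A hsum, Fin.sum_univ_two]
  refine (congrArg₂ (· + ·) (chartIntegral_angleChart 0 S₁.form)
    (chartIntegral_angleChart Real.pi S₂.form)).trans ?_
  rw [← intervalIntegral.integral_add ((continuous_density _).intervalIntegrable _ _)
    ((continuous_density _).intervalIntegrable _ _)]
  congr 1
  funext t
  change cutoff _ • density A t + (1 - cutoff _) • density A t = density A t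
  rw [← add_smul, add_sub_cancel, one_smul]

end Circle

namespace ImmersedCurve

variable {S : Type*} [TopologicalSpace S] [ChartedSpace (EuclideanSpace ℝ (Fin 2)) S]
  (γ : ImmersedCurve S) (σ : SymplecticForm (𝓡 2) S)

theorem toLagGr_lift (p : Circle) :
    (γ.lift p).toLagGr σ = gaussMap (γ.isLagrangianImmersion σ) p := by
  refine LagGr.ext rfl ?_
  refine (UnitTangent.toLagGr_plane σ (γ.lift p) (γ.velocity_ne_zero p) rfl).trans
    (LagGr.plane_eq_span_singleton _ (γ.velocity_ne_zero p) ?_).symm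
  exact ⟨circleField p, rfl⟩

variable [IsManifold (𝓡 2) ∞ S]

/-- The class of the constant function is stable, and the corresponding characteristic number of
a curve is its holonomy. -/
theorem isCharNumber_one {μ : DForm (lagGrDiffeology σ.toFun) 1} (hμ : IsActionForm σ μ)
    (h1 : DForm.d (DForm.ofFun (D := lagGrDiffeology σ.toFun) (fun _ => (1 : ℝ))
      fun _ _ => contDiff_const) = 0) :
    (γ.toOrientedLagrangian σ).IsCharNumber hμ (HdR.mk _ h1)
      (γ.holonomy (DForm.pullback _ (UnitTangent.smooth_toLagGr σ) μ)) := by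
  refine ((γ.toOrientedLagrangian σ).isCharNumber_iff hμ _ h1 _).2 ?_
  refine Eq.trans ?_ (Circle.integralForm_eq _).symm
  refine intervalIntegral.integral_congr fun t _ => ?_
  refine Eq.trans ?_ (wedgeOne_apply _ _ _).symm
  rw [Fin.sum_univ_one]
  change _ = (-1) ^ 0 * (_ * 1)
  rw [pow_zero, one_mul, mul_one]
  refine congrArg (fun A : EuclideanSpace ℝ (Fin 1) [⋀^Fin 1]→L[ℝ] ℝ =>
    A fun _ => EuclideanSpace.single 0 1) (μ.val_of_eq _ _ (funext fun u => ?_) _)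
  exact γ.toLagGr_lift σ (anglePlot u)

variable {σ}

theorem sum_holonomy_eq_zero [T2Space S] {lam : DForm (unitTangentDiffeology (𝓡 2) S) 1}
    (hlam : DForm.d lam =
      DForm.pullback UnitTangent.pt UnitTangent.smooth_pt σ.toSmoothForm.toDForm)
    {r : ℕ} (γ : Fin r → ImmersedCurve S)
    (C : OrientedCobordism (fun i => (γ i).toOrientedLagrangian σ)
      (fun j : Fin 0 => (j.elim0 : OrientedLagrangian.{0} 1 σ.toFun))) :
    ∑ i, (γ i).holonomy lam = 0 := by
  obtain ⟨μ, hμ, hμ'⟩ := UnitTangent.exists_isActionForm σ hlam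
  have hd : ∀ {X : Type _} (D : DiffeologicalSpace X), DForm.d (DForm.ofFun (D := D)
      (fun _ => (1 : ℝ)) fun _ _ => contDiff_const) = 0 := fun D => by
    refine DForm.ext fun P hP u => ?_
    rw [DForm.d_ofFun_val]
    ext v
    simp [Function.comp_def]
  have hst : IsStableClass (HdR.mk _ (hd (lagGrDiffeology σ.toFun))) :=
    ⟨HdR.mk _ (hd (lagGrDiffeology (prodForm σ.toFun))), rfl⟩
  have h := C.sum_eq_of_isStableClass hμ two_pos hst (fun i => (γ i).holonomy lam)
    (fun j => j.elim0) (fun i => by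
      have h1 := (γ i).isCharNumber_one σ hμ (hd _)
      rwa [hμ', (γ i).holonomy_average σ hlam] at h1) (fun j => j.elim0)
  rw [h]
  exact Fin.sum_univ_zero _

end ImmersedCurve

end

theorem mainTheorem10 :
    -- `π^*ω` is exact on the Lagrangian Grassmannian bundle of a monotone symplectic manifold
    (∀ (n : ℕ) (M : Type*) [TopologicalSpace M] [T2Space M] [SecondCountableTopology M]
      [ChartedSpace (EuclideanSpace ℝ (Fin (2 * n))) M] [IsManifold (𝓡 (2 * n)) ∞ M]
      (σ : SymplecticForm (𝓡 (2 * n)) M), IsMonotone σ →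
      ∃ lam : DForm (lagGrDiffeology σ.toFun) 1, IsActionForm σ lam) ∧
    -- characteristic numbers of the action class: well defined, and invariant under
    -- oriented Lagrangian cobordism when the second class is stable
    (∀ (k : ℕ) (M : Type*) [TopologicalSpace M] [T2Space M] [SecondCountableTopology M]
      [ChartedSpace (EuclideanSpace ℝ (Fin (2 * (k + 1)))) M] [IsManifold (𝓡 (2 * (k + 1))) ∞ M]
      (σ : SymplecticForm (𝓡 (2 * (k + 1))) M), IsMonotone σ →
      ∀ (lam : DForm (lagGrDiffeology σ.toFun) 1) (hlam : IsActionForm σ lam)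
        (x : HdR (lagGrDiffeology σ.toFun) k),
        (∀ f : OrientedLagrangian (k + 1) σ.toFun, ∃! c : ℝ, f.IsCharNumber hlam x c) ∧
        (IsStableClass x →
          ∀ (r s : ℕ) (α : Fin r → OrientedLagrangian (k + 1) σ.toFun)
            (β : Fin s → OrientedLagrangian (k + 1) σ.toFun), OrientedCobordism α β →
            ∀ (a : Fin r → ℝ) (b : Fin s → ℝ),
              (∀ i, (α i).IsCharNumber hlam x (a i)) → (∀ j, (β j).IsCharNumber hlam x (b j)) →
              ∑ i, a i = ∑ j, b j)) ∧
    -- curves on surfaces: holonomy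
    (∀ (S : Type*) [TopologicalSpace S] [T2Space S] [SecondCountableTopology S]
      [ChartedSpace (EuclideanSpace ℝ (Fin 2)) S] [IsManifold (𝓡 2) ∞ S]
      (σ : SymplecticForm (𝓡 2) S),
      (IsMonotone σ → ∃ lam : DForm (unitTangentDiffeology (𝓡 2) S) 1,
        DForm.d lam =
          DForm.pullback UnitTangent.pt UnitTangent.smooth_pt σ.toSmoothForm.toDForm) ∧
      ∀ lam : DForm (unitTangentDiffeology (𝓡 2) S) 1,
        DForm.d lam =
          DForm.pullback UnitTangent.pt UnitTangent.smooth_pt σ.toSmoothForm.toDForm →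
        ∀ (r : ℕ) (γ : Fin r → ImmersedCurve S),
          OrientedCobordism (fun i => (γ i).toOrientedLagrangian σ)
            (fun j : Fin 0 => (j.elim0 : OrientedLagrangian.{0} 1 σ.toFun)) →
          ∑ i, (γ i).holonomy lam = 0) := by
  refine ⟨fun n M _ _ _ _ _ σ hσ => LagGr.exists_isActionForm hσ,
    fun k M _ _ _ _ _ σ hσ lam hlam x => ⟨fun f => f.existsUnique_isCharNumber hlam x,
      fun hx r s α β C a b ha hb => C.sum_eq_of_isStableClass hlam (by omega) hx a b ha hb⟩,
    fun S _ _ _ _ _ σ => ⟨fun hσ => UnitTangent.exists_primitive hσ,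
      fun lam hlam r γ C => ImmersedCurve.sum_holonomy_eq_zero hlam γ C⟩⟩
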